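/- Fix an integer $k\ge 3$. In the problem $k$-SUM we are given $k$ lists $(x_{i,j})_{j\in[n]}$, $i\in[k]$, of integers and ask whether there are indices $a_1,\dots,a_k\in[n]$ with $\sum_{i=1}^k x_{i,a_i}=0$. For a fixed graph $H$, in the problem Exact-Weight-$H$ we are given a graph $G$ with integer edge weights and an integer target $t$ and ask whether $G$ has a (not necessarily induced) subgraph isomorphic to $H$ whose edge weights sum to $t$. The size of an instance is the number $n$ of integers per list, respectively the number of nodes of $G$, times the number of bits of the largest integer of the instance (so "$n$ numbers" and "$n$ nodes" below refer to this size). A problem can be solved in time $O(f(n))$ if some randomized random access machine (graphs are given by their adjacency and weight matrices; every instruction is charged the bit length of its operands) takes $O(f(n))$ steps on every instance of size $n$, for all outcomes of its coin flips, and answers each instance of size $n$ correctly with probability $1-o(1)$ as $n\to\infty$. Suppose that for every $\varepsilon>0$, $k$-SUM cannot be solved in time $O(n^{\lceil k/2\rceil-\varepsilon})$. Then, for every $\delta>0$, none of the following problems can be solved in time $O(n^{\lceil k/2\rceil-\delta})$: 1. Exact-Weight-$H$ on graphs on $n$ nodes, for any graph $H$ with $k$ nodes and no isolated node; 2. Exact-Weight-$H$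 on graphs on $\sqrt n$ nodes, where $H$ is the matching with $k$ edges and $2k$ nodes; that is, with $m$ for the size of an instance, it cannot be solved in time $O\big((m^{2})^{\lceil k/2\rceil-\delta}\big)$; 3. Exact-Weight-$H$ on graphs on $n^{1-1/k}$ nodes, where $H$ is the star with $k$ edges and $k+1$ nodes; that is, it cannot be solved in time $O\big((m^{1/(1-1/k)})^{\lceil k/2\rceil-\delta}\big)$; 4. Exact-Weight-$H$ on graphs on $n$ nodes, where $H$ is the path with $k-1$ nodes and $k-2$ edges. -/

import Mathlib

open scoped ENNReal Topology

namespace FineGrained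

/-! ### Randomized random access machines with the logarithmic cost criterion

A program works on registers `R 0, R 1, …` (each program mentions only finitely many of them) and on
a memory of integer cells that is addressed indirectly.  Every instruction is charged the number of
bits of the integers it handles.  Control flow is structured (`seq`, `ite`, `while`); jumps can be
simulated in this form with constant overhead by keeping the label in a register. -/

/-- The length of an integer in bits, including the sign bit. -/
def len (z : ℤ) : ℕ := Nat.size z.natAbs + 1

/-- Arithmetic operations. -/
inductive Op
  | add | sub | mul | div

/-- The value of an operation (`div` is Euclidean division, that is, rounding down for a positive
divisor; the value is `0` for divisor `0`). -/
def Op.eval : Op → ℤ → ℤ → ℤ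
  | .add, a, b => a + b
  | .sub, a, b => a - b
  | .mul, a, b => a * b
  | .div, a, b => a / b

/-- Programs. -/
inductive Prog
  /-- do nothing -/
  | skip
  /-- `R r := z` -/
  | const (r : ℕ) (z : ℤ)
  /-- `R r := R a ∘ R b` -/
  | arith (o : Op) (r a b : ℕ)
  /-- `R r := memory[R a]` -/
  | load (r a : ℕ)
  /-- `memory[R a] := R b` -/
  | store (a b : ℕ)
  /-- `R r :=` a fair random bit, independent of all others -/
  | flip (r : ℕ)
  /-- first `c`, then `d` -/
  | seq (c d : Prog)
  /-- if `R r > 0` then `c` else `d` -/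
  | ite (r : ℕ) (c d : Prog)
  /-- while `R r > 0` do `c` -/
  | while (r : ℕ) (c : Prog)

/-- A configuration: registers, memory, and the cost spent so far. -/
structure State where
  reg : ℕ → ℤ
  mem : ℤ → ℤ
  time : ℕ

/-- Charge `t` units of time. -/
def State.tick (s : State) (t : ℕ) : State := { s with time := s.time + t }

/-- Write a register. -/
def State.setReg (s : State) (r : ℕ) (z : ℤ) : State :=
  { s with reg := Function.update s.reg r z }

/-- Write a memory cell. -/
def State.setMem (s : State) (a z : ℤ) : State :=
  { s with mem := Function.update s.mem a z }

noncomputable section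

/-- Sequential composition of randomized, possibly unfinished computations. -/
def andThen (p : PMF (Option State)) (f : State → PMF (Option State)) : PMF (Option State) :=
  p.bind fun o => o.elim (PMF.pure none) f

/-- At most `n` rounds of the loop `while R r > 0 do body`; the outcome `none` means that the loop
is not finished after `n` rounds.  Each test is charged. -/
def loop (r : ℕ) (body : State → PMF (Option State)) : ℕ → State → PMF (Option State)
  | 0, s => if 0 < s.reg r then PMF.pure none else PMF.pure (some (s.tick (len (s.reg r))))
  | n + 1, s =>
      if 0 < s.reg r then andThen (body (s.tick (len (s.reg r)))) (loop r body n)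
      else PMF.pure (some (s.tick (len (s.reg r))))

/-- The distribution of the final configuration of a program, if every execution of a loop is cut
off after `fuel` rounds (outcome `none`). -/
def run (fuel : ℕ) : Prog → State → PMF (Option State)
  | .skip, s => PMF.pure (some (s.tick 1))
  | .const r z, s => PMF.pure (some ((s.setReg r z).tick (len z)))
  | .arith o r a b, s =>
      PMF.pure (some ((s.setReg r (o.eval (s.reg a) (s.reg b))).tick
        (len (s.reg a) + len (s.reg b))))
  | .load r a, s =>
      PMF.pure (some ((s.setReg r (s.mem (s.reg a))).tick
        (len (s.reg a) + len (s.mem (s.reg a)))))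
  | .store a b, s =>
      PMF.pure (some ((s.setMem (s.reg a) (s.reg b)).tick
        (len (s.reg a) + len (s.reg b))))
  | .flip r, s =>
      (PMF.uniformOfFintype Bool).map fun b => some ((s.setReg r (if b then 1 else 0)).tick 1)
  | .seq c d, s => andThen (run fuel c s) (run fuel d)
  | .ite r c d, s =>
      if 0 < s.reg r then run fuel c (s.tick (len (s.reg r)))
      else run fuel d (s.tick (len (s.reg r)))
  | .while r c, s => loop r (run fuel c) fuel s

/-- The initial configuration: the input is written in memory cells `0, 1, 2, …`; all other cells
and all registers hold `0`. -/
def initial (input : List ℤ) : State where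
  reg := fun _ => 0
  mem := fun a => if 0 ≤ a then input.getD a.toNat 0 else 0
  time := 0

/-- A machine accepts if register `0` holds a nonzero value at the end. -/
def State.Accepts (s : State) : Prop := s.reg 0 ≠ 0

/-! ### Decision problems and their randomized time complexity -/

/-- A decision problem: instances, the size of an instance, the instances with answer "yes", and the
presentation of an instance to a machine. -/
structure Problem where
  Inst : Type
  size : Inst → ℕ
  Yes : Inst → Prop
  input : Inst → List ℤ

/-- The outcome `o` is the correct answer to the instance `x`. -/
def Problem.Correct (P : Problem) (x : P.Inst) (o : Option State) : Prop :=
  ∃ s, o = some s ∧ (s.Accepts ↔ P.Yes x)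

/-- On every instance `x`, the program stops within time `T (P.size x)` for all outcomes of the coin
flips, and its answer is wrong with probability at most `err (P.size x)`. -/
def Prog.Solves (c : Prog) (P : Problem) (T : ℕ → ℕ) (err : ℕ → ℝ≥0∞) : Prop :=
  ∀ x : P.Inst, ∃ fuel : ℕ,
    (∀ o ∈ (run fuel c (initial (P.input x))).support,
      ∃ s, o = some s ∧ s.time ≤ T (P.size x)) ∧
    (run fuel c (initial (P.input x))).toOuterMeasure {o | ¬ P.Correct x o} ≤ err (P.size x)

/-- `P` can be solved in time `O(f(n))` on instances of size `n` by a randomized algorithm that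
succeeds with high probability, that is, with probability `1 - o(1)` on every instance. -/
def Problem.SolvableInTime (P : Problem) (f : ℕ → ℝ) : Prop :=
  ∃ (c : Prog) (T : ℕ → ℕ) (err : ℕ → ℝ≥0∞), c.Solves P T err ∧
    (fun n => (T n : ℝ)) =O[Filter.atTop] f ∧ Filter.Tendsto err Filter.atTop (𝓝 0)

/-! ### The problem `k`-SUM -/

/-- `k` lists of `n` integers each. -/
structure SumInstance (k : ℕ) where
  n : ℕ
  x : Fin k → Fin n → ℤ

/-- `k`-SUM: are there `k` numbers, one from each of the `k` lists, whose sum is `0`?  The size of an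
instance is the number of integers in a list times the number of bits of the largest of all the
integers.  The input is the number `n`, followed by the lists, one after the other. -/
def kSum (k : ℕ) : Problem where
  Inst := SumInstance k
  size I := I.n * Finset.univ.sup fun i => Finset.univ.sup fun j => len (I.x i j)
  Yes I := ∃ a : Fin k → Fin I.n, ∑ i, I.x i (a i) = 0
  input I := (I.n : ℤ) :: List.ofFn fun a : Fin (k * I.n) => I.x a.divNat a.modNat

/-! ### The problem Exact-Weight-`H` -/

/-- An edge-weighted graph on `n` nodes, and a target.  Only the weights of edges matter. -/
structure GraphInstance where
  n : ℕ
  graph : SimpleGraph (Fin n)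
  weight : Sym2 (Fin n) → ℤ
  target : ℤ

open Classical in
/-- The adjacency matrix. -/
def GraphInstance.adjEntry (I : GraphInstance) (i j : Fin I.n) : ℤ :=
  if I.graph.Adj i j then 1 else 0

open Classical in
/-- The matrix of edge weights, with `0` for non-edges. -/
def GraphInstance.weightEntry (I : GraphInstance) (i j : Fin I.n) : ℤ :=
  if I.graph.Adj i j then I.weight s(i, j) else 0

/-- Exact-Weight-`H`: does the graph have a (not necessarily induced) subgraph isomorphic to `H`
whose edge weights sum to the target?  The size of an instance is the number of nodes times the
number of bits of the largest of all the edge weights and the target.  The input is the number `n`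
of nodes, the target, the `n × n` adjacency matrix, and the `n × n` weight matrix. -/
def exactWeight {V : Type} (H : SimpleGraph V) : Problem where
  Inst := GraphInstance
  size I := I.n * max (len I.target)
    (Finset.univ.sup fun i => Finset.univ.sup fun j => len (I.weightEntry i j))
  Yes I := ∃ S : I.graph.Subgraph, Nonempty (H ≃g S.coe) ∧
    ∑ᶠ e ∈ S.edgeSet, I.weight e = I.target
  input I := (I.n : ℤ) :: I.target ::
    ((List.ofFn fun a : Fin (I.n * I.n) => I.adjEntry a.divNat a.modNat) ++
      List.ofFn fun a : Fin (I.n * I.n) => I.weightEntry a.divNat a.modNat)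

end

/-- The matching with `k` edges on `2k` nodes. -/
def matchingGraph (k : ℕ) : SimpleGraph (Fin k × Bool) where
  Adj u v := u.1 = v.1 ∧ u.2 ≠ v.2
  symm := ⟨fun _ _ h => ⟨h.1.symm, h.2.symm⟩⟩
  loopless := ⟨fun _ h => h.2 rfl⟩

/-- The star with `k` edges on `k + 1` nodes. -/
def kStarGraph (k : ℕ) : SimpleGraph (Fin (k + 1)) := SimpleGraph.starGraph 0

end FineGrained

open FineGrained

namespace FineGrained

/-! A fast algorithm for Exact-Weight-`H` is turned into a fast algorithm for `k`-SUM. A multiplier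
`a` is drawn uniformly below `M * D`, where `D` bounds the input numbers, and each number `x` is
replaced by `hash M D a x`, the integer part of `(a * x mod M * D) / D`. Up to carries this map is
linear: numbers with sum zero have hash values whose sum is `d * M - c` with `0 ≤ d, c < k`
(`sum_hash_of_sum_eq_zero`), so only `k * k` targets have to be tried. Conversely, a tuple with
nonzero sum meets one of these targets only for few multipliers, and `M` is so much larger than `n ^
k` that all tuples can be handled at once.

Each list goes to a hash table with `C` cells, where `C` is about `n` times a logarithm; the cell of
a number is its hash value modulo `C`, and a cell keeps only one hash value. For all but a vanishing
fraction of the multipliers, the numbers of one fixed solution share their cells with no different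
hash value. Both kinds of failure are counted in `card_not_goodMul_le`.

A `Layout` spreads the cells over the edges of a graph that has a part of `rho ^ lam` nodes for
every node of `H`, with `C = rho ^ kap`. The ends of an edge determine a cell, and any cells with
the right sum modulo `C` arise from a choice of one node per part. For the star and the path this
works only because the target and the other cells force the last residue. An additional large weight
for each edge type makes every copy of `H` of the right weight use one node of each part
(`Pattern.inst_yes_iff`). The weights are hash values, hence of logarithmic length, so a query has
size about `n ^ (lam / kap)`.

The queried graph is never written down: for `k = 3` and `k = 4` a matrix with `n ^ 2` entries would
already use up the allowed time. Instead the given program is simulated, and each input cell that it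
reads is computed on demand from the hash tables (`SimData.wp_simulate`, `Layout.entryCmd_spec`).
Correctness and running time are handled together through expected values of cost functions (`wp`,
`penalty`). `Layout.wp_program` adds the error of the multiplier and of the queries, `SubPow`
discards logarithmic factors in the running time, and `Layout.not_solvableInTime` gives the lower
bound for any layout. The theorem follows from the layouts `ofNodes`, `ofMatching`, `ofStar` and
`ofPath`. -/

/-! ### Expected values over the final configurations -/

/-- The expected value of `Φ` over the outcomes of a computation; an unfinished computation counts
as `⊤`. -/
noncomputable def expect (p : PMF (Option State)) (Φ : State → ℝ≥0∞) : ℝ≥0∞ :=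
  ∑' o, p o * o.elim ⊤ Φ

/-- The expected value of `Φ` over the final configurations of a program. -/
noncomputable def wp (fuel : ℕ) (c : Prog) (Φ : State → ℝ≥0∞) (s : State) : ℝ≥0∞ :=
  expect (run fuel c s) Φ

lemma expect_pure (o : Option State) (Φ : State → ℝ≥0∞) :
    expect (PMF.pure o) Φ = o.elim ⊤ Φ := by
  classical
  unfold expect
  rw [tsum_eq_single o]
  · simp
  · intro b hb
    simp [PMF.pure_apply, hb]

lemma expect_bind {α : Type} (p : PMF α) (f : α → PMF (Option State)) (Φ : State → ℝ≥0∞) :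
    expect (p.bind f) Φ = ∑' a, p a * expect (f a) Φ := by
  unfold expect
  simp_rw [PMF.bind_apply, ← ENNReal.tsum_mul_right, ← ENNReal.tsum_mul_left]
  rw [ENNReal.tsum_comm]
  simp_rw [mul_assoc]

lemma expect_andThen (p : PMF (Option State)) (f : State → PMF (Option State))
    (Φ : State → ℝ≥0∞) : expect (andThen p f) Φ = expect p fun s => expect (f s) Φ := by
  rw [andThen, expect_bind, expect]
  refine tsum_congr fun o => ?_
  cases o <;> simp [expect_pure]

lemma expect_mono (p : PMF (Option State)) {Φ Ψ : State → ℝ≥0∞} (h : ∀ s, Φ s ≤ Ψ s) :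
    expect p Φ ≤ expect p Ψ := by
  refine ENNReal.tsum_le_tsum fun o => ?_
  cases o
  · simp
  · simpa using mul_le_mul_right (h _) _

lemma wp_mono (fuel : ℕ) (c : Prog) {Φ Ψ : State → ℝ≥0∞} (h : ∀ s, Φ s ≤ Ψ s) (s : State) :
    wp fuel c Φ s ≤ wp fuel c Ψ s :=
  expect_mono _ h

section Rules
variable (fuel : ℕ) (Φ : State → ℝ≥0∞) (s : State)

lemma wp_skip : wp fuel .skip Φ s = Φ (s.tick 1) := by
  simp [wp, run, expect_pure]

lemma wp_const (r : ℕ) (z : ℤ) : wp fuel (.const r z) Φ s = Φ ((s.setReg r z).tick (len z)) := by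
  simp [wp, run, expect_pure]

lemma wp_arith (o : Op) (r a b : ℕ) : wp fuel (.arith o r a b) Φ s =
    Φ ((s.setReg r (o.eval (s.reg a) (s.reg b))).tick (len (s.reg a) + len (s.reg b))) := by
  simp [wp, run, expect_pure]

lemma wp_load (r a : ℕ) : wp fuel (.load r a) Φ s =
    Φ ((s.setReg r (s.mem (s.reg a))).tick (len (s.reg a) + len (s.mem (s.reg a)))) := by
  simp [wp, run, expect_pure]

lemma wp_store (a b : ℕ) : wp fuel (.store a b) Φ s =
    Φ ((s.setMem (s.reg a) (s.reg b)).tick (len (s.reg a) + len (s.reg b))) := by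
  simp [wp, run, expect_pure]

lemma wp_flip (r : ℕ) : wp fuel (.flip r) Φ s =
    2⁻¹ * Φ ((s.setReg r 0).tick 1) + 2⁻¹ * Φ ((s.setReg r 1).tick 1) := by
  simp only [wp, run, PMF.map, expect_bind]
  rw [tsum_fintype]
  simp [expect_pure, add_comm]

lemma wp_seq (c d : Prog) : wp fuel (.seq c d) Φ s = wp fuel c (wp fuel d Φ) s := by
  simp only [wp, run, expect_andThen]
  rfl

lemma wp_seq_fun (c d : Prog) : wp fuel (.seq c d) Φ = wp fuel c (wp fuel d Φ) :=
  funext fun s => wp_seq fuel Φ s c d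

lemma wp_ite (r : ℕ) (c d : Prog) : wp fuel (.ite r c d) Φ s =
    if 0 < s.reg r then wp fuel c Φ (s.tick (len (s.reg r)))
    else wp fuel d Φ (s.tick (len (s.reg r))) := by
  simp only [wp, run]
  split_ifs <;> rfl

/-- The expected value of `Φ` after at most `n` rounds of a loop. -/
noncomputable def wpLoop (fuel r : ℕ) (c : Prog) (Φ : State → ℝ≥0∞) (n : ℕ) (s : State) : ℝ≥0∞ :=
  expect (loop r (run fuel c) n s) Φ

lemma wp_while (r : ℕ) (c : Prog) : wp fuel (.while r c) Φ s = wpLoop fuel r c Φ fuel s := rfl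

lemma wpLoop_zero (r : ℕ) (c : Prog) : wpLoop fuel r c Φ 0 s =
    if 0 < s.reg r then ⊤ else Φ (s.tick (len (s.reg r))) := by
  simp only [wpLoop, loop]
  split_ifs <;> simp [expect_pure]

lemma wpLoop_succ (r : ℕ) (c : Prog) (n : ℕ) : wpLoop fuel r c Φ (n + 1) s =
    if 0 < s.reg r then wp fuel c (wpLoop fuel r c Φ n) (s.tick (len (s.reg r)))
    else Φ (s.tick (len (s.reg r))) := by
  simp only [wpLoop, loop]
  split_ifs
  · rw [expect_andThen]; rfl
  · simp [expect_pure]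

end Rules

/-- Fuel limits both the rounds of a loop and the loops inside its body, so the two effects are
combined here: `hc` covers the body and `h` the number of rounds. When the rounds run out the value
is `⊤`, which any continuation improves. -/
lemma wpLoop_antitone {fuel fuel' r : ℕ} {c : Prog}
    (hc : ∀ Φ s, wp fuel' c Φ s ≤ wp fuel c Φ s) (Φ : State → ℝ≥0∞) {n n' : ℕ} (h : n ≤ n')
    (s : State) : wpLoop fuel' r c Φ n' s ≤ wpLoop fuel r c Φ n s := by
  induction n generalizing n' s with
  | zero =>
    rw [wpLoop_zero]
    split_ifs with hr
    · exact le_top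
    · cases n' with
      | zero => simp [wpLoop_zero, hr]
      | succ n' => simp [wpLoop_succ, hr]
  | succ n ih =>
    obtain ⟨n', rfl⟩ : ∃ l, n' = l + 1 := ⟨n' - 1, by omega⟩
    rw [wpLoop_succ, wpLoop_succ]
    split_ifs with hr
    · exact (hc _ _).trans (wp_mono _ _ (fun s => ih (by omega) s) _)
    · exact le_rfl

/-- More fuel can only turn unfinished computations into finished ones. -/
lemma wp_antitone_fuel {fuel fuel' : ℕ} (h : fuel ≤ fuel') (c : Prog) (Φ : State → ℝ≥0∞)
    (s : State) : wp fuel' c Φ s ≤ wp fuel c Φ s := by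
  induction c generalizing Φ s with
  | skip => simp [wp_skip]
  | const => simp [wp_const]
  | arith => simp [wp_arith]
  | load => simp [wp_load]
  | store => simp [wp_store]
  | flip => simp [wp_flip]
  | seq c d hc hd =>
    rw [wp_seq, wp_seq]
    exact (hc _ _).trans (wp_mono _ _ (fun s => hd _ s) _)
  | ite r c d hc hd =>
    rw [wp_ite, wp_ite]
    split_ifs
    · exact hc _ _
    · exact hd _ _
  | _ =>
    rename_i r c hc
    rw [wp_while, wp_while]
    exact wpLoop_antitone hc Φ h s

/-! ### Relating expected values to correctness and running time -/

open Classical in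
/-- If a program is correct on an instance up to error `err` within time `T`, then expected values
over its outcomes can be bounded by looking at the correct outcomes and at the wrong outcomes. -/
lemma wp_le_of_solves {P : Problem} {x : P.Inst} {fuel : ℕ} {c : Prog} {T : ℕ} {err : ℝ≥0∞}
    (htime : ∀ o ∈ (run fuel c (initial (P.input x))).support, ∃ s, o = some s ∧ s.time ≤ T)
    (herr : (run fuel c (initial (P.input x))).toOuterMeasure {o | ¬ P.Correct x o} ≤ err)
    (v : ℝ≥0∞) {Ψ : State → ℝ≥0∞}
    (hgood : ∀ s, s.time ≤ T → (s.Accepts ↔ P.Yes x) → Ψ s ≤ v)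
    (hbad : ∀ s, s.time ≤ T → Ψ s ≤ v + 1) :
    wp fuel c Ψ (initial (P.input x)) ≤ v + err := by
  set p := run fuel c (initial (P.input x)) with hp
  -- A wrong outcome costs at most one unit more than `v`, weighted by its own probability; these
  -- excesses add up to the error probability.
  have h1 : wp fuel c Ψ (initial (P.input x)) ≤
      ∑' o, (p o * v + Set.indicator {o | ¬ P.Correct x o} p o) := by
    refine ENNReal.tsum_le_tsum fun o => ?_
    by_cases ho : o ∈ p.support
    · obtain ⟨s, rfl, hs⟩ := htime o ho
      by_cases hc : P.Correct x (some s)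
      · have hcs : s.Accepts ↔ P.Yes x := by
          obtain ⟨s', h, h'⟩ := hc
          cases h
          exact h'
        have := hgood s hs hcs
        refine le_trans ?_ le_self_add
        simpa using mul_le_mul_right this _
      · rw [Set.indicator_of_mem (show some s ∈ {o | ¬ P.Correct x o} from hc)]
        calc p (some s) * (some s).elim ⊤ Ψ ≤ p (some s) * (v + 1) :=
              mul_le_mul_right (hbad s hs) _
          _ = _ := by rw [mul_add, mul_one]
    · have : p o = 0 := by simpa [PMF.mem_support_iff] using ho
      simp [← hp, this]
  refine h1.trans ?_
  rw [ENNReal.tsum_add, ENNReal.tsum_mul_right, PMF.tsum_coe, one_mul,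
    ← PMF.toOuterMeasure_apply]
  gcongr

open Classical in
/-- The cost function that witnesses correctness and a time bound. -/
noncomputable def penalty (T : ℕ) (ans : Prop) (s : State) : ℝ≥0∞ :=
  if s.time ≤ T then (if s.Accepts ↔ ans then 0 else 1) else ⊤

/-- One inequality certifies both requirements. Since `penalty` and the unfinished outcome have
value `⊤` where time is exceeded, a finite expectation rules these out on the whole support; what
remains is the indicator of a wrong answer, whose expectation is the error probability. -/
lemma solves_of_wp_le {P : Problem} {x : P.Inst} {fuel : ℕ} {c : Prog} {T : ℕ} {e : ℝ≥0∞}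
    (he : e ≠ ⊤) (h : wp fuel c (penalty T (P.Yes x)) (initial (P.input x)) ≤ e) :
    (∀ o ∈ (run fuel c (initial (P.input x))).support, ∃ s, o = some s ∧ s.time ≤ T) ∧
    (run fuel c (initial (P.input x))).toOuterMeasure {o | ¬ P.Correct x o} ≤ e := by
  classical
  set p := run fuel c (initial (P.input x)) with hp
  have hfin : ∀ o, p o * o.elim ⊤ (penalty T (P.Yes x)) ≠ ⊤ := fun o hcon => by
    have := (ENNReal.le_tsum (f := fun o => p o * o.elim ⊤ (penalty T (P.Yes x))) o).trans h
    rw [hcon] at this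
    exact he (top_le_iff.mp this)
  have hsup : ∀ o ∈ p.support, ∃ s, o = some s ∧ s.time ≤ T := by
    intro o ho
    have h0 : p o ≠ 0 := by simpa [PMF.mem_support_iff] using ho
    have := hfin o
    cases o with
    | none => simp [ENNReal.mul_top h0] at this
    | some s =>
      refine ⟨s, rfl, ?_⟩
      by_contra hs
      simp [penalty, hs, ENNReal.mul_top h0] at this
  refine ⟨hsup, le_trans ?_ h⟩
  rw [PMF.toOuterMeasure_apply]
  refine ENNReal.tsum_le_tsum fun o => ?_
  by_cases ho : o ∈ p.support
  · obtain ⟨s, rfl, hs⟩ := hsup o ho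
    by_cases hc : P.Correct x (some s)
    · rw [Set.indicator_of_notMem (by simpa using hc)]
      exact zero_le
    · rw [Set.indicator_of_mem (show some s ∈ {o | ¬ P.Correct x o} from hc)]
      have : ¬ (s.Accepts ↔ P.Yes x) := fun h => hc ⟨s, rfl, h⟩
      simp [penalty, hs, this]
      exact le_rfl
  · have : p o = 0 := by simpa [PMF.mem_support_iff] using ho
    by_cases hm : o ∈ {o | ¬ P.Correct x o}
    · rw [Set.indicator_of_mem hm, this]; exact zero_le
    · rw [Set.indicator_of_notMem hm]; exact zero_le

/-! ### Assertions about all outcomes -/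

/-- Every outcome of `c`, started in `s`, is finished and satisfies `Q`. -/
def Ok (fuel : ℕ) (c : Prog) (s : State) (Q : State → Prop) : Prop :=
  ∀ (Φ : State → ℝ≥0∞) (v : ℝ≥0∞), (∀ s', Q s' → Φ s' ≤ v) → wp fuel c Φ s ≤ v

section Ok
variable {fuel : ℕ} {s : State} {Q Q' : State → Prop} {c d : Prog}

lemma Ok.mono (h : Ok fuel c s Q) (hQ : ∀ s', Q s' → Q' s') : Ok fuel c s Q' :=
  fun Φ v hv => h Φ v fun s' hs' => hv s' (hQ s' hs')

lemma Ok.seq (hc : Ok fuel c s Q) (hd : ∀ s', Q s' → Ok fuel d s' Q') :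
    Ok fuel (.seq c d) s Q' := fun Φ v hv => by
  rw [wp_seq]
  exact hc _ _ fun s' hs' => hd s' hs' Φ v hv

lemma Ok.skip (h : Q (s.tick 1)) : Ok fuel .skip s Q := fun Φ v hv => by
  rw [wp_skip]; exact hv _ h

lemma Ok.const {r : ℕ} {z : ℤ} (h : Q ((s.setReg r z).tick (len z))) :
    Ok fuel (.const r z) s Q := fun Φ v hv => by
  rw [wp_const]; exact hv _ h

lemma Ok.arith {o : Op} {r a b : ℕ}
    (h : Q ((s.setReg r (o.eval (s.reg a) (s.reg b))).tick (len (s.reg a) + len (s.reg b)))) :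
    Ok fuel (.arith o r a b) s Q := fun Φ v hv => by
  rw [wp_arith]; exact hv _ h

lemma Ok.load {r a : ℕ}
    (h : Q ((s.setReg r (s.mem (s.reg a))).tick (len (s.reg a) + len (s.mem (s.reg a))))) :
    Ok fuel (.load r a) s Q := fun Φ v hv => by
  rw [wp_load]; exact hv _ h

lemma Ok.store {a b : ℕ}
    (h : Q ((s.setMem (s.reg a) (s.reg b)).tick (len (s.reg a) + len (s.reg b)))) :
    Ok fuel (.store a b) s Q := fun Φ v hv => by
  rw [wp_store]; exact hv _ h

lemma Ok.ite {r : ℕ} (hc : 0 < s.reg r → Ok fuel c (s.tick (len (s.reg r))) Q)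
    (hd : ¬ 0 < s.reg r → Ok fuel d (s.tick (len (s.reg r))) Q) :
    Ok fuel (.ite r c d) s Q := fun Φ v hv => by
  rw [wp_ite]
  split_ifs with h
  · exact hc h Φ v hv
  · exact hd h Φ v hv

/-- A loop with a decreasing counter. -/
lemma Ok.while {r : ℕ} (Inv : ℕ → State → Prop) (n : ℕ) (hn : n ≤ fuel) (h0 : Inv n s)
    (hstep : ∀ i s, i < n → Inv (i + 1) s → 0 < s.reg r →
      Ok fuel c (s.tick (len (s.reg r))) (Inv i))
    (hzero : ∀ s, Inv 0 s → ¬ 0 < s.reg r)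
    (hQ : ∀ i s, i ≤ n → Inv i s → ¬ 0 < s.reg r → Q (s.tick (len (s.reg r)))) :
    Ok fuel (.while r c) s Q := fun Φ v hv => by
  rw [wp_while]
  have key : ∀ i m s, i ≤ n → i ≤ m → Inv i s → wpLoop fuel r c Φ m s ≤ v := by
    intro i
    induction i with
    | zero =>
      intro m s _ _ hI
      have hr := hzero s hI
      have : wpLoop fuel r c Φ m s = Φ (s.tick (len (s.reg r))) := by
        cases m with
        | zero => simp [wpLoop_zero, hr]
        | succ m => simp [wpLoop_succ, hr]
      rw [this]
      exact hv _ (hQ 0 s (Nat.zero_le _) hI hr)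
    | succ i ih =>
      intro m s hin him hI
      obtain ⟨m, rfl⟩ : ∃ l, m = l + 1 := ⟨m - 1, by omega⟩
      rw [wpLoop_succ]
      split_ifs with hr
      · exact hstep i s (by omega) hI hr _ _ fun s' hs' => ih m s' (by omega) (by omega) hs'
      · exact hv _ (hQ _ s hin hI hr)
  exact key n fuel s le_rfl hn h0

end Ok

/-! ### Bit lengths -/

lemma one_le_len (z : ℤ) : 1 ≤ len z := by simp [len]

@[simp] lemma len_zero : len 0 = 1 := by simp [len]

@[simp] lemma len_one : len 1 = 2 := by simp [len]

lemma len_le_iff {z : ℤ} {l : ℕ} : len z ≤ l + 1 ↔ z.natAbs < 2 ^ l := by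
  simp [len, Nat.size_le]

lemma len_le_of_natAbs_le {y z : ℤ} (h : y.natAbs ≤ z.natAbs) : len y ≤ len z := by
  simpa [len] using Nat.size_le_size h

lemma len_add_le (a b : ℤ) : len (a + b) ≤ len a + len b := by
  have ha : a.natAbs < 2 ^ Nat.size a.natAbs := Nat.lt_size_self _
  have hb : b.natAbs < 2 ^ Nat.size b.natAbs := Nat.lt_size_self _
  have h1 := Int.natAbs_add_le a b
  have : len (a + b) ≤ (Nat.size a.natAbs + Nat.size b.natAbs + 1) + 1 := by
    rw [len_le_iff]
    have e1 : 2 ^ Nat.size a.natAbs ≤ 2 ^ (Nat.size a.natAbs + Nat.size b.natAbs) :=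
      Nat.pow_le_pow_right (by norm_num) (by omega)
    have e2 : 2 ^ Nat.size b.natAbs ≤ 2 ^ (Nat.size a.natAbs + Nat.size b.natAbs) :=
      Nat.pow_le_pow_right (by norm_num) (by omega)
    rw [pow_succ]
    omega
  simp only [len] at this ⊢
  omega

@[simp] lemma len_neg (a : ℤ) : len (-a) = len a := by simp [len]

lemma len_sub_le (a b : ℤ) : len (a - b) ≤ len a + len b := by
  rw [sub_eq_add_neg, ← len_neg b]
  exact len_add_le _ _

lemma len_mul_le (a b : ℤ) : len (a * b) ≤ len a + len b := by
  have ha : a.natAbs < 2 ^ Nat.size a.natAbs := Nat.lt_size_self _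
  have hb : b.natAbs < 2 ^ Nat.size b.natAbs := Nat.lt_size_self _
  have : len (a * b) ≤ (Nat.size a.natAbs + Nat.size b.natAbs) + 1 := by
    rw [len_le_iff, Int.natAbs_mul, pow_add]
    exact Nat.mul_lt_mul'' ha hb
  simp only [len] at this ⊢
  omega

lemma len_div_le (a b : ℤ) : len (a / b) ≤ len a + len b :=
  (len_le_of_natAbs_le (Int.natAbs_ediv_le_natAbs a b)).trans (Nat.le_add_right _ _)

lemma Op.len_eval_le (o : Op) (a b : ℤ) : len (o.eval a b) ≤ len a + len b := by
  cases o
  · exact len_add_le a b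
  · exact len_sub_le a b
  · exact len_mul_le a b
  · exact len_div_le a b

/-! ### Expressions and commands without loops

Such commands work on the registers `2 * i` for `i < 64`, use the even registers from `128` on for
intermediate results, and leave the odd registers alone. -/

/-- The values of the variables, and the memory. -/
@[ext] structure Env where
  v : Fin 64 → ℤ
  m : ℤ → ℤ

/-- Arithmetic expressions. -/
inductive Expr
  | var (i : Fin 64)
  | const (z : ℤ)
  | op (o : Op) (e f : Expr)
  | mem (e : Expr)

namespace Expr

instance : Add Expr := ⟨op .add⟩
instance : Sub Expr := ⟨op .sub⟩
instance : Mul Expr := ⟨op .mul⟩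
instance : Div Expr := ⟨op .div⟩
instance (n : ℕ) : OfNat Expr n := ⟨const n⟩

/-- The value of an expression. -/
def eval : Expr → Env → ℤ
  | var i, s => s.v i
  | const z, _ => z
  | op o e f, s => o.eval (e.eval s) (f.eval s)
  | mem e, s => s.m (e.eval s)

/-- The cost of the evaluation. -/
def cost : Expr → Env → ℕ
  | var i, s => 2 + len (s.v i)
  | const z, _ => len z
  | op _ e f, s => e.cost s + f.cost s + (len (e.eval s) + len (f.eval s))
  | mem e, s => e.cost s + (len (e.eval s) + len (s.m (e.eval s)))

/-- A program that writes the value to register `2 * t`. -/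
def comp : Expr → ℕ → Prog
  -- There is no copy instruction; a register is copied by adding it to a zeroed one.
  | var i, t => .seq (.const (2 * t) 0) (.arith .add (2 * t) (2 * i) (2 * t))
  | const z, t => .const (2 * t) z
  | op o e f, t => .seq (e.comp t) (.seq (f.comp (t + 1)) (.arith o (2 * t) (2 * t) (2 * (t + 1))))
  | mem e, t => .seq (e.comp t) (.load (2 * t) (2 * t))

/-- All variables are from `S`. -/
def In (S : Finset (Fin 64)) : Expr → Prop
  | var i => i ∈ S
  | const _ => True
  | op _ e f => e.In S ∧ f.In S
  | mem e => e.In S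

/-- All values that are read from the memory have length at most `l`. -/
def LoadsLe (l : ℕ) (s : Env) : Expr → Prop
  | var _ => True
  | const _ => True
  | op _ e f => e.LoadsLe l s ∧ f.LoadsLe l s
  | mem e => e.LoadsLe l s ∧ len (s.m (e.eval s)) ≤ l

/-- A growth factor for costs and lengths. -/
def growth (K : ℕ) : Expr → ℕ
  | var _ => K + 2
  | const z => len z
  | op _ e f => 2 * (e.growth K + f.growth K)
  | mem e => 2 * e.growth K + 1

section Eval
variable (s : Env) (e f : Expr)
@[simp] lemma eval_var (i : Fin 64) : (var i).eval s = s.v i := rfl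
@[simp] lemma eval_const (z : ℤ) : (const z).eval s = z := rfl
@[simp] lemma eval_mem : (mem e).eval s = s.m (e.eval s) := rfl
@[simp] lemma eval_add : (e + f).eval s = e.eval s + f.eval s := rfl
@[simp] lemma eval_sub : (e - f).eval s = e.eval s - f.eval s := rfl
@[simp] lemma eval_mul : (e * f).eval s = e.eval s * f.eval s := rfl
@[simp] lemma eval_div : (e / f).eval s = e.eval s / f.eval s := rfl
@[simp] lemma eval_ofNat (n : ℕ) [n.AtLeastTwo] :
    (ofNat(n) : Expr).eval s = (ofNat(n) : ℤ) := rfl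
@[simp] lemma eval_zero : (0 : Expr).eval s = 0 := rfl
@[simp] lemma eval_one : (1 : Expr).eval s = 1 := rfl

variable (S : Finset (Fin 64)) (l : ℕ)
@[simp] lemma in_zero : (0 : Expr).In S := trivial
@[simp] lemma in_one : (1 : Expr).In S := trivial
@[simp] lemma loadsLe_one : (1 : Expr).LoadsLe l s := trivial
@[simp] lemma in_var (i : Fin 64) : (var i).In S ↔ i ∈ S := Iff.rfl
@[simp] lemma in_const (z : ℤ) : (const z).In S := trivial
@[simp] lemma in_mem : (mem e).In S ↔ e.In S := Iff.rfl
@[simp] lemma in_add : (e + f).In S ↔ e.In S ∧ f.In S := Iff.rfl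
@[simp] lemma in_sub : (e - f).In S ↔ e.In S ∧ f.In S := Iff.rfl
@[simp] lemma in_mul : (e * f).In S ↔ e.In S ∧ f.In S := Iff.rfl
@[simp] lemma in_div : (e / f).In S ↔ e.In S ∧ f.In S := Iff.rfl
@[simp] lemma in_ofNat (n : ℕ) : (ofNat(n) : Expr).In S := trivial

@[simp] lemma loadsLe_var (i : Fin 64) : (var i).LoadsLe l s := trivial
@[simp] lemma loadsLe_const (z : ℤ) : (const z).LoadsLe l s := trivial
@[simp] lemma loadsLe_mem : (mem e).LoadsLe l s ↔ e.LoadsLe l s ∧ len (s.m (e.eval s)) ≤ l :=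
  Iff.rfl
@[simp] lemma loadsLe_add : (e + f).LoadsLe l s ↔ e.LoadsLe l s ∧ f.LoadsLe l s := Iff.rfl
@[simp] lemma loadsLe_sub : (e - f).LoadsLe l s ↔ e.LoadsLe l s ∧ f.LoadsLe l s := Iff.rfl
@[simp] lemma loadsLe_mul : (e * f).LoadsLe l s ↔ e.LoadsLe l s ∧ f.LoadsLe l s := Iff.rfl
@[simp] lemma loadsLe_div : (e / f).LoadsLe l s ↔ e.LoadsLe l s ∧ f.LoadsLe l s := Iff.rfl
@[simp] lemma loadsLe_ofNat (n : ℕ) : (ofNat(n) : Expr).LoadsLe l s := trivial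

end Eval

/-- The length of a result and the charge of an operation are at most the sum of the lengths of the
operands, so an expression of fixed shape enlarges lengths by a constant factor only. This factor
replaces all bookkeeping of exact bit lengths; `1 ≤ l` absorbs additive constants. -/
lemma growth_spec {S : Finset (Fin 64)} {l K : ℕ} (hl : 1 ≤ l) {s : Env}
    (hs : ∀ i ∈ S, len (s.v i) ≤ K * l) (e : Expr) (he : e.In S) (hle : e.LoadsLe l s) :
    len (e.eval s) ≤ e.growth K * l ∧ e.cost s ≤ e.growth K * l := by
  induction e with
  | var i =>
    have := hs i he
    simp only [eval, cost, growth]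
    constructor <;> nlinarith
  | const z =>
    simp only [eval, cost, growth]
    exact ⟨Nat.le_mul_of_pos_right _ hl, Nat.le_mul_of_pos_right _ hl⟩
  | op o e f ihe ihf =>
    obtain ⟨h1, h2⟩ := ihe he.1 hle.1
    obtain ⟨h3, h4⟩ := ihf he.2 hle.2
    have := o.len_eval_le (e.eval s) (f.eval s)
    simp only [eval, cost, growth]
    constructor <;> nlinarith
  | mem e ihe =>
    obtain ⟨h1, h2⟩ := ihe he hle.1
    have := hle.2
    simp only [eval, cost, growth]
    constructor <;> nlinarith

end Expr

/-- The state `s` has the variables and the memory of `env`, the odd registers `o`, and has used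
time at most `t`. -/
structure At (s : State) (env : Env) (o : ℕ → ℤ) (t : ℕ) : Prop where
  even : ∀ i : Fin 64, s.reg (2 * i) = env.v i
  odd : ∀ r, s.reg (2 * r + 1) = o r
  mem : s.mem = env.m
  time : s.time ≤ t

lemma At.mono {s : State} {env : Env} {o : ℕ → ℤ} {t t' : ℕ} (h : At s env o t) (ht : t ≤ t') :
    At s env o t' := ⟨h.even, h.odd, h.mem, h.time.trans ht⟩

section comp

/-- What is left unchanged by the evaluation of an expression. -/
structure SameBelow (s s' : State) (t : ℕ) : Prop where
  reg : ∀ r, (∀ j, t ≤ j → r ≠ 2 * j) → s'.reg r = s.reg r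
  mem : s'.mem = s.mem

/-- The number `t` acts as a stack pointer. The second operand is evaluated one level higher and
touches only even registers from `2 * (t + 1)` on, so the first result survives; `64 ≤ t` protects
the variables. -/
lemma Expr.ok_comp (fuel : ℕ) (e : Expr) {env : Env} {t : ℕ} {s : State} (ht : 64 ≤ t)
    (hv : ∀ i : Fin 64, s.reg (2 * i) = env.v i) (hm : s.mem = env.m) :
    Ok fuel (e.comp t) s fun s' => s'.reg (2 * t) = e.eval env ∧ SameBelow s s' t ∧
      s'.time = s.time + e.cost env := by
  induction e generalizing t s with
  | var i =>
    refine Ok.seq (Ok.const rfl) ?_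
    rintro s' rfl
    refine Ok.arith ?_
    have hi : (2 * (i : ℕ)) ≠ 2 * t := by have := i.2; omega
    refine ⟨by simp [State.setReg, State.tick, Op.eval, hi, hv, Expr.eval], ⟨fun r hr => ?_, rfl⟩, ?_⟩
    · simp [State.setReg, State.tick, hr t le_rfl]
    · simp [State.setReg, State.tick, hi, hv, Expr.cost]; ring
  | const z =>
    refine Ok.const ⟨by simp [State.setReg, State.tick, Expr.eval], ⟨fun r hr => ?_, rfl⟩, rfl⟩
    simp [State.setReg, State.tick, hr t le_rfl]
  | op o e f ihe ihf =>
    refine Ok.seq (ihe ht hv hm) ?_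
    rintro s1 ⟨h1, h2, h3⟩
    refine Ok.seq (ihf (t := t + 1) (by omega) ?_ (by rw [h2.mem, hm])) ?_
    · intro i
      rw [h2.reg _ (fun j hj => by have := i.2; omega), hv]
    · rintro s2 ⟨h4, h5, h6⟩
      refine Ok.arith ?_
      have e1 : s2.reg (2 * t) = e.eval env := by
        rw [h5.reg _ (fun j hj => by omega), h1]
      refine ⟨?_, ⟨fun r hr => ?_, ?_⟩, ?_⟩
      · simp only [State.setReg, State.tick, Function.update_self, e1, h4, Expr.eval]
      · simp only [State.setReg, State.tick]
        rw [Function.update_of_ne (hr t le_rfl), h5.reg _ (fun j hj => hr j (by omega)),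
          h2.reg _ hr]
      · simp [State.setReg, State.tick, h5.mem, h2.mem]
      · simp only [State.setReg, State.tick, e1, h4, Expr.cost]
        omega
  | mem e ihe =>
    refine Ok.seq (ihe ht hv hm) ?_
    rintro s1 ⟨h1, h2, h3⟩
    refine Ok.load ⟨?_, ⟨fun r hr => ?_, ?_⟩, ?_⟩
    · simp [State.setReg, State.tick, h1, h2.mem, hm, Expr.eval]
    · simp only [State.setReg, State.tick]
      rw [Function.update_of_ne (hr t le_rfl), h2.reg _ hr]
    · simp [State.setReg, State.tick, h2.mem]
    · simp only [State.setReg, State.tick, h1, h2.mem, hm, Expr.cost]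
      omega

lemma SameBelow.at {s s' : State} {env : Env} {o : ℕ → ℤ} {t t' u : ℕ} (h : SameBelow s s' u)
    (hu : 64 ≤ u) (hs : At s env o t) (ht : s'.time ≤ t') : At s' env o t' where
  even i := by rw [h.reg _ (fun j hj => by have := i.2; omega), hs.even]
  odd r := by rw [h.reg _ (fun j hj => by omega), hs.odd]
  mem := by rw [h.mem, hs.mem]
  time := ht

end comp

/-- Commands without loops. -/
inductive Cmd
  | nop
  /-- write the value of `e` to variable `x` -/
  | asg (x : Fin 64) (e : Expr)
  /-- write the value of `e` to the memory cell with address `a` -/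
  | sto (a e : Expr)
  /-- if the value of `e` is positive then `c` else `d` -/
  | ifp (e : Expr) (c d : Cmd)
  | seq (c d : Cmd)

namespace Cmd

instance : AndThen Cmd := ⟨fun c d => .seq c (d ())⟩

/-- The effect of a command. -/
def sem : Cmd → Env → Env
  | nop, s => s
  | asg x e, s => { s with v := Function.update s.v x (e.eval s) }
  | sto a e, s => { s with m := Function.update s.m (a.eval s) (e.eval s) }
  | ifp e c d, s => if 0 < e.eval s then c.sem s else d.sem s
  | seq c d, s => d.sem (c.sem s)

/-- The cost of a command. -/
def cost : Cmd → Env → ℕ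
  | nop, _ => 1
  | asg _ e, s => e.cost s + (len (e.eval s) + 2)
  | sto a e, s => a.cost s + e.cost s + (len (a.eval s) + len (e.eval s))
  | ifp e c d, s => e.cost s + len (e.eval s) + if 0 < e.eval s then c.cost s else d.cost s
  | seq c d, s => c.cost s + d.cost (c.sem s)

/-- The program for a command. -/
def comp : Cmd → Prog
  | nop => .skip
  | asg x e => .seq (e.comp 64) (.seq (.const (2 * x) 0) (.arith .add (2 * x) (2 * 64) (2 * x)))
  | sto a e => .seq (a.comp 64) (.seq (e.comp 65) (.store (2 * 64) (2 * 65)))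
  | ifp e c d => .seq (e.comp 64) (.ite (2 * 64) c.comp d.comp)
  | seq c d => .seq c.comp d.comp

/-- All variables are from `S`. -/
def In (S : Finset (Fin 64)) : Cmd → Prop
  | nop => True
  | asg x e => x ∈ S ∧ e.In S
  | sto a e => a.In S ∧ e.In S
  | ifp e c d => e.In S ∧ c.In S ∧ d.In S
  | seq c d => c.In S ∧ d.In S

/-- All values that are read from the memory have length at most `l`. -/
def LoadsLe (l : ℕ) : Cmd → Env → Prop
  | nop, _ => True
  | asg _ e, s => e.LoadsLe l s
  | sto a e, s => a.LoadsLe l s ∧ e.LoadsLe l s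
  | ifp e c d, s => e.LoadsLe l s ∧ (0 < e.eval s → c.LoadsLe l s) ∧
      (¬ 0 < e.eval s → d.LoadsLe l s)
  | seq c d, s => c.LoadsLe l s ∧ d.LoadsLe l (c.sem s)

/-- A growth factor for costs and lengths. -/
def growth : Cmd → ℕ → ℕ
  | nop, K => K + 1
  | asg _ e, K => K + 2 * e.growth K + 2
  | sto a e, K => K + 2 * (a.growth K + e.growth K)
  | ifp e c d, K => 2 * e.growth K + c.growth K + d.growth K
  | seq c d, K => c.growth K + d.growth (c.growth K)

/-- The induction has to vary `K`: in a sequence the second command meets variables that the first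
one has already enlarged, so its factor is taken at the growth of the first. -/
lemma growth_spec {S : Finset (Fin 64)} {l K : ℕ} (hl : 1 ≤ l) {s : Env}
    (hs : ∀ i ∈ S, len (s.v i) ≤ K * l) (c : Cmd) (hc : c.In S) (hle : c.LoadsLe l s) :
    c.cost s ≤ c.growth K * l ∧ ∀ i ∈ S, len ((c.sem s).v i) ≤ c.growth K * l := by
  induction c generalizing s K with
  | nop =>
    simp only [cost, sem, growth]
    exact ⟨by nlinarith, fun i hi => by nlinarith [hs i hi]⟩
  | asg x e =>
    obtain ⟨h1, h2⟩ := e.growth_spec hl hs hc.2 hle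
    simp only [cost, sem, growth]
    refine ⟨by nlinarith, fun i hi => ?_⟩
    rcases eq_or_ne i x with rfl | hix
    · rw [Function.update_self]; nlinarith
    · rw [Function.update_of_ne hix]; nlinarith [hs i hi]
  | sto a e =>
    obtain ⟨h1, h2⟩ := e.growth_spec hl hs hc.2 hle.2
    obtain ⟨h3, h4⟩ := a.growth_spec hl hs hc.1 hle.1
    simp only [cost, sem, growth]
    exact ⟨by nlinarith, fun i hi => by nlinarith [hs i hi]⟩
  | ifp e c d ihc ihd =>
    obtain ⟨h1, h2⟩ := e.growth_spec hl hs hc.1 hle.1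
    simp only [cost, sem, growth]
    split_ifs with h
    · obtain ⟨h3, h4⟩ := ihc hs hc.2.1 (hle.2.1 h)
      exact ⟨by nlinarith, fun i hi => by nlinarith [h4 i hi]⟩
    · obtain ⟨h3, h4⟩ := ihd hs hc.2.2 (hle.2.2 h)
      exact ⟨by nlinarith, fun i hi => by nlinarith [h4 i hi]⟩
  | seq c d ihc ihd =>
    obtain ⟨h1, h2⟩ := ihc hs hc.1 hle.1
    obtain ⟨h3, h4⟩ := ihd h2 hc.2 hle.2
    simp only [cost, sem, growth]
    exact ⟨by nlinarith, fun i hi => by nlinarith [h4 i hi]⟩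

lemma ok_comp (fuel : ℕ) (c : Cmd) {env : Env} {o : ℕ → ℤ} {t : ℕ} {s : State}
    (h : At s env o t) :
    Ok fuel c.comp s fun s' => At s' (c.sem env) o (t + c.cost env) := by
  induction c generalizing env t s with
  | nop => exact Ok.skip ⟨h.even, h.odd, h.mem, by simpa [State.tick, cost] using h.time⟩
  | asg x e =>
    refine Ok.seq (e.ok_comp fuel le_rfl h.even h.mem) ?_
    rintro s1 ⟨h1, h2, h3⟩
    have h4 := h2.at le_rfl h (t' := t + e.cost env) (by have := h.time; omega)
    refine Ok.seq (Ok.const rfl) ?_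
    rintro s2 rfl
    have hx : (2 * 64 : ℕ) ≠ 2 * x := by have := x.2; omega
    refine Ok.arith ⟨fun i => ?_, fun r => ?_, ?_, ?_⟩
    · rcases eq_or_ne i x with rfl | hix
      · simp only [State.setReg, State.tick, sem, Function.update_self, Op.eval]
        rw [Function.update_of_ne hx, h1, add_zero]
      · have h5 : 2 * (i : ℕ) ≠ 2 * x := fun hc => hix (Fin.ext (by omega))
        simp only [State.setReg, State.tick, sem]
        rw [Function.update_of_ne h5, Function.update_of_ne h5, Function.update_of_ne hix, h4.even]
    · have h5 : 2 * r + 1 ≠ 2 * x := by omega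
      simp only [State.setReg, State.tick]
      rw [Function.update_of_ne h5, Function.update_of_ne h5, h4.odd]
    · simpa [State.setReg, State.tick, sem] using h4.mem
    · simp only [State.setReg, State.tick, Function.update_self, cost]
      rw [Function.update_of_ne hx, h1, len_zero]
      have := h4.time
      omega
  | sto a e =>
    refine Ok.seq (a.ok_comp fuel le_rfl h.even h.mem) ?_
    rintro s1 ⟨h1, h2, h3⟩
    have h4 := h2.at le_rfl h (t' := t + a.cost env) (by have := h.time; omega)
    refine Ok.seq (e.ok_comp (t := 65) fuel (by norm_num) h4.even h4.mem) ?_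
    rintro s2 ⟨h5, h6, h7⟩
    have h8 := h6.at (by norm_num) h4 (t' := t + a.cost env + e.cost env)
      (by have := h4.time; omega)
    have h9 : s2.reg (2 * 64) = a.eval env := by
      rw [h6.reg _ (fun j hj => by omega), h1]
    refine Ok.store ⟨h8.even, h8.odd, ?_, ?_⟩
    · simp only [State.setMem, State.tick, sem, h9, h5, h8.mem]
    · simp only [State.setMem, State.tick, cost, h9, h5]
      have := h8.time
      omega
  | ifp e c d ihc ihd =>
    refine Ok.seq (e.ok_comp fuel le_rfl h.even h.mem) ?_
    rintro s1 ⟨h1, h2, h3⟩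
    have h4 := h2.at le_rfl h (t' := t + e.cost env) (by have := h.time; omega)
    have h5 : At (s1.tick (len (s1.reg (2 * 64)))) env o (t + e.cost env + len (e.eval env)) :=
      ⟨h4.even, h4.odd, h4.mem, by simpa [State.tick, h1] using h4.time⟩
    refine Ok.ite (fun hp => ?_) (fun hp => ?_) <;> rw [h1] at hp
    · refine (ihc h5).mono fun s' hs' => ?_
      simp only [sem, cost, hp, if_true]
      exact hs'.mono (by omega)
    · refine (ihd h5).mono fun s' hs' => ?_
      simp only [sem, cost, hp, if_false]
      exact hs'.mono (by omega)
  | seq c d ihc ihd =>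
    exact Ok.seq (ihc h) fun s1 h1 => (ihd h1).mono fun s' hs' => hs'.mono (by simp [cost]; omega)

end Cmd

/-! ### Loops -/

/-- The loop that repeats `c` as long as the value of `e` is positive. -/
def wh (e : Expr) (c : Prog) : Prog :=
  .seq (e.comp 64) (.while (2 * 64) (.seq c (e.comp 64)))

/-- Invariant of a loop whose body has no loops; `i` is a bound for the number of remaining rounds,
and `κ` bounds the cost of a round. -/
lemma ok_wh {fuel : ℕ} {e : Expr} {c : Cmd} (P : ℕ → Env → Prop) {n κ : ℕ} {o : ℕ → ℤ}
    {env : Env} {s : State} {t : ℕ} (h : At s env o t) (hn : n ≤ fuel) (h0 : P n env)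
    (hstep : ∀ i env, i < n → P (i + 1) env → 0 < e.eval env → P i (c.sem env))
    (hzero : ∀ env, P 0 env → e.eval env ≤ 0)
    (hcost : ∀ i env, i ≤ n → P i env → e.cost env + len (e.eval env) ≤ κ ∧
      (0 < e.eval env → e.cost env + len (e.eval env) + c.cost env ≤ κ)) :
    Ok fuel (wh e c.comp) s fun s' => ∃ i env', P i env' ∧ e.eval env' ≤ 0 ∧
      At s' env' o (t + (n + 1) * κ) := by
  refine Ok.seq (e.ok_comp fuel le_rfl h.even h.mem) ?_
  rintro s1 ⟨h1, h2, h3⟩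
  have h4 := h2.at le_rfl h (t' := t + e.cost env) (by have := h.time; omega)
  -- The guard for the coming test has been evaluated before the round to which its cost belongs,
  -- hence the separate summand `e.cost env'`.
  refine Ok.while (fun i s => ∃ env' t', P i env' ∧ s.reg (2 * 64) = e.eval env' ∧
    At s env' o t' ∧ t' ≤ t + (n - i) * κ + e.cost env') n hn
    ⟨env, _, h0, h1, h4, by omega⟩ ?_ ?_ ?_
  · rintro i s hi ⟨env', t', hP, hr, hs, ht⟩ hpos
    rw [hr] at hpos
    have hs' : At (s.tick (len (s.reg (2 * 64)))) env' o (t' + len (e.eval env')) :=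
      ⟨hs.even, hs.odd, hs.mem, by simpa [State.tick, hr] using hs.time⟩
    refine Ok.seq (c.ok_comp fuel hs') fun s2 h5 => ?_
    refine (e.ok_comp fuel le_rfl h5.even h5.mem).mono ?_
    rintro s3 ⟨h6, h7, h8⟩
    refine ⟨_, _, hstep i env' hi hP hpos, h6, h7.at le_rfl h5 (h8.le.trans
      (Nat.add_le_add_right h5.time _)), ?_⟩
    have := (hcost _ _ (by omega) hP).2 hpos
    have e1 : (n - i) * κ = (n - (i + 1)) * κ + κ := by
      rw [show n - i = n - (i + 1) + 1 by omega, add_mul, one_mul]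
    omega
  · rintro s ⟨env', t', hP, hr, hs, ht⟩
    rw [hr]
    exact not_lt.mpr (hzero _ hP)
  · rintro i s hi ⟨env', t', hP, hr, hs, ht⟩ hpos
    rw [hr] at hpos
    refine ⟨i, env', hP, not_lt.mp hpos, hs.even, hs.odd, hs.mem, ?_⟩
    have := (hcost _ _ hi hP).1
    have e1 : (n - i) * κ ≤ n * κ := Nat.mul_le_mul_right _ (by omega)
    have := hs.time
    simp only [State.tick, hr, add_mul, one_mul]
    omega

/-! ### Simulation of a machine on a virtual input -/

lemma At.setOdd {s : State} {env : Env} {o : ℕ → ℤ} {t : ℕ} (h : At s env o t) (r : ℕ) (z : ℤ)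
    (k : ℕ) : At ((s.setReg (2 * r + 1) z).tick k) env (Function.update o r z) (t + k) where
  even i := by
    simp only [State.setReg, State.tick]
    rw [Function.update_of_ne (by omega), h.even]
  odd r' := by
    simp only [State.setReg, State.tick]
    rcases eq_or_ne r' r with rfl | hr
    · simp
    · rw [Function.update_of_ne (by omega), Function.update_of_ne hr, h.odd]
  mem := h.mem
  time := Nat.add_le_add_right h.time k

lemma At.setEven {s : State} {env : Env} {o : ℕ → ℤ} {t : ℕ} (h : At s env o t) (i : Fin 64)
    (z : ℤ) (k : ℕ) : At ((s.setReg (2 * i) z).tick k) { env with v := Function.update env.v i z }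
      o (t + k) where
  even j := by
    simp only [State.setReg, State.tick]
    rcases eq_or_ne j i with rfl | hj
    · simp
    · rw [Function.update_of_ne (fun hc => hj (Fin.ext (by omega))), Function.update_of_ne hj,
        h.even]
  odd r' := by
    simp only [State.setReg, State.tick]
    rw [Function.update_of_ne (by omega), h.odd]
  mem := h.mem
  time := Nat.add_le_add_right h.time k

lemma At.tick {s : State} {env : Env} {o : ℕ → ℤ} {t : ℕ} (h : At s env o t) (k : ℕ) :
    At (s.tick k) env o (t + k) :=
  ⟨h.even, h.odd, h.mem, Nat.add_le_add_right h.time k⟩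

/-- Copy the odd register `2 * a + 1` to the variable `i`. -/
def getOdd (i : Fin 64) (a : ℕ) : Prog :=
  .seq (.const (2 * i) 0) (.arith .add (2 * i) (2 * a + 1) (2 * i))

/-- Copy the variable `i` to the odd register `2 * a + 1`. -/
def putOdd (a : ℕ) (i : Fin 64) : Prog :=
  .seq (.const (2 * a + 1) 0) (.arith .add (2 * a + 1) (2 * i) (2 * a + 1))

lemma ok_getOdd (fuel : ℕ) (i : Fin 64) (a : ℕ) {s : State} {env : Env} {o : ℕ → ℤ} {t : ℕ}
    (h : At s env o t) : Ok fuel (getOdd i a) s fun s' =>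
      At s' { env with v := Function.update env.v i (o a) } o (t + (len (o a) + 2)) := by
  refine Ok.seq (Ok.const rfl) ?_
  rintro s1 rfl
  have h1 := h.setEven i 0 (len 0)
  set s1 := (s.setReg (2 * i) 0).tick (len 0)
  refine Ok.arith ?_
  have e1 : s1.reg (2 * i) = 0 := by rw [h1.even]; simp
  have := h1.setEven i (Op.add.eval (s1.reg (2 * a + 1)) (s1.reg (2 * i)))
    (len (s1.reg (2 * a + 1)) + len (s1.reg (2 * i)))
  rw [e1, h1.odd] at this ⊢
  simp only [Op.eval, add_zero, Function.update_idem, len_zero] at this ⊢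
  exact this.mono (by omega)

lemma ok_putOdd (fuel : ℕ) (i : Fin 64) (a : ℕ) {s : State} {env : Env} {o : ℕ → ℤ} {t : ℕ}
    (h : At s env o t) : Ok fuel (putOdd a i) s fun s' =>
      At s' env (Function.update o a (env.v i)) (t + (len (env.v i) + 2)) := by
  refine Ok.seq (Ok.const rfl) ?_
  rintro s1 rfl
  have h1 := h.setOdd a 0 (len 0)
  set s1 := (s.setReg (2 * a + 1) 0).tick (len 0)
  refine Ok.arith ?_
  have e1 : s1.reg (2 * a + 1) = 0 := by rw [h1.odd]; simp
  have := h1.setOdd a (Op.add.eval (s1.reg (2 * i)) (s1.reg (2 * a + 1)))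
    (len (s1.reg (2 * i)) + len (s1.reg (2 * a + 1)))
  rw [e1, h1.even] at this ⊢
  simp only [Op.eval, add_zero, Function.update_idem, len_zero] at this ⊢
  exact this.mono (by omega)

lemma Cmd.sem_andThen (c d : Cmd) (s : Env) : (c >> d).sem s = d.sem (c.sem s) := rfl
lemma Cmd.in_andThen (c d : Cmd) (S : Finset (Fin 64)) : (c >> d).In S ↔ c.In S ∧ d.In S := Iff.rfl
lemma Cmd.loadsLe_andThen (c d : Cmd) (l : ℕ) (s : Env) :
    (c >> d).LoadsLe l s ↔ c.LoadsLe l s ∧ d.LoadsLe l (c.sem s) := Iff.rfl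

/-- Set variables to zero. -/
def clear (l : List (Fin 64)) : Cmd := l.foldr (fun x c => .seq (.asg x 0) c) .nop

lemma clear_sem (l : List (Fin 64)) (s : Env) :
    (clear l).sem s = ⟨fun i => if i ∈ l then 0 else s.v i, s.m⟩ := by
  induction l generalizing s with
  | nil => simp [clear, Cmd.sem]
  | cons x l ih =>
    change (clear l).sem _ = _
    rw [ih]
    ext i
    · by_cases h : i ∈ l
      · simp [h]
      · by_cases hx : i = x
        · subst hx; simp [Cmd.sem]
        · simp [h, hx, Cmd.sem]
    · rfl

lemma clear_cost (l : List (Fin 64)) (s : Env) : (clear l).cost s = 4 * l.length + 1 := by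
  induction l generalizing s with
  | nil => simp [clear, Cmd.cost]
  | cons x l ih =>
    change (Cmd.asg x 0).cost s + (clear l).cost _ = _
    rw [ih, List.length_cons]
    have : (Cmd.asg x 0).cost s = 4 := by
      change len 0 + (len 0 + 2) = 4
      simp
    omega

/-- The variables that are used only during the simulation of a memory access. -/
def scratch : List (Fin 64) := [29, 30, 31, 32, 33, 34, 35, 36, 37, 38, 39, 40, 41, 42, 43]

/-- The variables that may occur in the simulation of a memory access. -/
def simVars : Finset (Fin 64) :=
  {1, 9, 11, 12, 13, 21, 22, 23, 24, 25, 26, 27, 28, 29, 30, 31, 32, 33, 34, 35, 36, 37, 38, 39, 40,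
    41, 42, 43}

set_option maxRecDepth 10000 in
lemma mem_scratch_of_mem_simVars : ∀ i ∈ simVars, ¬ i < 28 → i ≠ 28 → i ∈ scratch := by
  decide

lemma notMem_scratch : ∀ i < 28, i ∉ scratch := by
  decide

/-- Read the simulated memory cell with the address in variable `28` to variable `30`: the
simulated cell `x` has its value in cell `x * W + S`, provided that cell `x * W + S + 1` holds the
tag of the present simulation; otherwise its value is computed by `E`. -/
def loadCmd (E : Cmd) : Cmd :=
  .asg 29 (.var 28 * .var 22 + .var 21) >>
  .ifp (.mem (.var 29 + 1) - .var 23 + 1) (.asg 30 (.mem (.var 29))) E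

/-- Write variable `30` to the simulated memory cell with the address in variable `28`. -/
def storeCmd : Cmd :=
  .asg 29 (.var 28 * .var 22 + .var 21) >> .sto (.var 29) (.var 30) >>
  .sto (.var 29 + 1) (.var 23)

/-- Simulation of a program, where `E` computes the virtual input. -/
def simulate (E : Cmd) : Prog → Prog
  | .skip => .skip
  | .const r z => .const (2 * r + 1) z
  | .arith o r a b => .arith o (2 * r + 1) (2 * a + 1) (2 * b + 1)
  | .load r a => .seq (getOdd 28 a) (.seq (clear scratch).comp (.seq (loadCmd E).comp (putOdd r 30)))
  | .store a b => .seq (getOdd 28 a) (.seq (clear scratch).comp (.seq (getOdd 30 b) storeCmd.comp))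
  | .flip r => .flip (2 * r + 1)
  | .seq c d => .seq (simulate E c) (simulate E d)
  | .ite r c d => .ite (2 * r + 1) (simulate E c) (simulate E d)
  | .while r c => .while (2 * r + 1) (simulate E c)

/-- The fixed data of a simulation, started at time `t0`. -/
structure SimData (E : Cmd) where
  v : Fin 64 → ℤ
  m : ℤ → ℤ
  virt : ℤ → ℤ
  l : ℕ
  t0 : ℕ
  one_le : 1 ≤ l
  S_nonneg : 0 ≤ v 21
  -- With stride `S + 2` the pairs of cells `a * W + S`, `a * W + S + 1` are disjoint for different
  -- `a`, and even for negative `a` none of them meets the protected cells `0, …, S - 1`.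
  W_eq : v 22 = v 21 + 2
  tag_pos : 0 < v 23
  len_le : ∀ i ∈ simVars, i < 28 → len (v i) ≤ l
  E_in : E.In simVars
  -- A virtual cell may be recomputed at any moment of the simulation, so its value must be
  -- determined by the protected variables and the protected memory alone.
  E_spec : ∀ env : Env, (∀ i < 28, env.v i = v i) → (∀ z, 0 ≤ z → z < v 21 → env.m z = m z) →
    (E.sem env).v 30 = virt (env.v 28) ∧ (E.sem env).m = env.m ∧
    (∀ i < 28, (E.sem env).v i = env.v i) ∧ E.LoadsLe l env

namespace SimData

variable {E : Cmd} (D : SimData E)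

/-- The slowdown of the simulation. -/
def slow : ℕ := ((loadCmd E).growth 1 + storeCmd.growth 1 + 100) * (D.l + 1)

/-- The address of a simulated cell. -/
def addr (a : ℤ) : ℤ := a * D.v 22 + D.v 21

lemma addr_inj {a b : ℤ} (h : D.addr a = D.addr b) : a = b := by
  have h1 := D.W_eq; have h2 := D.S_nonneg
  exact mul_right_cancel₀ (b := D.v 22) (by omega) (by simpa [addr] using h)

lemma addr_ne_succ (a b : ℤ) : D.addr a ≠ D.addr b + 1 := by
  intro h
  have h1 := D.W_eq; have h2 := D.S_nonneg
  have h3 : (a - b) * D.v 22 = 1 := by simp only [addr] at h; linarith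
  have h4 := Int.eq_one_or_neg_one_of_mul_eq_one' h3
  omega

lemma addr_out (a : ℤ) : D.addr a < 0 ∨ D.v 21 ≤ D.addr a := by
  have h1 := D.W_eq; have h2 := D.S_nonneg
  rcases lt_or_ge a 0 with h | h
  · left; simp only [addr]; nlinarith
  · right; simp only [addr]; nlinarith

lemma addr_succ_out (a : ℤ) : D.addr a + 1 < 0 ∨ D.v 21 ≤ D.addr a + 1 := by
  have h1 := D.W_eq; have h2 := D.S_nonneg
  rcases lt_or_ge a 0 with h | h
  · left; simp only [addr]; nlinarith
  · right; simp only [addr]; nlinarith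

/-- The memory `m` represents the simulated memory `m'`. -/
structure Mem (m m' : ℤ → ℤ) : Prop where
  table : ∀ z, 0 ≤ z → z < D.v 21 → m z = D.m z
  written : ∀ a, m (D.addr a + 1) = D.v 23 → m (D.addr a) = m' a
  unwritten : ∀ a, m (D.addr a + 1) ≠ D.v 23 → D.virt a = m' a
  -- Earlier simulations leave smaller tags, so their cells count as unwritten and need not be
  -- erased. The bounds turn the test for `tag - v 23 + 1 > 0` into a test for equality, and they
  -- limit the length of a tag that is read.
  tag_nonneg : ∀ a, 0 ≤ m (D.addr a + 1)
  tag_le : ∀ a, m (D.addr a + 1) ≤ D.v 23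

/-- The state `s'` represents the state `s` of the simulated machine. -/
def Rel (s s' : State) : Prop :=
  ∃ env, At s' env s.reg (D.t0 + D.slow * s.time) ∧ (∀ i < 28, env.v i = D.v i) ∧
    D.Mem env.m s.mem

variable {D}

lemma le_slow (k : ℕ) : k ≤ D.slow * k := by
  have : 1 ≤ D.slow := Nat.mul_pos (by omega) (by omega)
  nlinarith

/-- A memory access charged `k` is simulated with numbers of length at most `k + l`, and `k + l ≤ (l
+ 1) * k` because `k` is positive. The terms `k + 99` pay for copying registers and clearing the
scratch variables. -/
lemma cost_le_slow {g c k : ℕ} (hg : g ≤ (loadCmd E).growth 1 + storeCmd.growth 1) (hk : 1 ≤ k)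
    (hc : c ≤ g * (k + D.l)) : c + k + 99 ≤ D.slow * k := by
  have h1 : k + D.l ≤ (D.l + 1) * k := by nlinarith
  have h2 : g * (k + D.l) ≤ g * ((D.l + 1) * k) := Nat.mul_le_mul_left _ h1
  have h3 : (g + 100) * (D.l + 1) * k ≤ D.slow * k := by
    unfold slow
    gcongr
  have h4 : k ≤ (D.l + 1) * k := by nlinarith
  nlinarith

lemma loads_simVars {env : Env} {l : ℕ} (hl : D.l ≤ l) (hv : ∀ i < 28, env.v i = D.v i)
    (h28 : len (env.v 28) ≤ l) (h30 : len (env.v 30) ≤ l)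
    (hs : ∀ i ∈ scratch, i ≠ 30 → env.v i = 0) :
    ∀ i ∈ simVars, len (env.v i) ≤ 1 * l := by
  have := D.one_le
  intro i hi
  rw [one_mul]
  by_cases h : i < 28
  · rw [hv i h]; exact (D.len_le i hi h).trans hl
  · by_cases h28' : i = 28
    · subst h28'; exact h28
    · by_cases h30' : i = 30
      · subst h30'; exact h30
      · have : i ∈ scratch := mem_scratch_of_mem_simVars i hi h h28'
        rw [hs i this h30', len_zero]
        omega

/-- Either the present tag shows that the cell has been written, or its content is still the virtual
input and is recomputed by `E`. The length of a written value is part of the cost `k` of the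
simulated instruction, so it may enter the bound. -/
lemma ok_load (fuel : ℕ) (r a : ℕ) {s s' : State} (h : D.Rel s s') :
    Ok fuel (simulate E (.load r a)) s' (D.Rel
      ((s.setReg r (s.mem (s.reg a))).tick (len (s.reg a) + len (s.mem (s.reg a))))) := by
  obtain ⟨env, h1, hv, hm⟩ := h
  refine Ok.seq (ok_getOdd fuel 28 a h1) fun s1 h2 => ?_
  refine Ok.seq ((clear scratch).ok_comp fuel h2) fun s2 h3 => ?_
  rw [clear_cost, clear_sem] at h3
  set x := s.reg a with hx
  set env2 : Env := ⟨fun i => if i ∈ scratch then 0 else Function.update env.v 28 x i, env.m⟩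
    with henv2
  have hv2 : ∀ i < 28, env2.v i = D.v i := by
    intro i hi
    have h5 := notMem_scratch i hi
    simp only [henv2, h5, if_false]
    rw [Function.update_of_ne (by rintro rfl; exact absurd hi (by decide)), hv i hi]
  have h28 : env2.v 28 = x := by simp [henv2, scratch]
  have hsc : ∀ i ∈ scratch, env2.v i = 0 := fun i hi => by simp [henv2, hi]
  have h30 : env2.v 30 = 0 := hsc 30 (by decide)
  set k := len x + len (s.mem x) with hk
  have hk1 : 1 ≤ k := (one_le_len x).trans (Nat.le_add_right _ _)
  set env3 : Env := ⟨Function.update env2.v 29 (D.addr x), env.m⟩ with henv3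
  have hasg : (Cmd.asg 29 (.var 28 * .var 22 + .var 21)).sem env2 = env3 := by
    simp only [Cmd.sem, Expr.eval_add, Expr.eval_mul, Expr.eval_var, h28, hv2 22 (by decide),
      hv2 21 (by decide), henv3, addr]
    rfl
  have hv3 : ∀ i < 28, env3.v i = D.v i := by
    intro i hi
    simp only [henv3]
    rw [Function.update_of_ne (by rintro rfl; exact absurd hi (by decide)), hv2 i hi]
  have h328 : env3.v 28 = x := by simp [henv3, h28]
  have h329 : env3.v 29 = D.addr x := by simp [henv3]
  have htab : ∀ z, 0 ≤ z → z < D.v 21 → env3.m z = D.m z := hm.table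
  obtain ⟨hE1, hE2, hE3, hE4⟩ := D.E_spec env3 hv3 htab
  have hguard : (Expr.mem (.var 29 + 1) - .var 23 + 1).eval env3 =
      env.m (D.addr x + 1) - D.v 23 + 1 := by
    have h323 := hv3 23 (by decide)
    simp only [Expr.eval_add, Expr.eval_sub, Expr.eval_mem, Expr.eval_var, Expr.eval_one, h329, h323]
    rfl
  have hsem : ((loadCmd E).sem env2).v 30 = s.mem x ∧ ((loadCmd E).sem env2).m = env.m ∧
      ∀ i < 28, ((loadCmd E).sem env2).v i = D.v i := by
    rw [loadCmd, Cmd.sem_andThen, hasg]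
    simp only [Cmd.sem]
    rw [hguard]
    have t1 := hm.tag_le x
    split_ifs with hp
    · have t2 := hm.written x (by omega)
      refine ⟨by simp [henv3, t2], rfl, fun i hi => ?_⟩
      simp only []
      rw [Function.update_of_ne (by rintro rfl; exact absurd hi (by decide)), hv3 i hi]
    · have t2 := hm.unwritten x (by omega)
      exact ⟨by rw [hE1, h328, t2], hE2, fun i hi => by rw [hE3 i hi, hv3 i hi]⟩
  have hloads : (loadCmd E).LoadsLe (k + D.l) env2 := by
    rw [loadCmd, Cmd.loadsLe_andThen, hasg]
    refine ⟨by simp [Cmd.LoadsLe], ?_, fun hp => ?_, fun hp => ?_⟩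
    · simp only [Expr.loadsLe_add, Expr.loadsLe_sub, Expr.loadsLe_mem, Expr.loadsLe_var,
        Expr.eval_add, Expr.eval_var, Expr.eval_one, h329, true_and, and_true]
      refine ⟨⟨trivial, ?_⟩, trivial⟩
      have t1 := hm.tag_le x
      have t2 := hm.tag_nonneg x
      have : len (env.m (D.addr x + 1)) ≤ len (D.v 23) := len_le_of_natAbs_le (by omega)
      exact this.trans ((D.len_le 23 (by decide) (by decide)).trans (by omega))
    · rw [hguard] at hp
      have t1 := hm.tag_le x
      have t2 := hm.written x (by omega)
      simp only [Cmd.LoadsLe, Expr.loadsLe_mem, Expr.loadsLe_var, true_and, Expr.eval_var, h329]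
      change len (env.m (D.addr x)) ≤ _
      rw [t2]; omega
    · have hmono : ∀ (c : Cmd) (l l' : ℕ) (e : Env), l ≤ l' → c.LoadsLe l e → c.LoadsLe l' e := by
        have hmonoE : ∀ (c : Expr) (l l' : ℕ) (e : Env), l ≤ l' → c.LoadsLe l e →
            c.LoadsLe l' e := by
          intro c l l' e hl
          induction c with
          | var | const => exact id
          | op o e f ihe ihf => exact fun h => ⟨ihe h.1, ihf h.2⟩
          | mem e ih => exact fun h => ⟨ih h.1, h.2.trans hl⟩
        intro c l l' e hl
        induction c generalizing e with
        | nop => exact id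
        | asg => exact hmonoE _ _ _ _ hl
        | sto => exact fun h => ⟨hmonoE _ _ _ _ hl h.1, hmonoE _ _ _ _ hl h.2⟩
        | ifp e c d ihc ihd =>
          exact fun h => ⟨hmonoE _ _ _ _ hl h.1, fun hp => ihc _ (h.2.1 hp),
            fun hp => ihd _ (h.2.2 hp)⟩
        | seq c d ihc ihd => exact fun h => ⟨ihc _ h.1, ihd _ h.2⟩
      exact hmono _ _ _ _ (by omega) hE4
  have hin : (loadCmd E).In simVars := by
    simp only [loadCmd, Cmd.in_andThen, Cmd.In, Expr.in_add, Expr.in_mul, Expr.in_sub,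
      Expr.in_mem, Expr.in_var, Expr.in_one, D.E_in, and_true]
    decide
  have hcost := ((loadCmd E).growth_spec (l := k + D.l) (by omega)
    (D.loads_simVars (by omega) hv2 (by rw [h28]; omega) (by rw [h30, len_zero]; omega)
      (fun i hi _ => hsc i hi)) hin hloads).1
  refine Ok.seq ((loadCmd E).ok_comp fuel h3) fun s3 h4 => ?_
  refine (ok_putOdd fuel 30 r h4).mono fun s4 h5 => ?_
  rw [hsem.1] at h5
  refine ⟨_, h5.mono ?_, hsem.2.2, ?_⟩
  · have := D.cost_le_slow (g := (loadCmd E).growth 1) (by omega) hk1 hcost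
    simp only [State.tick, State.setReg, scratch, List.length_cons, List.length_nil, mul_add] at *
    omega
  · rw [hsem.2.1]; exact hm

lemma ok_store (fuel : ℕ) (a b : ℕ) {s s' : State} (h : D.Rel s s') :
    Ok fuel (simulate E (.store a b)) s' (D.Rel
      ((s.setMem (s.reg a) (s.reg b)).tick (len (s.reg a) + len (s.reg b)))) := by
  obtain ⟨env, h1, hv, hm⟩ := h
  refine Ok.seq (ok_getOdd fuel 28 a h1) fun s1 h2 => ?_
  refine Ok.seq ((clear scratch).ok_comp fuel h2) fun s2 h3 => ?_
  rw [clear_cost, clear_sem] at h3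
  refine Ok.seq (ok_getOdd fuel 30 b h3) fun s2 h3 => ?_
  set x := s.reg a with hx
  set env2 : Env := ⟨Function.update
    (fun i => if i ∈ scratch then 0 else Function.update env.v 28 x i) 30 (s.reg b), env.m⟩
    with henv2
  have hv2 : ∀ i < 28, env2.v i = D.v i := by
    intro i hi
    have h5 := notMem_scratch i hi
    simp only [henv2]
    rw [Function.update_of_ne (by rintro rfl; exact absurd hi (by decide)), if_neg h5,
      Function.update_of_ne (by rintro rfl; exact absurd hi (by decide)), hv i hi]
  have h28 : env2.v 28 = x := by simp [henv2, scratch]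
  have hsc : ∀ i ∈ scratch, i ≠ 30 → env2.v i = 0 := fun i hi hi' => by simp [henv2, hi, hi']
  have h30 : env2.v 30 = s.reg b := by simp [henv2]
  set k := len x + len (s.reg b) with hk
  have hk1 : 1 ≤ k := (one_le_len x).trans (Nat.le_add_right _ _)
  have hsem : (storeCmd.sem env2).m = Function.update (Function.update env.m (D.addr x) (s.reg b))
      (D.addr x + 1) (D.v 23) ∧ ∀ i < 28, (storeCmd.sem env2).v i = D.v i := by
    simp only [storeCmd, Cmd.sem_andThen, Cmd.sem, Expr.eval_add, Expr.eval_mul, Expr.eval_var,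
      Expr.eval_one, Function.update_self, h28, hv2 22 (by decide), hv2 21 (by decide)]
    rw [Function.update_of_ne (by decide), Function.update_of_ne (by decide), h30,
      hv2 23 (by decide)]
    refine ⟨rfl, fun i hi => ?_⟩
    rw [Function.update_of_ne (by rintro rfl; exact absurd hi (by decide)), hv2 i hi]
  have hloads : storeCmd.LoadsLe (k + D.l) env2 := by
    simp only [storeCmd, Cmd.loadsLe_andThen, Cmd.LoadsLe, Expr.loadsLe_add, Expr.loadsLe_mul,
      Expr.loadsLe_var]
    simp
  have hin : storeCmd.In simVars := by
    simp only [storeCmd, Cmd.in_andThen, Cmd.In, Expr.in_add, Expr.in_mul, Expr.in_var,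
      Expr.in_one, and_true]
    decide
  have hcost := (storeCmd.growth_spec (l := k + D.l) (by omega)
    (D.loads_simVars (by omega) hv2 (by rw [h28]; omega) (by rw [h30]; omega) hsc) hin hloads).1
  refine (storeCmd.ok_comp fuel h3).mono fun s4 h5 => ?_
  refine ⟨_, h5.mono ?_, hsem.2, ?_⟩
  · have := D.cost_le_slow (g := storeCmd.growth 1) (by omega) hk1 hcost
    simp only [State.tick, State.setMem, scratch, List.length_cons, List.length_nil, mul_add] at *
    omega
  · rw [hsem.1]
    have n1 := D.addr_ne_succ
    constructor
    · intro z hz hz'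
      have t1 := D.addr_out x
      have t2 := D.addr_succ_out x
      rw [Function.update_of_ne (by omega), Function.update_of_ne (by omega), hm.table z hz hz']
    · intro c hc
      simp only [State.tick, State.setMem]
      rw [Function.update_of_ne (n1 c x)]
      by_cases hcx : c = x
      · simp [hcx]
      · have n2 : D.addr c ≠ D.addr x := fun h => hcx (D.addr_inj h)
        rw [Function.update_of_ne n2, Function.update_of_ne hcx]
        apply hm.written
        rwa [Function.update_of_ne (by simpa using n2),
          Function.update_of_ne (n1 x c).symm] at hc
    · intro c hc
      simp only [State.tick, State.setMem]
      by_cases hcx : c = x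
      · simp [hcx] at hc
      · have n2 : D.addr c ≠ D.addr x := fun h => hcx (D.addr_inj h)
        rw [Function.update_of_ne hcx]
        apply hm.unwritten
        rwa [Function.update_of_ne (by simpa using n2),
          Function.update_of_ne (n1 x c).symm] at hc
    · intro c
      by_cases hcx : c = x
      · have := D.tag_pos
        simp only [hcx, Function.update_self]; omega
      · have n2 : D.addr c ≠ D.addr x := fun h => hcx (D.addr_inj h)
        rw [Function.update_of_ne (by simpa using n2), Function.update_of_ne (n1 x c).symm]
        exact hm.tag_nonneg c
    · intro c
      by_cases hcx : c = x
      · simp [hcx]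
      · have n2 : D.addr c ≠ D.addr x := fun h => hcx (D.addr_inj h)
        rw [Function.update_of_ne (by simpa using n2), Function.update_of_ne (n1 x c).symm]
        exact hm.tag_le c

lemma Rel.tick {s s' : State} (h : D.Rel s s') (k : ℕ) :
    D.Rel (s.tick k) (s'.tick k) := by
  obtain ⟨env, h1, hv, hm⟩ := h
  refine ⟨env, (h1.tick k).mono ?_, hv, hm⟩
  have := D.le_slow k
  simp only [State.tick, mul_add]
  omega

lemma Rel.set {s s' : State} (h : D.Rel s s') (r : ℕ) (z : ℤ) (k : ℕ) :
    D.Rel ((s.setReg r z).tick k) ((s'.setReg (2 * r + 1) z).tick k) := by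
  obtain ⟨env, h1, hv, hm⟩ := h
  refine ⟨env, (h1.setOdd r z k).mono ?_, hv, hm⟩
  have := D.le_slow k
  simp only [State.tick, State.setReg, mul_add]
  omega

lemma Rel.reg {s s' : State} (h : D.Rel s s') (r : ℕ) : s'.reg (2 * r + 1) = s.reg r := by
  obtain ⟨env, h1, hv, hm⟩ := h
  exact h1.odd r

variable (D) in
/-- Expected values are preserved by the simulation. -/
theorem wp_simulate (fuel : ℕ) (c : Prog) {Φ Ψ : State → ℝ≥0∞}
    (hΦ : ∀ s s', D.Rel s s' → Φ s' ≤ Ψ s) {s s' : State} (h : D.Rel s s') :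
    wp fuel (simulate E c) Φ s' ≤ wp fuel c Ψ s := by
  induction c generalizing Φ Ψ s s' with
  | skip =>
    rw [simulate, wp_skip, wp_skip]
    exact hΦ _ _ (h.tick 1)
  | const r z =>
    rw [simulate, wp_const, wp_const]
    exact hΦ _ _ (h.set r z _)
  | arith o r a b =>
    rw [simulate, wp_arith, wp_arith, h.reg, h.reg]
    exact hΦ _ _ (h.set r _ _)
  | load r a =>
    rw [wp_load]
    exact D.ok_load fuel r a h _ _ fun s' hs' => hΦ _ _ hs'
  | store a b =>
    rw [wp_store]
    exact D.ok_store fuel a b h _ _ fun s' hs' => hΦ _ _ hs'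
  | flip r =>
    rw [simulate, wp_flip, wp_flip]
    exact add_le_add (mul_le_mul_right (hΦ _ _ (h.set r _ _)) _)
      (mul_le_mul_right (hΦ _ _ (h.set r _ _)) _)
  | seq c d hc hd =>
    rw [simulate, wp_seq, wp_seq]
    exact hc (fun s s' hs => hd hΦ hs) h
  | ite r c d hc hd =>
    rw [simulate, wp_ite, wp_ite, h.reg]
    split_ifs
    · exact hc hΦ (h.tick _)
    · exact hd hΦ (h.tick _)
  | _ =>
    rename_i r c hc
    rw [simulate, wp_while, wp_while]
    -- The simulation of a memory access is loop-free, so loops correspond round by round and the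
    -- same fuel serves both programs.
    have : ∀ n s s', D.Rel s s' → wpLoop fuel (2 * r + 1) (simulate E c) Φ n s' ≤
        wpLoop fuel r c Ψ n s := by
      intro n
      induction n with
      | zero =>
        intro s s' h
        rw [wpLoop_zero, wpLoop_zero, h.reg]
        split_ifs
        · exact le_rfl
        · exact hΦ _ _ (h.tick _)
      | succ n ih =>
        intro s s' h
        rw [wpLoop_succ, wpLoop_succ, h.reg]
        split_ifs
        · exact hc ih (h.tick _)
        · exact hΦ _ _ (h.tick _)
    exact this fuel s s' h

end SimData

/-! ### Averages -/

/-- The average of `g` over `0, …, N - 1`. -/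
noncomputable def avg (N : ℕ) (g : ℕ → ℝ≥0∞) : ℝ≥0∞ := (N : ℝ≥0∞)⁻¹ * ∑ j ∈ Finset.range N, g j

lemma avg_one (g : ℕ → ℝ≥0∞) : avg 1 g = g 0 := by simp [avg]

lemma avg_mono {N : ℕ} {g g' : ℕ → ℝ≥0∞} (h : ∀ j < N, g j ≤ g' j) : avg N g ≤ avg N g' :=
  mul_le_mul_right (Finset.sum_le_sum fun j hj => h j (Finset.mem_range.mp hj)) _

lemma sum_range_mul (A B : ℕ) (g : ℕ → ℝ≥0∞) : ∑ j ∈ Finset.range (A * B), g j =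
    ∑ i ∈ Finset.range A, ∑ j ∈ Finset.range B, g (i * B + j) := by
  induction A with
  | zero => simp
  | succ A ih => rw [add_mul, one_mul, Finset.sum_range_add, ih, Finset.sum_range_succ]

/-- Independent uniform choices of a high and a low part make a uniform number. Single bits, blocks
of bits, and finally the two parts of the multiplier are put together in this way. -/
lemma avg_mul {A B : ℕ} (g : ℕ → ℝ≥0∞) :
    avg (A * B) g = avg A fun i => avg B fun j => g (i * B + j) := by
  unfold avg
  rw [sum_range_mul, ← Finset.mul_sum, ← mul_assoc, Nat.cast_mul, ENNReal.mul_inv]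
  · right; exact ENNReal.natCast_ne_top _
  · left; exact ENNReal.natCast_ne_top _

lemma avg_two (g : ℕ → ℝ≥0∞) : avg 2 g = 2⁻¹ * g 0 + 2⁻¹ * g 1 := by
  simp [avg, Finset.sum_range_succ, mul_add]

/-! ### Random numbers -/

/-- `env'` differs from `env` at most in the variables from `S`. -/
structure Agree (S : Finset (Fin 64)) (env env' : Env) : Prop where
  m : env'.m = env.m
  v : ∀ i, i ∉ S → env'.v i = env.v i

lemma Agree.refl (S : Finset (Fin 64)) (env : Env) : Agree S env env := ⟨rfl, fun _ _ => rfl⟩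

lemma Agree.trans {S S' S'' : Finset (Fin 64)} {e e' e'' : Env} (h : Agree S e e')
    (h' : Agree S' e' e'') (hS : S ⊆ S'') (hS' : S' ⊆ S'') : Agree S'' e e'' :=
  ⟨h'.m.trans h.m, fun i hi => (h'.v i fun hc => hi (hS' hc)).trans (h.v i fun hc => hi (hS hc))⟩

lemma Agree.update {S : Finset (Fin 64)} {e e' : Env} (h : Agree S e e') {x : Fin 64} (hx : x ∈ S)
    (z : ℤ) : Agree S e { e' with v := Function.update e'.v x z } :=
  ⟨h.m, fun i hi => by
    simp only []
    rw [Function.update_of_ne (by rintro rfl; exact hi hx), h.v i hi]⟩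

/-- The deterministic part of a round of `flips`. -/
def flipCmd : Cmd := .asg 16 (2 * .var 16 + .var 17) >> .asg 15 (.var 15 - 1)

/-- Append as many random bits to variable `16` as variable `15` says. -/
def flips : Prog := wh (.var 15) (.seq (.flip (2 * (17 : Fin 64))) flipCmd.comp)

/-- A bound for the cost of a round of `flips`, divided by the length of the numbers. -/
def flipCost : ℕ := 5 + flipCmd.growth 1

lemma len_le_of_lt_two_pow {z : ℤ} {c : ℕ} (h0 : 0 ≤ z) (h : z < 2 ^ c) : len z ≤ c + 1 := by
  rw [len_le_iff]
  zify
  rwa [abs_of_nonneg h0]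

/-- The induction is on the number `i` of bits still to be drawn: if the bits so far form `v`, the
final value is uniform among the numbers `v * 2 ^ i + j`. Each round handles numbers of length up to
`c + 1`, which makes the cost quadratic in `c`. -/
lemma wp_flips {fuel c : ℕ} (hc : c ≤ fuel) {s : State} {env : Env} {o : ℕ → ℤ} {t : ℕ}
    (h : At s env o t) (hcnt : env.v 15 = c) (hv : env.v 16 = 0) (hf : env.v 17 = 0 ∨ env.v 17 = 1)
    {Φ : State → ℝ≥0∞} {g : ℕ → ℝ≥0∞}
    (hΦ : ∀ j : ℕ, j < 2 ^ c → ∀ s' env', At s' env' o (t + (c + 1) * (flipCost * (c + 1))) →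
      Agree {15, 16, 17} env env' → env'.v 15 = 0 → env'.v 16 = j →
      (env'.v 17 = 0 ∨ env'.v 17 = 1) → Φ s' ≤ g j) :
    wp fuel flips Φ s ≤ avg (2 ^ c) g := by
  set κ := flipCost * (c + 1) with hκ
  have hlenc : ∀ i ≤ c, len (i : ℤ) ≤ c + 1 := fun i hi =>
    len_le_of_lt_two_pow (by positivity) (by exact_mod_cast hi.trans_lt Nat.lt_two_pow_self)
  have key : ∀ (i n v : ℕ) s env' t', i ≤ n → i ≤ c → v < 2 ^ (c - i) → At s env' o t' →
      t' ≤ t + (c - i) * κ + 2 * (c + 1) + 1 → env'.v 15 = i → env'.v 16 = v →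
      (env'.v 17 = 0 ∨ env'.v 17 = 1) →
      Agree {15, 16, 17} env env' → s.reg (2 * 64) = i →
      wpLoop fuel (2 * 64) (.seq (.flip (2 * (17 : Fin 64))) (.seq flipCmd.comp
        ((Expr.var 15).comp 64))) Φ n s ≤ avg (2 ^ i) fun j => g (v * 2 ^ i + j) := by
    intro i
    induction i with
    | zero =>
      intro n v s env' t' _ _ hv' hs ht h15 h16 h17 hA hr
      have e1 : wpLoop fuel (2 * 64) (.seq (.flip (2 * (17 : Fin 64))) (.seq flipCmd.comp
        ((Expr.var 15).comp 64))) Φ n s = Φ (s.tick (len (s.reg (2 * 64)))) := by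
        cases n with
        | zero => rw [wpLoop_zero, if_neg (by simp [hr])]
        | succ n => rw [wpLoop_succ, if_neg (by simp [hr])]
      rw [e1, pow_zero, avg_one, hr]
      simp only [mul_one, add_zero, Nat.sub_zero] at hv' ⊢
      refine hΦ v hv' _ _ ((hs.tick _).mono ?_) hA h15 h16 h17
      have : 4 * (c + 1) ≤ κ := Nat.mul_le_mul_right _ (by unfold flipCost; omega)
      simp only [Nat.cast_zero, len_zero, Nat.sub_zero] at ht ⊢
      nlinarith
    | succ i ih =>
      intro n v s env' t' hn hic hv' hs ht h15 h16 h17 hA hr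
      obtain ⟨n, rfl⟩ : ∃ l, n = l + 1 := ⟨n - 1, by omega⟩
      rw [wpLoop_succ, if_pos (by rw [hr]; positivity), wp_seq, wp_flip, hr]
      have step : ∀ b : ℕ, b < 2 → wp fuel (.seq flipCmd.comp ((Expr.var 15).comp 64))
          (wpLoop fuel (2 * 64) (.seq (.flip (2 * (17 : Fin 64))) (.seq flipCmd.comp
            ((Expr.var 15).comp 64))) Φ n)
          (((s.tick (len ((i + 1 : ℕ) : ℤ))).setReg (2 * (17 : Fin 64)) b).tick 1) ≤
          avg (2 ^ i) fun j => g ((v * 2 + b) * 2 ^ i + j) := by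
        intro b hb
        have hs' := (hs.tick (len ((i + 1 : ℕ) : ℤ))).setEven 17 b 1
        set env1 : Env := { env' with v := Function.update env'.v 17 (b : ℤ) } with henv1
        have hv15 : env1.v 15 = (i + 1 : ℕ) := by
          simp only [henv1]; rw [Function.update_of_ne (by decide), h15]
        have hv16 : env1.v 16 = v := by
          simp only [henv1]; rw [Function.update_of_ne (by decide), h16]
        have hv17 : env1.v 17 = b := by simp [henv1]
        have hvlt : v * 2 + b < 2 ^ (c - i) := by
          rw [show c - i = c - (i + 1) + 1 by omega, pow_succ]; omega
        have hpow : 2 ^ (c - i) ≤ 2 ^ c := Nat.pow_le_pow_right (by norm_num) (by omega)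
        have hcost := (flipCmd.growth_spec (S := {15, 16, 17}) (K := 1) (l := c + 1) (s := env1)
          (by omega) (by
            intro x hx
            rw [one_mul]
            simp only [Finset.mem_insert, Finset.mem_singleton] at hx
            rcases hx with rfl | rfl | rfl
            · rw [hv15]; exact hlenc _ hic
            · rw [hv16]
              exact len_le_of_lt_two_pow (by positivity)
                (by exact_mod_cast (by omega : v < 2 ^ c))
            · rw [hv17]
              refine len_le_of_lt_two_pow (by positivity) ?_
              have : b < 2 ^ c := by
                have : 2 ^ 1 ≤ 2 ^ c := Nat.pow_le_pow_right (by norm_num) (by omega)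
                omega
              exact_mod_cast this)
          (by
            simp only [flipCmd, Cmd.in_andThen, Cmd.In, Expr.in_add, Expr.in_mul, Expr.in_sub,
              Expr.in_var, Expr.in_ofNat, and_true]
            decide)
          (by simp [flipCmd, Cmd.loadsLe_andThen, Cmd.LoadsLe])).1
        have hsem : (flipCmd.sem env1).v 15 = i ∧ (flipCmd.sem env1).v 16 = (v * 2 + b : ℕ) ∧
            (flipCmd.sem env1).v 17 = b ∧ Agree {15, 16, 17} env (flipCmd.sem env1) := by
          simp only [flipCmd, Cmd.sem_andThen, Cmd.sem, Expr.eval_add, Expr.eval_mul, Expr.eval_sub,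
            Expr.eval_var, Expr.eval_one, Expr.eval_ofNat, Function.update_self, hv16, hv17]
          refine ⟨?_, ?_, ?_, ?_⟩
          · rw [Function.update_of_ne (by decide), hv15]; push_cast; ring
          · rw [Function.update_of_ne (by decide), Function.update_self]; push_cast; ring
          · rw [Function.update_of_ne (by decide), Function.update_of_ne (by decide), hv17]
          · exact (((hA.update (by decide) _).update (x := 16) (by decide) _).update
              (x := 15) (by decide) _)
        obtain ⟨k1, k2, k3, k4⟩ := hsem
        rw [wp_seq]
        refine flipCmd.ok_comp fuel hs' _ _ fun s2 h2 => ?_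
        refine (Expr.var 15).ok_comp fuel le_rfl h2.even h2.mem _ _ ?_
        rintro s3 ⟨h5, h6, h7⟩
        have h8 := h6.at le_rfl h2 (h7.le.trans (Nat.add_le_add_right h2.time _))
        refine ih n (v * 2 + b) s3 _ _ (by omega) (by omega) hvlt h8 ?_ k1 k2 ?_ k4
          (by rw [h5]; exact k1)
        · have q1 : len ((i + 1 : ℕ) : ℤ) ≤ c + 1 := hlenc _ hic
          have q2 : (Expr.var 15).cost (flipCmd.sem env1) ≤ 2 + (c + 1) := by
            change 2 + len ((flipCmd.sem env1).v 15) ≤ _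
            rw [k1]
            exact Nat.add_le_add_left (hlenc i (by omega)) _
          have q3 : (c - i) * κ = (c - (i + 1)) * κ + κ := by
            rw [show c - i = c - (i + 1) + 1 by omega, add_mul, one_mul]
          have q4 : κ = 5 * (c + 1) + flipCmd.growth 1 * (c + 1) := by
            rw [hκ, flipCost, add_mul]
          omega
        · rw [k3]; interval_cases b <;> simp
      rw [pow_succ, mul_comm (2 ^ i) 2, avg_mul, avg_two]
      refine add_le_add (mul_le_mul_right ?_ _) (mul_le_mul_right ?_ _)
      · refine (step 0 (by norm_num)).trans (avg_mono fun j _ => ?_)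
        rw [show v * (2 * 2 ^ i) + (0 * 2 ^ i + j) = (v * 2 + 0) * 2 ^ i + j by ring]
      · refine (step 1 (by norm_num)).trans (avg_mono fun j _ => ?_)
        rw [show v * (2 * 2 ^ i) + (1 * 2 ^ i + j) = (v * 2 + 1) * 2 ^ i + j by ring]
  -- The body is reassociated so that the coin flip comes first and its two outcomes can be followed
  -- separately.
  have hwp : wp fuel flips Φ s = wp fuel ((Expr.var 15).comp 64) (wpLoop fuel (2 * 64)
      (.seq (.flip (2 * (17 : Fin 64))) (.seq flipCmd.comp ((Expr.var 15).comp 64))) Φ fuel) s := by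
    rw [flips, wh, wp_seq]
    congr 1
    funext s
    rw [wp_while]
    have : ∀ n s, wpLoop fuel (2 * 64) (.seq (.seq (.flip (2 * (17 : Fin 64))) flipCmd.comp)
        ((Expr.var 15).comp 64)) Φ n s = wpLoop fuel (2 * 64) (.seq (.flip (2 * (17 : Fin 64)))
        (.seq flipCmd.comp ((Expr.var 15).comp 64))) Φ n s := by
      intro n
      induction n with
      | zero => intro s; rw [wpLoop_zero, wpLoop_zero]
      | succ n ih =>
        intro s
        rw [wpLoop_succ, wpLoop_succ, funext ih]
        simp only [wp_seq_fun]
    exact this _ _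
  rw [hwp]
  refine (Expr.var 15).ok_comp fuel le_rfl h.even h.mem _ _ ?_
  rintro s1 ⟨h5, h6, h7⟩
  have h8 := h6.at le_rfl h (h7.le.trans (Nat.add_le_add_right h.time _))
  refine (key c fuel 0 s1 env _ hc le_rfl (by simp) h8 ?_ hcnt (by simpa using hv) hf
    (Agree.refl _ _) (by rw [h5]; exact hcnt)).trans (avg_mono fun j _ => by simp)
  have : (Expr.var 15).cost env ≤ 2 + (c + 1) := by
    change 2 + len (env.v 15) ≤ _
    rw [hcnt]
    exact Nat.add_le_add_left (hlenc c le_rfl) _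
  simp only [Nat.sub_self, zero_mul]
  omega

/-- The beginning of a round of `blocks`. -/
def blockInit : Cmd := .asg 16 0 >> .asg 15 (.var 5)

/-- The end of a round of `blocks`. -/
def blockEnd : Cmd := .asg 14 (.var 14 * .var 4 + .var 16) >> .asg 18 (.var 18 - 1)

/-- Append as many blocks of random bits to variable `14` as variable `18` says.  The length of a
block is in variable `5`, and variable `4` is the corresponding power of two. -/
def blocks : Prog := wh (.var 18) (.seq blockInit.comp (.seq flips blockEnd.comp))

/-- A constant in the cost of `blocks`. -/
def blockCost : ℕ := 10 + flipCost + blockInit.growth 1 + blockEnd.growth 1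

/-- Appending `B` bits one by one to a number of length `B` costs about `B ^ 2`, which can be as
much as the square of the instance size. With `w` blocks of `w` bits, where `w ^ 2 = B`, only `w`
operations touch the long number, and the blocks themselves cost `w ^ 2` each; the total is of order
`B ^ (3 / 2)`. -/
lemma wp_blocks {fuel w c l : ℕ} (hc : c ≤ fuel) (hw : w ≤ fuel) {s : State} {env : Env}
    {o : ℕ → ℤ} {t a : ℕ} (h : At s env o t) (hcnt : env.v 18 = c) (hwv : env.v 5 = w)
    (hh : env.v 4 = 2 ^ w) (ha : env.v 14 = a) (hf : env.v 17 = 0 ∨ env.v 17 = 1)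
    (hl : ∀ i ∈ ({15, 16} : Finset (Fin 64)), len (env.v i) ≤ l)
    (hla : ∀ z : ℕ, z < (a + 1) * 2 ^ (w * c) → len z ≤ l) (hlc : c + 1 ≤ l) (hlw : w + 2 ≤ l)
    {Φ : State → ℝ≥0∞} {g : ℕ → ℝ≥0∞}
    (hΦ : ∀ j : ℕ, j < 2 ^ (w * c) → ∀ s' env',
      At s' env' o (t + (c + 1) * (blockCost * (l + (w + 1) * (w + 1)))) →
      Agree {14, 15, 16, 17, 18} env env' → env'.v 14 = (a * 2 ^ (w * c) + j : ℕ) → Φ s' ≤ g j) :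
    wp fuel blocks Φ s ≤ avg (2 ^ (w * c)) g := by
  set κ := blockCost * (l + (w + 1) * (w + 1)) with hκ
  have hlenc : ∀ i ≤ c, len (i : ℤ) ≤ l := fun i hi =>
    (len_le_of_lt_two_pow (c := c) (by positivity)
      (by exact_mod_cast hi.trans_lt Nat.lt_two_pow_self)).trans hlc
  set body : Prog := .seq (.seq blockInit.comp (.seq flips blockEnd.comp)) ((Expr.var 18).comp 64)
    with hbody
  have key : ∀ (i n v : ℕ) s env' t', i ≤ n → i ≤ c → v < 2 ^ (w * (c - i)) → At s env' o t' →
      t' ≤ t + (c - i) * κ + 2 * l + 2 → env'.v 18 = i → env'.v 14 = (a * 2 ^ (w * (c - i)) + v : ℕ) →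
      (env'.v 17 = 0 ∨ env'.v 17 = 1) → (∀ i ∈ ({15, 16} : Finset (Fin 64)), len (env'.v i) ≤ l) →
      Agree {14, 15, 16, 17, 18} env env' → s.reg (2 * 64) = i →
      wpLoop fuel (2 * 64) body Φ n s ≤ avg (2 ^ (w * i)) fun j => g (v * 2 ^ (w * i) + j) := by
    intro i
    induction i with
    | zero =>
      intro n v s env' t' _ _ hv' hs ht h18 h14 h17 hl' hA hr
      have e1 : wpLoop fuel (2 * 64) body Φ n s = Φ (s.tick (len (s.reg (2 * 64)))) := by
        cases n with
        | zero => rw [wpLoop_zero, if_neg (by simp [hr])]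
        | succ n => rw [wpLoop_succ, if_neg (by simp [hr])]
      rw [e1, mul_zero, pow_zero, avg_one, hr]
      simp only [mul_one, add_zero, Nat.sub_zero] at hv' h14 ⊢
      refine hΦ v hv' _ _ ((hs.tick _).mono ?_) hA h14
      have : 10 * (l + (w + 1) * (w + 1)) ≤ κ := Nat.mul_le_mul_right _ (by unfold blockCost; omega)
      simp only [Nat.cast_zero, len_zero, Nat.sub_zero] at ht ⊢
      nlinarith
    | succ i ih =>
      intro n v s env' t' hn hic hv' hs ht h18 h14 h17 hl' hA hr
      obtain ⟨n, rfl⟩ : ∃ l, n = l + 1 := ⟨n - 1, by omega⟩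
      rw [wpLoop_succ, if_pos (by rw [hr]; positivity), hr, hbody, wp_seq, wp_seq]
      have hA5 : env'.v 5 = w := by rw [hA.v 5 (by decide), hwv]
      have hA4 : env'.v 4 = 2 ^ w := by rw [hA.v 4 (by decide), hh]
      have hwl : len (w : ℤ) ≤ l :=
        (len_le_of_lt_two_pow (c := w) (by positivity)
          (by exact_mod_cast Nat.lt_two_pow_self)).trans (by omega)
      have hpow : len ((2 : ℤ) ^ w) ≤ l :=
        (len_le_of_lt_two_pow (c := w + 1) (by positivity) (by
          rw [pow_succ]; have : (0 : ℤ) < 2 ^ w := by positivity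
          linarith)).trans (by omega)
      have hcost1 := (blockInit.growth_spec (S := {5, 15, 16}) (K := 1) (l := l) (s := env')
        (by omega) (by
          intro x hx
          rw [one_mul]
          simp only [Finset.mem_insert, Finset.mem_singleton] at hx
          rcases hx with rfl | rfl | rfl
          · rw [hA5]; exact hwl
          · exact hl' _ (by decide)
          · exact hl' _ (by decide))
        (by
          simp only [blockInit, Cmd.in_andThen, Cmd.In, Expr.in_var, Expr.in_zero, and_true]
          decide)
        (by simp [blockInit, Cmd.loadsLe_andThen, Cmd.LoadsLe])).1
      have hs' := hs.tick (len ((i + 1 : ℕ) : ℤ))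
      refine blockInit.ok_comp fuel hs' _ _ fun s2 h2 => ?_
      have hsem : (blockInit.sem env').v 15 = w ∧ (blockInit.sem env').v 16 = 0 ∧
          Agree {15, 16} env' (blockInit.sem env') := by
        simp only [blockInit, Cmd.sem_andThen, Cmd.sem, Expr.eval_var, Expr.eval_zero]
        refine ⟨?_, ?_, ?_⟩
        · rw [Function.update_self, Function.update_of_ne (by decide), hA5]
        · rw [Function.update_of_ne (by decide), Function.update_self]
        · exact ((Agree.refl _ _).update (x := 16) (by decide) _).update (x := 15) (by decide) _
      obtain ⟨k1, k2, k3⟩ := hsem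
      rw [mul_add, mul_one, pow_add, mul_comm (2 ^ (w * i)), avg_mul, wp_seq]
      refine wp_flips hw h2 k1 k2 (by rw [k3.v 17 (by decide)]; exact h17) ?_
      intro b hb s3 env3 h3 hA3 h315 h316 h317
      have hA3' : Agree {15, 16, 17} env' env3 := k3.trans hA3 (by decide) (by decide)
      have hvlt : v * 2 ^ w + b < 2 ^ (w * (c - i)) := by
        have h1 : (v + 1) * 2 ^ w ≤ 2 ^ (w * (c - (i + 1))) * 2 ^ w := Nat.mul_le_mul_right _ hv'
        have h2 : 2 ^ (w * (c - i)) = 2 ^ (w * (c - (i + 1))) * 2 ^ w := by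
          rw [← pow_add]; congr 1
          rw [show c - i = c - (i + 1) + 1 by omega, mul_add, mul_one]
        rw [add_mul, one_mul] at h1
        omega
      have hlt : ∀ j u, j ≤ c → u < 2 ^ (w * (c - j)) → len ((a * 2 ^ (w * (c - j)) + u : ℕ) : ℤ) ≤ l := by
        intro j u hj hu
        apply hla
        calc a * 2 ^ (w * (c - j)) + u < (a + 1) * 2 ^ (w * (c - j)) := by rw [add_mul]; omega
          _ ≤ _ := Nat.mul_le_mul_left _ (Nat.pow_le_pow_right (by norm_num)
            (Nat.mul_le_mul_left _ (by omega)))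
      have hb' : len (b : ℤ) ≤ l :=
        (len_le_of_lt_two_pow (c := w) (by positivity) (by exact_mod_cast hb)).trans (by omega)
      have hcost2 := (blockEnd.growth_spec (S := {4, 14, 16, 18}) (K := 1) (l := l) (s := env3)
        (by omega) (by
          intro x hx
          rw [one_mul]
          simp only [Finset.mem_insert, Finset.mem_singleton] at hx
          rcases hx with rfl | rfl | rfl | rfl
          · rw [hA3'.v 4 (by decide), hA4]; exact hpow
          · rw [hA3'.v 14 (by decide), h14]; exact hlt _ _ hic hv'
          · rw [h316]; exact hb'
          · rw [hA3'.v 18 (by decide), h18]; exact hlenc _ hic)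
        (by
          simp only [blockEnd, Cmd.in_andThen, Cmd.In, Expr.in_add, Expr.in_mul, Expr.in_sub,
            Expr.in_var, Expr.in_one, and_true]
          decide)
        (by simp [blockEnd, Cmd.loadsLe_andThen, Cmd.LoadsLe])).1
      have hsem2 : (blockEnd.sem env3).v 18 = i ∧
          (blockEnd.sem env3).v 14 = (a * 2 ^ (w * (c - i)) + (v * 2 ^ w + b) : ℕ) ∧
          Agree {14, 18} env3 (blockEnd.sem env3) := by
        simp only [blockEnd, Cmd.sem_andThen, Cmd.sem, Expr.eval_var, Expr.eval_add,
          Expr.eval_mul, Expr.eval_sub, Expr.eval_one]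
        refine ⟨?_, ?_, ?_⟩
        · rw [Function.update_self, Function.update_of_ne (by decide), hA3'.v 18 (by decide), h18]
          push_cast; ring
        · rw [Function.update_of_ne (by decide), Function.update_self, hA3'.v 14 (by decide),
            hA3'.v 4 (by decide), hA4, h14, h316, show c - i = c - (i + 1) + 1 by omega, mul_add,
            mul_one, pow_add]
          push_cast; ring
        · exact ((Agree.refl _ _).update (x := 14) (by decide) _).update (x := 18) (by decide) _
      obtain ⟨m1, m2, m3⟩ := hsem2
      refine blockEnd.ok_comp fuel h3 _ _ fun s4 h4 => ?_
      refine (Expr.var 18).ok_comp fuel le_rfl h4.even h4.mem _ _ ?_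
      rintro s5 ⟨h5, h6, h7⟩
      have h8 := h6.at le_rfl h4 (h7.le.trans (Nat.add_le_add_right h4.time _))
      refine (ih n (v * 2 ^ w + b) s5 _ _ (by omega) (by omega) hvlt h8 ?_ m1 m2 ?_ ?_ ?_
        (by rw [h5]; exact m1)).trans (avg_mono fun j _ => by
          rw [show v * (2 ^ w * 2 ^ (w * i)) + (b * 2 ^ (w * i) + j) =
            (v * 2 ^ w + b) * 2 ^ (w * i) + j by ring])
      · have q1 : len ((i + 1 : ℕ) : ℤ) ≤ l := hlenc _ hic
        have q2 : (Expr.var 18).cost (blockEnd.sem env3) ≤ 2 + l := by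
          change 2 + len ((blockEnd.sem env3).v 18) ≤ _
          rw [m1]
          exact Nat.add_le_add_left (hlenc i (by omega)) _
        have q3 : (c - i) * κ = (c - (i + 1)) * κ + κ := by
          rw [show c - i = c - (i + 1) + 1 by omega, add_mul, one_mul]
        have q4 : κ = 10 * (l + (w + 1) * (w + 1)) + flipCost * (l + (w + 1) * (w + 1)) +
            blockInit.growth 1 * (l + (w + 1) * (w + 1)) +
            blockEnd.growth 1 * (l + (w + 1) * (w + 1)) := by
          rw [hκ, blockCost]; ring
        have q5 : (w + 1) * (flipCost * (w + 1)) ≤ flipCost * (l + (w + 1) * (w + 1)) := by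
          calc _ = flipCost * ((w + 1) * (w + 1)) := by ring
            _ ≤ _ := Nat.mul_le_mul_left _ (by omega)
        have q6 : blockInit.growth 1 * l ≤ blockInit.growth 1 * (l + (w + 1) * (w + 1)) :=
          Nat.mul_le_mul_left _ (by omega)
        have q7 : blockEnd.growth 1 * l ≤ blockEnd.growth 1 * (l + (w + 1) * (w + 1)) :=
          Nat.mul_le_mul_left _ (by omega)
        omega
      · rw [m3.v 17 (by decide)]; exact h317
      · intro x hx
        simp only [Finset.mem_insert, Finset.mem_singleton] at hx
        rcases hx with rfl | rfl
        · rw [m3.v 15 (by decide), h315, len_zero]; omega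
        · rw [m3.v 16 (by decide), h316]; exact hb'
      · exact hA.trans (hA3'.trans m3 (S'' := {14, 15, 16, 17, 18}) (by decide) (by decide))
          (by decide) (by decide)
  rw [blocks, wh, wp_seq]
  refine (Expr.var 18).ok_comp fuel le_rfl h.even h.mem _ _ ?_
  rintro s1 ⟨h5, h6, h7⟩
  have h8 := h6.at le_rfl h (h7.le.trans (Nat.add_le_add_right h.time _))
  refine (key c fuel 0 s1 env _ hc le_rfl (by simp) h8 ?_ hcnt (by simpa using ha) hf hl
    (Agree.refl _ _) (by rw [h5]; exact hcnt)).trans (avg_mono fun j _ => by simp)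
  have : (Expr.var 18).cost env ≤ 2 + l := by
    change 2 + len (env.v 18) ≤ _
    rw [hcnt]
    exact Nat.add_le_add_left (hlenc c le_rfl) _
  simp only [Nat.sub_self, zero_mul]
  omega

/-! ### An almost linear family of hash functions -/

/-- The number of multiples of `z` in an interval. -/
lemma card_mul_near_le (P z : ℕ) (hz : 0 < z) (c : ℤ) (K : ℕ) :
    ((Finset.range P).filter fun a : ℕ => |(a : ℤ) * z - c| < K).card ≤ 2 * K / z + 1 := by
  set s := (Finset.range P).filter fun a : ℕ => |(a : ℤ) * z - c| < K
  rcases s.eq_empty_or_nonempty with h | h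
  · simp [h]
  · set b := s.min' h
    have hb : |(b : ℤ) * z - c| < K := (Finset.mem_filter.mp (s.min'_mem h)).2
    -- Two multiples of `z` at distance less than `K` from `c` differ by less than `2 * K`, so all
    -- multipliers lie within `2 * K / z` of the least one.
    have hsub : s ⊆ Finset.Icc b (b + 2 * K / z) := by
      intro a ha
      have h1 : b ≤ a := s.min'_le a ha
      have h2 := (Finset.mem_filter.mp ha).2
      obtain ⟨j, rfl⟩ := Nat.exists_eq_add_of_le h1
      rw [Finset.mem_Icc]
      refine ⟨h1, Nat.add_le_add_left ?_ _⟩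
      rw [Nat.le_div_iff_mul_le hz]
      rw [abs_lt] at h2 hb
      zify
      push_cast at h2
      nlinarith
    refine (Finset.card_le_card hsub).trans ?_
    simp
    omega

open Classical in
/-- The number of multipliers `a` for which `a * z` is close to a multiple of `Q`. -/
lemma card_near_multiple_le {R Q : ℕ} (hR : 0 < R) {z : ℤ} (hz : z ≠ 0) (K : ℕ) :
    ((Finset.range (R * Q)).filter fun a : ℕ => ∃ l : ℤ, |(a : ℤ) * z - l * Q| < K).card ≤
      2 * (R * (2 * K + z.natAbs)) := by
  set m := z.natAbs with hm
  have hm0 : 0 < m := Int.natAbs_pos.mpr hz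
  -- The product `a * m` lies between `0` and `m * R * Q`. A factor `l` outside `[0, m * R]` can
  -- therefore be moved to the nearer end of this interval without increasing the distance, and `m *
  -- R + 1` factors remain.
  have hsub : ((Finset.range (R * Q)).filter fun a : ℕ => ∃ l : ℤ, |(a : ℤ) * z - l * Q| < K) ⊆
      (Finset.range (m * R + 1)).biUnion fun l =>
        (Finset.range (R * Q)).filter fun a : ℕ => |(a : ℤ) * m - (l * Q : ℕ)| < K := by
    intro a ha
    obtain ⟨ha1, l, hl⟩ := Finset.mem_filter.mp ha
    have ha2 : a < R * Q := Finset.mem_range.mp ha1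
    have hl' : ∃ l : ℤ, |(a : ℤ) * m - l * Q| < K := by
      rcases Int.natAbs_eq z with h | h
      · exact ⟨l, by rwa [h, ← hm] at hl⟩
      · refine ⟨-l, ?_⟩
        rw [h, ← hm, ← abs_neg] at hl
        convert hl using 2
        ring
    obtain ⟨l, hl⟩ := hl'
    have h1 : (a : ℤ) * m ≤ (m * R : ℤ) * Q := by
      have : (a : ℤ) ≤ R * Q := by exact_mod_cast ha2.le
      nlinarith
    have h0 : (0 : ℤ) ≤ (a : ℤ) * m := by positivity
    rw [abs_lt] at hl
    simp only [Finset.mem_biUnion, Finset.mem_filter, Finset.mem_range, abs_lt]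
    rcases lt_or_ge l 0 with hneg | hpos
    · have : l * (Q : ℤ) ≤ 0 := mul_nonpos_of_nonpos_of_nonneg hneg.le (by positivity)
      exact ⟨0, by omega, ha2, by push_cast; linarith, by push_cast; linarith⟩
    · rcases le_or_gt l ((m * R : ℕ) : ℤ) with hle | hgt
      · lift l to ℕ using hpos
        refine ⟨l, by exact_mod_cast Nat.lt_succ_of_le (by exact_mod_cast hle), ha2, ?_, ?_⟩ <;>
          push_cast <;> linarith
      · have : ((m * R : ℕ) : ℤ) * Q ≤ l * Q := mul_le_mul_of_nonneg_right hgt.le (by positivity)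
        refine ⟨m * R, by omega, ha2, ?_, ?_⟩ <;> push_cast at this ⊢ <;> linarith
  refine (Finset.card_le_card hsub).trans (Finset.card_biUnion_le.trans ?_)
  refine (Finset.sum_le_sum fun l _ => card_mul_near_le (R * Q) m hm0 _ K).trans ?_
  rw [Finset.sum_const, Finset.card_range, smul_eq_mul]
  have h1 : m * R + 1 ≤ 2 * (m * R) := by have := Nat.mul_pos hm0 hR; omega
  have h2 : m * (2 * K / m) ≤ 2 * K := Nat.mul_div_le _ _
  calc (m * R + 1) * (2 * K / m + 1) ≤ 2 * (m * R) * (2 * K / m + 1) := Nat.mul_le_mul_right _ h1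
    _ = 2 * (R * (m * (2 * K / m) + m)) := by ring
    _ ≤ _ := by gcongr

/-- The hash function with multiplier `a`, with values in `[0, M)`. -/
def hash (M D : ℕ) (a x : ℤ) : ℤ := a * x % (M * D : ℕ) / D

section hash
variable {M D : ℕ} {a : ℤ}

lemma hash_nonneg (hD : 0 < D) (hM : 0 < M) (x : ℤ) : 0 ≤ hash M D a x :=
  Int.ediv_nonneg (Int.emod_nonneg _ (by have := Nat.mul_pos hM hD; omega)) (by positivity)

lemma hash_lt (hD : 0 < D) (hM : 0 < M) (x : ℤ) : hash M D a x < M := by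
  apply Int.ediv_lt_of_lt_mul (by exact_mod_cast hD)
  have := Int.emod_lt_of_pos (a * x) (b := ((M * D : ℕ) : ℤ)) (by exact_mod_cast Nat.mul_pos hM hD)
  rwa [Nat.cast_mul] at this

/-- The hash value, up to a remainder, is `a * x` modulo `M * D`. -/
lemma hash_spec (hD : 0 < D) (x : ℤ) : ∃ r l : ℤ, 0 ≤ r ∧ r < D ∧
    a * x = D * hash M D a x + r + l * (M * D : ℕ) := by
  refine ⟨(a * x % (M * D : ℕ)) % D, a * x / (M * D : ℕ), Int.emod_nonneg _ (by omega),
    Int.emod_lt_of_pos _ (by exact_mod_cast hD), ?_⟩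
  have h1 := Int.mul_ediv_add_emod (a * x % (M * D : ℕ)) D
  have h2 := Int.mul_ediv_add_emod (a * x) (M * D : ℕ)
  rw [hash]
  linarith [mul_comm ((M * D : ℕ) : ℤ) (a * x / (M * D : ℕ))]

lemma sum_hash_spec (hD : 0 < D) {k : ℕ} (hk : 0 < k) (x : Fin k → ℤ) : ∃ r l : ℤ, 0 ≤ r ∧
    r < k * D ∧ a * ∑ i, x i = D * ∑ i, hash M D a (x i) + r + l * (M * D : ℕ) := by
  choose r l h0 h1 h2 using fun i => hash_spec (M := M) (a := a) hD (x i)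
  refine ⟨∑ i, r i, ∑ i, l i, Finset.sum_nonneg fun i _ => h0 i, ?_, ?_⟩
  · have : (Finset.univ : Finset (Fin k)).Nonempty := ⟨⟨0, hk⟩, Finset.mem_univ _⟩
    calc ∑ i, r i < ∑ _i : Fin k, (D : ℤ) := Finset.sum_lt_sum_of_nonempty this fun i _ => h1 i
      _ = _ := by simp
  · rw [Finset.mul_sum, Finset.sum_congr rfl fun i _ => h2 i, Finset.mul_sum, Finset.sum_mul,
      ← Finset.sum_add_distrib, ← Finset.sum_add_distrib]

/-- Numbers with sum zero have hash values with one of few sums. -/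
lemma sum_hash_of_sum_eq_zero (hD : 0 < D) (hM : 0 < M) {k : ℕ} (hk : 0 < k) {x : Fin k → ℤ}
    (h : ∑ i, x i = 0) : ∃ d c : Fin k, ∑ i, hash M D a (x i) = (d : ℕ) * M - (c : ℕ) := by
  obtain ⟨r, l, h0, h1, h2⟩ := sum_hash_spec (M := M) (a := a) hD hk x
  rw [h, mul_zero] at h2
  set y := ∑ i, hash M D a (x i)
  have hy0 : 0 ≤ y := Finset.sum_nonneg fun i _ => hash_nonneg hD hM _
  have hy1 : y ≤ k * (M - 1) := by
    calc y ≤ ∑ _i : Fin k, ((M : ℤ) - 1) :=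
          Finset.sum_le_sum fun i _ => by have := hash_lt (a := a) hD hM (x i); omega
      _ = _ := by simp [mul_sub]
  have hD' : (0 : ℤ) < D := by exact_mod_cast hD
  push_cast at h2
  -- Every other term is divisible by `D`, so the remainders add up to `c * D`. This carry is the
  -- deviation of the sum of the hash values from a multiple of `M`.
  obtain ⟨c, rfl⟩ : ∃ c, r = c * D := ⟨-(y + l * M), by linarith⟩
  have hc0 : 0 ≤ c := by
    by_contra hc
    nlinarith
  have hc1 : c < k := lt_of_mul_lt_mul_right h1 hD'.le
  have h3 : y + c = -l * M := by
    have : D * (y + c + l * M) = 0 := by linarith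
    rcases mul_eq_zero.mp this with h | h
    · omega
    · linarith
  have hM' : (0 : ℤ) < M := by exact_mod_cast hM
  have hk' : (0 : ℤ) < k := by exact_mod_cast hk
  have hd0 : 0 ≤ -l := by
    by_contra hd
    nlinarith
  have hd1 : -l < k := by
    have : -l * M < k * M := by nlinarith
    exact lt_of_mul_lt_mul_right this hM'.le
  refine ⟨⟨(-l).toNat, by omega⟩, ⟨c.toNat, by omega⟩, ?_⟩
  simp only [Int.toNat_of_nonneg hd0, Int.toNat_of_nonneg hc0]
  linarith

/-- A false positive is expensive for the multiplier: it forces `a` times the sum close to a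
multiple of `M * D`, which `card_near_multiple_le` makes rare for a nonzero sum. -/
lemma near_of_sum_hash (hD : 0 < D) {k : ℕ} (hk : 0 < k) {x : Fin k → ℤ} {d c : Fin k}
    (h : ∑ i, hash M D a (x i) = (d : ℕ) * M - (c : ℕ)) :
    ∃ l : ℤ, |a * ∑ i, x i - l * (M * D : ℕ)| < (k * D : ℕ) := by
  obtain ⟨r, l, h0, h1, h2⟩ := sum_hash_spec (M := M) (a := a) hD hk x
  refine ⟨l + d, ?_⟩
  rw [h2, h, abs_lt]
  have hc : ((c : ℕ) : ℤ) + 1 ≤ k := by exact_mod_cast c.2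
  have hD' : (0 : ℤ) < D := by exact_mod_cast hD
  have hcD : ((c : ℕ) : ℤ) * D + D ≤ k * D := by nlinarith
  have hcD0 : 0 ≤ ((c : ℕ) : ℤ) * D := by positivity
  push_cast
  constructor <;> nlinarith

/-- Since `C` divides `M`, the multiples of `M * D` are also multiples of `C * D`. After reduction
only the difference of two remainders below `D` is left, so collisions in a table are rare as well.
-/
lemma near_of_hash_modEq {C : ℕ} (hD : 0 < D) (hC : C ∣ M) {x x' : ℤ}
    (h : hash M D a x % C = hash M D a x' % C) :
    ∃ l : ℤ, |a * (x - x') - l * (C * D : ℕ)| < D := by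
  obtain ⟨r, l, h0, h1, h2⟩ := hash_spec (M := M) (a := a) hD x
  obtain ⟨r', l', h0', h1', h2'⟩ := hash_spec (M := M) (a := a) hD x'
  obtain ⟨R, rfl⟩ := hC
  obtain ⟨e, he⟩ := Int.ModEq.dvd (n := (C : ℤ)) h.symm
  refine ⟨e + (l - l') * R, ?_⟩
  rw [mul_sub, h2, h2', abs_lt]
  have he' : hash (C * R) D a x = hash (C * R) D a x' + C * e := by linarith
  rw [he']
  push_cast
  constructor <;> nlinarith
end hash

/-- The multiplier `a` is good for the instance: `k` numbers whose hash values have one of the sums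
`d * M - c` have sum `0`, and if there is a solution, then there is one whose numbers do not collide
modulo `C` with other hash values. -/
def GoodMul {k n : ℕ} (x : Fin k → Fin n → ℤ) (M D C : ℕ) (a : ℤ) : Prop :=
  (∀ (τ : Fin k → Fin n) (d c : Fin k), ∑ i, hash M D a (x i (τ i)) = (d : ℕ) * M - (c : ℕ) →
    ∑ i, x i (τ i) = 0) ∧
  ((∃ τ : Fin k → Fin n, ∑ i, x i (τ i) = 0) → ∃ τ : Fin k → Fin n, ∑ i, x i (τ i) = 0 ∧
    ∀ i j, hash M D a (x i j) % C = hash M D a (x i (τ i)) % C →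
      hash M D a (x i j) = hash M D a (x i (τ i)))

open Classical in
/-- Few multipliers are not good. -/
lemma card_not_goodMul_le {k n : ℕ} (hk : 0 < k) (x : Fin k → Fin n → ℤ) {M D C R : ℕ} (hD : 0 < D)
    (hM : 0 < M) (hMC : M = R * C) (hx : ∀ i j, |x i j| ≤ D) :
    ((Finset.range (M * D)).filter fun a : ℕ => ¬ GoodMul x M D C a).card ≤
      6 * k * n ^ k * D + 8 * k * n * R * D := by
  have hR : 0 < R := Nat.pos_of_ne_zero (by rintro rfl; omega)
  have hCd : C ∣ M := ⟨R, by rw [hMC, mul_comm]⟩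
  -- Multipliers for which the tuple `τ` is a false positive; the factor `1` is the `R` of
  -- `card_near_multiple_le`, since the range is a single period here.
  set A : (Fin k → Fin n) → Finset ℕ := fun τ => if ∑ i, x i (τ i) = 0 then ∅ else
    (Finset.range (1 * (M * D))).filter fun a : ℕ =>
      ∃ l : ℤ, |(a : ℤ) * ∑ i, x i (τ i) - l * (M * D : ℕ)| < (k * D : ℕ) with hA
  have hAcard : ∀ τ, (A τ).card ≤ 6 * k * D := by
    intro τ
    simp only [hA]
    split_ifs with h
    · simp
    · refine (card_near_multiple_le one_pos h _).trans ?_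
      have : (∑ i, x i (τ i)).natAbs ≤ k * D := by
        zify
        calc |∑ i, x i (τ i)| ≤ ∑ i, |x i (τ i)| := Finset.abs_sum_le_sum_abs _ _
          _ ≤ ∑ _i : Fin k, (D : ℤ) := Finset.sum_le_sum fun i _ => hx _ _
          _ = _ := by simp
      nlinarith
  -- One solution is fixed before the multiplier is considered. Collisions matter only for its `k`
  -- numbers, which makes their count linear in `n` instead of proportional to `n ^ k`.
  set τ₀ : Option (Fin k → Fin n) := if h : ∃ τ : Fin k → Fin n, ∑ i, x i (τ i) = 0 then
    some h.choose else none with hτ₀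
  set B : Fin k × Fin n → Finset ℕ := fun p => τ₀.elim ∅ fun τ =>
    if x p.1 p.2 - x p.1 (τ p.1) = 0 then ∅ else
    (Finset.range (R * (C * D))).filter fun a : ℕ =>
      ∃ l : ℤ, |(a : ℤ) * (x p.1 p.2 - x p.1 (τ p.1)) - l * (C * D : ℕ)| < D with hB
  have hBcard : ∀ p, (B p).card ≤ 8 * R * D := by
    intro p
    simp only [hB]
    cases τ₀ with
    | none => simp
    | some τ =>
      simp only [Option.elim]
      split_ifs with h
      · simp
      · refine (card_near_multiple_le hR h _).trans ?_
        have : (x p.1 p.2 - x p.1 (τ p.1)).natAbs ≤ 2 * D := by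
          zify
          refine (abs_sub _ _).trans ?_
          have h1 := hx p.1 p.2
          have h2 := hx p.1 (τ p.1)
          linarith
        calc 2 * (R * (2 * D + _)) ≤ 2 * (R * (2 * D + 2 * D)) := by gcongr
          _ = _ := by ring
  have hsub : ((Finset.range (M * D)).filter fun a : ℕ => ¬ GoodMul x M D C a) ⊆
      Finset.univ.biUnion A ∪ Finset.univ.biUnion B := by
    intro a ha
    obtain ⟨ha1, ha2⟩ := Finset.mem_filter.mp ha
    by_contra hcon
    simp only [Finset.mem_union, Finset.mem_biUnion, Finset.mem_univ, true_and, not_or,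
      not_exists] at hcon
    obtain ⟨hcA, hcB⟩ := hcon
    refine ha2 ⟨fun τ d c h => ?_, fun hex => ?_⟩
    · by_contra h0
      apply hcA τ
      simp only [hA, h0, if_false, one_mul, Finset.mem_filter]
      exact ⟨ha1, near_of_sum_hash hD hk h⟩
    · have hτ : τ₀ = some hex.choose := by rw [hτ₀, dif_pos hex]
      refine ⟨hex.choose, hex.choose_spec, fun i j h => ?_⟩
      by_cases h0 : x i j - x i (hex.choose i) = 0
      · rw [sub_eq_zero.mp h0]
      · exfalso
        apply hcB (i, j)
        simp only [hB, hτ, Option.elim, h0, if_false, Finset.mem_filter]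
        refine ⟨?_, near_of_hash_modEq hD hCd h⟩
        rwa [← mul_assoc, ← hMC]
  refine (Finset.card_le_card hsub).trans ((Finset.card_union_le _ _).trans (Nat.add_le_add ?_ ?_))
  · refine Finset.card_biUnion_le.trans ((Finset.sum_le_sum fun τ _ => hAcard τ).trans ?_)
    simp only [Finset.sum_const, Finset.card_univ, Fintype.card_fun, Fintype.card_fin, smul_eq_mul]
    exact le_of_eq (by ring)
  · refine Finset.card_biUnion_le.trans ((Finset.sum_le_sum fun p _ => hBcard p).trans ?_)
    simp only [Finset.sum_const, Finset.card_univ, Fintype.card_prod, Fintype.card_fin, smul_eq_mul]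
    exact le_of_eq (by ring)

/-! ### Subgraphs and copies -/

open Classical in
-- The subgraphs isomorphic to `H` are the images of its copies. An injective map of nodes is
-- injective on unordered pairs, so the weight of the image becomes a sum over the edges of `H`.
lemma exactWeight_yes_iff {V : Type} [Fintype V] (H : SimpleGraph V) (I : GraphInstance) :
    (exactWeight H).Yes I ↔ ∃ f : V → Fin I.n, Function.Injective f ∧
      (∀ u v, H.Adj u v → I.graph.Adj (f u) (f v)) ∧
      ∑ e ∈ H.edgeFinset, I.weight (e.map f) = I.target := by
  have hsum : ∀ f : H.Copy I.graph, ∑ᶠ e ∈ f.toSubgraph.edgeSet, I.weight e =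
      ∑ e ∈ H.edgeFinset, I.weight (e.map f) := by
    intro f
    rw [SimpleGraph.Copy.toSubgraph, SimpleGraph.Subgraph.edgeSet_map,
      SimpleGraph.Subgraph.edgeSet_top,
      finsum_mem_image ((Sym2.map.injective f.injective).injOn), ← SimpleGraph.coe_edgeFinset,
      finsum_mem_coe_finset]
    rfl
  constructor
  · rintro ⟨S, hS, hw⟩
    have : S ∈ Set.range (SimpleGraph.Copy.toSubgraph (A := H)) := by
      rw [SimpleGraph.Copy.range_toSubgraph]; exact hS
    obtain ⟨f, rfl⟩ := this
    rw [hsum] at hw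
    exact ⟨f, f.injective, fun u v h => f.toHom.map_adj h, hw⟩
  · rintro ⟨f, hf, hadj, hw⟩
    refine ⟨(⟨⟨f, fun {u v} h => hadj u v h⟩, hf⟩ : H.Copy I.graph).toSubgraph,
      ⟨SimpleGraph.Copy.isoToSubgraph _⟩, ?_⟩
    rw [hsum]
    exact hw

/-- The problem depends on the isomorphism type of the pattern only. -/
lemma solvableInTime_of_iso {V V' : Type} [Fintype V] [Fintype V'] {H : SimpleGraph V}
    {H' : SimpleGraph V'} (e : H ≃g H') {f : ℕ → ℝ} (h : (exactWeight H).SolvableInTime f) :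
    (exactWeight H').SolvableInTime f := by
  have hyes : ∀ I, (exactWeight H').Yes I ↔ (exactWeight H).Yes I := by
    intro I
    constructor
    · rintro ⟨S, ⟨g⟩, hw⟩
      exact ⟨S, ⟨e.trans g⟩, hw⟩
    · rintro ⟨S, ⟨g⟩, hw⟩
      exact ⟨S, ⟨e.symm.trans g⟩, hw⟩
  obtain ⟨c, T, err, hc, hT, herr⟩ := h
  refine ⟨c, T, err, fun x => ?_, hT, herr⟩
  obtain ⟨fuel, h1, h2⟩ := hc x
  refine ⟨fuel, h1, le_trans (le_of_eq ?_) h2⟩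
  congr 1
  ext o
  simp only [Problem.Correct, Set.mem_ofPred_eq, hyes]

/-! ### Representations in a base -/

lemma base_repr_unique {b N : ℕ} {c c' : Fin N → ℕ} (hc : ∀ i, c i < b) (hc' : ∀ i, c' i < b)
    (h : ∑ i, c i * b ^ (i : ℕ) = ∑ i, c' i * b ^ (i : ℕ)) : c = c' := by
  induction N with
  | zero => exact Subsingleton.elim _ _
  | succ N ih =>
    have hs : ∀ d : Fin (N + 1) → ℕ, ∑ i, d i * b ^ (i : ℕ) =
        d 0 + b * ∑ i : Fin N, d i.succ * b ^ (i : ℕ) := by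
      intro d
      rw [Fin.sum_univ_succ, Finset.mul_sum]
      simp only [Fin.val_zero, pow_zero, mul_one, Fin.val_succ, pow_succ]
      congr 1
      exact Finset.sum_congr rfl fun i _ => by ring
    rw [hs, hs] at h
    have hb : 0 < b := (Nat.zero_le _).trans_lt (hc 0)
    have h0 : c 0 = c' 0 := by
      have := congrArg (· % b) h
      simpa [Nat.add_mul_mod_self_left, Nat.mod_eq_of_lt (hc 0), Nat.mod_eq_of_lt (hc' 0)] using this
    have h1 := ih (c := fun i => c i.succ) (c' := fun i => c' i.succ) (fun i => hc _)
      (fun i => hc' _) (by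
        rw [h0] at h
        exact Nat.eq_of_mul_eq_mul_left hb (Nat.add_left_cancel h))
    funext i
    refine Fin.cases h0 (fun j => congrFun h1 j) i

/-- Weights for the elements of a finite type such that sums determine the summands. -/
noncomputable def typeWeight {α : Type} [Fintype α] (e : α) : ℕ :=
  (Fintype.card α + 1) ^ (Fintype.equivFin α e : ℕ)

/-- Grouping a sum by the values of `π` writes it in base `card α + 1` with the multiplicities as
digits. These are at most `card α`, so the sum determines them, and an element of `E` has positive
multiplicity. -/
lemma surj_of_sum_typeWeight {α : Type} [Fintype α] {E : Finset α} {π : α → α}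
    (h : ∑ e ∈ E, typeWeight (π e) = ∑ e ∈ E, typeWeight e) :
    ∀ e ∈ E, ∃ e' ∈ E, π e' = e := by
  classical
  set N := Fintype.card α
  set φ := Fintype.equivFin α
  set c : Fin N → ℕ := fun i => (E.filter fun e' => φ (π e') = i).card with hc
  set c' : Fin N → ℕ := fun i => (E.filter fun e' => φ e' = i).card with hc'
  have hsum : ∀ ρ : α → α, ∑ e ∈ E, typeWeight (ρ e) =
      ∑ i : Fin N, (E.filter fun e' => φ (ρ e') = i).card * (N + 1) ^ (i : ℕ) := by
    intro ρ
    rw [← Finset.sum_fiberwise E (fun e' => φ (ρ e'))]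
    refine Finset.sum_congr rfl fun i _ => ?_
    rw [← smul_eq_mul, ← Finset.sum_const]
    refine Finset.sum_congr rfl fun e he => ?_
    rw [typeWeight, (Finset.mem_filter.mp he).2]
  have hlt : ∀ ρ : α → α, ∀ i, (E.filter fun e' => φ (ρ e') = i).card < N + 1 := fun ρ i =>
    Nat.lt_succ_of_le ((Finset.card_le_card (Finset.filter_subset _ _)).trans
      (Finset.card_le_univ E))
  have key : c = c' := base_repr_unique (hlt π) (hlt id) (by
    rw [← hsum π, h]
    exact hsum id)
  intro e he
  have h1 : 0 < c' (φ e) := Finset.card_pos.mpr ⟨e, Finset.mem_filter.mpr ⟨he, rfl⟩⟩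
  rw [← key] at h1
  obtain ⟨e', he'⟩ := Finset.card_pos.mp h1
  obtain ⟨h2, h3⟩ := Finset.mem_filter.mp he'
  exact ⟨e', h2, φ.injective h3⟩

/-! ### Layered graphs -/

/-- A pattern graph together with an assignment of `k` lists of numbers to its edges. -/
structure Pattern (k : ℕ) where
  h : ℕ
  H : SimpleGraph (Fin h)
  src : Fin k → Fin h
  dst : Fin k → Fin h
  adj : ∀ i, H.Adj (src i) (dst i)
  noIso : ∀ v, ∃ u, H.Adj v u

namespace Pattern

variable {k : ℕ} (P : Pattern k)

/-- What the lists contribute to the weight of the edge between node `a` of part `u` and node `b`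
of part `v`. -/
def contrib (val : Fin k → ℕ → ℕ → ℤ) (u v : Fin P.h) (a b : ℕ) : ℤ :=
  ∑ i, ((if u = P.src i ∧ v = P.dst i then val i a b else 0) +
    if v = P.src i ∧ u = P.dst i then val i b a else 0)

/-- No list forbids the edge between node `a` of part `u` and node `b` of part `v`. -/
def Avail (val : Fin k → ℕ → ℕ → ℤ) (u v : Fin P.h) (a b : ℕ) : Prop :=
  ∀ i, (u = P.src i ∧ v = P.dst i → val i a b ≠ 0) ∧ (v = P.src i ∧ u = P.dst i → val i b a ≠ 0)

variable {P} in
lemma contrib_comm (val : Fin k → ℕ → ℕ → ℤ) (u v : Fin P.h) (a b : ℕ) :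
    P.contrib val u v a b = P.contrib val v u b a :=
  Finset.sum_congr rfl fun _ _ => add_comm _ _

variable {P} in
lemma Avail.symm {val : Fin k → ℕ → ℕ → ℤ} {u v : Fin P.h} {a b : ℕ} (h : P.Avail val u v a b) :
    P.Avail val v u b a := fun i => ⟨(h i).2, (h i).1⟩

open Classical in
/-- The sum of the weights of all types of edges. -/
noncomputable def totalType : ℕ := ∑ e ∈ P.H.edgeFinset, typeWeight e

/-- The graph with a part of `L` nodes for each node of the pattern. -/
noncomputable def inst (val : Fin k → ℕ → ℕ → ℤ) (L : ℕ) (W T : ℤ) : GraphInstance where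
  n := P.h * L
  graph :=
    { Adj := fun p q => P.H.Adj p.divNat q.divNat ∧
        P.Avail val p.divNat q.divNat p.modNat q.modNat
      symm := ⟨fun _ _ h => ⟨h.1.symm, h.2.symm⟩⟩
      loopless := ⟨fun _ h => h.1.ne rfl⟩ }
  weight := Sym2.lift ⟨fun p q => P.contrib val p.divNat q.divNat p.modNat q.modNat +
    W * typeWeight s(p.divNat, q.divNat), fun p q => by
      simp only []
      rw [contrib_comm, Sym2.eq_swap]⟩
  target := T + W * P.totalType

variable {P}

lemma abs_contrib_le {val : Fin k → ℕ → ℕ → ℤ} {L : ℕ} {B : ℤ} (hB : 0 ≤ B)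
    (hval : ∀ i a b, a < L → b < L → |val i a b| ≤ B) (u v : Fin P.h) {a b : ℕ} (ha : a < L)
    (hb : b < L) : |P.contrib val u v a b| ≤ k * (2 * B) := by
  calc |P.contrib val u v a b| ≤ ∑ i, |(if u = P.src i ∧ v = P.dst i then val i a b else 0) +
        if v = P.src i ∧ u = P.dst i then val i b a else 0| := Finset.abs_sum_le_sum_abs _ _
    _ ≤ ∑ _i : Fin k, 2 * B := Finset.sum_le_sum fun i _ => by
        refine (abs_add_le _ _).trans ?_
        have h1 := hval i a b ha hb
        have h2 := hval i b a hb ha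
        split_ifs <;> simp <;> linarith
    _ = _ := by simp

/-- As `W` exceeds all remaining terms, the equation for the weights splits into one for the lists
and one for the types. The latter shows that a copy of `H` uses every edge type; without isolated
nodes it then meets every part, hence each part exactly once. The copy may permute the parts by an
automorphism of `H`, so the node chosen in a part is found through the inverse permutation. -/
theorem inst_yes_iff {val : Fin k → ℕ → ℕ → ℤ} {L : ℕ} {W T B : ℤ} (hB : 0 ≤ B)
    (hval : ∀ i a b, a < L → b < L → |val i a b| ≤ B)
    (hW : Fintype.card (Sym2 (Fin P.h)) * (k * (2 * B)) + |T| < W) :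
    (exactWeight P.H).Yes (P.inst val L W T) ↔ ∃ α : Fin P.h → Fin L,
      (∀ i, val i (α (P.src i)) (α (P.dst i)) ≠ 0) ∧
      ∑ i, val i (α (P.src i)) (α (P.dst i)) = T := by
  classical
  rw [exactWeight_yes_iff]
  -- the contribution of a choice of nodes to the weight of an edge of the pattern
  set F : (Fin P.h → Fin L) → Sym2 (Fin P.h) → ℤ := fun α =>
    Sym2.lift ⟨fun u v => P.contrib val u v (α u) (α v), fun u v => contrib_comm _ _ _ _ _⟩ with hF
  have hFsum : ∀ α, ∑ e ∈ P.H.edgeFinset, F α e = ∑ i, val i (α (P.src i)) (α (P.dst i)) := by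
    intro α
    have : ∀ e ∈ P.H.edgeFinset, F α e =
        ∑ i, if e = s(P.src i, P.dst i) then val i (α (P.src i)) (α (P.dst i)) else 0 := by
      intro e he
      induction e using Sym2.ind with
      | h u v =>
        have huv : P.H.Adj u v := by simpa using he
        simp only [hF, Sym2.lift_mk, contrib, Sym2.eq_iff]
        refine Finset.sum_congr rfl fun i _ => ?_
        by_cases h1 : u = P.src i ∧ v = P.dst i
        · have h2 : ¬ (v = P.src i ∧ u = P.dst i) := fun h2 => huv.ne (h1.1.trans h2.1.symm)
          simp only [h1, true_or, if_true, and_self]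
          rw [if_neg, add_zero]
          rintro ⟨h3, h4⟩
          exact (P.adj i).ne h4
        · by_cases h2 : v = P.src i ∧ u = P.dst i
          · rw [if_neg h1, if_pos h2, if_pos (Or.inr ⟨h2.2, h2.1⟩), zero_add, h2.1, h2.2]
          · rw [if_neg h1, if_neg h2, if_neg, add_zero]
            rintro (h | h)
            · exact h1 h
            · exact h2 ⟨h.2, h.1⟩
    rw [Finset.sum_congr rfl this, Finset.sum_comm]
    refine Finset.sum_congr rfl fun i _ => ?_
    rw [Finset.sum_ite_eq' , if_pos (by simpa using P.adj i)]
  have hweight : ∀ (α : Fin P.h → Fin L) (f : Fin P.h → Fin (P.h * L)) (e : Sym2 (Fin P.h)),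
      (∀ v, α (f v).divNat = (f v).modNat) → (P.inst val L W T).weight (e.map f) =
        F α (e.map fun v => (f v).divNat) + W * typeWeight (e.map fun v => (f v).divNat) := by
    intro α f e h
    induction e using Sym2.ind with
    | h u v => simp [inst, hF, h]
  constructor
  · rintro ⟨f, hinj, hadj, hsum⟩
    change Fin P.h → Fin (P.h * L) at f
    set σ : Fin P.h → Fin P.h := fun v => (f v).divNat with hσ
    have hE : ∀ e ∈ P.H.edgeFinset, e.map σ ∈ P.H.edgeFinset := by
      intro e he
      induction e using Sym2.ind with
      | h u v =>
        have huv : P.H.Adj u v := by simpa using he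
        simpa using (hadj u v huv).1
    -- the weights force that every type of edges occurs
    have hwt : ∀ e ∈ P.H.edgeFinset, ∃ z : ℤ, |z| ≤ k * (2 * B) ∧
        (P.inst val L W T).weight (e.map f) = z + W * typeWeight (e.map σ) := by
      intro e he
      induction e using Sym2.ind with
      | h u v =>
        exact ⟨_, abs_contrib_le hB hval _ _ (f u).modNat.2 (f v).modNat.2, rfl⟩
    choose! z hz1 hz2 using hwt
    have hsum1 : ∑ e ∈ P.H.edgeFinset, z e + W * (∑ e ∈ P.H.edgeFinset, typeWeight (e.map σ) : ℕ) =
        T + W * P.totalType := by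
      rw [← show (P.inst val L W T).target = T + W * P.totalType from rfl, ← hsum,
        Finset.sum_congr rfl hz2, Finset.sum_add_distrib, Nat.cast_sum, Finset.mul_sum]
    have hzs : |∑ e ∈ P.H.edgeFinset, z e| ≤ Fintype.card (Sym2 (Fin P.h)) * (k * (2 * B)) := by
      calc |∑ e ∈ P.H.edgeFinset, z e| ≤ ∑ e ∈ P.H.edgeFinset, |z e| :=
            Finset.abs_sum_le_sum_abs _ _
        _ ≤ ∑ _e ∈ P.H.edgeFinset, (k * (2 * B) : ℤ) := Finset.sum_le_sum hz1
        _ = P.H.edgeFinset.card * (k * (2 * B)) := by simp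
        _ ≤ _ := by
          gcongr
          exact Finset.card_le_univ _
    -- The difference of the type sums, multiplied by `W`, is smaller than `W` in absolute value, so
    -- it vanishes.
    have htype : ∑ e ∈ P.H.edgeFinset, typeWeight (e.map σ) = P.totalType := by
      have h1 : |W * ((∑ e ∈ P.H.edgeFinset, typeWeight (e.map σ) : ℕ) - (P.totalType : ℤ))| < W := by
        have : W * ((∑ e ∈ P.H.edgeFinset, typeWeight (e.map σ) : ℕ) - (P.totalType : ℤ)) =
          T - ∑ e ∈ P.H.edgeFinset, z e := by linarith
        rw [this]
        refine (abs_sub _ _).trans_lt ?_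
        linarith
      have hW0 : 0 < W := (abs_nonneg _).trans_lt h1
      rw [abs_mul, abs_of_pos hW0] at h1
      have h2 : |((∑ e ∈ P.H.edgeFinset, typeWeight (e.map σ) : ℕ) - (P.totalType : ℤ))| < 1 := by
        by_contra hc
        nlinarith
      have := Int.abs_lt_one_iff.mp h2
      omega
    have hsurjE := surj_of_sum_typeWeight (π := Sym2.map σ) htype
    have hsurj : Function.Surjective σ := by
      intro v
      obtain ⟨u, hu⟩ := P.noIso v
      obtain ⟨e, he, h⟩ := hsurjE s(v, u) (by simpa using hu)
      induction e using Sym2.ind with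
      | h x y =>
        rw [Sym2.map_mk, Sym2.eq_iff] at h
        rcases h with h | h
        · exact ⟨x, h.1⟩
        · exact ⟨y, h.2⟩
    have hσinj : Function.Injective σ := Finite.injective_iff_surjective.mpr hsurj
    set τ := Equiv.ofBijective σ ⟨hσinj, hsurj⟩
    set α : Fin P.h → Fin L := fun v => (f (τ.symm v)).modNat with hα
    have hατ : ∀ v, α (f v).divNat = (f v).modNat := by
      intro v
      simp only [hα]
      rw [show (f v).divNat = τ v from rfl, Equiv.symm_apply_apply]
    refine ⟨α, fun i => ?_, ?_⟩
    · obtain ⟨e, he, h⟩ := hsurjE s(P.src i, P.dst i) (by simpa using P.adj i)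
      induction e using Sym2.ind with
      | h x y =>
        have hxy : P.H.Adj x y := by simpa using he
        have h1 := (hadj x y hxy).2 i
        have h2 := (hadj y x hxy.symm).2 i
        rw [Sym2.map_mk, Sym2.eq_iff] at h
        rcases h with ⟨h3, h4⟩ | ⟨h3, h4⟩
        · rw [← h3, ← h4]
          simp only [hσ, hατ]
          exact h1.1 ⟨h3, h4⟩
        · rw [← h3, ← h4]
          simp only [hσ, hατ]
          exact h1.2 ⟨h4, h3⟩
    -- The map of parts permutes the edges of the pattern, so the order in which the copy visits the
    -- parts does not affect the sum.
    · have hbij : ∑ e ∈ P.H.edgeFinset, F α (e.map σ) = ∑ e ∈ P.H.edgeFinset, F α e := by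
        refine Finset.sum_bij (fun e _ => e.map σ) hE
          (fun _ _ _ _ h => Sym2.map.injective hσinj h) (fun e he => ?_) fun _ _ => rfl
        obtain ⟨e', he', h⟩ := hsurjE e he
        exact ⟨e', he', h⟩
      rw [← hFsum, ← hbij]
      have : ∑ e ∈ P.H.edgeFinset, F α (e.map σ) + W * P.totalType = T + W * P.totalType := by
        rw [← show (P.inst val L W T).target = T + W * P.totalType from rfl, ← hsum, ← htype,
          Nat.cast_sum, Finset.mul_sum, ← Finset.sum_add_distrib]
        exact Finset.sum_congr rfl fun e _ => (hweight α f e hατ).symm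
      linarith
  · rintro ⟨α, hα, hsum⟩
    set f : Fin P.h → Fin (P.h * L) := fun v => finProdFinEquiv (v, α v) with hf
    have hdiv : ∀ v, (f v).divNat = v := fun v =>
      congrArg Prod.fst (finProdFinEquiv.symm_apply_apply (v, α v))
    have hmod : ∀ v, (f v).modNat = α v := fun v =>
      congrArg Prod.snd (finProdFinEquiv.symm_apply_apply (v, α v))
    refine ⟨f, fun u v h => by rw [← hdiv u, h, hdiv], fun u v huv => ?_, ?_⟩
    · change P.H.Adj (f u).divNat (f v).divNat ∧ P.Avail val (f u).divNat (f v).divNat _ _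
      rw [hdiv, hdiv, hmod, hmod]
      refine ⟨huv, fun i => ⟨?_, ?_⟩⟩
      · rintro ⟨rfl, rfl⟩; exact hα i
      · rintro ⟨rfl, rfl⟩; exact hα i
    · have hid : ∀ e : Sym2 (Fin P.h), e.map (fun v => (f v).divNat) = e := by
        intro e; simp only [hdiv]; exact congrFun Sym2.map_id e
      rw [Finset.sum_congr rfl fun e _ => hweight α f e fun v => by rw [hdiv, hmod]]
      simp only [hid]
      rw [Finset.sum_add_distrib, hFsum, hsum, ← Finset.mul_sum, ← Nat.cast_sum]
      rfl

end Pattern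

/-! ### The input of an exact-weight instance -/

lemma initial_mem_graph {V : Type} (H : SimpleGraph V) (I : GraphInstance) (x : ℤ) :
    (initial ((exactWeight H).input I)).mem x =
      if x = 0 then (I.n : ℤ) else if x = 1 then I.target else
      if h : 2 ≤ x ∧ x - 2 < (I.n * I.n : ℕ) then
        I.adjEntry (⟨(x - 2).toNat, by omega⟩ : Fin (I.n * I.n)).divNat
          (⟨(x - 2).toNat, by omega⟩ : Fin (I.n * I.n)).modNat
      else if h : 2 + (I.n * I.n : ℕ) ≤ x ∧ x - 2 - (I.n * I.n : ℕ) < (I.n * I.n : ℕ) then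
        I.weightEntry (⟨(x - 2 - (I.n * I.n : ℕ)).toNat, by omega⟩ : Fin (I.n * I.n)).divNat
          (⟨(x - 2 - (I.n * I.n : ℕ)).toNat, by omega⟩ : Fin (I.n * I.n)).modNat
      else 0 := by
  set A := List.ofFn fun a : Fin (I.n * I.n) => I.adjEntry a.divNat a.modNat with hA
  set W := List.ofFn fun a : Fin (I.n * I.n) => I.weightEntry a.divNat a.modNat with hW
  have hAl : A.length = I.n * I.n := by simp [hA]
  have hWl : W.length = I.n * I.n := by simp [hW]
  change (if 0 ≤ x then ((I.n : ℤ) :: I.target :: (A ++ W)).getD x.toNat 0 else 0) = _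
  rcases lt_or_ge x 0 with hx | hx
  · rw [if_neg (by omega), if_neg (by omega), if_neg (by omega), dif_neg (by omega),
      dif_neg (by omega)]
  rw [if_pos hx]
  lift x to ℕ using hx
  rw [Int.toNat_natCast]
  rcases x with _ | _ | x
  · simp
  · simp
  · rw [List.getD_cons_succ, List.getD_cons_succ, if_neg (by push_cast; omega),
      if_neg (by push_cast; omega)]
    by_cases h1 : x < I.n * I.n
    · rw [dif_pos (by push_cast at *; omega), List.getD_append _ _ _ _ (by omega),
        List.getD_eq_getElem _ _ (by omega)]
      simp only [hA, List.getElem_ofFn]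
      have : (((x + 1 + 1 : ℕ) : ℤ) - 2).toNat = x := by omega
      congr 2 <;> simp only [this]
    · rw [dif_neg (by push_cast at *; omega), List.getD_append_right _ _ _ _ (by omega), hAl]
      by_cases h2 : x - I.n * I.n < I.n * I.n
      · rw [dif_pos (by push_cast at *; omega), List.getD_eq_getElem _ _ (by omega)]
        simp only [hW, List.getElem_ofFn]
        have : (((x + 1 + 1 : ℕ) : ℤ) - 2 - (I.n * I.n : ℕ)).toNat = x - I.n * I.n := by omega
        congr 2 <;> simp only [this]
      · rw [dif_neg (by push_cast at *; omega), List.getD_eq_default _ _ (by omega)]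

/-! ### Layouts -/

/-- A way to arrange the cells of `k` hash tables of size `rho ^ kap` along the edges of a graph
with parts of `rho ^ lam` nodes.  The nodes of an edge that belongs to list `i` determine a cell of
the table of this list, where a given number `T` may be used. -/
structure Layout (k : ℕ) extends Pattern k where
  -- A table needs about `n` cells, so a part has about `n ^ (lam / kap)` nodes; this quotient
  -- decides the exponent in the lower bound.
  kap : ℕ
  lam : ℕ
  kap_pos : 0 < kap
  lam_pos : 0 < lam
  /-- The cell, computed from `rho` (variable `9`), `T` (variable `24`), and the nodes (variables
  `41` and `42`). -/
  cell : Fin k → Expr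
  cell_in : ∀ i, (cell i).In {9, 24, 41, 42}
  cell_loads : ∀ i l s, (cell i).LoadsLe l s
  cellF : Fin k → ℤ → ℤ → ℤ → ℤ → ℤ
  cell_eval : ∀ i s, (cell i).eval s = cellF i (s.v 9) (s.v 24) (s.v 41) (s.v 42)
  cell_range : ∀ (i : Fin k) (r : ℕ) (T : ℤ) (a b : ℕ), 0 < r → a < r ^ lam → b < r ^ lam →
    0 ≤ cellF i r T a b ∧ cellF i r T a b < (r ^ kap : ℕ)
  /-- Cells whose sum is `T` modulo `rho ^ kap` are realized by some choice of nodes. -/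
  complete : ∀ (r : ℕ) (T : ℤ) (c : Fin k → ℤ), 0 < r → (∀ i, 0 ≤ c i ∧ c i < (r ^ kap : ℕ)) →
    ∑ i, c i ≡ T [ZMOD (r ^ kap : ℕ)] → ∃ α : Fin h → Fin (r ^ lam),
      ∀ i, cellF i r T (α (src i)) (α (dst i)) = c i

lemma Expr.In.mono {S S' : Finset (Fin 64)} (hS : S ⊆ S') {e : Expr} (h : e.In S) : e.In S' := by
  induction e with
  | var i => exact hS h
  | const => trivial
  | op o e f ihe ihf => exact ⟨ihe h.1, ihf h.2⟩
  | mem e ih => exact ih h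

lemma Cmd.sem_ifp_pos {e : Expr} {s : Env} (h : 0 < e.eval s) (c d : Cmd) :
    (ifp e c d).sem s = c.sem s := if_pos h

lemma Cmd.sem_ifp_neg {e : Expr} {s : Env} (h : ¬ 0 < e.eval s) (c d : Cmd) :
    (ifp e c d).sem s = d.sem s := if_neg h

lemma Cmd.loadsLe_ifp_pos {e : Expr} {s : Env} (h : 0 < e.eval s) (c d : Cmd) (l : ℕ) :
    (ifp e c d).LoadsLe l s ↔ e.LoadsLe l s ∧ c.LoadsLe l s := by simp [LoadsLe, h]

lemma Cmd.loadsLe_ifp_neg {e : Expr} {s : Env} (h : ¬ 0 < e.eval s) (c d : Cmd) (l : ℕ) :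
    (ifp e c d).LoadsLe l s ↔ e.LoadsLe l s ∧ d.LoadsLe l s := by simp [LoadsLe, h]

lemma code_inj {h : ℕ} {u v u' v' : Fin h} :
    ((u : ℕ) : ℤ) * h + (v : ℕ) = ((u' : ℕ) : ℤ) * h + (v' : ℕ) ↔ u = u' ∧ v = v' := by
  constructor
  · intro e
    have e' : (u : ℕ) * h + v = (u' : ℕ) * h + v' := by exact_mod_cast e
    have h1 : finProdFinEquiv (u, v) = finProdFinEquiv (u', v') := by
      ext
      simp only [finProdFinEquiv_apply_val]
      rw [mul_comm h, mul_comm h]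
      omega
    have := finProdFinEquiv.injective h1
    exact ⟨congrArg Prod.fst this, congrArg Prod.snd this⟩
  · rintro ⟨rfl, rfl⟩; rfl

/-! ### Loop-free computation of matrix entries of a query -/

namespace Layout
variable {k : ℕ} (Y : Layout k)

/-- Positive if and only if variable `38` is the code of the pair `(u, v)`. -/
def test (u v : Fin Y.h) : Expr :=
  1 - (.var 38 - .const ((u : ℕ) * Y.h + (v : ℕ))) * (.var 38 - .const ((u : ℕ) * Y.h + (v : ℕ)))

variable {Y} in
lemma test_pos {u v u' v' : Fin Y.h} {s : Env} (hs : s.v 38 = ((u : ℕ) : ℤ) * Y.h + (v : ℕ)) :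
    0 < (Y.test u' v').eval s ↔ u = u' ∧ v = v' := by
  rw [← code_inj, ← hs]
  simp only [test, Expr.eval_sub, Expr.eval_mul, Expr.eval_one, Expr.eval_var, Expr.eval_const]
  constructor
  · intro h
    by_contra hne
    have : s.v 38 - (((u' : ℕ) : ℤ) * Y.h + (v' : ℕ)) ≠ 0 := sub_ne_zero.mpr hne
    have : 0 < (s.v 38 - (((u' : ℕ) : ℤ) * Y.h + (v' : ℕ))) *
      (s.v 38 - (((u' : ℕ) : ℤ) * Y.h + (v' : ℕ))) := mul_self_pos.mpr this
    linarith
  · intro h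
    rw [h]; simp

/-- Set the weight for the type of the edge. -/
noncomputable def edgeCmd (p : Fin Y.h × Fin Y.h) : Cmd :=
  .ifp (Y.test p.1 p.2) (.asg 39 1 >> .asg 40 (.var 27 * .const (typeWeight s(p.1, p.2)))) .nop

noncomputable def edgesCmd (l : List (Fin Y.h × Fin Y.h)) : Cmd :=
  l.foldr (fun p c => Y.edgeCmd p >> c) .nop

/-- Read the entry of the table of list `i`. -/
def lookup (i : Fin k) : Cmd :=
  .asg 43 (.mem (.const k * .var 1 + 1 + .const (i : ℕ) * .var 11 + Y.cell i)) >>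
  -- The entry `0` marks an empty cell: no number is available there, and the edge is deleted.
  .asg 40 (.var 40 + .var 43) >> .ifp (.var 43) .nop (.asg 39 0)

/-- Take the entry of list `i` into account. -/
def listCmd (i : Fin k) : Cmd :=
  .ifp (Y.test (Y.src i) (Y.dst i)) (.asg 41 (.var 35) >> .asg 42 (.var 37) >> Y.lookup i) .nop >>
  .ifp (Y.test (Y.dst i) (Y.src i)) (.asg 41 (.var 37) >> .asg 42 (.var 35) >> Y.lookup i) .nop

def listsCmd (l : List (Fin k)) : Cmd := l.foldr (fun i c => Y.listCmd i >> c) .nop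

open Classical in
/-- The ordered pairs of adjacent nodes. -/
noncomputable def adjPairs : List (Fin Y.h × Fin Y.h) :=
  (Finset.univ.filter fun p : Fin Y.h × Fin Y.h => Y.H.Adj p.1 p.2).toList

/-- Compute the matrix entries with number `31`: adjacency to variable `39`, and the weight for
adjacent nodes to variable `40`. -/
noncomputable def matrixCmd : Cmd :=
  .asg 32 (.var 31 / .var 26) >> .asg 33 (.var 31 - .var 32 * .var 26) >>
  .asg 34 (.var 32 / .var 12) >> .asg 35 (.var 32 - .var 34 * .var 12) >>
  .asg 36 (.var 33 / .var 12) >> .asg 37 (.var 33 - .var 36 * .var 12) >>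
  .asg 38 (.var 34 * .const Y.h + .var 36) >> .asg 39 0 >> .asg 40 0 >>
  Y.edgesCmd Y.adjPairs >> Y.listsCmd (List.finRange k)

/-- Compute the cell of the virtual input whose address is in variable `28`. -/
noncomputable def entryCmd : Cmd :=
  .asg 30 0 >> .ifp (.var 28 + 1) (.ifp (.var 28) (.ifp (.var 28 - 1)
    (.asg 31 (.var 28 - 2) >> .ifp (.var 26 * .var 26 - .var 31)
      (Y.matrixCmd >> .asg 30 (.var 39))
      (.asg 31 (.var 31 - .var 26 * .var 26) >> .ifp (.var 26 * .var 26 - .var 31)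
        (Y.matrixCmd >> .asg 30 (.var 39 * .var 40)) .nop))
    (.asg 30 (.var 25))) (.asg 30 (.var 26))) .nop

lemma cell_in_simVars (i : Fin k) : (Y.cell i).In simVars :=
  (Y.cell_in i).mono (by decide)

lemma edgesCmd_in (l : List (Fin Y.h × Fin Y.h)) : (Y.edgesCmd l).In simVars := by
  induction l with
  | nil => trivial
  | cons p l ih =>
    refine ⟨?_, ih⟩
    simp only [edgeCmd, test, Cmd.in_andThen, Cmd.In, Expr.in_sub, Expr.in_mul, Expr.in_var,
      Expr.in_const, Expr.in_one, and_true]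
    decide

lemma lookup_in (i : Fin k) : (Y.lookup i).In simVars := by
  simp only [lookup, Cmd.in_andThen, Cmd.In, Expr.in_add, Expr.in_mul, Expr.in_var,
      Expr.in_const, Expr.in_one, Expr.in_zero, Expr.in_mem, cell_in_simVars, and_true]
  decide

lemma listsCmd_in (l : List (Fin k)) : (Y.listsCmd l).In simVars := by
  induction l with
  | nil => trivial
  | cons p l ih =>
    refine ⟨?_, ih⟩
    simp only [listCmd, test, Cmd.in_andThen, Cmd.In, Expr.in_sub, Expr.in_mul, Expr.in_var,
      Expr.in_const, Expr.in_one, and_true, lookup_in]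
    decide

lemma entryCmd_in : Y.entryCmd.In simVars := by
  simp only [entryCmd, matrixCmd, Cmd.in_andThen, Cmd.In, Expr.in_sub, Expr.in_mul, Expr.in_var,
      Expr.in_const, Expr.in_ofNat, Expr.in_add, Expr.in_div, and_true,
      edgesCmd_in, listsCmd_in]
  refine ⟨?_, ?_⟩ <;> and_intros <;> decide

variable {Y}

lemma edgesCmd_spec (u v : Fin Y.h) (l : List (Fin Y.h × Fin Y.h)) {s : Env} (b : ℕ)
    (hs : s.v 38 = ((u : ℕ) : ℤ) * Y.h + (v : ℕ)) :
    Agree {39, 40} s ((Y.edgesCmd l).sem s) ∧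
    ((Y.edgesCmd l).sem s).v 39 = (if (u, v) ∈ l then 1 else s.v 39) ∧
    ((Y.edgesCmd l).sem s).v 40 = (if (u, v) ∈ l then s.v 27 * typeWeight s(u, v) else s.v 40) ∧
    (Y.edgesCmd l).LoadsLe b s := by
  induction l generalizing s with
  | nil => exact ⟨Agree.refl _ _, by simp [edgesCmd, Cmd.sem], by simp [edgesCmd, Cmd.sem], trivial⟩
  | cons p l ih =>
    have hstep : Agree {39, 40} s ((Y.edgeCmd p).sem s) ∧
        ((Y.edgeCmd p).sem s).v 39 = (if (u, v) = p then 1 else s.v 39) ∧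
        ((Y.edgeCmd p).sem s).v 40 = (if (u, v) = p then s.v 27 * typeWeight s(u, v) else s.v 40) ∧
        (Y.edgeCmd p).LoadsLe b s := by
      have hl : (Y.edgeCmd p).LoadsLe b s := by
        simp only [edgeCmd, test, Cmd.loadsLe_andThen, Cmd.LoadsLe, Expr.loadsLe_sub,
          Expr.loadsLe_mul, Expr.loadsLe_var, Expr.loadsLe_const, Expr.loadsLe_one]
        simp
      refine ⟨?_, ?_, ?_, hl⟩ <;>
        simp only [edgeCmd, Cmd.sem, test_pos hs, Cmd.sem_andThen] <;>
        by_cases h : u = p.1 ∧ v = p.2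
      · rw [if_pos h]
        exact ((Agree.refl _ _).update (x := 39) (by decide) _).update (x := 40) (by decide) _
      · rw [if_neg h]; exact Agree.refl _ _
      · rw [if_pos h, if_pos (Prod.ext h.1 h.2)]
        simp only [Expr.eval_one]
        rw [Function.update_of_ne (by decide), Function.update_self]
      · rw [if_neg h, if_neg (fun e => h ⟨congrArg Prod.fst e, congrArg Prod.snd e⟩)]
      · rw [if_pos h, if_pos (Prod.ext h.1 h.2)]
        simp only [Expr.eval_mul, Expr.eval_var, Expr.eval_const, Function.update_self]
        rw [Function.update_of_ne (by decide), h.1, h.2]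
      · rw [if_neg h, if_neg (fun e => h ⟨congrArg Prod.fst e, congrArg Prod.snd e⟩)]
    obtain ⟨a1, a2, a3, a4⟩ := hstep
    obtain ⟨b1, b2, b3, b4⟩ := ih (s := (Y.edgeCmd p).sem s) (by rw [a1.v 38 (by decide), hs])
    refine ⟨a1.trans b1 (by decide) (by decide), b2.trans ?_, b3.trans ?_, a4, b4⟩
    · simp only [a2, List.mem_cons]
      by_cases h1 : (u, v) = p <;> by_cases h2 : (u, v) ∈ l <;> simp [h1, h2]
    · simp only [a3, a1.v 27 (by decide), List.mem_cons]
      by_cases h1 : (u, v) = p <;> by_cases h2 : (u, v) ∈ l <;> simp [h1, h2]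

/-- The values of the variables and the part of the memory on which the virtual input depends. -/
structure Table (Y : Layout k) (n r : ℕ) (T : ℤ) (tab : Fin k → ℤ → ℤ) (b : ℕ) (s : Env) :
    Prop where
  v1 : s.v 1 = n
  v9 : s.v 9 = r
  v11 : s.v 11 = (r ^ Y.kap : ℕ)
  v24 : s.v 24 = T
  r_pos : 0 < r
  mem : ∀ i (c : ℤ), 0 ≤ c → c < (r ^ Y.kap : ℕ) →
    s.m (k * n + 1 + (i : Fin k) * (r ^ Y.kap : ℕ) + c) = tab i c
  nonneg : ∀ i c, 0 ≤ tab i c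
  le : ∀ i c, len (tab i c) ≤ b

lemma Table.congr {n r : ℕ} {T : ℤ} {tab : Fin k → ℤ → ℤ} {b : ℕ} {s s' : Env}
    (h : Table Y n r T tab b s) {S : Finset (Fin 64)} (hA : Agree S s s')
    (hS : Disjoint S {1, 9, 11, 24}) : Table Y n r T tab b s' where
  v1 := by rw [hA.v 1 (Finset.disjoint_right.mp hS (by decide)), h.v1]
  v9 := by rw [hA.v 9 (Finset.disjoint_right.mp hS (by decide)), h.v9]
  v11 := by rw [hA.v 11 (Finset.disjoint_right.mp hS (by decide)), h.v11]
  v24 := by rw [hA.v 24 (Finset.disjoint_right.mp hS (by decide)), h.v24]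
  r_pos := h.r_pos
  mem := by rw [hA.m]; exact h.mem
  nonneg := h.nonneg
  le := h.le

/-- The entry of list `i` that belongs to the nodes `a` and `b`. -/
def val (Y : Layout k) (r : ℕ) (T : ℤ) (tab : Fin k → ℤ → ℤ) (i : Fin k) (a b : ℕ) : ℤ :=
  tab i (Y.cellF i r T a b)

lemma lookup_spec {n r : ℕ} {T : ℤ} {tab : Fin k → ℤ → ℤ} {l : ℕ} {s : Env}
    (h : Table Y n r T tab l s) (i : Fin k) {a b : ℕ} (ha : a < r ^ Y.lam) (hb : b < r ^ Y.lam)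
    (h41 : s.v 41 = a) (h42 : s.v 42 = b) :
    Agree {39, 40, 43} s ((Y.lookup i).sem s) ∧
    ((Y.lookup i).sem s).v 39 = (if Y.val r T tab i a b ≠ 0 then s.v 39 else 0) ∧
    ((Y.lookup i).sem s).v 40 = s.v 40 + Y.val r T tab i a b ∧
    (Y.lookup i).LoadsLe l s := by
  obtain ⟨hr0, hr1⟩ := Y.cell_range i r T a b h.r_pos ha hb
  have hval : (Expr.mem (.const k * .var 1 + 1 + .const (i : ℕ) * .var 11 + Y.cell i)).eval s =
      Y.val r T tab i a b := by
    simp only [Expr.eval_mem, Expr.eval_add, Expr.eval_mul, Expr.eval_const, Expr.eval_var,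
      Expr.eval_one, Y.cell_eval, h.v1, h.v11, h.v9, h.v24, h41, h42]
    exact h.mem i _ hr0 hr1
  have hnn : 0 ≤ Y.val r T tab i a b := h.nonneg _ _
  have hl : (Y.lookup i).LoadsLe l s := by
    refine ⟨⟨?_, ?_⟩, ?_⟩
    · simp only [Expr.loadsLe_add, Expr.loadsLe_mul, Expr.loadsLe_const, Expr.loadsLe_var,
        Expr.loadsLe_one, Y.cell_loads, and_self]
    · change len ((Expr.mem (.const k * .var 1 + 1 + .const (i : ℕ) * .var 11 + Y.cell i)).eval s) ≤ l
      rw [hval]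
      exact h.le _ _
    · simp [Cmd.loadsLe_andThen, Cmd.LoadsLe]
  rw [lookup] at hl ⊢
  simp only [Cmd.sem_andThen, Cmd.sem, hval, Expr.eval_var, Expr.eval_add, Expr.eval_zero,
    Function.update_of_ne (by decide : (43 : Fin 64) ≠ 40), Function.update_self,
    Function.update_of_ne (by decide : (40 : Fin 64) ≠ 43)]
  by_cases h0 : Y.val r T tab i a b = 0
  · rw [if_neg (by omega), h0, if_neg (by simp)]
    refine ⟨?_, by simp, ?_, hl⟩
    · exact (((Agree.refl _ _).update (x := 43) (by decide) _).update (x := 40) (by decide) _).update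
        (x := 39) (by decide) _
    · simp only []
      rw [Function.update_of_ne (by decide), Function.update_self]
  · rw [if_pos (by omega), if_pos h0]
    refine ⟨?_, ?_, by simp, hl⟩
    · exact ((Agree.refl _ _).update (x := 43) (by decide) _).update (x := 40) (by decide) _
    · simp only []
      rw [Function.update_of_ne (by decide), Function.update_of_ne (by decide)]

/-- The contribution of one list to the weight of an edge. -/
def contribAt (Y : Layout k) (val : Fin k → ℕ → ℕ → ℤ) (u v : Fin Y.h) (a b : ℕ) (i : Fin k) : ℤ :=
  (if u = Y.src i ∧ v = Y.dst i then val i a b else 0) +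
    if v = Y.src i ∧ u = Y.dst i then val i b a else 0

/-- List `i` does not forbid the edge. -/
def AvailAt (Y : Layout k) (val : Fin k → ℕ → ℕ → ℤ) (u v : Fin Y.h) (a b : ℕ) (i : Fin k) :
    Prop :=
  (u = Y.src i ∧ v = Y.dst i → val i a b ≠ 0) ∧ (v = Y.src i ∧ u = Y.dst i → val i b a ≠ 0)

lemma ifp_lookup_spec {n r : ℕ} {T : ℤ} {tab : Fin k → ℤ → ℤ} {l : ℕ} {s : Env}
    (h : Table Y n r T tab l s) (i : Fin k) {a b : ℕ} (ha : a < r ^ Y.lam) (hb : b < r ^ Y.lam)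
    {x y : Fin 64} (hx : s.v x = a) (hy : s.v y = b) (hy' : y ≠ 41) {u v u' v' : Fin Y.h}
    (hs : s.v 38 = ((u : ℕ) : ℤ) * Y.h + (v : ℕ)) (c : Cmd)
    (hc : c = .ifp (Y.test u' v') (.asg 41 (.var x) >> .asg 42 (.var y) >> Y.lookup i) .nop) :
    Agree {39, 40, 41, 42, 43} s (c.sem s) ∧
    (c.sem s).v 39 = (if u = u' ∧ v = v' → Y.val r T tab i a b ≠ 0 then s.v 39 else 0) ∧
    (c.sem s).v 40 = s.v 40 + (if u = u' ∧ v = v' then Y.val r T tab i a b else 0) ∧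
    c.LoadsLe l s := by
  subst hc
  have ht : (Y.test u' v').LoadsLe l s := by
    simp only [test, Expr.loadsLe_sub, Expr.loadsLe_mul, Expr.loadsLe_var, Expr.loadsLe_const,
      Expr.loadsLe_one, and_self]
  simp only [Cmd.sem, Cmd.LoadsLe, test_pos hs, ht, true_and]
  by_cases huv : u = u' ∧ v = v'
  · simp only [huv, not_true_eq_false, if_true, false_imp_iff, true_imp_iff, and_true, and_self]
    have hA : Agree {41, 42} s ((Cmd.asg 42 (.var y)).sem ((Cmd.asg 41 (.var x)).sem s)) :=
      ((Agree.refl _ _).update (x := 41) (by decide) _).update (x := 42) (by decide) _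
    obtain ⟨h1, h2, h3, h4⟩ := lookup_spec (h.congr hA (by decide)) i ha hb
      (by
        simp only [Cmd.sem, Expr.eval_var]
        rw [Function.update_of_ne (by decide), Function.update_self, hx])
      (by
        simp only [Cmd.sem, Expr.eval_var]
        rw [Function.update_self, Function.update_of_ne hy', hy])
    rw [hA.v 39 (by decide)] at h2
    rw [hA.v 40 (by decide)] at h3
    exact ⟨hA.trans h1 (by decide) (by decide), h2, h3, trivial, trivial, h4⟩
  · simp only [huv, not_false_eq_true, if_false, false_imp_iff, if_true, add_zero, true_and]
    exact ⟨Agree.refl _ _, fun _ => trivial⟩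

open Classical in
lemma listsCmd_spec {n r : ℕ} {T : ℤ} {tab : Fin k → ℤ → ℤ} {l : ℕ} {a b : ℕ}
    (ha : a < r ^ Y.lam) (hb : b < r ^ Y.lam) (u v : Fin Y.h) (L : List (Fin k)) {s : Env}
    (h : Table Y n r T tab l s) (h35 : s.v 35 = a) (h37 : s.v 37 = b)
    (hs : s.v 38 = ((u : ℕ) : ℤ) * Y.h + (v : ℕ)) :
    Agree {39, 40, 41, 42, 43} s ((Y.listsCmd L).sem s) ∧
    ((Y.listsCmd L).sem s).v 39 =
      (if ∀ i ∈ L, Y.AvailAt (Y.val r T tab) u v a b i then s.v 39 else 0) ∧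
    ((Y.listsCmd L).sem s).v 40 = s.v 40 + (L.map (Y.contribAt (Y.val r T tab) u v a b)).sum ∧
    (Y.listsCmd L).LoadsLe l s := by
  induction L generalizing s with
  | nil => exact ⟨Agree.refl _ _, by simp [listsCmd, Cmd.sem], by simp [listsCmd, Cmd.sem], trivial⟩
  | cons i L ih =>
    set c1 : Cmd := .ifp (Y.test (Y.src i) (Y.dst i))
      (.asg 41 (.var 35) >> .asg 42 (.var 37) >> Y.lookup i) .nop with hc1
    set c2 : Cmd := .ifp (Y.test (Y.dst i) (Y.src i))
      (.asg 41 (.var 37) >> .asg 42 (.var 35) >> Y.lookup i) .nop with hc2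
    obtain ⟨p1, p2, p3, p4⟩ := ifp_lookup_spec h i ha hb h35 h37 (by decide) hs c1 hc1
    obtain ⟨q1, q2, q3, q4⟩ := ifp_lookup_spec (h.congr p1 (by decide)) i hb ha
      ((p1.v 37 (by decide)).trans h37) ((p1.v 35 (by decide)).trans h35) (by decide)
      ((p1.v 38 (by decide)).trans hs) c2 hc2
    have hA := p1.trans q1 (S'' := {39, 40, 41, 42, 43}) (by decide) (by decide)
    obtain ⟨r1, r2, r3, r4⟩ := ih (h.congr hA (by decide)) ((hA.v 35 (by decide)).trans h35)
      ((hA.v 37 (by decide)).trans h37) ((hA.v 38 (by decide)).trans hs)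
    refine ⟨hA.trans r1 (by decide) (by decide), r2.trans ?_, r3.trans ?_, ⟨p4, q4⟩, r4⟩
    · rw [q2, p2]
      simp only [List.forall_mem_cons, AvailAt, and_comm (a := v = _)]
      split_ifs <;> first | rfl | (exfalso; tauto)
    · rw [q3, p3, List.map_cons, List.sum_cons]
      simp only [contribAt, and_comm (a := v = _)]
      ring

open Classical in
-- Division with remainder decodes an index into a row and a column, and each of these into a part
-- and a node of it. Variable `39` starts as adjacency in the pattern and is cleared by any empty
-- cell; multiplying by it gives weight `0` to non-edges, as the input format demands.
lemma matrixCmd_spec {n r : ℕ} {T : ℤ} {tab : Fin k → ℤ → ℤ} {l : ℕ} {s : Env}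
    (h : Table Y n r T tab l s) {L : ℕ} (hL : L = r ^ Y.lam) (h12 : s.v 12 = L)
    (h26 : s.v 26 = (Y.h * L : ℕ)) {p : Fin (Y.h * L * (Y.h * L))}
    (h31 : s.v 31 = (p : ℕ)) {W : ℤ} (h27 : s.v 27 = W) :
    Agree {32, 33, 34, 35, 36, 37, 38, 39, 40, 41, 42, 43} s (Y.matrixCmd.sem s) ∧
    (Y.matrixCmd.sem s).v 39 =
      (Y.inst (Y.val r T tab) L W (T + k)).adjEntry p.divNat p.modNat ∧
    (Y.matrixCmd.sem s).v 39 * (Y.matrixCmd.sem s).v 40 =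
      (Y.inst (Y.val r T tab) L W (T + k)).weightEntry p.divNat p.modNat ∧
    Y.matrixCmd.LoadsLe l s := by
  set u : Fin Y.h := Fin.divNat (n := L) p.divNat with hu
  set v : Fin Y.h := Fin.divNat (n := L) p.modNat with hv
  set a : ℕ := (Fin.modNat (n := L) p.divNat : ℕ) with ha
  set b : ℕ := (Fin.modNat (n := L) p.modNat : ℕ) with hb
  set init : Cmd := .asg 32 (.var 31 / .var 26) >> .asg 33 (.var 31 - .var 32 * .var 26) >>
    .asg 34 (.var 32 / .var 12) >> .asg 35 (.var 32 - .var 34 * .var 12) >>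
    .asg 36 (.var 33 / .var 12) >> .asg 37 (.var 33 - .var 36 * .var 12) >>
    .asg 38 (.var 34 * .const Y.h + .var 36) >> .asg 39 0 >> .asg 40 0 with hinit
  have hsem : Y.matrixCmd.sem s =
      (Y.listsCmd (List.finRange k)).sem ((Y.edgesCmd Y.adjPairs).sem (init.sem s)) := rfl
  have hload : Y.matrixCmd.LoadsLe l s ↔ init.LoadsLe l s ∧
      (Y.edgesCmd Y.adjPairs).LoadsLe l (init.sem s) ∧
      (Y.listsCmd (List.finRange k)).LoadsLe l ((Y.edgesCmd Y.adjPairs).sem (init.sem s)) := by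
    simp only [matrixCmd, hinit, Cmd.loadsLe_andThen, Cmd.sem_andThen, and_assoc]
  have hIA : Agree {32, 33, 34, 35, 36, 37, 38, 39, 40} s (init.sem s) := by
    simp only [hinit, Cmd.sem_andThen, Cmd.sem]
    refine Agree.update (Agree.update (Agree.update (Agree.update (Agree.update (Agree.update
      (Agree.update (Agree.update (Agree.update (Agree.refl _ _) (x := 32) ?_ _) (x := 33) ?_ _)
      (x := 34) ?_ _) (x := 35) ?_ _) (x := 36) ?_ _) (x := 37) ?_ _) (x := 38) ?_ _)
      (x := 39) ?_ _) (x := 40) ?_ _ <;> decide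
  have hdiv : ∀ {A B : ℕ} (x : Fin (A * B)),
      ((x : ℕ) : ℤ) / (B : ℕ) = ((x.divNat : Fin A) : ℕ) := fun x => (Int.natCast_ediv _ _).symm
  have hmod : ∀ {A B : ℕ} (x : Fin (A * B)),
      ((x : ℕ) : ℤ) - ((x.divNat : Fin A) : ℕ) * (B : ℕ) = ((x.modNat : Fin B) : ℕ) := by
    intro A B x
    rw [← hdiv, Fin.coe_modNat, Int.natCast_mod, Int.emod_def]; ring
  have hrow : ((p : ℕ) : ℤ) / (Y.h * L : ℕ) = ((p.divNat : Fin (Y.h * L)) : ℕ) := hdiv p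
  have hcol : ((p : ℕ) : ℤ) - ((p.divNat : Fin (Y.h * L)) : ℕ) * (Y.h * L : ℕ) =
    ((p.modNat : Fin (Y.h * L)) : ℕ) := hmod p
  have hpu : (((p.divNat : Fin (Y.h * L)) : ℕ) : ℤ) / (L : ℕ) = (u : ℕ) := hdiv _
  have hpa : (((p.divNat : Fin (Y.h * L)) : ℕ) : ℤ) - (u : ℕ) * (L : ℕ) = a := hmod _
  have hpv : (((p.modNat : Fin (Y.h * L)) : ℕ) : ℤ) / (L : ℕ) = (v : ℕ) := hdiv _
  have hpb : (((p.modNat : Fin (Y.h * L)) : ℕ) : ℤ) - (v : ℕ) * (L : ℕ) = b := hmod _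
  have hIv : (init.sem s).v 35 = a ∧ (init.sem s).v 37 = b ∧
      (init.sem s).v 38 = ((u : ℕ) : ℤ) * Y.h + (v : ℕ) ∧ (init.sem s).v 39 = 0 ∧
      (init.sem s).v 40 = 0 := by
    simp only [hinit, Cmd.sem_andThen, Cmd.sem, Expr.eval_sub, Expr.eval_mul, Expr.eval_var,
      Expr.eval_div, Expr.eval_add, Expr.eval_const, Expr.eval_zero, Function.update_apply,
      reduceIte, h31, h26, h12, Fin.reduceEq]
    simp only [hrow, hcol, hpu, hpa, hpv, hpb, and_self]
  obtain ⟨i35, i37, i38, i39, i40⟩ := hIv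
  obtain ⟨e1, e2, e3, e4⟩ := edgesCmd_spec u v Y.adjPairs l i38
  have hA2 := hIA.trans e1 (S'' := {32, 33, 34, 35, 36, 37, 38, 39, 40}) (by decide) (by decide)
  obtain ⟨l1, l2, l3, l4⟩ := listsCmd_spec ((Fin.modNat (n := L) p.divNat).2.trans_eq hL)
    ((Fin.modNat (n := L) p.modNat).2.trans_eq hL) u v (List.finRange k) (h.congr hA2 (by decide))
    ((e1.v 35 (by decide)).trans i35) ((e1.v 37 (by decide)).trans i37)
    ((e1.v 38 (by decide)).trans i38)
  have hmem : (u, v) ∈ Y.adjPairs ↔ Y.H.Adj u v := by simp [adjPairs]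
  have havail : (∀ i ∈ List.finRange k, Y.AvailAt (Y.val r T tab) u v a b i) ↔
      Y.Avail (Y.val r T tab) u v a b := by simp [AvailAt, Pattern.Avail]
  have hcontr : ((List.finRange k).map (Y.contribAt (Y.val r T tab) u v a b)).sum =
      Y.contrib (Y.val r T tab) u v a b := by
    rw [Pattern.contrib, ← List.sum_ofFn, List.ofFn_eq_map]
    rfl
  have hadj : (Y.inst (Y.val r T tab) L W (T + k)).graph.Adj p.divNat p.modNat ↔
      Y.H.Adj u v ∧ Y.Avail (Y.val r T tab) u v a b := Iff.rfl
  rw [hsem, hload]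
  rw [e2, i39] at l2
  rw [e3, i40, hcontr, hIA.v 27 (by decide), h27] at l3
  simp only [← ha, ← hb, havail, hmem] at l2 l3
  refine ⟨hA2.trans l1 (by decide) (by decide), ?_, ?_, ?_, e4, l4⟩
  · rw [l2]
    simp only [GraphInstance.adjEntry, hadj]
    by_cases h1 : Y.H.Adj u v <;> by_cases h2 : Y.Avail (Y.val r T tab) u v a b <;> simp [h1, h2]
  · rw [l2, l3]
    simp only [GraphInstance.weightEntry, hadj]
    by_cases h1 : Y.H.Adj u v <;> by_cases h2 : Y.Avail (Y.val r T tab) u v a b <;> simp [h1, h2]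
    rw [add_comm]
    rfl
  · simp [hinit, Cmd.loadsLe_andThen, Cmd.LoadsLe]

/-- The variables that change during the computation of a virtual memory cell. -/
def entryVars : Finset (Fin 64) := {30, 31, 32, 33, 34, 35, 36, 37, 38, 39, 40, 41, 42, 43}

/-- This is the link to the simulation: any cell of the graph input can be produced from the tables
in a constant number of operations, so the quadratically many entries are never stored. -/
lemma entryCmd_spec {n r : ℕ} {T : ℤ} {tab : Fin k → ℤ → ℤ} {l : ℕ} {s : Env}
    (h : Table Y n r T tab l s) {L : ℕ} (hL : L = r ^ Y.lam) (h12 : s.v 12 = L)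
    (h26 : s.v 26 = (Y.h * L : ℕ)) {W : ℤ} (h27 : s.v 27 = W)
    (h25 : s.v 25 = (Y.inst (Y.val r T tab) L W (T + k)).target) :
    (Y.entryCmd.sem s).v 30 =
      (initial ((exactWeight Y.H).input (Y.inst (Y.val r T tab) L W (T + k)))).mem (s.v 28) ∧
    Agree entryVars s (Y.entryCmd.sem s) ∧ Y.entryCmd.LoadsLe l s := by
  rw [initial_mem_graph]
  set I := Y.inst (Y.val r T tab) L W (T + k) with hI
  have hn : I.n = Y.h * L := rfl
  set x := s.v 28 with hx
  set s0 : Env := { s with v := Function.update s.v 30 0 } with hs0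
  have hA0 : Agree entryVars s s0 := (Agree.refl _ _).update (by decide) _
  have h030 : s0.v 30 = 0 := by simp [hs0]
  have c1 : 0 < (Expr.var 28 + 1).eval s0 ↔ 0 ≤ x := by
    simp only [Expr.eval_add, Expr.eval_var, Expr.eval_one, hA0.v 28 (by decide)]
    omega
  have c2 : 0 < (Expr.var 28).eval s0 ↔ 0 < x := by
    simp only [Expr.eval_var, hA0.v 28 (by decide), hx]
  have c3 : 0 < (Expr.var 28 - 1).eval s0 ↔ 1 < x := by
    simp only [Expr.eval_sub, Expr.eval_var, Expr.eval_one, hA0.v 28 (by decide)]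
    omega
  set s1 : Env := { s0 with v := Function.update s0.v 31 (x - 2) } with hs1
  have e1 : (Cmd.asg 31 (.var 28 - 2)).sem s0 = s1 := by
    simp only [Cmd.sem, Expr.eval_sub, Expr.eval_var, Expr.eval_ofNat, hA0.v 28 (by decide), hs1, hx]
  have hA1 : Agree entryVars s s1 := hA0.update (by decide) _
  have h131 : s1.v 31 = x - 2 := by simp [hs1]
  have c4 : 0 < (Expr.var 26 * .var 26 - .var 31).eval s1 ↔ x - 2 < (I.n * I.n : ℕ) := by
    simp only [Expr.eval_mul, Expr.eval_sub, Expr.eval_var, hA1.v 26 (by decide), h26, h131, hn]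
    push_cast
    omega
  set s2 : Env := { s1 with v := Function.update s1.v 31 (x - 2 - (I.n * I.n : ℕ)) } with hs2
  have e2 : (Cmd.asg 31 (.var 31 - .var 26 * .var 26)).sem s1 = s2 := by
    simp only [Cmd.sem, Expr.eval_sub, Expr.eval_mul, Expr.eval_var, hA1.v 26 (by decide), h26,
      h131, hs2, hn, Nat.cast_mul]
  have hA2 : Agree entryVars s s2 := hA1.update (by decide) _
  have h231 : s2.v 31 = x - 2 - (I.n * I.n : ℕ) := by simp [hs2]
  have c5 : 0 < (Expr.var 26 * .var 26 - .var 31).eval s2 ↔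
      x - 2 - (I.n * I.n : ℕ) < (I.n * I.n : ℕ) := by
    simp only [Expr.eval_mul, Expr.eval_sub, Expr.eval_var, hA2.v 26 (by decide), h26, h231, hn]
    push_cast
    omega
  have e0 : (Cmd.asg 30 0).sem s = s0 := rfl
  have hl : (Cmd.asg 30 0).LoadsLe l s := trivial
  have hd : ∀ i, 1 ≤ i → i ≤ 27 → i ∉ entryVars := by decide
  rw [entryCmd, Cmd.sem_andThen, Cmd.loadsLe_andThen, e0]
  rcases lt_or_ge x 0 with h0 | h0
  · rw [Cmd.sem_ifp_neg (by rw [c1]; omega), Cmd.loadsLe_ifp_neg (by rw [c1]; omega),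
      if_neg (by omega), if_neg (by omega), dif_neg (by omega), dif_neg (by omega)]
    exact ⟨h030, hA0, hl, by simp, trivial⟩
  rw [Cmd.sem_ifp_pos (by rw [c1]; omega), Cmd.loadsLe_ifp_pos (by rw [c1]; omega)]
  rcases h0.eq_or_lt with h0 | h0
  · rw [Cmd.sem_ifp_neg (by rw [c2]; omega), Cmd.loadsLe_ifp_neg (by rw [c2]; omega),
      if_pos h0.symm]
    refine ⟨?_, hA0.update (by decide) _, hl, by simp, trivial, trivial⟩
    simp only [Cmd.sem, Function.update_self, Expr.eval_var, hA0.v 26 (by decide), h26, hn]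
  rw [Cmd.sem_ifp_pos (by rw [c2]; omega), Cmd.loadsLe_ifp_pos (by rw [c2]; omega),
    if_neg (by omega)]
  rcases (show 1 ≤ x from h0).eq_or_lt with h1 | h1
  · rw [Cmd.sem_ifp_neg (by rw [c3]; omega), Cmd.loadsLe_ifp_neg (by rw [c3]; omega),
      if_pos h1.symm]
    refine ⟨?_, hA0.update (by decide) _, hl, by simp, trivial, by simp, trivial⟩
    simp only [Cmd.sem, Function.update_self, Expr.eval_var, hA0.v 25 (by decide), h25]
  rw [Cmd.sem_ifp_pos (by rw [c3]; omega), Cmd.loadsLe_ifp_pos (by rw [c3]; omega),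
    if_neg (by omega), Cmd.sem_andThen, Cmd.loadsLe_andThen, e1]
  have hsub : {32, 33, 34, 35, 36, 37, 38, 39, 40, 41, 42, 43} ⊆ entryVars := by decide
  by_cases h2 : x - 2 < (I.n * I.n : ℕ)
  · rw [Cmd.sem_ifp_pos (by rw [c4]; omega), Cmd.loadsLe_ifp_pos (by rw [c4]; omega),
      dif_pos ⟨h1, h2⟩, Cmd.sem_andThen, Cmd.loadsLe_andThen]
    have hp : (x - 2).toNat < I.n * I.n := by omega
    obtain ⟨m1, m2, m3, m4⟩ := matrixCmd_spec (W := W) (p := ⟨(x - 2).toNat, hp⟩)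
      (h.congr hA1 (by decide)) hL (by rw [hA1.v 12 (by decide), h12])
      (by rw [hA1.v 26 (by decide), h26]) (by rw [h131]; exact (Int.toNat_of_nonneg (by omega)).symm)
      (by rw [hA1.v 27 (by decide), h27])
    refine ⟨?_, (hA1.trans m1 subset_rfl hsub).update (by decide) _, hl, by simp, by simp, by simp,
      by simp [Cmd.LoadsLe], by simp, m4, trivial⟩
    simp only [Cmd.sem, Function.update_self, Expr.eval_var, m2]
    rfl
  · rw [Cmd.sem_ifp_neg (by rw [c4]; omega), Cmd.loadsLe_ifp_neg (by rw [c4]; omega),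
      dif_neg (fun h => h2 h.2), Cmd.sem_andThen, Cmd.loadsLe_andThen, e2]
    by_cases h3 : x - 2 - (I.n * I.n : ℕ) < (I.n * I.n : ℕ)
    · rw [Cmd.sem_ifp_pos (by rw [c5]; omega), Cmd.loadsLe_ifp_pos (by rw [c5]; omega),
        dif_pos ⟨by omega, h3⟩, Cmd.sem_andThen, Cmd.loadsLe_andThen]
      have hp : (x - 2 - (I.n * I.n : ℕ)).toNat < I.n * I.n := by omega
      obtain ⟨m1, m2, m3, m4⟩ := matrixCmd_spec (W := W)
        (p := ⟨(x - 2 - (I.n * I.n : ℕ)).toNat, hp⟩)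
        (h.congr hA2 (by decide)) hL (by rw [hA2.v 12 (by decide), h12])
        (by rw [hA2.v 26 (by decide), h26])
        (by rw [h231]; exact (Int.toNat_of_nonneg (by omega)).symm)
        (by rw [hA2.v 27 (by decide), h27])
      refine ⟨?_, (hA2.trans m1 subset_rfl hsub).update (by decide) _, hl, by simp, by simp, by simp,
        by simp [Cmd.LoadsLe], by simp, by simp [Cmd.LoadsLe], by simp, m4, by simp [Cmd.LoadsLe]⟩
      simp only [Cmd.sem, Function.update_self, Expr.eval_var, Expr.eval_mul, m3]
      rfl
    · rw [Cmd.sem_ifp_neg (by rw [c5]; omega), Cmd.loadsLe_ifp_neg (by rw [c5]; omega),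
        dif_neg (fun h => h3 h.2)]
      refine ⟨?_, hA2, hl, by simp, by simp, by simp, by simp [Cmd.LoadsLe], by simp,
        by simp [Cmd.LoadsLe], by simp, trivial⟩
      simp only [Cmd.sem, hs2, hs1]
      rw [Function.update_of_ne (by decide), Function.update_of_ne (by decide), h030]

end Layout

/-! ### Programs that work on short numbers -/

lemma Expr.in_univ (e : Expr) : e.In Finset.univ := by
  induction e with
  | var => exact Finset.mem_univ _
  | const => trivial
  | op o e f ihe ihf => exact ⟨ihe, ihf⟩
  | mem e ih => exact ih

lemma Cmd.in_univ (c : Cmd) : c.In Finset.univ := by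
  induction c with
  | nop => trivial
  | asg x e => exact ⟨Finset.mem_univ _, e.in_univ⟩
  | sto a e => exact ⟨a.in_univ, e.in_univ⟩
  | ifp e c d ihc ihd => exact ⟨e.in_univ, ihc, ihd⟩
  | seq c d ihc ihd => exact ⟨ihc, ihd⟩

/-- All variables have length at most `l`. -/
def Small (l : ℕ) (env : Env) : Prop := ∀ i, len (env.v i) ≤ l

lemma Small.one_le {l : ℕ} {env : Env} (h : Small l env) : 1 ≤ l := (one_le_len _).trans (h 0)

lemma Small.of_agree {l : ℕ} {env env' : Env} (h : Small l env) {S : Finset (Fin 64)}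
    (hA : Agree S env env') (hS : ∀ i ∈ S, len (env'.v i) ≤ l) : Small l env' := by
  intro i
  by_cases hi : i ∈ S
  · exact hS i hi
  · rw [hA.v i hi]; exact h i

lemma Small.cost {l : ℕ} {env : Env} (h : Small l env) {c : Cmd} (hc : c.LoadsLe l env) :
    c.cost env ≤ c.growth 1 * l :=
  (c.growth_spec h.one_le (fun i _ => by rw [one_mul]; exact h i) c.in_univ hc).1

lemma Small.cost_expr {l : ℕ} {env : Env} (h : Small l env) {e : Expr} (he : e.LoadsLe l env) :
    len (e.eval env) ≤ e.growth 1 * l ∧ e.cost env ≤ e.growth 1 * l :=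
  e.growth_spec h.one_le (fun i (_ : i ∈ Finset.univ) => by rw [one_mul]; exact h i) e.in_univ he

lemma ok_cmd {fuel l t : ℕ} {c : Cmd} {s : State} {env : Env} {o : ℕ → ℤ} (h : At s env o t)
    (hs : Small l env) (hc : c.LoadsLe l env) :
    Ok fuel c.comp s fun s' => At s' (c.sem env) o (t + c.growth 1 * l) :=
  (c.ok_comp fuel h).mono fun _ hs' => hs'.mono (Nat.add_le_add_left (hs.cost hc) _)

/-- The cost of a round of a loop, divided by the length of the numbers. -/
def roundCost (e : Expr) (c : Cmd) : ℕ := 2 * e.growth 1 + c.growth 1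

/-- When the number of rounds is known and the states are explicit iterates, no invariant has to be
invented; all conditions concern `c.sem^[j] env`. -/
lemma ok_iterate {fuel l t J : ℕ} {e : Expr} {c : Cmd} {s : State} {env : Env} {o : ℕ → ℤ}
    (h : At s env o t) (hJ : J ≤ fuel) (hpos : ∀ j < J, 0 < e.eval (c.sem^[j] env))
    (hend : e.eval (c.sem^[J] env) ≤ 0) (hs : ∀ j ≤ J, Small l (c.sem^[j] env))
    (he : ∀ j ≤ J, e.LoadsLe l (c.sem^[j] env)) (hc : ∀ j < J, c.LoadsLe l (c.sem^[j] env)) :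
    Ok fuel (wh e c.comp) s fun s' =>
      At s' (c.sem^[J] env) o (t + (J + 1) * (roundCost e c * l)) := by
  refine (ok_wh (fun i env' => i ≤ J ∧ env' = c.sem^[J - i] env) (κ := roundCost e c * l) h hJ ⟨le_rfl, by simp⟩ ?_ ?_
    ?_).mono ?_
  · rintro i env' hi ⟨-, rfl⟩ hp
    refine ⟨hi.le, ?_⟩
    rw [show J - i = (J - (i + 1)) + 1 by omega, Function.iterate_succ_apply']
  · rintro env' ⟨-, rfl⟩
    exact hend
  · rintro i env' - ⟨hi, rfl⟩
    have h1 := (hs (J - i) (by omega)).cost_expr (he (J - i) (by omega))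
    have h2 : roundCost e c * l = e.growth 1 * l + e.growth 1 * l + c.growth 1 * l := by
      unfold roundCost; ring
    refine ⟨by omega, fun hp => ?_⟩
    rcases Nat.eq_zero_or_pos i with rfl | hi0
    · exact absurd hp (not_lt.mpr hend)
    · have h3 := (hs (J - i) (by omega)).cost (hc (J - i) (by omega))
      omega
  · rintro s' ⟨i, env', ⟨hi, rfl⟩, hle, hs'⟩
    rcases Nat.eq_zero_or_pos i with rfl | hi0
    · exact hs'
    · exact absurd (hpos (J - i) (by omega)) (not_lt.mpr hle)

/-- Powers of expressions. -/
def Expr.pow (e : Expr) : ℕ → Expr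
  | 0 => 1
  | n + 1 => e.pow n * e

@[simp] lemma Expr.eval_pow (e : Expr) (n : ℕ) (s : Env) : (e.pow n).eval s = e.eval s ^ n := by
  induction n with
  | zero => simp [Expr.pow]
  | succ n ih => rw [Expr.pow, eval_mul, ih, pow_succ]

@[simp] lemma Expr.loadsLe_pow (e : Expr) (n l : ℕ) (s : Env) (h : e.LoadsLe l s) :
    (e.pow n).LoadsLe l s := by
  induction n with
  | zero => trivial
  | succ n ih => exact ⟨ih, h⟩

/-! ### The sum of the squares of the input numbers -/

/-- One plus the sum of the squares of the memory cells `1, …, K`. -/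
def sqSum (m : ℤ → ℤ) (K : ℕ) : ℕ := 1 + ∑ j ∈ Finset.range K, (m (K - j)).natAbs ^ 2

def sqInit (k : ℕ) : Cmd := .asg 1 (.mem 0) >> .asg 19 (.const k * .var 1) >> .asg 2 1

def sqBody : Cmd := .asg 2 (.var 2 + .mem (.var 19) * .mem (.var 19)) >> .asg 19 (.var 19 - 1)

lemma sqBody_iterate (env : Env) (j : ℕ) : Agree {2, 19} env (sqBody.sem^[j] env) ∧
    (sqBody.sem^[j] env).v 19 = env.v 19 - j ∧
    (sqBody.sem^[j] env).v 2 = env.v 2 + ∑ i ∈ Finset.range j, env.m (env.v 19 - i) ^ 2 := by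
  induction j with
  | zero => simp [Agree.refl]
  | succ j ih =>
    obtain ⟨h1, h2, h3⟩ := ih
    rw [Function.iterate_succ_apply']
    generalize sqBody.sem^[j] env = e at *
    simp only [sqBody, Cmd.sem_andThen, Cmd.sem, Expr.eval_add, Expr.eval_mul, Expr.eval_sub,
      Expr.eval_mem, Expr.eval_var, Expr.eval_one, Function.update_apply, reduceIte,
      Fin.reduceEq] at h2 h3 ⊢
    refine ⟨(h1.update (x := 2) (by decide) _).update (x := 19) (by decide) _, ?_, ?_⟩
    · rw [h2]; push_cast; ring
    · rw [Finset.sum_range_succ, h3, h2, h1.m]; ring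

/-- The sum of squares bounds every input number in absolute value without any case distinction, and
its length is only a constant factor and a logarithm above that of the longest number. The partial
sums increase, so the final length bounds all of them. -/
lemma ok_sq {fuel l t k n : ℕ} {s : State} {env : Env} {o : ℕ → ℤ} (h : At s env o t)
    (hs : Small l env) (hfuel : k * n ≤ fuel) (hn : env.m 0 = n) (hnl : len n ≤ l)
    (hkn : len (k * n : ℕ) ≤ l) (hX : len (sqSum env.m (k * n)) ≤ l)
    (hm : ∀ z : ℤ, 1 ≤ z → z ≤ (k * n : ℕ) → len (env.m z) ≤ l) :
    Ok fuel (.seq (sqInit k).comp (wh (.var 19) sqBody.comp)) s fun s' => ∃ env',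
      At s' env' o (t + ((sqInit k).growth 1 * l + (k * n + 1) * (roundCost (.var 19) sqBody * l)))
      ∧ Agree {1, 2, 19} env env' ∧ Small l env' ∧ env'.v 1 = n ∧ env'.v 2 = sqSum env.m (k * n) ∧
      env'.v 19 = 0 := by
  set env1 := (sqInit k).sem env with henv1
  have hA1 : Agree {1, 2, 19} env env1 := by
    simp only [henv1, sqInit, Cmd.sem_andThen, Cmd.sem]
    exact (((Agree.refl _ _).update (x := 1) (by decide) _).update (x := 19) (by decide) _).update
      (x := 2) (by decide) _
  have hv : env1.v 1 = n ∧ env1.v 19 = (k * n : ℕ) ∧ env1.v 2 = 1 := by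
    simp only [henv1, sqInit, Cmd.sem_andThen, Cmd.sem, Expr.eval_mul, Expr.eval_const,
      Expr.eval_mem, Expr.eval_zero, Expr.eval_one, Expr.eval_var, Function.update_apply, reduceIte,
      Fin.reduceEq, hn]
    simp
  obtain ⟨v1, v19, v2⟩ := hv
  have hit := sqBody_iterate env1
  simp only [v19, v2, hA1.m] at hit
  have hpart : ∀ j ≤ k * n, ((1 : ℤ) + ∑ i ∈ Finset.range j, env.m ((k * n : ℕ) - i) ^ 2).natAbs ≤
      (sqSum env.m (k * n) : ℤ).natAbs := by
    intro j hj
    have e1 : (1 : ℤ) + ∑ i ∈ Finset.range j, env.m ((k * n : ℕ) - i) ^ 2 =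
        ((1 + ∑ i ∈ Finset.range j, (env.m ((k * n : ℕ) - i)).natAbs ^ 2 : ℕ) : ℤ) := by
      push_cast; simp
    rw [e1, Int.natAbs_natCast, Int.natAbs_natCast, sqSum]
    gcongr
  have hsm : ∀ j ≤ k * n, Small l (sqBody.sem^[j] env1) := by
    intro j hj
    refine hs.of_agree (hA1.trans (hit j).1 (S'' := {1, 2, 19}) (by decide) (by decide)) ?_
    simp only [Finset.mem_insert, Finset.mem_singleton]
    rintro i (rfl | rfl | rfl)
    · rw [(hit j).1.v 1 (by decide), v1]; exact hnl
    · rw [(hit j).2.2]; exact (len_le_of_natAbs_le (hpart j hj)).trans hX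
    · rw [(hit j).2.1]; exact (len_le_of_natAbs_le (by omega)).trans hkn
  refine Ok.seq (ok_cmd h hs (by simpa [sqInit, Cmd.loadsLe_andThen, Cmd.LoadsLe, hn] using hnl))
    fun s1 hs1 => ?_
  rw [← henv1] at hs1
  refine (ok_iterate (J := k * n) (l := l) hs1 hfuel ?_ ?_ hsm ?_ ?_).mono ?_
  · intro j hj
    rw [Expr.eval_var, (hit j).2.1]
    omega
  · rw [Expr.eval_var, (hit _).2.1]
    omega
  · simp
  · intro j hj
    have h3 : len ((sqBody.sem^[j] env1).m ((sqBody.sem^[j] env1).v 19)) ≤ l := by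
      rw [(hit j).2.1, (hit j).1.m, hA1.m]
      exact hm _ (by omega) (by omega)
    generalize sqBody.sem^[j] env1 = e at h3 ⊢
    simp only [sqBody, Cmd.loadsLe_andThen, Cmd.LoadsLe, Expr.loadsLe_add, Expr.loadsLe_mul,
      Expr.loadsLe_mem, Expr.loadsLe_sub, Expr.loadsLe_var, Expr.loadsLe_one, Expr.eval_var, h3,
      and_self]
  · intro s' hs'
    refine ⟨_, hs'.mono (by omega), hA1.trans (hit _).1 (by decide) (by decide), hsm _ le_rfl,
      ?_, ?_, ?_⟩
    · rw [(hit _).1.v 1 (by decide), v1]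
    · rw [(hit _).2.2, sqSum]; push_cast; simp
    · rw [(hit _).2.1, sub_self]

/-! ### A bound for the input numbers -/

lemma exists_lt_two_pow_four_pow (X : ℕ) : ∃ j, X < 2 ^ 4 ^ j :=
  ⟨X, Nat.lt_two_pow_self.trans_le (Nat.pow_le_pow_right (by norm_num)
    (Nat.lt_pow_self (by norm_num)).le)⟩

/-- The number of rounds until a power of two greater than `X` is reached. -/
def rounds (X : ℕ) : ℕ := Nat.find (exists_lt_two_pow_four_pow X)

/-- The length of a block of random bits. -/
def blockLen (X : ℕ) : ℕ := 2 ^ rounds X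

/-- The exponents `4 ^ j` are tried because they are squares: the bits of the resulting bound can be
drawn as `blockLen X` blocks of `blockLen X` bits. -/
lemma lt_two_pow_blockLen (X : ℕ) : X < 2 ^ (blockLen X * blockLen X) := by
  have := Nat.find_spec (exists_lt_two_pow_four_pow X)
  rwa [show 4 ^ Nat.find (exists_lt_two_pow_four_pow X) = blockLen X * blockLen X by
    rw [blockLen, ← mul_pow, rounds]; norm_num] at this

def boundInit : Cmd := .asg 3 2 >> .asg 4 2 >> .asg 5 1

/-- A fourth power, a square and a doubling keep the values `2 ^ 4 ^ j`, `2 ^ 2 ^ j` and `2 ^ j` in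
step, so the bound, the base for a block and the block length are found in one loop. -/
def boundBody : Cmd := .asg 3 (.var 3 * .var 3 * (.var 3 * .var 3)) >> .asg 4 (.var 4 * .var 4) >>
  .asg 5 (.var 5 + .var 5)

def boundGuard : Expr := .var 2 - .var 3 + 1

lemma boundBody_iterate {env : Env} (h3 : env.v 3 = 2) (h4 : env.v 4 = 2) (h5 : env.v 5 = 1)
    (j : ℕ) : Agree {3, 4, 5} env (boundBody.sem^[j] env) ∧
    (boundBody.sem^[j] env).v 3 = (2 ^ 4 ^ j : ℕ) ∧ (boundBody.sem^[j] env).v 4 = (2 ^ 2 ^ j : ℕ) ∧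
    (boundBody.sem^[j] env).v 5 = (2 ^ j : ℕ) := by
  induction j with
  | zero => simp [Agree.refl, h3, h4, h5]
  | succ j ih =>
    obtain ⟨h1, h2, h3, h4⟩ := ih
    rw [Function.iterate_succ_apply']
    generalize boundBody.sem^[j] env = e at *
    simp only [boundBody, Cmd.sem_andThen, Cmd.sem, Expr.eval_add, Expr.eval_mul,
      Expr.eval_var, Function.update_apply, reduceIte, Fin.reduceEq] at h2 h3 h4 ⊢
    refine ⟨((h1.update (x := 3) (by decide) _).update (x := 4) (by decide) _).update
      (x := 5) (by decide) _, ?_, ?_, ?_⟩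
    · rw [h2, pow_succ, pow_mul]; push_cast; ring
    · rw [h3, pow_succ, pow_mul]; push_cast; ring
    · rw [h4, pow_succ]; push_cast; ring

lemma ok_bound {fuel l t X : ℕ} {s : State} {env : Env} {o : ℕ → ℤ} (h : At s env o t)
    (hs : Small l env) (hX : env.v 2 = X) (hfuel : rounds X ≤ fuel)
    (hl : blockLen X * blockLen X + 2 ≤ l) :
    Ok fuel (.seq boundInit.comp (wh boundGuard boundBody.comp)) s fun s' => ∃ env',
      At s' env' o (t + (boundInit.growth 1 * l +
        (rounds X + 1) * (roundCost boundGuard boundBody * l)))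
      ∧ Agree {3, 4, 5} env env' ∧ Small l env' ∧
      env'.v 3 = (2 ^ (blockLen X * blockLen X) : ℕ) ∧
      env'.v 4 = (2 ^ blockLen X : ℕ) ∧ env'.v 5 = blockLen X := by
  set env1 := boundInit.sem env with henv1
  have hA1 : Agree {3, 4, 5} env env1 := by
    simp only [henv1, boundInit, Cmd.sem_andThen, Cmd.sem]
    exact (((Agree.refl _ _).update (x := 3) (by decide) _).update (x := 4) (by decide) _).update
      (x := 5) (by decide) _
  have hv : env1.v 3 = 2 ∧ env1.v 4 = 2 ∧ env1.v 5 = 1 := by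
    simp only [henv1, boundInit, Cmd.sem_andThen, Cmd.sem, Expr.eval_ofNat, Expr.eval_one,
      Function.update_apply, reduceIte, Fin.reduceEq]
    simp
  have hit := boundBody_iterate hv.1 hv.2.1 hv.2.2
  have hb : 4 ^ rounds X = blockLen X * blockLen X := by rw [blockLen, ← mul_pow]; norm_num
  have h2le : ∀ j, 2 ^ j ≤ 4 ^ j := fun j => Nat.pow_le_pow_left (by norm_num) _
  have hsm : ∀ j ≤ rounds X, Small l (boundBody.sem^[j] env1) := by
    intro j hj
    have h4 : 4 ^ j ≤ blockLen X * blockLen X := by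
      rw [← hb]; exact Nat.pow_le_pow_right (by norm_num) hj
    have hle : ∀ z : ℕ, z ≤ 2 ^ 4 ^ j → len z ≤ l := fun z hz =>
      (len_le_of_lt_two_pow (c := 4 ^ j + 1) (by positivity) (by
        have : z < 2 ^ (4 ^ j + 1) := by
          rw [pow_succ]; have : 0 < 2 ^ 4 ^ j := by positivity
          omega
        exact_mod_cast this)).trans (by omega)
    refine hs.of_agree (hA1.trans (hit j).1 (S'' := {3, 4, 5}) (by decide) (by decide)) ?_
    simp only [Finset.mem_insert, Finset.mem_singleton]
    rintro i (rfl | rfl | rfl)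
    · rw [(hit j).2.1]; exact hle _ le_rfl
    · rw [(hit j).2.2.1]; exact hle _ (Nat.pow_le_pow_right (by norm_num) (h2le j))
    · rw [(hit j).2.2.2]; exact hle _ (((h2le j).trans Nat.lt_two_pow_self.le))
  have h2' : ∀ j, (boundBody.sem^[j] env1).v 2 = X := fun j => by
    rw [(hit j).1.v 2 (by decide), hA1.v 2 (by decide), hX]
  refine Ok.seq (ok_cmd h hs (by simp [boundInit, Cmd.loadsLe_andThen, Cmd.LoadsLe]))
    fun s1 hs1 => ?_
  rw [← henv1] at hs1
  refine (ok_iterate (J := rounds X) (l := l) hs1 hfuel ?_ ?_ hsm ?_ ?_).mono ?_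
  · intro j hj
    have := Nat.find_min (exists_lt_two_pow_four_pow X) hj
    simp only [boundGuard, Expr.eval_add, Expr.eval_sub, Expr.eval_var, Expr.eval_one, (hit j).2.1,
      h2']
    omega
  · have := Nat.find_spec (exists_lt_two_pow_four_pow X)
    simp only [boundGuard, Expr.eval_add, Expr.eval_sub, Expr.eval_var, Expr.eval_one,
      (hit _).2.1, h2']
    unfold rounds at *
    omega
  · simp [boundGuard]
  · simp [boundBody, Cmd.loadsLe_andThen, Cmd.LoadsLe]
  · intro s' hs'
    refine ⟨_, hs'.mono (by omega), hA1.trans (hit _).1 (by decide) (by decide), hsm _ le_rfl,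
      ?_, ?_, (hit _).2.2.2⟩
    · rw [(hit _).2.1, hb]
    · rw [(hit _).2.2.1]; rfl

/-! ### Search for powers of two -/

lemma len_le_of_le_two_pow {z c l : ℕ} (h : z ≤ 2 ^ c) (hl : c + 2 ≤ l) : len z ≤ l :=
  (len_le_of_lt_two_pow (c := c + 1) (by positivity) (by
    have : z < 2 ^ (c + 1) := by
      rw [pow_succ]; have : 0 < 2 ^ c := by positivity
      omega
    exact_mod_cast this)).trans (by omega)

/-- Double `x`, and count in `y`. -/
def doubleBody (x y : Fin 64) : Cmd := .asg x (.var x + .var x) >> .asg y (.var y + 1)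

lemma doubleBody_iterate {x y : Fin 64} (hxy : x ≠ y) (env : Env) (j : ℕ) :
    Agree {x, y} env ((doubleBody x y).sem^[j] env) ∧
    ((doubleBody x y).sem^[j] env).v x = env.v x * 2 ^ j ∧
    ((doubleBody x y).sem^[j] env).v y = env.v y + j := by
  induction j with
  | zero => simp [Agree.refl]
  | succ j ih =>
    obtain ⟨h1, h2, h3⟩ := ih
    rw [Function.iterate_succ_apply']
    generalize (doubleBody x y).sem^[j] env = e at *
    simp only [doubleBody, Cmd.sem_andThen, Cmd.sem, Expr.eval_add, Expr.eval_var, Expr.eval_one,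
      Function.update_self, Function.update_of_ne hxy, Function.update_of_ne hxy.symm] at h2 h3 ⊢
    refine ⟨(h1.update (x := x) (by simp) _).update (x := y) (by simp) _, ?_, ?_⟩
    · rw [h2, pow_succ]; ring
    · rw [h3]; push_cast; ring

lemma ok_double {fuel l t J : ℕ} {x y : Fin 64} (hxy : x ≠ y) {e : Expr} {s : State} {env : Env}
    {o : ℕ → ℤ} (h : At s env o t) (hs : Small l env) (hx : env.v x = 1) (hy : env.v y = 0)
    (hfuel : J ≤ fuel) (hl : J + 2 ≤ l) (heval : ∀ j ≤ J, ∀ env', Agree {x, y} env env' →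
      env'.v x = (2 ^ j : ℕ) → e.LoadsLe l env' ∧ (0 < e.eval env' ↔ j < J)) :
    Ok fuel (wh e (doubleBody x y).comp) s fun s' => ∃ env',
      At s' env' o (t + (J + 1) * (roundCost e (doubleBody x y) * l)) ∧ Agree {x, y} env env' ∧
      Small l env' ∧ env'.v x = (2 ^ J : ℕ) ∧ env'.v y = J := by
  have hit : ∀ j, Agree {x, y} env ((doubleBody x y).sem^[j] env) ∧
      ((doubleBody x y).sem^[j] env).v x = (2 ^ j : ℕ) ∧
      ((doubleBody x y).sem^[j] env).v y = j := by
    intro j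
    have := doubleBody_iterate hxy env j
    rw [hx, hy] at this
    refine ⟨this.1, this.2.1.trans ?_, this.2.2.trans ?_⟩
    · push_cast; ring
    · ring
  have hsm : ∀ j ≤ J, Small l ((doubleBody x y).sem^[j] env) := by
    intro j hj
    refine hs.of_agree (hit j).1 ?_
    simp only [Finset.mem_insert, Finset.mem_singleton]
    rintro i (rfl | rfl)
    · rw [(hit j).2.1]; exact len_le_of_le_two_pow le_rfl (by omega)
    · rw [(hit j).2.2]; exact len_le_of_le_two_pow (Nat.lt_two_pow_self (n := j)).le (by omega)
  refine (ok_iterate (J := J) (l := l) h hfuel (fun j hj => ?_) ?_ hsm (fun j hj => ?_)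
    (fun j hj => ?_)).mono ?_
  · exact (heval j hj.le _ (hit j).1 (hit j).2.1).2.mpr hj
  · exact not_lt.mp fun hp => absurd ((heval J le_rfl _ (hit J).1 (hit J).2.1).2.mp hp) (lt_irrefl _)
  · exact (heval j hj _ (hit j).1 (hit j).2.1).1
  · simp [doubleBody, Cmd.loadsLe_andThen, Cmd.LoadsLe]
  · intro s' hs'
    exact ⟨_, hs', (hit _).1, hsm _ le_rfl, (hit _).2⟩

/-- The logarithm of the order of magnitude of the size of an instance. -/
def logSize (n X : ℕ) : ℕ := Nat.clog 2 ((n + 1) * (blockLen X * blockLen X + 1))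

def sizeInit : Cmd := .asg 6 ((.var 1 + 1) * (.var 5 * .var 5 + 1)) >> .asg 8 1 >> .asg 7 0

def sizeGuard : Expr := .var 6 - .var 8

lemma ok_size {fuel l t n X : ℕ} {s : State} {env : Env} {o : ℕ → ℤ} (h : At s env o t)
    (hs : Small l env) (h1 : env.v 1 = n) (h5 : env.v 5 = blockLen X) (hfuel : logSize n X ≤ fuel)
    (hl : logSize n X + 2 ≤ l) :
    Ok fuel (.seq sizeInit.comp (wh sizeGuard (doubleBody 8 7).comp)) s fun s' => ∃ env',
      At s' env' o (t + (sizeInit.growth 1 * l +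
        (logSize n X + 1) * (roundCost sizeGuard (doubleBody 8 7) * l)))
      ∧ Agree {6, 7, 8} env env' ∧ Small l env' ∧
      env'.v 8 = (2 ^ logSize n X : ℕ) ∧ env'.v 7 = logSize n X := by
  set env1 := sizeInit.sem env with henv1
  have hA1 : Agree {6, 7, 8} env env1 := by
    simp only [henv1, sizeInit, Cmd.sem_andThen, Cmd.sem]
    exact (((Agree.refl _ _).update (x := 6) (by decide) _).update (x := 8) (by decide) _).update
      (x := 7) (by decide) _
  set NN := (n + 1) * (blockLen X * blockLen X + 1) with hNN
  have hv : env1.v 6 = NN ∧ env1.v 8 = 1 ∧ env1.v 7 = 0 := by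
    simp only [henv1, sizeInit, Cmd.sem_andThen, Cmd.sem, Expr.eval_add, Expr.eval_mul,
      Expr.eval_var, Expr.eval_one, Expr.eval_zero, Function.update_apply, reduceIte, Fin.reduceEq,
      h1, h5, hNN]
    simp
  have hNle : NN ≤ 2 ^ logSize n X := Nat.le_pow_clog (by norm_num) _
  have hs1 : Small l env1 := by
    refine hs.of_agree hA1 ?_
    simp only [Finset.mem_insert, Finset.mem_singleton]
    rintro i (rfl | rfl | rfl)
    · rw [hv.1]; exact len_le_of_le_two_pow hNle hl
    · rw [hv.2.2, len_zero]; omega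
    · rw [hv.2.1, len_one]; omega
  refine Ok.seq (ok_cmd h hs (by simp [sizeInit, Cmd.loadsLe_andThen, Cmd.LoadsLe]))
    fun s1 hs1' => ?_
  rw [← henv1] at hs1'
  refine (ok_double (by decide) hs1' hs1 hv.2.1 hv.2.2 hfuel hl ?_).mono ?_
  · intro j hj env' hA' h8
    refine ⟨by simp [sizeGuard], ?_⟩
    simp only [sizeGuard, Expr.eval_sub, Expr.eval_var, h8, hA'.v 6 (by decide), hv.1, logSize]
    rw [Nat.lt_clog_iff_pow_lt (by norm_num)]
    omega
  · rintro s' ⟨env', a1, a2, a3, a4, a5⟩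
    exact ⟨env', a1.mono (by omega), hA1.trans a2 (by decide) (by decide), a3, a4, a5⟩

namespace Layout
variable {k : ℕ} (Y : Layout k)

lemma exists_le_pow (m : ℕ) : ∃ e, m ≤ (2 ^ e) ^ Y.kap :=
  ⟨m, Nat.lt_two_pow_self.le.trans (Nat.le_self_pow Y.kap_pos.ne' _)⟩

/-- The logarithm of the number of nodes, up to the factor `lam`. -/
def expo (n X : ℕ) : ℕ := Nat.find (Y.exists_le_pow (n * logSize n X))

def expoInit : Cmd := .asg 9 1 >> .asg 10 0

def expoGuard : Expr := .var 1 * .var 7 - (Expr.var 9).pow Y.kap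

lemma ok_expo {fuel l t n X : ℕ} {s : State} {env : Env} {o : ℕ → ℤ} (h : At s env o t)
    (hs : Small l env) (h1 : env.v 1 = n) (h7 : env.v 7 = logSize n X) (hfuel : Y.expo n X ≤ fuel)
    (hl : Y.expo n X + 2 ≤ l) :
    Ok fuel (.seq expoInit.comp (wh Y.expoGuard (doubleBody 9 10).comp)) s fun s' => ∃ env',
      At s' env' o (t + (expoInit.growth 1 * l +
        (Y.expo n X + 1) * (roundCost Y.expoGuard (doubleBody 9 10) * l)))
      ∧ Agree {9, 10} env env' ∧ Small l env' ∧
      env'.v 9 = (2 ^ Y.expo n X : ℕ) ∧ env'.v 10 = Y.expo n X := by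
  set env1 := expoInit.sem env with henv1
  have hA1 : Agree {9, 10} env env1 := by
    simp only [henv1, expoInit, Cmd.sem_andThen, Cmd.sem]
    exact ((Agree.refl _ _).update (x := 9) (by decide) _).update (x := 10) (by decide) _
  have hv : env1.v 9 = 1 ∧ env1.v 10 = 0 := by
    simp only [henv1, expoInit, Cmd.sem_andThen, Cmd.sem, Expr.eval_one, Expr.eval_zero,
      Function.update_apply, reduceIte, Fin.reduceEq]
    simp
  have hs1 : Small l env1 := by
    refine hs.of_agree hA1 ?_
    simp only [Finset.mem_insert, Finset.mem_singleton]
    rintro i (rfl | rfl)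
    · rw [hv.1, len_one]; omega
    · rw [hv.2, len_zero]; omega
  refine Ok.seq (ok_cmd h hs (by simp [expoInit, Cmd.loadsLe_andThen, Cmd.LoadsLe]))
    fun s1 hs1' => ?_
  rw [← henv1] at hs1'
  refine (ok_double (by decide) hs1' hs1 hv.1 hv.2 hfuel hl ?_).mono ?_
  · intro j hj env' hA' h9
    refine ⟨by simp [expoGuard], ?_⟩
    simp only [expoGuard, Expr.eval_sub, Expr.eval_mul, Expr.eval_pow, Expr.eval_var, h9,
      hA'.v 1 (by decide), hA'.v 7 (by decide), hA1.v 1 (by decide), hA1.v 7 (by decide), h1, h7]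
    have e1 : 0 < (n : ℤ) * logSize n X - ((2 ^ j : ℕ) : ℤ) ^ Y.kap ↔
        ¬ n * logSize n X ≤ (2 ^ j) ^ Y.kap := by
      push_cast
      rw [not_le, sub_pos]
      exact_mod_cast Iff.rfl
    rw [e1]
    constructor
    · intro h
      by_contra hc
      obtain rfl : j = Y.expo n X := by omega
      exact h (Nat.find_spec (Y.exists_le_pow (n * logSize n X)))
    · exact fun h => Nat.find_min (Y.exists_le_pow (n * logSize n X)) h
  · rintro s' ⟨env', a1, a2, a3, a4, a5⟩
    exact ⟨env', a1.mono (by omega), hA1.trans a2 (by decide) (by decide), a3, a4, a5⟩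

/-- The range of the hash function. -/
def range (n X : ℕ) : ℕ := 2 ^ (Y.kap * Y.expo n X + (k + 1) * logSize n X)

def rangeCmd : Cmd := .asg 11 ((Expr.var 9).pow Y.kap) >> .asg 12 ((Expr.var 9).pow Y.lam) >>
  .asg 13 (.var 11 * (Expr.var 8).pow (k + 1)) >>
  .asg 15 (.const Y.kap * .var 10 + .const (k + 1) * .var 7)

lemma rangeCmd_spec {l n X : ℕ} {env : Env} (hs : Small l env)
    (h7 : env.v 7 = logSize n X) (h8 : env.v 8 = (2 ^ logSize n X : ℕ))
    (h9 : env.v 9 = (2 ^ Y.expo n X : ℕ)) (h10 : env.v 10 = Y.expo n X)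
    (hl : Y.kap * Y.expo n X + Y.lam * Y.expo n X + (k + 1) * logSize n X + 2 ≤ l) :
    Agree {11, 12, 13, 15} env (Y.rangeCmd.sem env) ∧ Small l (Y.rangeCmd.sem env) ∧
    (Y.rangeCmd.sem env).v 11 = ((2 ^ Y.expo n X) ^ Y.kap : ℕ) ∧
    (Y.rangeCmd.sem env).v 12 = ((2 ^ Y.expo n X) ^ Y.lam : ℕ) ∧
    (Y.rangeCmd.sem env).v 13 = Y.range n X ∧
    (Y.rangeCmd.sem env).v 15 = (Y.kap * Y.expo n X + (k + 1) * logSize n X : ℕ) ∧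
    Y.rangeCmd.LoadsLe l env := by
  have hA : Agree {11, 12, 13, 15} env (Y.rangeCmd.sem env) := by
    simp only [rangeCmd, Cmd.sem_andThen, Cmd.sem]
    exact ((((Agree.refl _ _).update (x := 11) (by decide) _).update (x := 12) (by decide) _).update
      (x := 13) (by decide) _).update (x := 15) (by decide) _
  have hv : (Y.rangeCmd.sem env).v 11 = ((2 ^ Y.expo n X) ^ Y.kap : ℕ) ∧
      (Y.rangeCmd.sem env).v 12 = ((2 ^ Y.expo n X) ^ Y.lam : ℕ) ∧
      (Y.rangeCmd.sem env).v 13 = Y.range n X ∧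
      (Y.rangeCmd.sem env).v 15 = (Y.kap * Y.expo n X + (k + 1) * logSize n X : ℕ) := by
    simp only [rangeCmd, Cmd.sem_andThen, Cmd.sem, Expr.eval_add, Expr.eval_mul, Expr.eval_pow,
      Expr.eval_const, Expr.eval_var, Function.update_apply, reduceIte, Fin.reduceEq, h7, h8, h9,
      h10, range]
    refine ⟨by push_cast; rfl, by push_cast; rfl, ?_, by push_cast; rfl⟩
    push_cast
    ring
  refine ⟨hA, hs.of_agree hA ?_, hv.1, hv.2.1, hv.2.2.1, hv.2.2.2, by
    simp [rangeCmd, Cmd.loadsLe_andThen, Cmd.LoadsLe]⟩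
  simp only [Finset.mem_insert, Finset.mem_singleton]
  rintro i (rfl | rfl | rfl | rfl)
  · rw [hv.1, ← pow_mul, mul_comm]; exact len_le_of_le_two_pow le_rfl (by omega)
  · rw [hv.2.1, ← pow_mul, mul_comm]; exact len_le_of_le_two_pow le_rfl (by omega)
  · rw [hv.2.2.1]; exact len_le_of_le_two_pow le_rfl (by omega)
  · rw [hv.2.2.2]; exact len_le_of_le_two_pow Nat.lt_two_pow_self.le (by omega)

end Layout

/-! ### The hash tables -/

/-- Enter the input number with the address in variable `19` in the table of its list. -/
def fillBody (k : ℕ) : Cmd :=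
  .asg 20 (.var 14 * .mem (.var 19)) >>
  .asg 20 ((.var 20 - .var 20 / (.var 13 * .var 3) * (.var 13 * .var 3)) / .var 3) >>
  .sto (.const k * .var 1 + 1 + (.var 19 - 1) / .var 1 * .var 11 +
    (.var 20 - .var 20 / .var 11 * .var 11)) (.var 20 + 1) >>
  .asg 19 (.var 19 - 1)

/-- The address of cell `c` of the table of list `i`. -/
def tableAddr (k n C : ℕ) (i c : ℤ) : ℤ := k * n + 1 + i * C + c

lemma tableAddr_inj {k n C : ℕ} {i i' c c' : ℤ} (hc : 0 ≤ c ∧ c < C) (hc' : 0 ≤ c' ∧ c' < C)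
    (h : tableAddr k n C i c = tableAddr k n C i' c') : i = i' ∧ c = c' := by
  have h1 : i * C + c = i' * C + c' := by unfold tableAddr at h; linarith
  have h2 : ∀ j d : ℤ, 0 ≤ d ∧ d < C → (j * C + d) / C = j := by
    intro j d hd
    rw [add_comm, Int.add_mul_ediv_right _ _ (by omega), Int.ediv_eq_zero_of_lt hd.1 hd.2, zero_add]
  have h3 : i = i' := by rw [← h2 i c hc, h1, h2 i' c' hc']
  subst h3
  exact ⟨rfl, by linarith⟩

lemma tableAddr_bounds {k n C : ℕ} {i c : ℤ} (hi : 0 ≤ i ∧ i < k) (hc : 0 ≤ c ∧ c < C) :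
    (k * n : ℕ) + 1 ≤ tableAddr k n C i c ∧ tableAddr k n C i c < (k * n : ℕ) + 1 + k * C := by
  unfold tableAddr
  push_cast
  constructor <;> nlinarith

/-- The hash tables contain the input numbers with addresses from `A`. -/
structure Filled (k n : ℕ) (m0 : ℤ → ℤ) (M D C : ℕ) (a : ℤ) (A : Set ℤ) (m : ℤ → ℤ) : Prop where
  out : ∀ z : ℤ, z < (k * n : ℕ) + 1 ∨ (k * n : ℕ) + 1 + k * C ≤ z → m z = m0 z
  -- Nothing is said about which number occupies a cell: later entries overwrite earlier ones, and
  -- the losses are harmless only for good multipliers.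
  entry : ∀ i c : ℤ, 0 ≤ i ∧ i < k → 0 ≤ c ∧ c < C → m (tableAddr k n C i c) ≠ 0 →
    ∃ z ∈ A, (z - 1) / n = i ∧ hash M D a (m0 z) % C = c ∧
      m (tableAddr k n C i c) = hash M D a (m0 z) + 1
  mem : ∀ z ∈ A, m (tableAddr k n C ((z - 1) / n) (hash M D a (m0 z) % C)) ≠ 0

lemma fillBody_sem {k n M D C : ℕ} {a : ℤ} {m0 : ℤ → ℤ} {env : Env} (h1 : env.v 1 = n)
    (h3 : env.v 3 = D) (h11 : env.v 11 = C) (h13 : env.v 13 = M) (h14 : env.v 14 = a)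
    (hm : env.m (env.v 19) = m0 (env.v 19)) :
    (∀ i, i ∉ ({19, 20} : Finset (Fin 64)) → ((fillBody k).sem env).v i = env.v i) ∧
    ((fillBody k).sem env).v 19 = env.v 19 - 1 ∧
    ((fillBody k).sem env).v 20 = hash M D a (m0 (env.v 19)) ∧
    ((fillBody k).sem env).m = Function.update env.m (tableAddr k n C ((env.v 19 - 1) / n)
      (hash M D a (m0 (env.v 19)) % C)) (hash M D a (m0 (env.v 19)) + 1) := by
  have hh : ∀ p q : ℤ, p - p / q * q = p % q := fun p q => by rw [Int.emod_def]; ring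
  simp only [fillBody, Cmd.sem_andThen, Cmd.sem, Expr.eval_add, Expr.eval_mul, Expr.eval_sub,
    Expr.eval_div, Expr.eval_mem, Expr.eval_const, Expr.eval_var, Expr.eval_one,
    Function.update_apply, reduceIte, Fin.reduceEq, h1, h3, h11, h13, h14, hm, hh]
  refine ⟨fun i hi => ?_, trivial, ?_, ?_⟩
  · simp only [Finset.mem_insert, Finset.mem_singleton, not_or] at hi
    simp [hi]
  · rw [hash, Nat.cast_mul]
  · rw [hash, Nat.cast_mul, tableAddr]

lemma Filled.step {k n M D C : ℕ} {a : ℤ} {m0 m : ℤ → ℤ} {A : Set ℤ} (hD : 0 < D) (hM : 0 < M)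
    (hC : 0 < C) (h : Filled k n m0 M D C a A m) {z : ℤ} (hz : 1 ≤ z ∧ z ≤ (k * n : ℕ)) :
    Filled k n m0 M D C a (insert z A) (Function.update m (tableAddr k n C ((z - 1) / n)
      (hash M D a (m0 z) % C)) (hash M D a (m0 z) + 1)) := by
  have hn : (0 : ℤ) < n := by
    rcases Nat.eq_zero_or_pos n with rfl | h
    · simp at hz; omega
    · exact_mod_cast h
  have hz' : 0 ≤ (z - 1) / n ∧ (z - 1) / n < k := by
    refine ⟨Int.ediv_nonneg (by omega) hn.le, Int.ediv_lt_of_lt_mul hn ?_⟩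
    have := hz.2
    push_cast at this
    omega
  have hCz : (0 : ℤ) < C := by exact_mod_cast hC
  have hmod : ∀ y : ℤ, 0 ≤ y % C ∧ y % C < C := fun y =>
    ⟨Int.emod_nonneg _ hCz.ne', Int.emod_lt_of_pos _ hCz⟩
  have hnn := hash_nonneg (a := a) hD hM (m0 z)
  constructor
  · intro w hw
    have := tableAddr_bounds (n := n) hz' (hmod (hash M D a (m0 z)))
    rw [Function.update_of_ne (by omega), h.out w hw]
  · intro i c hi hc hne
    by_cases he : tableAddr k n C i c = tableAddr k n C ((z - 1) / n) (hash M D a (m0 z) % C)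
    · obtain ⟨rfl, rfl⟩ := tableAddr_inj hc (hmod _) he
      exact ⟨z, Set.mem_insert _ _, rfl, rfl, Function.update_self ..⟩
    · rw [Function.update_of_ne he] at hne ⊢
      obtain ⟨w, hw, h1⟩ := h.entry i c hi hc hne
      exact ⟨w, Set.mem_insert_of_mem _ hw, h1⟩
  · intro w hw
    rw [Function.update_apply]
    split_ifs with he
    · omega
    · rcases hw with rfl | hw
      · exact absurd rfl he
      · exact h.mem w hw

lemma ok_fill {fuel l t k n M D C : ℕ} {a : ℤ} (hD : 0 < D) (hM : 0 < M) (hC : 0 < C) {s : State}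
    {env : Env} {o : ℕ → ℤ} (h : At s env o t) (hs : Small l env) (hfuel : k * n ≤ fuel)
    (h1 : env.v 1 = n) (h3 : env.v 3 = D) (h11 : env.v 11 = C) (h13 : env.v 13 = M)
    (h14 : env.v 14 = a) (h19 : env.v 19 = (k * n : ℕ))
    (hm : ∀ z : ℤ, 1 ≤ z → z ≤ (k * n : ℕ) → len (env.m z) ≤ l)
    (hzero : ∀ z : ℤ, (k * n : ℕ) + 1 ≤ z → env.m z = 0) :
    Ok fuel (wh (.var 19) (fillBody k).comp) s fun s' => ∃ env',
      At s' env' o (t + (k * n + 1) * (roundCost (.var 19) (fillBody k) * l)) ∧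
      (∀ i, i ∉ ({19, 20} : Finset (Fin 64)) → env'.v i = env.v i) ∧ Small l env' ∧
      Filled k n env.m M D C a (Set.Icc 1 (k * n : ℕ)) env'.m := by
  have hCz : (0 : ℤ) < C := by exact_mod_cast hC
  have hit : ∀ j ≤ k * n, (∀ i, i ∉ ({19, 20} : Finset (Fin 64)) →
        ((fillBody k).sem^[j] env).v i = env.v i) ∧
      ((fillBody k).sem^[j] env).v 19 = (k * n : ℕ) - j ∧
      len (((fillBody k).sem^[j] env).v 20) ≤ l ∧
      Filled k n env.m M D C a (Set.Ioc ((k * n : ℕ) - j : ℤ) (k * n : ℕ))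
        ((fillBody k).sem^[j] env).m := by
    intro j hj
    induction j with
    | zero =>
      refine ⟨fun _ _ => rfl, by simpa using h19, hs 20, fun _ _ => rfl, fun i c hi hc hne => ?_,
        fun z hz => ?_⟩
      · exact absurd (hzero _ (tableAddr_bounds hi hc).1) hne
      · simp at hz
    | succ j ih =>
      obtain ⟨p1, p2, p3, p4⟩ := ih (by omega)
      rw [Function.iterate_succ_apply']
      generalize (fillBody k).sem^[j] env = e at *
      have hr : ∀ i, i ∉ ({19, 20} : Finset (Fin 64)) → e.v i = env.v i := p1
      obtain ⟨q1, q2, q3, q4⟩ := fillBody_sem (k := k) (m0 := env.m) ((hr 1 (by decide)).trans h1)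
        ((hr 3 (by decide)).trans h3) ((hr 11 (by decide)).trans h11)
        ((hr 13 (by decide)).trans h13) ((hr 14 (by decide)).trans h14)
        (p4.out _ (by rw [p2]; omega))
      refine ⟨fun i hi => (q1 i hi).trans (p1 i hi), ?_, ?_, ?_⟩
      · rw [q2, p2]; push_cast; ring
      · rw [q3]
        have hlM : len (env.v 13) ≤ l := hs 13
        have u1 := hash_nonneg (a := a) hD hM (env.m (e.v 19))
        have u2 := hash_lt (a := a) hD hM (env.m (e.v 19))
        exact (len_le_of_natAbs_le (by rw [h13]; omega)).trans hlM
      · rw [q4]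
        have := p4.step hD hM hC (z := e.v 19) (by rw [p2]; omega)
        convert this using 1
        ext z
        simp only [Set.mem_Ioc, Set.mem_insert_iff, p2]
        push_cast
        constructor
        · rintro ⟨u1, u2⟩
          by_cases hz : z = k * n - j
          · exact Or.inl hz
          · right; constructor <;> omega
        · rintro (rfl | ⟨u1, u2⟩)
          · constructor <;> omega
          · constructor <;> omega
  have hsm : ∀ j ≤ k * n, Small l ((fillBody k).sem^[j] env) := by
    intro j hj i
    obtain ⟨p1, p2, p3, p4⟩ := hit j hj
    by_cases hi : i ∈ ({19, 20} : Finset (Fin 64))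
    · simp only [Finset.mem_insert, Finset.mem_singleton] at hi
      rcases hi with rfl | rfl
      · have := hs 19
        rw [p2]
        rw [h19] at this
        exact (len_le_of_natAbs_le (by omega)).trans this
      · exact p3
    · rw [p1 i hi]; exact hs i
  refine (ok_iterate (J := k * n) (l := l) h hfuel ?_ ?_ hsm ?_ ?_).mono ?_
  · intro j hj
    rw [Expr.eval_var, (hit j hj.le).2.1]
    omega
  · rw [Expr.eval_var, (hit _ le_rfl).2.1]
    omega
  · simp
  · intro j hj
    have h3 : len (((fillBody k).sem^[j] env).m (((fillBody k).sem^[j] env).v 19)) ≤ l := by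
      rw [(hit j hj.le).2.1, (hit j hj.le).2.2.2.out _ (by omega)]
      exact hm _ (by omega) (by omega)
    generalize (fillBody k).sem^[j] env = e at h3 ⊢
    simp only [fillBody, Cmd.loadsLe_andThen, Cmd.LoadsLe, Expr.loadsLe_add, Expr.loadsLe_mul,
      Expr.loadsLe_mem, Expr.loadsLe_sub, Expr.loadsLe_div, Expr.loadsLe_var, Expr.loadsLe_one,
      Expr.loadsLe_const, Expr.eval_var, h3, and_self]
  · intro s' hs'
    obtain ⟨p1, p2, p3, p4⟩ := hit (k * n) le_rfl
    refine ⟨_, hs', p1, hsm _ le_rfl, ?_⟩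
    convert p4 using 1
    ext z
    simp only [Set.mem_Ioc, Set.mem_Icc]
    omega

/-! ### Correctness of the hash tables -/

/-- The entries of `tab` are the hash values of the input numbers, plus one. -/
structure TabSpec {k n : ℕ} (x : Fin k → Fin n → ℤ) (M D C : ℕ) (a : ℤ) (tab : Fin k → ℤ → ℤ) :
    Prop where
  entry : ∀ i c, tab i c ≠ 0 → ∃ j, hash M D a (x i j) % C = c ∧ tab i c = hash M D a (x i j) + 1
  mem : ∀ i j, tab i (hash M D a (x i j) % C) ≠ 0

/-- The tables in the memory `m`. -/
def tableOf (k n C : ℕ) (m : ℤ → ℤ) (i : Fin k) (c : ℤ) : ℤ :=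
  if 0 ≤ c ∧ c < C then m (tableAddr k n C (i : ℕ) c) else 0

lemma Filled.tabSpec {k n M D C : ℕ} {a : ℤ} {m0 m : ℤ → ℤ} {x : Fin k → Fin n → ℤ} (hC : 0 < C)
    (h : Filled k n m0 M D C a (Set.Icc 1 (k * n : ℕ)) m)
    (hx : ∀ (i : Fin k) (j : Fin n), m0 (1 + (i : ℕ) * n + (j : ℕ)) = x i j) :
    TabSpec x M D C a (tableOf k n C m) := by
  have hCz : (0 : ℤ) < C := by exact_mod_cast hC
  have hdiv : ∀ (i : Fin k) (j : Fin n),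
      ((1 + ((i : ℕ) : ℤ) * n + (j : ℕ)) - 1) / n = ((i : ℕ) : ℤ) := by
    intro i j
    rw [show (1 + ((i : ℕ) : ℤ) * n + (j : ℕ)) - 1 = (j : ℕ) + ((i : ℕ) : ℤ) * n by ring,
      Int.add_mul_ediv_right _ _ (by have := j.2; omega),
      Int.ediv_eq_zero_of_lt (by positivity) (by exact_mod_cast j.2), zero_add]
  constructor
  · intro i c hne
    unfold tableOf at hne ⊢
    split_ifs at hne ⊢ with hc
    · obtain ⟨z, hz, h1, h2, h3⟩ := h.entry (i : ℕ) c ⟨by positivity, by exact_mod_cast i.2⟩ hc hne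
      have hn : (0 : ℤ) < n := by
        rcases Nat.eq_zero_or_pos n with rfl | h
        · simp at hz
        · exact_mod_cast h
      have hj0 := Int.emod_nonneg (z - 1) hn.ne'
      have hj1 := Int.emod_lt_of_pos (z - 1) hn
      have hz' : z = 1 + ((i : ℕ) : ℤ) * n + (((z - 1) % n).toNat : ℕ) := by
        rw [Int.toNat_of_nonneg hj0, ← h1]
        have := Int.mul_ediv_add_emod (z - 1) n
        linarith [mul_comm (n : ℤ) ((z - 1) / n)]
      have := hx i ⟨((z - 1) % n).toNat, by omega⟩
      simp only [← hz'] at this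
      rw [this] at h2 h3
      exact ⟨_, h2, h3⟩
    · exact absurd rfl hne
  · intro i j
    have hz : (1 + ((i : ℕ) : ℤ) * n + (j : ℕ)) ∈ Set.Icc (1 : ℤ) (k * n : ℕ) := by
      refine ⟨by have : (0 : ℤ) ≤ ((i : ℕ) : ℤ) * n + (j : ℕ) := by positivity
                 linarith, ?_⟩
      have h1 : (i : ℕ) * n + (j : ℕ) + 1 ≤ k * n := by
        have := Nat.mul_le_mul_right n (Nat.succ_le_of_lt i.2)
        have := j.2
        rw [Nat.succ_mul] at *
        omega
      have : (((i : ℕ) * n + (j : ℕ) + 1 : ℕ) : ℤ) ≤ (k * n : ℕ) := by exact_mod_cast h1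
      push_cast at this ⊢
      linarith
    have := h.mem _ hz
    rw [hdiv, hx] at this
    rwa [tableOf, if_pos ⟨Int.emod_nonneg _ hCz.ne', Int.emod_lt_of_pos _ hCz⟩]

section TabSpec
variable {k n M D C : ℕ} {a : ℤ} {x : Fin k → Fin n → ℤ} {tab : Fin k → ℤ → ℤ}

lemma TabSpec.nonneg (h : TabSpec x M D C a tab) (hD : 0 < D) (hM : 0 < M) (i : Fin k) (c : ℤ) :
    0 ≤ tab i c := by
  by_contra hc
  obtain ⟨j, -, h2⟩ := h.entry i c (by omega)
  have := hash_nonneg (a := a) hD hM (x i j)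
  omega

lemma TabSpec.le (h : TabSpec x M D C a tab) (hD : 0 < D) (hM : 0 < M) (i : Fin k) (c : ℤ) :
    tab i c ≤ M := by
  by_contra hc
  obtain ⟨j, -, h2⟩ := h.entry i c (by omega)
  have := hash_lt (a := a) hD hM (x i j)
  omega

end TabSpec

/-! ### The queries: their relation to `k`-SUM and their size -/

namespace Layout
variable {k : ℕ} (Y : Layout k)

/-- A factor by which the weights of types exceed the other weights. -/
def typeFactor : ℕ := Fintype.card (Sym2 (Fin Y.h)) * (k * 2) + 3 * k + 1

/-- The instance for sum `T` of the hash values. -/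
noncomputable def query (M r : ℕ) (T : ℤ) (tab : Fin k → ℤ → ℤ) : GraphInstance :=
  -- Entries are hash values plus one, so that `0` can mark an empty cell; `k` of them add up to `T
  -- + k`.
  Y.inst (Y.val r T tab) (r ^ Y.lam) (Y.typeFactor * M : ℕ) (T + k)

/-- The sum of hash values that belongs to a pair of small numbers. -/
def sumOf (M : ℕ) (p : Fin k × Fin k) : ℤ := ((p.1 : ℕ) : ℤ) * M - ((p.2 : ℕ) : ℤ)

lemma abs_sumOf_le {M : ℕ} (hM : 0 < M) (p : Fin k × Fin k) : |sumOf M p + k| ≤ 3 * k * M := by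
  have h1 : ((p.1 : ℕ) : ℤ) + 1 ≤ k := by exact_mod_cast p.1.2
  have h2 : ((p.2 : ℕ) : ℤ) + 1 ≤ k := by exact_mod_cast p.2.2
  have hM' : (1 : ℤ) ≤ M := by exact_mod_cast hM
  have h3 : (0 : ℤ) ≤ ((p.1 : ℕ) : ℤ) := by positivity
  have h4 : (0 : ℤ) ≤ ((p.2 : ℕ) : ℤ) := by positivity
  have h5 : ((p.1 : ℕ) : ℤ) * M ≤ k * M := by nlinarith
  have h6 : (k : ℤ) ≤ k * M := by nlinarith
  have h7 : 0 ≤ ((p.1 : ℕ) : ℤ) * M := by positivity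
  unfold sumOf
  rw [abs_le]
  constructor <;> nlinarith

variable {Y} {n M D r : ℕ} {a : ℤ} {x : Fin k → Fin n → ℤ} {tab : Fin k → ℤ → ℤ}

lemma query_yes_iff (hD : 0 < D) (hM : 0 < M) (h : TabSpec x M D (r ^ Y.kap) a tab)
    (p : Fin k × Fin k) : (exactWeight Y.H).Yes (Y.query M r (sumOf M p) tab) ↔
      ∃ α : Fin Y.h → Fin (r ^ Y.lam),
        (∀ i, Y.val r (sumOf M p) tab i (α (Y.src i)) (α (Y.dst i)) ≠ 0) ∧
        ∑ i, Y.val r (sumOf M p) tab i (α (Y.src i)) (α (Y.dst i)) = sumOf M p + k := by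
  refine Pattern.inst_yes_iff (B := (M : ℤ)) (by positivity) ?_ ?_
  · intro i a b _ _
    rw [val, abs_of_nonneg (h.nonneg hD hM _ _)]
    exact h.le hD hM _ _
  · have h1 := abs_sumOf_le hM p
    have hM' : (1 : ℤ) ≤ M := by exact_mod_cast hM
    -- Entries are bounded by `M` and the target by `3 * k * M`, which is where the summands of
    -- `typeFactor` come from; the last `1` makes the inequality strict.
    rw [typeFactor]
    push_cast
    nlinarith

/-- For good multipliers, the queries give the answer. -/
lemma exists_query_yes_iff (hk : 0 < k) (hr : 0 < r) (hD : 0 < D) (hM : 0 < M)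
    (h : TabSpec x M D (r ^ Y.kap) a tab) (hgood : GoodMul x M D (r ^ Y.kap) a) :
    (∃ p : Fin k × Fin k, (exactWeight Y.H).Yes (Y.query M r (sumOf M p) tab)) ↔
      ∃ τ : Fin k → Fin n, ∑ i, x i (τ i) = 0 := by
  refine (exists_congr fun p => query_yes_iff hD hM h p).trans ?_
  constructor
  · rintro ⟨p, α, hα, hsum⟩
    choose τ h1 h2 using fun i => h.entry i _ (hα i)
    refine ⟨τ, hgood.1 τ p.1 p.2 ?_⟩
    have h2' : ∀ i, Y.val r (sumOf M p) tab i (α (Y.src i)) (α (Y.dst i)) =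
      hash M D a (x i (τ i)) + 1 := h2
    rw [Finset.sum_congr rfl fun i _ => h2' i, Finset.sum_add_distrib] at hsum
    simpa [sumOf] using hsum
  · intro hyes
    obtain ⟨τ, hτ, hno⟩ := hgood.2 hyes
    obtain ⟨d, c, hdc⟩ := sum_hash_of_sum_eq_zero (a := a) hD hM hk hτ
    have hC : (0 : ℤ) < (r ^ Y.kap : ℕ) := by exact_mod_cast Nat.pow_pos hr
    -- The exact equation for the hash values holds in particular modulo the number of cells, and
    -- this is all that the layout needs to realize the cells of the solution.
    obtain ⟨α, hα⟩ := Y.complete r (sumOf M (d, c))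
      (fun i => hash M D a (x i (τ i)) % (r ^ Y.kap : ℕ)) hr
      (fun i => ⟨Int.emod_nonneg _ hC.ne', Int.emod_lt_of_pos _ hC⟩) (by
        rw [sumOf, ← hdc]
        exact Int.ModEq.sum fun i _ => Int.mod_modEq _ _)
    have hv : ∀ i, Y.val r (sumOf M (d, c)) tab i (α (Y.src i)) (α (Y.dst i)) =
        hash M D a (x i (τ i)) + 1 := by
      intro i
      rw [val, hα]
      -- The cell may have been taken by another number of the list, but for a good multiplier this
      -- number has the same hash value.
      obtain ⟨j, h1, h2⟩ := h.entry i _ (h.mem i (τ i))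
      rw [h2, hno i j h1]
    refine ⟨(d, c), α, fun i => ?_, ?_⟩
    · rw [hv]
      have := hash_nonneg (a := a) hD hM (x i (τ i))
      omega
    · rw [Finset.sum_congr rfl fun i _ => hv i, Finset.sum_add_distrib, hdc]
      simp [sumOf]

variable (Y) in
/-- The sum of all type weights. -/
noncomputable def typeSum : ℕ := ∑ e : Sym2 (Fin Y.h), typeWeight e

variable (Y) in
/-- A constant in the lengths of the weights in a query. -/
noncomputable def lenConst : ℕ := k * 2 + 3 * k + Y.typeFactor * Y.typeSum

lemma typeWeight_le (e : Sym2 (Fin Y.h)) : typeWeight e ≤ Y.typeSum :=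
  Finset.single_le_sum (f := fun e : Sym2 (Fin Y.h) => typeWeight e) (fun _ _ => Nat.zero_le _)
    (Finset.mem_univ e)

lemma totalType_le : Y.totalType ≤ Y.typeSum :=
  Finset.sum_le_sum_of_subset (Finset.subset_univ _)

lemma one_le_totalType (hk : 0 < k) : 1 ≤ Y.totalType := by
  classical
  have he : s(Y.src ⟨0, hk⟩, Y.dst ⟨0, hk⟩) ∈ Y.H.edgeFinset := by simpa using Y.adj ⟨0, hk⟩
  calc 1 ≤ typeWeight s(Y.src ⟨0, hk⟩, Y.dst ⟨0, hk⟩) := Nat.one_le_pow _ _ (by omega)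
    _ ≤ Y.totalType := Finset.single_le_sum
      (f := fun e : Sym2 (Fin Y.h) => typeWeight e) (fun _ _ => Nat.zero_le _) he

lemma len_le_of_abs_le {z : ℤ} {K u : ℕ} (hM : 0 < M) (hu : M ≤ 2 ^ u) (hz : |z| ≤ K * M) :
    len z ≤ K + u + 1 := by
  rw [len_le_iff, pow_add]
  have h1 : z.natAbs ≤ K * M := by zify; exact hz
  exact h1.trans_lt ((Nat.mul_lt_mul_of_pos_right Nat.lt_two_pow_self hM).trans_le
    (Nat.mul_le_mul_left _ hu))

lemma abs_target_le (hM : 0 < M) (p : Fin k × Fin k) :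
    |(Y.query M r (sumOf M p) tab).target| ≤ (Y.lenConst : ℕ) * M := by
  have h1 := abs_sumOf_le hM p
  have h2 : Y.typeFactor * M * Y.totalType ≤ Y.typeFactor * M * Y.typeSum :=
    Nat.mul_le_mul_left _ totalType_le
  have h2' : ((Y.typeFactor * M * Y.totalType : ℕ) : ℤ) ≤ (Y.typeFactor * M * Y.typeSum : ℕ) := by
    exact_mod_cast h2
  have h3 : (0 : ℤ) ≤ k * M := by positivity
  calc |(Y.query M r (sumOf M p) tab).target|
      = |sumOf M p + k + (Y.typeFactor * M * Y.totalType : ℕ)| := by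
        rw [Nat.cast_mul]; rfl
    _ ≤ |sumOf M p + k| + |((Y.typeFactor * M * Y.totalType : ℕ) : ℤ)| := abs_add_le _ _
    _ ≤ 3 * k * M + (Y.typeFactor * M * Y.typeSum : ℕ) := by
        rw [abs_of_nonneg (by positivity : (0 : ℤ) ≤ (Y.typeFactor * M * Y.totalType : ℕ))]
        linarith
    _ ≤ _ := by
        rw [lenConst]
        push_cast
        nlinarith

/-- All weights are bounded by a constant times `M`, however long the original numbers are.
Therefore the size of a query is the number of nodes up to a factor logarithmic in `M`. -/
lemma query_size_le (hD : 0 < D) (hM : 0 < M) (h : TabSpec x M D (r ^ Y.kap) a tab)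
    (p : Fin k × Fin k) {u : ℕ} (hu : M ≤ 2 ^ u) :
    (exactWeight Y.H).size (Y.query M r (sumOf M p) tab) ≤
      Y.h * r ^ Y.lam * (Y.lenConst + u + 1) := by
  refine Nat.mul_le_mul le_rfl (max_le ?_ ?_)
  · exact len_le_of_abs_le hM hu (abs_target_le hM p)
  · refine Finset.sup_le fun i _ => Finset.sup_le fun j _ => len_le_of_abs_le hM hu ?_
    rw [GraphInstance.weightEntry]
    split_ifs
    · set i' : Fin (Y.h * r ^ Y.lam) := i
      set j' : Fin (Y.h * r ^ Y.lam) := j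
      have h1 := Pattern.abs_contrib_le (P := Y.toPattern) (val := Y.val r (sumOf M p) tab)
        (L := r ^ Y.lam) (B := (M : ℤ)) (by positivity) (fun i a b _ _ => by
          rw [val, abs_of_nonneg (h.nonneg hD hM _ _)]
          exact h.le hD hM _ _) i'.divNat j'.divNat i'.modNat.2 j'.modNat.2
      have h2 : Y.typeFactor * M * typeWeight s(i'.divNat, j'.divNat) ≤
          Y.typeFactor * M * Y.typeSum := Nat.mul_le_mul_left _ (typeWeight_le _)
      have h2' : ((Y.typeFactor * M * typeWeight s(i'.divNat, j'.divNat) : ℕ) : ℤ) ≤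
          (Y.typeFactor * M * Y.typeSum : ℕ) := by exact_mod_cast h2
      have h3 : (0 : ℤ) ≤ 3 * k * M := by positivity
      calc |(Y.query M r (sumOf M p) tab).weight s(i, j)|
          = |Y.contrib (Y.val r (sumOf M p) tab) i'.divNat j'.divNat i'.modNat j'.modNat +
              (Y.typeFactor * M * typeWeight s(i'.divNat, j'.divNat) : ℕ)| := by
            rw [Nat.cast_mul]; rfl
        _ ≤ _ := abs_add_le _ _
        _ ≤ k * (2 * M) + (Y.typeFactor * M * Y.typeSum : ℕ) := by
            refine add_le_add h1 ?_
            rwa [abs_of_nonneg (by positivity)]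
        _ ≤ _ := by
            rw [lenConst]
            push_cast
            nlinarith
    · rw [abs_zero]; positivity

/-- The error of the given algorithm vanishes only as the size grows, so queries must not be too
small. The type weights push the target to at least `M`, whose length is then a lower bound for the
size. -/
lemma le_query_size (hk : 0 < k) (hr : 0 < r) (hM : 0 < M) (p : Fin k × Fin k) {u : ℕ}
    (hu : 2 ^ u ≤ M) : u ≤ (exactWeight Y.H).size (Y.query M r (sumOf M p) tab) := by
  have h1 : u ≤ len (Y.query M r (sumOf M p) tab).target := by
    by_contra hcon
    obtain ⟨u, rfl⟩ : ∃ v, u = v + 1 := ⟨u - 1, by omega⟩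
    have h2 : len (Y.query M r (sumOf M p) tab).target ≤ u + 1 := by omega
    rw [len_le_iff] at h2
    have h3 : (2 : ℤ) ^ (u + 1) ≤ M := by exact_mod_cast hu
    have h4 : ((Y.query M r (sumOf M p) tab).target.natAbs : ℤ) < 2 ^ u := by exact_mod_cast h2
    have h5 : (2 : ℤ) ^ u ≤ 2 ^ (u + 1) := pow_le_pow_right₀ (by norm_num) (by omega)
    have h6 := abs_sumOf_le hM p
    have h7 : 3 * k + 1 ≤ Y.typeFactor * Y.totalType := by
      have := Nat.mul_le_mul_left Y.typeFactor (one_le_totalType (Y := Y) hk)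
      rw [mul_one] at this
      exact le_trans (by rw [typeFactor]; omega) this
    have h8 : (3 * (k : ℤ) + 1) * M ≤ Y.typeFactor * Y.totalType * M := by
      have h7' : 3 * (k : ℤ) + 1 ≤ Y.typeFactor * Y.totalType := by exact_mod_cast h7
      exact mul_le_mul_of_nonneg_right h7' (by positivity)
    have h9 : (Y.query M r (sumOf M p) tab).target =
        sumOf M p + k + (Y.typeFactor * M : ℕ) * Y.totalType := rfl
    rw [abs_le] at h6
    push_cast at h9
    have : (M : ℤ) ≤ (Y.query M r (sumOf M p) tab).target := by rw [h9]; nlinarith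
    omega
  have h2 : 1 ≤ Y.h * r ^ Y.lam := Nat.mul_pos (by have := (Y.src ⟨0, hk⟩).2; omega)
    (Nat.pow_pos hr)
  calc u ≤ 1 * len (Y.query M r (sumOf M p) tab).target := by rw [one_mul]; exact h1
    _ ≤ _ := Nat.mul_le_mul h2 (le_max_left _ _)

end Layout

/-! ### Registers that a program does not use, and the length of registers -/

/-- All registers to which a program writes are below this bound. -/
def Prog.regBound : Prog → ℕ
  | .skip => 0
  | .const r _ => r + 1
  | .arith _ r _ _ => r + 1
  | .load r _ => r + 1
  | .store _ _ => 0
  | .flip r => r + 1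
  | .seq c d => max c.regBound d.regBound
  | .ite _ c d => max c.regBound d.regBound
  | .while _ c => c.regBound

/-- The registers from `R` on are zero, and no register is longer than the running time allows. -/
structure Tame (R : ℕ) (s : State) : Prop where
  zero : ∀ r, R ≤ r → s.reg r = 0
  len_le : ∀ r, len (s.reg r) ≤ s.time + 2

lemma tame_initial (R : ℕ) (l : List ℤ) : Tame R (initial l) :=
  ⟨fun _ _ => rfl, fun _ => by simp [initial]⟩

lemma Tame.tick {R : ℕ} {s : State} (h : Tame R s) (t : ℕ) : Tame R (s.tick t) :=
  ⟨h.zero, fun r => (h.len_le r).trans (by simp [State.tick])⟩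

lemma Tame.set {R : ℕ} {s : State} (h : Tame R s) {r t : ℕ} {z : ℤ} (hr : r + 1 ≤ R)
    (hz : len z ≤ s.time + t + 2) : Tame R ((s.setReg r z).tick t) where
  zero r' hr' := by
    simp only [State.setReg, State.tick]
    rw [Function.update_of_ne (by omega), h.zero r' hr']
  len_le r' := by
    have := h.len_le r'
    simp only [State.setReg, State.tick]
    rcases eq_or_ne r' r with rfl | hne
    · rw [Function.update_self]; exact hz
    · rw [Function.update_of_ne hne]; omega

/-- Two facts about the simulated program are needed between queries: only finitely many registers
must be reset to restore its initial configuration, and its answer is short enough to be read within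
its own time bound. -/
lemma wp_tame (fuel : ℕ) (c : Prog) {R : ℕ} (hR : c.regBound ≤ R) {Φ Ψ : State → ℝ≥0∞}
    (h : ∀ s, Tame R s → Φ s ≤ Ψ s) {s : State} (hs : Tame R s) :
    wp fuel c Φ s ≤ wp fuel c Ψ s := by
  induction c generalizing Φ Ψ s with
  | skip =>
    rw [wp_skip, wp_skip]
    exact h _ (hs.tick 1)
  | const r z =>
    rw [wp_const, wp_const]
    exact h _ (hs.set hR (by omega))
  | arith o r a b =>
    rw [wp_arith, wp_arith]
    exact h _ (hs.set hR ((o.len_eval_le _ _).trans (by omega)))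
  | load r a =>
    rw [wp_load, wp_load]
    exact h _ (hs.set hR (by omega))
  | store a b =>
    rw [wp_store, wp_store]
    exact h _ ⟨hs.zero, fun r => (hs.len_le r).trans (by simp [State.setMem, State.tick])⟩
  | flip r =>
    rw [wp_flip, wp_flip]
    exact add_le_add (mul_le_mul_right (h _ (hs.set hR (by simp))) _)
      (mul_le_mul_right (h _ (hs.set hR (by simp))) _)
  | seq c d hc hd =>
    rw [wp_seq, wp_seq]
    exact hc ((le_max_left _ _).trans hR) (fun s hs => hd ((le_max_right _ _).trans hR) h hs) hs
  | ite r c d hc hd =>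
    rw [wp_ite, wp_ite]
    split_ifs
    · exact hc ((le_max_left _ _).trans hR) h (hs.tick _)
    · exact hd ((le_max_right _ _).trans hR) h (hs.tick _)
  | _ =>
    rename_i r c hc
    rw [wp_while, wp_while]
    have : ∀ n s, Tame R s → wpLoop fuel r c Φ n s ≤ wpLoop fuel r c Ψ n s := by
      intro n
      induction n with
      | zero =>
        intro s hs
        rw [wpLoop_zero, wpLoop_zero]
        split_ifs
        · exact le_rfl
        · exact h _ (hs.tick _)
      | succ n ih =>
        intro s hs
        rw [wpLoop_succ, wpLoop_succ]
        split_ifs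
        · exact hc hR ih (hs.tick _)
        · exact h _ (hs.tick _)
    exact this fuel s hs

/-- Set the first `R` odd registers to zero. -/
def resetOdd : ℕ → Prog
  | 0 => .skip
  | r + 1 => .seq (.const (2 * r + 1) 0) (resetOdd r)

lemma ok_resetOdd (fuel R : ℕ) {s : State} {env : Env} {o : ℕ → ℤ} {t : ℕ} (h : At s env o t) :
    Ok fuel (resetOdd R) s fun s' => At s' env (fun r => if r < R then 0 else o r) (t + (R + 1)) := by
  induction R generalizing s o t with
  | zero => exact Ok.skip (by simpa using h.tick 1)
  | succ R ih =>
    refine Ok.seq (Ok.const rfl) ?_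
    rintro s1 rfl
    refine (ih (h.setOdd R 0 (len 0))).mono fun s' hs' => ?_
    rw [len_zero] at hs'
    refine ⟨hs'.even, fun r => ?_, hs'.mem, hs'.time.trans (by omega)⟩
    rw [hs'.odd]
    rcases lt_trichotomy r R with hr | rfl | hr
    · simp [hr, hr.trans (Nat.lt_succ_self R)]
    · simp
    · rw [if_neg (by omega), if_neg (by omega), Function.update_of_ne (by omega)]

/-! ### Queries -/

namespace Layout
variable {k : ℕ} (Y : Layout k)

/-- Prepare the query for a pair of small numbers. -/
noncomputable def callCmd (p : Fin k × Fin k) : Cmd :=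
  .asg 23 (.var 23 + 1) >> .asg 24 (.const (p.1 : ℕ) * .var 13 - .const (p.2 : ℕ)) >>
  .asg 25 (.var 24 + .const k + .var 27 * .const Y.totalType)

/-- Evaluate the answer to a query. -/
def collect : Cmd := .ifp (.var 20 * .var 20) (.asg 0 1) .nop

/-- Ask one query. -/
noncomputable def call (c : Prog) (p : Fin k × Fin k) : Prog :=
  .seq (Y.callCmd p).comp (.seq (resetOdd c.regBound) (.seq (simulate Y.entryCmd c)
    (.seq (getOdd 20 0) collect.comp)))

/-- The variables and the memory before a query. -/
structure Ready (n r M l : ℕ) (tab : Fin k → ℤ → ℤ) (tag : ℕ) (env : Env) : Prop where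
  r_pos : 0 < r
  v1 : env.v 1 = n
  v9 : env.v 9 = r
  v11 : env.v 11 = (r ^ Y.kap : ℕ)
  v12 : env.v 12 = (r ^ Y.lam : ℕ)
  v13 : env.v 13 = M
  v21 : env.v 21 = (k * n + 1 + k * r ^ Y.kap : ℕ)
  v22 : env.v 22 = env.v 21 + 2
  v23 : env.v 23 = tag
  v26 : env.v 26 = (Y.h * r ^ Y.lam : ℕ)
  v27 : env.v 27 = (Y.typeFactor * M : ℕ)
  small : ∀ i ∈ simVars, i < 28 → len (env.v i) ≤ l
  mem : ∀ i (c : ℤ), 0 ≤ c → c < (r ^ Y.kap : ℕ) →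
    env.m (k * n + 1 + (i : Fin k) * (r ^ Y.kap : ℕ) + c) = tab i c
  tags : ∀ a, 0 ≤ env.m (a * env.v 22 + env.v 21 + 1) ∧ env.m (a * env.v 22 + env.v 21 + 1) ≤ tag
  v0 : env.v 0 = 0 ∨ env.v 0 = 1

/-- A constant in the cost of a query. -/
noncomputable def callCost (c : Prog) : ℕ :=
  (∑ p : Fin k × Fin k, (Y.callCmd p).growth 1) + c.regBound + (loadCmd Y.entryCmd).growth 1 +
    storeCmd.growth 1 + collect.growth 1 + 110

variable {Y}

lemma callCmd_spec {n r M l tag : ℕ} {tab : Fin k → ℤ → ℤ} {env : Env}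
    (h : Y.Ready n r M l tab tag env) (hM : 0 < M) (p : Fin k × Fin k) (htag : tag + 2 ≤ l)
    (hl : ∀ z : ℤ, |z| ≤ (Y.lenConst : ℕ) * M → len z ≤ l) :
    Agree {23, 24, 25} env ((Y.callCmd p).sem env) ∧ (Y.callCmd p).LoadsLe l env ∧
    (Y.callCmd p).cost env ≤ (Y.callCmd p).growth 1 * l ∧
    ((Y.callCmd p).sem env).v 23 = (tag + 1 : ℕ) ∧
    ((Y.callCmd p).sem env).v 24 = sumOf M p ∧
    ((Y.callCmd p).sem env).v 25 = (Y.query M r (sumOf M p) tab).target ∧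
    ∀ i ∈ simVars, i < 28 → len (((Y.callCmd p).sem env).v i) ≤ l := by
  have hA : Agree {23, 24, 25} env ((Y.callCmd p).sem env) := by
    simp only [callCmd, Cmd.sem_andThen, Cmd.sem]
    exact (((Agree.refl _ _).update (x := 23) (by decide) _).update (x := 24) (by decide) _).update
      (x := 25) (by decide) _
  have hv : ((Y.callCmd p).sem env).v 23 = (tag + 1 : ℕ) ∧
      ((Y.callCmd p).sem env).v 24 = sumOf M p ∧
      ((Y.callCmd p).sem env).v 25 = (Y.query M r (sumOf M p) tab).target := by
    have ht : (Y.query M r (sumOf M p) tab).target =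
        sumOf M p + k + (Y.typeFactor * M : ℕ) * Y.totalType := rfl
    simp only [callCmd, Cmd.sem_andThen, Cmd.sem, Expr.eval_add, Expr.eval_mul, Expr.eval_sub,
      Expr.eval_const, Expr.eval_one, Expr.eval_var, Function.update_apply, reduceIte, Fin.reduceEq,
      h.v23, h.v13, h.v27, ht]
    exact ⟨by push_cast; rfl, rfl, rfl⟩
  have hloads : (Y.callCmd p).LoadsLe l env := by
    simp [callCmd, Cmd.loadsLe_andThen, Cmd.LoadsLe]
  have hin : (Y.callCmd p).In (simVars.filter (· < 28)) := by
    simp only [callCmd, Cmd.in_andThen, Cmd.In, Expr.in_add, Expr.in_mul, Expr.in_sub,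
      Expr.in_var, Expr.in_const, Expr.in_one, and_true]
    decide
  have hl1 : 1 ≤ l := by omega
  refine ⟨hA, hloads, ((Y.callCmd p).growth_spec hl1 (fun i hi => ?_) hin hloads).1, hv.1, hv.2.1,
    hv.2.2, ?_⟩
  · rw [one_mul]
    exact h.small i (Finset.mem_filter.mp hi).1 (Finset.mem_filter.mp hi).2
  · intro i hi hi28
    by_cases hS : i ∈ ({23, 24, 25} : Finset (Fin 64))
    · simp only [Finset.mem_insert, Finset.mem_singleton] at hS
      rcases hS with rfl | rfl | rfl
      · rw [hv.1]
        exact len_le_of_le_two_pow (c := tag) Nat.lt_two_pow_self (by omega)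
      · rw [hv.2.1]
        refine hl _ ?_
        have h1 : ((p.1 : ℕ) : ℤ) + 1 ≤ k := by exact_mod_cast p.1.2
        have h2 : ((p.2 : ℕ) : ℤ) + 1 ≤ k := by exact_mod_cast p.2.2
        have hM' : (1 : ℤ) ≤ M := by exact_mod_cast hM
        have h3 : (0 : ℤ) ≤ ((p.1 : ℕ) : ℤ) := by positivity
        have h4 : (0 : ℤ) ≤ ((p.2 : ℕ) : ℤ) := by positivity
        have h5 : ((p.1 : ℕ) : ℤ) * M ≤ k * M := by nlinarith
        have h6 : (k : ℤ) ≤ k * M := by nlinarith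
        have h7 : 0 ≤ ((p.1 : ℕ) : ℤ) * M := by positivity
        have h8 : (0 : ℤ) ≤ (Y.typeFactor * Y.typeSum : ℕ) * M := by positivity
        rw [lenConst, sumOf, abs_le]
        push_cast at h8 ⊢
        constructor <;> nlinarith
      · rw [hv.2.2]
        exact hl _ (abs_target_le hM p)
    · rw [hA.v i hS]; exact h.small i hi hi28

/-- The data for the simulation of the program that answers a query. -/
noncomputable def simData {n r M l tag t0 : ℕ} {tab : Fin k → ℤ → ℤ} {env : Env}
    (h : Y.Ready n r M l tab tag env) (hM : 0 < M) (p : Fin k × Fin k) (htag : tag + 2 ≤ l)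
    (hl : ∀ z : ℤ, |z| ≤ (Y.lenConst : ℕ) * M → len z ≤ l) (htab : ∀ i c, 0 ≤ tab i c)
    (htab' : ∀ i c, len (tab i c) ≤ l) : SimData Y.entryCmd where
  v := ((Y.callCmd p).sem env).v
  m := env.m
  virt := (initial ((exactWeight Y.H).input (Y.query M r (sumOf M p) tab))).mem
  l := l
  t0 := t0
  one_le := by omega
  S_nonneg := by
    rw [(callCmd_spec h hM p htag hl).1.v 21 (by decide), h.v21]; positivity
  W_eq := by
    rw [(callCmd_spec h hM p htag hl).1.v 21 (by decide),
      (callCmd_spec h hM p htag hl).1.v 22 (by decide), h.v22]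
  tag_pos := by
    rw [(callCmd_spec h hM p htag hl).2.2.2.1]; positivity
  len_le := (callCmd_spec h hM p htag hl).2.2.2.2.2.2
  E_in := Y.entryCmd_in
  E_spec := by
    intro env' hv hm
    obtain ⟨hA, -, -, h23, h24, h25, -⟩ := callCmd_spec h hM p htag hl
    have hT : Table Y n r (sumOf M p) tab l env' := by
      refine ⟨?_, ?_, ?_, ?_, h.r_pos, ?_, htab, htab'⟩
      · rw [hv 1 (by decide), hA.v 1 (by decide), h.v1]
      · rw [hv 9 (by decide), hA.v 9 (by decide), h.v9]
      · rw [hv 11 (by decide), hA.v 11 (by decide), h.v11]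
      · rw [hv 24 (by decide), h24]
      · intro i c hc hc'
        rw [hm, h.mem i c hc hc']
        · positivity
        · rw [hA.v 21 (by decide), h.v21]
          have hi : ((i : ℕ) : ℤ) + 1 ≤ k := by exact_mod_cast i.2
          have := mul_le_mul_of_nonneg_right hi (by positivity : (0 : ℤ) ≤ (r ^ Y.kap : ℕ))
          push_cast at this hc' ⊢
          linarith
    obtain ⟨e1, e2, e3⟩ := entryCmd_spec hT rfl
      (by rw [hv 12 (by decide), hA.v 12 (by decide), h.v12])
      (by rw [hv 26 (by decide), hA.v 26 (by decide), h.v26])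
      (W := (Y.typeFactor * M : ℕ)) (by rw [hv 27 (by decide), hA.v 27 (by decide), h.v27])
      (by rw [hv 25 (by decide), h25]; rfl)
    have hlt : ∀ i : Fin 64, i < 28 → i ∉ entryVars := by decide
    exact ⟨e1, e2.m, fun i hi => e2.v i (hlt i hi), e3⟩

set_option maxHeartbeats 1000000 in
open Classical in
-- The hypothesis `hsol` is the given algorithm in the form supplied by `wp_le_of_solves`: value `v`
-- for right answers and `v + 1` for wrong ones give expectation `v + e`. Raising the tag makes the
-- simulated memory appear untouched, so the same tables serve every query.
lemma wp_call {fuel n r M l tag t T : ℕ} {tab : Fin k → ℤ → ℤ} {s : State} {env : Env}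
    {o : ℕ → ℤ} {c : Prog} {e : ℝ≥0∞} (hs : At s env o t) (h : Y.Ready n r M l tab tag env)
    (ho : ∀ r, c.regBound ≤ r → o r = 0) (hM : 0 < M) (p : Fin k × Fin k) (htag : tag + 2 ≤ l)
    (hl : ∀ z : ℤ, |z| ≤ (Y.lenConst : ℕ) * M → len z ≤ l) (htab : ∀ i c, 0 ≤ tab i c)
    (htab' : ∀ i c, len (tab i c) ≤ l) (hT : 1 ≤ T)
    (hsol : ∀ (Ψ : State → ℝ≥0∞) (v : ℝ≥0∞),
      (∀ s, s.time ≤ T → (s.Accepts ↔ (exactWeight Y.H).Yes (Y.query M r (sumOf M p) tab)) →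
        Ψ s ≤ v) → (∀ s, s.time ≤ T → Ψ s ≤ v + 1) →
      wp fuel c Ψ (initial ((exactWeight Y.H).input (Y.query M r (sumOf M p) tab))) ≤ v + e)
    {Φ : State → ℝ≥0∞} {v : ℝ≥0∞}
    (hgood : ∀ s' env' o', At s' env' o' (t + Y.callCost c * (l + 1) * T) →
      Y.Ready n r M l tab (tag + 1) env' → (∀ r, c.regBound ≤ r → o' r = 0) →
      (env'.v 0 = if (exactWeight Y.H).Yes (Y.query M r (sumOf M p) tab) then 1 else env.v 0) →
      Φ s' ≤ v)
    (hbad : ∀ s' env' o', At s' env' o' (t + Y.callCost c * (l + 1) * T) →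
      Y.Ready n r M l tab (tag + 1) env' → (∀ r, c.regBound ≤ r → o' r = 0) → Φ s' ≤ v + 1) :
    wp fuel (Y.call c p) Φ s ≤ v + e := by
  obtain ⟨hA, hloads, hcost, h23, h24, h25, hsm⟩ := callCmd_spec h hM p htag hl
  rw [call, wp_seq]
  refine (Y.callCmd p).ok_comp fuel hs _ _ fun s1 h1 => ?_
  rw [wp_seq]
  refine ok_resetOdd fuel c.regBound h1 _ _ fun s2 h2 => ?_
  have hz : (fun r => if r < c.regBound then 0 else o r) = fun _ => 0 := by
    funext r
    split_ifs with hr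
    · rfl
    · exact ho r (not_lt.mp hr)
  rw [hz] at h2
  set t0 := t + (Y.callCmd p).cost env + (c.regBound + 1) with ht0
  set D := simData (t0 := t0) h hM p htag hl htab htab' with hD
  set env1 := (Y.callCmd p).sem env with henv1
  set x := (exactWeight Y.H).input (Y.query M r (sumOf M p) tab) with hx
  have hDm : D.m = env.m := rfl
  have hD21 : D.v 21 = env.v 21 := hA.v 21 (by decide)
  have hD22 : D.v 22 = env.v 22 := hA.v 22 (by decide)
  have hD23 : D.v 23 = (tag + 1 : ℕ) := h23
  have haddr : ∀ a, D.addr a + 1 = a * env.v 22 + env.v 21 + 1 := fun a => by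
    rw [SimData.addr, hD21, hD22]
  have hrel : D.Rel (initial x) s2 := by
    refine ⟨env1, h2.mono ?_, fun _ _ => rfl, ?_⟩
    · exact le_of_eq (by simp [initial, hD, simData])
    · constructor
      · intro z _ _
        rw [hA.m, hDm]
      · intro a ha
        have := (h.tags a).2
        rw [haddr, hA.m, hD23] at ha
        push_cast at ha
        omega
      · intro a _
        rfl
      · intro a
        rw [haddr, hA.m]
        exact (h.tags a).1
      · intro a
        have := (h.tags a).2
        rw [haddr, hA.m, hD23]
        push_cast
        omega
  -- what follows the simulation
  set Φ' : State → ℝ≥0∞ := wp fuel (.seq (getOdd 20 0) collect.comp) Φ with hΦ'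
  -- The simulated state does not determine the real one, so the cost of the continuation is
  -- replaced by its worst value over all representing states.
  set Ψ : State → ℝ≥0∞ := fun s => ⨆ (s' : State) (_ : D.Rel s s'), Φ' s' with hΨ
  rw [wp_seq]
  have key : ∀ (s s' : State) (w : ℝ≥0∞), s.time ≤ T → Tame c.regBound s → D.Rel s s' →
      (∀ s' env' o', At s' env' o' (t + Y.callCost c * (l + 1) * T) →
        Y.Ready n r M l tab (tag + 1) env' → (∀ r, c.regBound ≤ r → o' r = 0) →
        (env'.v 0 = if s.Accepts then 1 else env.v 0) → Φ s' ≤ w) → Φ' s' ≤ w := by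
    intro s s' w htime htame hRel hw
    obtain ⟨env2, hat, hv2, hm2⟩ := hRel
    rw [hΦ']
    refine Ok.seq (Q' := fun s' => Φ s' ≤ w) (ok_getOdd fuel 20 0 hat) (fun s3 h3 => ?_) Φ w
      fun _ h => h
    set env3 : Env := { env2 with v := Function.update env2.v 20 (s.reg 0) } with henv3
    have h3v : ∀ i < 28, i ≠ 20 → env3.v i = env1.v i := fun i hi hne => by
      simp only [henv3]
      rw [Function.update_of_ne hne, hv2 i hi]
      rfl
    have h30 : env3.v 0 = env.v 0 := (h3v 0 (by decide) (by decide)).trans (hA.v 0 (by decide))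
    have h320 : env3.v 20 = s.reg 0 := by simp [henv3]
    have hv0len : len (env.v 0) ≤ 2 := by rcases h.v0 with h | h <;> simp [h]
    have hcol := (collect.growth_spec (S := {0, 20}) (K := 1) (l := T + 2) (s := env3) (by omega)
      (by
        intro i hi
        rw [one_mul]
        simp only [Finset.mem_insert, Finset.mem_singleton] at hi
        rcases hi with rfl | rfl
        · rw [h30]; omega
        · rw [h320]; exact (htame.len_le 0).trans (by omega))
      (by simp [collect, Cmd.In]) (by simp [collect, Cmd.LoadsLe])).1
    refine (collect.ok_comp fuel h3).mono fun s4 h4 => ?_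
    have hcsem : (collect.sem env3).m = env3.m ∧
        (∀ i ≠ 0, (collect.sem env3).v i = env3.v i) ∧
        (collect.sem env3).v 0 = if s.Accepts then 1 else env.v 0 := by
      have hpos : 0 < (Expr.var 20 * Expr.var 20).eval env3 ↔ s.Accepts := by
        simp only [Expr.eval_mul, Expr.eval_var, h320, State.Accepts]
        constructor
        · rintro hp h0
          rw [h0] at hp
          simp at hp
        · exact fun h0 => mul_self_pos.mpr h0
      simp only [collect, Cmd.sem, hpos]
      split_ifs
      · refine ⟨rfl, fun i hi => ?_, ?_⟩
        · simp only []
          rw [Function.update_of_ne hi]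
        · simp
      · exact ⟨rfl, fun _ _ => rfl, h30⟩
    obtain ⟨c1, c2, c3⟩ := hcsem
    have hfin : ∀ i < 28, i ≠ 20 → i ≠ 0 → (collect.sem env3).v i = env1.v i := fun i hi h1 h2 =>
      (c2 i h2).trans (h3v i hi h1)
    have hfin' : ∀ i < 28, i ≠ 20 → i ≠ 0 → i ∉ ({23, 24, 25} : Finset (Fin 64)) →
        (collect.sem env3).v i = env.v i := fun i hi h1 h2 h3 =>
      (hfin i hi h1 h2).trans (hA.v i h3)
    have hmem : (collect.sem env3).m = env2.m := c1
    refine hw s4 (collect.sem env3) s.reg (h4.mono ?_) ?_ htame.zero c3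
    · have hslow : D.slow * s.time ≤
          ((loadCmd Y.entryCmd).growth 1 + storeCmd.growth 1 + 100) * (l + 1) * T :=
        Nat.mul_le_mul_left _ htime
      have hlen0 : len (s.reg 0) ≤ T + 2 := (htame.len_le 0).trans (by omega)
      have hp : (Y.callCmd p).growth 1 ≤ ∑ p : Fin k × Fin k, (Y.callCmd p).growth 1 :=
        Finset.single_le_sum (f := fun p => (Y.callCmd p).growth 1) (fun _ _ => Nat.zero_le _)
          (Finset.mem_univ p)
      have hDt : D.t0 = t0 := rfl
      have e1 : (Y.callCmd p).cost env ≤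
          (∑ p : Fin k × Fin k, (Y.callCmd p).growth 1) * (l + 1) * T := by
        calc _ ≤ (Y.callCmd p).growth 1 * l := hcost
          _ ≤ (∑ p : Fin k × Fin k, (Y.callCmd p).growth 1) * (l + 1) := by gcongr; omega
          _ ≤ _ := Nat.le_mul_of_pos_right _ hT
      have hlT : T + 2 ≤ 3 * ((l + 1) * T) := by nlinarith
      have hlT' : 1 ≤ (l + 1) * T := Nat.mul_pos (by omega) hT
      have hlT2 : T + 2 ≤ (l + 1) * T := by nlinarith
      have e2 : collect.growth 1 * (T + 2) ≤ collect.growth 1 * ((l + 1) * T) :=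
        Nat.mul_le_mul_left _ hlT2
      have e3 : c.regBound ≤ c.regBound * ((l + 1) * T) := Nat.le_mul_of_pos_right _ hlT'
      rw [hDt, ht0, callCost, mul_assoc _ (l + 1) T]
      rw [mul_assoc _ (l + 1) T] at e1 hslow
      generalize (l + 1) * T = q at *
      simp only [add_mul] at hslow ⊢
      omega
    · have hm21 : (collect.sem env3).v 21 = env.v 21 :=
        hfin' 21 (by decide) (by decide) (by decide) (by decide)
      have hm22 : (collect.sem env3).v 22 = env.v 22 :=
        hfin' 22 (by decide) (by decide) (by decide) (by decide)
      refine ⟨h.r_pos, ?_, ?_, ?_, ?_, ?_, ?_, ?_, ?_, ?_, ?_, ?_, ?_, ?_, ?_⟩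
      · rw [hfin' 1 (by decide) (by decide) (by decide) (by decide), h.v1]
      · rw [hfin' 9 (by decide) (by decide) (by decide) (by decide), h.v9]
      · rw [hfin' 11 (by decide) (by decide) (by decide) (by decide), h.v11]
      · rw [hfin' 12 (by decide) (by decide) (by decide) (by decide), h.v12]
      · rw [hfin' 13 (by decide) (by decide) (by decide) (by decide), h.v13]
      · rw [hm21, h.v21]
      · rw [hm21, hm22, h.v22]
      · rw [hfin 23 (by decide) (by decide) (by decide), h23]
      · rw [hfin' 26 (by decide) (by decide) (by decide) (by decide), h.v26]
      · rw [hfin' 27 (by decide) (by decide) (by decide) (by decide), h.v27]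
      · intro i hi hi28
        have hne : i ≠ 20 ∧ i ≠ 0 := ⟨by rintro rfl; exact absurd hi (by decide),
          by rintro rfl; exact absurd hi (by decide)⟩
        rw [hfin i hi28 hne.1 hne.2]
        exact hsm i hi hi28
      · intro i z hz hz'
        rw [hmem, hm2.table, hDm, h.mem i z hz hz']
        · positivity
        · rw [hD21, h.v21]
          have hi : ((i : ℕ) : ℤ) + 1 ≤ k := by exact_mod_cast i.2
          have := mul_le_mul_of_nonneg_right hi (by positivity : (0 : ℤ) ≤ (r ^ Y.kap : ℕ))
          push_cast at this hz' ⊢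
          linarith
      · intro a
        rw [hm21, hm22, hmem, ← haddr]
        refine ⟨hm2.tag_nonneg a, (hm2.tag_le a).trans (le_of_eq hD23)⟩
      · rw [c3]
        split_ifs
        · exact Or.inr rfl
        · exact h.v0
  calc wp fuel (simulate Y.entryCmd c) Φ' s2
      ≤ wp fuel c Ψ (initial x) := D.wp_simulate fuel c
        (fun s s' hR => le_iSup₂ (f := fun (s' : State) (_ : D.Rel s s') => Φ' s') s' hR) hrel
    -- States that are not tame cannot be reached, so any value may be assigned to them.
    _ ≤ wp fuel c (fun s => if Tame c.regBound s then Ψ s else 0) (initial x) :=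
        wp_tame fuel c le_rfl (fun s hs => by rw [if_pos hs]) (tame_initial _ _)
    _ ≤ v + e := by
        refine hsol _ v (fun s htime hacc => ?_) fun s htime => ?_
        · split_ifs with htame
          · refine iSup₂_le fun s' hR => key s s' v htime htame hR ?_
            intro s' env' o' a1 a2 a3 a4
            refine hgood s' env' o' a1 a2 a3 (a4.trans ?_)
            simp only [hacc]
          · exact zero_le
        · split_ifs with htame
          · refine iSup₂_le fun s' hR => key s s' _ htime htame hR ?_
            intro s' env' o' a1 a2 a3 _
            exact hbad s' env' o' a1 a2 a3
          · exact zero_le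

end Layout

namespace Layout
variable {k : ℕ} (Y : Layout k)

/-- Ask several queries. -/
noncomputable def calls (c : Prog) (ps : List (Fin k × Fin k)) : Prog :=
  ps.foldr (fun p q => .seq (Y.call c p) q) .skip

variable {Y}

/-- This is the union bound: every query contributes `e`, and variable `0` collects the disjunction
of the answers. -/
lemma wp_calls {fuel n r M l T : ℕ} {tab : Fin k → ℤ → ℤ} {c : Prog} {e : ℝ≥0∞} (hM : 0 < M)
    (hl : ∀ z : ℤ, |z| ≤ (Y.lenConst : ℕ) * M → len z ≤ l) (htab : ∀ i c, 0 ≤ tab i c)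
    (htab' : ∀ i c, len (tab i c) ≤ l) (hT : 1 ≤ T)
    (hsol : ∀ (p : Fin k × Fin k) (Ψ : State → ℝ≥0∞) (v : ℝ≥0∞),
      (∀ s, s.time ≤ T → (s.Accepts ↔ (exactWeight Y.H).Yes (Y.query M r (sumOf M p) tab)) →
        Ψ s ≤ v) → (∀ s, s.time ≤ T → Ψ s ≤ v + 1) →
      wp fuel c Ψ (initial ((exactWeight Y.H).input (Y.query M r (sumOf M p) tab))) ≤ v + e)
    {Φ : State → ℝ≥0∞} (ps : List (Fin k × Fin k)) {tag t : ℕ} (htag : tag + ps.length + 2 ≤ l)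
    {s : State} {env : Env} {o : ℕ → ℤ} (hs : At s env o t) (h : Y.Ready n r M l tab tag env)
    (ho : ∀ r, c.regBound ≤ r → o r = 0) {v : ℝ≥0∞}
    (hgood : ∀ s', s'.time ≤ t + ps.length * (Y.callCost c * (l + 1) * T) + 1 →
      (s'.Accepts ↔ env.v 0 ≠ 0 ∨
        ∃ p ∈ ps, (exactWeight Y.H).Yes (Y.query M r (sumOf M p) tab)) → Φ s' ≤ v)
    (hbad : ∀ s', s'.time ≤ t + ps.length * (Y.callCost c * (l + 1) * T) + 1 → Φ s' ≤ v + 1) :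
    wp fuel (Y.calls c ps) Φ s ≤ v + ps.length * e := by
  induction ps generalizing tag t s env o v with
  | nil =>
    rw [calls, List.foldr_nil, wp_skip]
    simp only [List.length_nil, Nat.cast_zero, zero_mul, add_zero]
    refine hgood _ ?_ ?_
    · simpa [State.tick] using hs.time
    · have : s.reg 0 = env.v 0 := hs.even 0
      simp [State.Accepts, State.tick, this]
  | cons p ps ih =>
    have hc : Y.calls c (p :: ps) = .seq (Y.call c p) (Y.calls c ps) := rfl
    set κ := Y.callCost c * (l + 1) * T with hκ
    rw [hc, wp_seq, List.length_cons, Nat.cast_succ, add_mul, one_mul, ← add_assoc]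
    rw [List.length_cons] at htag hgood hbad
    have htime : ∀ a, a ≤ t + κ + ps.length * κ + 1 → a ≤ t + (ps.length + 1) * κ + 1 := by
      intro a ha
      rw [add_mul, one_mul]
      omega
    refine wp_call hs h ho hM p (by omega) hl htab htab' hT (hsol p) ?_ ?_
    · intro s' env' o' h1 h2 h3 h4
      refine ih (by omega) h1 h2 h3 (fun s'' ht hacc => hgood s'' (htime _ ht) ?_)
        fun s'' ht => hbad s'' (htime _ ht)
      rw [hacc, h4]
      by_cases hy : (exactWeight Y.H).Yes (Y.query M r (sumOf M p) tab)
      · simp [hy]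
      · simp [hy]
    -- After a wrong answer the bound `v + 1` holds for every continuation, so the remaining queries
    -- may be treated as if both kinds of outcomes were bad.
    · intro s' env' o' h1 h2 h3
      rw [add_right_comm]
      refine ih (by omega) h1 h2 h3 (fun s'' ht _ => hbad s'' (htime _ ht))
        fun s'' ht => (hbad s'' (htime _ ht)).trans le_self_add

/-! ### The parameters -/

variable (Y) in
/-- The number of bits of the hash values. -/
def hashBits (n X : ℕ) : ℕ := Y.kap * Y.expo n X + (k + 1) * logSize n X

variable (Y) in
/-- A bound for the length of the numbers in queries. -/
noncomputable def simLen (n X : ℕ) : ℕ := Y.lenConst + k * k + 3 * k + Y.h + Y.typeFactor +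
  Y.lam * Y.expo n X + Y.hashBits n X + 5

variable (Y) in
/-- A bound for the length of all numbers. -/
noncomputable def maxLen (n X : ℕ) : ℕ := Y.simLen n X + blockLen X * blockLen X + 2

lemma succ_le_two_pow_logSize (n X : ℕ) : n + 1 ≤ 2 ^ logSize n X :=
  (Nat.le_mul_of_pos_right _ (by omega)).trans (Nat.le_pow_clog (by norm_num) _)

lemma logSize_pos (n X : ℕ) : 0 < logSize n X := by
  apply Nat.clog_pos (by norm_num)
  have : 1 ≤ blockLen X * blockLen X := Nat.mul_pos (by unfold blockLen; positivity)
    (by unfold blockLen; positivity)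
  nlinarith

lemma natAbs_lt_of_sqSum {m : ℤ → ℤ} {K : ℕ} {z : ℤ} (h1 : 1 ≤ z) (h2 : z ≤ K) :
    (m z).natAbs < 2 ^ (blockLen (sqSum m K) * blockLen (sqSum m K)) := by
  refine lt_of_le_of_lt ?_ (lt_two_pow_blockLen _)
  have hj : (K - z).toNat ∈ Finset.range K := by rw [Finset.mem_range]; omega
  have h3 := Finset.single_le_sum (f := fun j : ℕ => (m (K - j)).natAbs ^ 2)
    (fun _ _ => Nat.zero_le _) hj
  have h4 : (K : ℤ) - ((K - z).toNat : ℕ) = z := by omega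
  simp only [h4] at h3
  have h5 : (m z).natAbs ≤ (m z).natAbs ^ 2 := Nat.le_self_pow (by norm_num) _
  unfold sqSum
  omega

variable (Y) in
/-- Compute the parameters. -/
def prepare : Prog :=
  .seq (.seq (sqInit k).comp (wh (.var 19) sqBody.comp))
    (.seq (.seq boundInit.comp (wh boundGuard boundBody.comp))
      (.seq (.seq sizeInit.comp (wh sizeGuard (doubleBody 8 7).comp))
        (.seq (.seq expoInit.comp (wh Y.expoGuard (doubleBody 9 10).comp)) Y.rangeCmd.comp)))

variable (Y) in
/-- A constant in the cost of `prepare`. -/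
def prepareCost : ℕ := (sqInit k).growth 1 + roundCost (.var 19) sqBody + boundInit.growth 1 +
  roundCost boundGuard boundBody + sizeInit.growth 1 + roundCost sizeGuard (doubleBody 8 7) +
  expoInit.growth 1 + roundCost Y.expoGuard (doubleBody 9 10) + Y.rangeCmd.growth 1

/-- The values of the variables after `prepare`. -/
structure Prepared (Y : Layout k) (n X : ℕ) (m : ℤ → ℤ) (env : Env) : Prop where
  mem : env.m = m
  small : Small (Y.maxLen n X) env
  v0 : env.v 0 = 0
  v1 : env.v 1 = n
  v3 : env.v 3 = (2 ^ (blockLen X * blockLen X) : ℕ)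
  v4 : env.v 4 = (2 ^ blockLen X : ℕ)
  v5 : env.v 5 = blockLen X
  v9 : env.v 9 = (2 ^ Y.expo n X : ℕ)
  v11 : env.v 11 = ((2 ^ Y.expo n X) ^ Y.kap : ℕ)
  v12 : env.v 12 = ((2 ^ Y.expo n X) ^ Y.lam : ℕ)
  v13 : env.v 13 = Y.range n X
  v15 : env.v 15 = Y.hashBits n X
  v16 : env.v 16 = 0
  v17 : env.v 17 = 0
  v23 : env.v 23 = 0
  v24 : env.v 24 = 0
  v25 : env.v 25 = 0

lemma ok_prepare {fuel n X : ℕ} {m : ℤ → ℤ} {s : State} (h : At s ⟨fun _ => 0, m⟩ (fun _ => 0) 0)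
    (hn : m 0 = n) (hX : X = sqSum m (k * n))
    (hfuel : k * n + blockLen X + logSize n X + Y.expo n X ≤ fuel) :
    Ok fuel Y.prepare s fun s' => ∃ env', At s' env' (fun _ => 0)
      (Y.prepareCost * ((k * n + blockLen X + Y.simLen n X + 1) * Y.maxLen n X)) ∧
      Y.Prepared n X m env' := by
  set l := Y.maxLen n X with hl
  have hke : Y.expo n X ≤ Y.kap * Y.expo n X := Nat.le_mul_of_pos_left _ Y.kap_pos
  have hle : Y.expo n X ≤ Y.lam * Y.expo n X := Nat.le_mul_of_pos_left _ Y.lam_pos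
  have hkG : (k + 1) * logSize n X = k * logSize n X + logSize n X := by ring
  have hsim : Y.simLen n X = Y.lenConst + k * k + 3 * k + Y.h + Y.typeFactor +
    Y.lam * Y.expo n X + (Y.kap * Y.expo n X + (k + 1) * logSize n X) + 5 := rfl
  have hlv : l = Y.simLen n X + blockLen X * blockLen X + 2 := rfl
  have hs0 : Small l ⟨fun _ => 0, m⟩ := fun i => by rw [len_zero]; omega
  have hround : rounds X ≤ blockLen X := Nat.lt_two_pow_self.le
  have hnG : n ≤ 2 ^ logSize n X := (Nat.le_succ n).trans (succ_le_two_pow_logSize n X)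
  have hkn : k * n ≤ 2 ^ (k + logSize n X) := by
    rw [pow_add]; exact Nat.mul_le_mul Nat.lt_two_pow_self.le hnG
  refine Ok.seq (ok_sq h hs0 (by omega) hn (len_le_of_le_two_pow hnG (by omega))
    (len_le_of_le_two_pow hkn (by omega))
    (by rw [← hX]; exact len_le_of_le_two_pow (lt_two_pow_blockLen X).le (by omega)) ?_) ?_
  · intro z h1 h2
    have := natAbs_lt_of_sqSum (m := m) h1 h2
    rw [← hX] at this
    exact (len_le_iff.mpr this).trans (by omega)
  rintro s1 ⟨env1, a1, a2, a3, a4, a5, a6⟩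
  refine Ok.seq (ok_bound a1 a3 (a5.trans (by rw [← hX])) (by omega) (by omega)) ?_
  rintro s2 ⟨env2, b1, b2, b3, b4, b5, b6⟩
  refine Ok.seq (ok_size (n := n) b1 b3 (by rw [b2.v 1 (by decide), a4]) b6 (by omega)
    (by omega)) ?_
  rintro s3 ⟨env3, c1, c2, c3, c4, c5⟩
  have c1v : env3.v 1 = n := by rw [c2.v 1 (by decide), b2.v 1 (by decide), a4]
  refine Ok.seq (Y.ok_expo c1 c3 c1v c5 (by omega) (by omega)) ?_
  rintro s4 ⟨env4, d1, d2, d3, d4, d5⟩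
  obtain ⟨e1, e2, e3, e4, e5, e6, e7⟩ := Y.rangeCmd_spec d3 (by rw [d2.v 7 (by decide), c5])
    (by rw [d2.v 8 (by decide), c4]) d4 d5 (by omega)
  have hrest : ∀ i, i ∉ ({1, 2, 3, 4, 5, 6, 7, 8, 9, 10, 11, 12, 13, 15, 19} : Finset (Fin 64)) →
      (Y.rangeCmd.sem env4).v i = 0 := by
    intro i hi
    simp only [Finset.mem_insert, Finset.mem_singleton, not_or] at hi
    rw [e1.v i (by simp [hi]), d2.v i (by simp [hi]), c2.v i (by simp [hi]), b2.v i (by simp [hi]),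
      a2.v i (by simp [hi])]
  refine (ok_cmd d1 d3 e7).mono fun s5 h5 => ⟨_, h5.mono ?_, ?_⟩
  · set Q := (k * n + blockLen X + Y.simLen n X + 1) * l with hQ
    have hl1 : 1 * l ≤ Q := Nat.mul_le_mul_right _ (by omega)
    have hb : ∀ K J : ℕ, J ≤ k * n + blockLen X + Y.simLen n X + 1 → J * (K * l) ≤ K * Q := by
      intro K J hJ
      rw [hQ]
      calc J * (K * l) = K * (J * l) := by ring
        _ ≤ _ := Nat.mul_le_mul_left _ (Nat.mul_le_mul_right _ hJ)
    have hb1 : ∀ K : ℕ, K * l ≤ K * Q := fun K => by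
      have := hb K 1 (by omega)
      rwa [one_mul] at this
    rw [prepareCost]
    simp only [add_mul _ _ Q]
    have r1 := hb1 ((sqInit k).growth 1)
    have r2 := hb (roundCost (.var 19) sqBody) (k * n + 1) (by omega)
    have r3 := hb1 (boundInit.growth 1)
    have r4 := hb (roundCost boundGuard boundBody) (rounds X + 1) (by omega)
    have r5 := hb1 (sizeInit.growth 1)
    have r6 := hb (roundCost sizeGuard (doubleBody 8 7)) (logSize n X + 1) (by omega)
    have r7 := hb1 (expoInit.growth 1)
    have r8 := hb (roundCost Y.expoGuard (doubleBody 9 10)) (Y.expo n X + 1) (by omega)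
    have r9 := hb1 (Y.rangeCmd.growth 1)
    omega
  · refine ⟨?_, e2, hrest 0 (by decide), ?_, ?_, ?_, ?_, ?_, e3, e4, e5, e6, hrest 16 (by decide),
      hrest 17 (by decide), hrest 23 (by decide), hrest 24 (by decide), hrest 25 (by decide)⟩
    · rw [e1.m, d2.m, c2.m, b2.m, a2.m]
    · rw [e1.v 1 (by decide), d2.v 1 (by decide), c1v]
    · rw [e1.v 3 (by decide), d2.v 3 (by decide), c2.v 3 (by decide), b4]
    · rw [e1.v 4 (by decide), d2.v 4 (by decide), c2.v 4 (by decide), b5]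
    · rw [e1.v 5 (by decide), d2.v 5 (by decide), c2.v 5 (by decide), b6]
    · rw [e1.v 9 (by decide), d4]

end Layout

/-! ### The reduction -/

/-- The input memory of `k`-SUM. -/
lemma initial_mem_sum {k : ℕ} (I : SumInstance k) :
    (initial ((kSum k).input I)).mem 0 = I.n ∧
    (∀ (i : Fin k) (j : Fin I.n),
      (initial ((kSum k).input I)).mem (1 + (i : ℕ) * I.n + (j : ℕ)) = I.x i j) ∧
    (∀ z : ℤ, z < 0 ∨ (k * I.n : ℕ) + 1 ≤ z → (initial ((kSum k).input I)).mem z = 0) := by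
  refine ⟨rfl, fun i j => ?_, fun z hz => ?_⟩
  · have h1 : (i : ℕ) * I.n + (j : ℕ) < k * I.n := by
      have := Nat.mul_le_mul_right I.n (Nat.succ_le_of_lt i.2)
      have := j.2
      rw [Nat.succ_mul] at *
      omega
    have h2 : (1 + ((i : ℕ) : ℤ) * I.n + (j : ℕ)).toNat = (i : ℕ) * I.n + (j : ℕ) + 1 := by
      have : 1 + ((i : ℕ) : ℤ) * I.n + (j : ℕ) = ((i : ℕ) * I.n + (j : ℕ) + 1 : ℕ) := by
        push_cast; ring
      rw [this, Int.toNat_natCast]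
    simp only [initial, kSum, h2, List.getD_cons_succ]
    rw [if_pos (by positivity), List.getD_eq_getElem _ _ (by simpa using h1), List.getElem_ofFn]
    have h3 : (⟨(i : ℕ) * I.n + (j : ℕ), h1⟩ : Fin (k * I.n)) = finProdFinEquiv (i, j) :=
      Fin.ext (by simp [mul_comm, add_comm])
    have h4 := finProdFinEquiv.symm_apply_apply (i, j)
    rw [← h3] at h4
    simp only [finProdFinEquiv, Equiv.coe_fn_symm_mk, Prod.mk.injEq] at h4
    rw [h4.1, h4.2]
  · simp only [initial, kSum]
    split_ifs with h
    · rw [List.getD_eq_default]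
      simp only [List.length_cons, List.length_ofFn]
      omega
    · rfl

/-- Prepare the generation of the low bits of the multiplier. -/
def drawCmd : Cmd := .asg 14 (.var 16) >> .asg 18 (.var 5)

/-- Clear the variables of the generation of random numbers. -/
def resetCmd : Cmd := .asg 15 0 >> .asg 16 0 >> .asg 17 0 >> .asg 18 0

/-- Draw the multiplier. -/
def draw : Prog := .seq flips (.seq drawCmd.comp (.seq blocks resetCmd.comp))

/-- A constant in the cost of `draw`. -/
def drawCost : ℕ := flipCost + drawCmd.growth 1 + 3 * blockCost + resetCmd.cost ⟨0, 0⟩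

/-! ### Drawing the multiplier and filling the tables -/

namespace Layout
variable {k : ℕ} (Y : Layout k)

variable {Y} in
-- The high part, uniform below the range `M`, has only logarithmically many bits and is drawn bit
-- by bit; the part below `D` is as long as the input numbers and is drawn in blocks.
lemma wp_draw {fuel n X t : ℕ} {m : ℤ → ℤ} {s : State} {env : Env} {o : ℕ → ℤ} (h : At s env o t)
    (hp : Y.Prepared n X m env) (hf1 : Y.hashBits n X ≤ fuel) (hf2 : blockLen X ≤ fuel)
    {Φ : State → ℝ≥0∞} {g : ℕ → ℝ≥0∞}
    (hΦ : ∀ a < Y.range n X * 2 ^ (blockLen X * blockLen X), ∀ s' env',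
      At s' env' o (t + drawCost * ((blockLen X + Y.simLen n X + 1) * Y.maxLen n X)) →
      Agree {14, 15, 16, 17, 18} env env' → Small (Y.maxLen n X) env' → env'.v 14 = a →
      Φ s' ≤ g a) :
    wp fuel draw Φ s ≤ avg (Y.range n X * 2 ^ (blockLen X * blockLen X)) g := by
  have hc5 : Y.hashBits n X + 5 ≤ Y.simLen n X := by unfold simLen; omega
  have hlv : Y.maxLen n X = Y.simLen n X + blockLen X * blockLen X + 2 := rfl
  rw [draw, wp_seq, avg_mul]
  refine wp_flips hf1 h hp.v15 hp.v16 (Or.inl hp.v17) ?_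
  intro j hj s1 env1 a1 a2 a3 a4 a5
  have hjl : len (j : ℤ) ≤ Y.maxLen n X :=
    len_le_of_le_two_pow (c := Y.hashBits n X) hj.le (by omega)
  have hs1 : Small (Y.maxLen n X) env1 := by
    refine hp.small.of_agree a2 ?_
    simp only [Finset.mem_insert, Finset.mem_singleton]
    rintro i (rfl | rfl | rfl)
    · rw [a3, len_zero]; omega
    · rw [a4]; exact hjl
    · rcases a5 with h | h <;> rw [h] <;> simp <;> omega
  rw [wp_seq]
  refine ok_cmd a1 hs1 (by simp [drawCmd, Cmd.loadsLe_andThen, Cmd.LoadsLe]) _ _ fun s2 b1 => ?_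
  have hA2 : Agree {14, 18} env1 (drawCmd.sem env1) := by
    simp only [drawCmd, Cmd.sem_andThen, Cmd.sem]
    exact ((Agree.refl _ _).update (x := 14) (by decide) _).update (x := 18) (by decide) _
  have hv2 : (drawCmd.sem env1).v 14 = j ∧ (drawCmd.sem env1).v 18 = blockLen X := by
    simp only [drawCmd, Cmd.sem_andThen, Cmd.sem, Expr.eval_var, Function.update_apply, reduceIte,
      Fin.reduceEq, a4, a2.v 5 (by decide), hp.v5, and_self]
  rw [wp_seq]
  refine wp_blocks (l := Y.maxLen n X) hf2 hf2 b1 hv2.2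
    (by rw [hA2.v 5 (by decide), a2.v 5 (by decide), hp.v5])
    (by rw [hA2.v 4 (by decide), a2.v 4 (by decide), hp.v4]; push_cast; rfl) hv2.1
    (by rw [hA2.v 17 (by decide)]; exact a5) ?_ ?_ ?_ ?_ ?_
  · intro i hi
    rw [hA2.v i (by revert i; decide)]
    exact hs1 i
  · intro z hz
    refine len_le_of_le_two_pow (c := Y.hashBits n X + blockLen X * blockLen X) ?_ (by omega)
    rw [pow_add]
    exact hz.le.trans (Nat.mul_le_mul_right _ hj)
  · have : blockLen X ≤ blockLen X * blockLen X := Nat.le_mul_self _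
    omega
  · have : blockLen X ≤ blockLen X * blockLen X := Nat.le_mul_self _
    omega
  · intro j' hj' s3 env3 c1 c2 c3
    have hlt : j * 2 ^ (blockLen X * blockLen X) + j' <
        Y.range n X * 2 ^ (blockLen X * blockLen X) := by
      have := Nat.mul_le_mul_right (2 ^ (blockLen X * blockLen X)) (Nat.succ_le_of_lt hj)
      rw [Nat.succ_mul] at this
      exact lt_of_lt_of_le (by omega) this
    have hA3 : Agree {14, 15, 16, 17, 18} env (resetCmd.sem env3) := by
      have : Agree {15, 16, 17, 18} env3 (resetCmd.sem env3) := by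
        simp only [resetCmd, Cmd.sem_andThen, Cmd.sem]
        exact ((((Agree.refl _ _).update (x := 15) (by decide) _).update (x := 16) (by decide)
          _).update (x := 17) (by decide) _).update (x := 18) (by decide) _
      exact ((a2.trans (S'' := {14, 15, 16, 17, 18}) hA2 (by decide) (by decide)).trans
        (S'' := {14, 15, 16, 17, 18}) c2 (by decide) (by decide)).trans this (by decide) (by decide)
    have hv3 : (resetCmd.sem env3).v 14 = (j * 2 ^ (blockLen X * blockLen X) + j' : ℕ) ∧
        (resetCmd.sem env3).v 15 = 0 ∧ (resetCmd.sem env3).v 16 = 0 ∧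
        (resetCmd.sem env3).v 17 = 0 ∧ (resetCmd.sem env3).v 18 = 0 := by
      simp only [resetCmd, Cmd.sem_andThen, Cmd.sem, Expr.eval_zero, Function.update_apply,
        reduceIte, Fin.reduceEq, c3, and_self]
    refine (resetCmd.ok_comp fuel c1) _ _ fun s4 d1 => hΦ _ hlt s4 _ (d1.mono ?_) hA3 ?_ hv3.1
    · set w := blockLen X
      set l := Y.maxLen n X
      set S := Y.simLen n X
      set c := Y.hashBits n X
      have e0 : resetCmd.cost env3 = resetCmd.cost ⟨0, 0⟩ := rfl
      rw [e0, drawCost]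
      have e1 : (c + 1) * (flipCost * (c + 1)) ≤ flipCost * ((w + S + 1) * l) := by
        calc (c + 1) * (flipCost * (c + 1)) = flipCost * ((c + 1) * (c + 1)) := by ring
          _ ≤ _ := Nat.mul_le_mul_left _ (Nat.mul_le_mul (by omega) (by omega))
      have e2 : drawCmd.growth 1 * l ≤ drawCmd.growth 1 * ((w + S + 1) * l) :=
        Nat.mul_le_mul_left _ (Nat.le_mul_of_pos_left _ (by omega))
      have e3 : (w + 1) * (blockCost * (l + (w + 1) * (w + 1))) ≤
          3 * blockCost * ((w + S + 1) * l) := by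
        have hw : (w + 1) * (w + 1) ≤ 2 * l := by nlinarith [sq_nonneg ((w : ℤ) - 1), Nat.le_mul_self w]
        calc _ = blockCost * ((w + 1) * (l + (w + 1) * (w + 1))) := by ring
          _ ≤ blockCost * ((w + S + 1) * (3 * l)) :=
            Nat.mul_le_mul_left _ (Nat.mul_le_mul (by omega) (by omega))
          _ = _ := by ring
      have e4 : resetCmd.cost ⟨0, 0⟩ ≤ resetCmd.cost ⟨0, 0⟩ * ((w + S + 1) * l) :=
        Nat.le_mul_of_pos_right _ (Nat.mul_pos (by omega) (by omega))
      simp only [add_mul _ _ ((w + S + 1) * l)]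
      omega
    · refine hp.small.of_agree hA3 ?_
      simp only [Finset.mem_insert, Finset.mem_singleton]
      rintro i (rfl | rfl | rfl | rfl | rfl)
      · rw [hv3.1]
        refine len_le_of_le_two_pow (c := Y.hashBits n X + blockLen X * blockLen X) ?_ (by omega)
        rw [pow_add]
        exact hlt.le
      · rw [hv3.2.1, len_zero]; omega
      · rw [hv3.2.2.1, len_zero]; omega
      · rw [hv3.2.2.2.1, len_zero]; omega
      · rw [hv3.2.2.2.2, len_zero]; omega

lemma tag_addr_bounds {b z : ℤ} (hz : 0 ≤ z) :
    b * (z + 2) + z + 1 < 0 ∨ z ≤ b * (z + 2) + z + 1 := by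
  rcases lt_or_ge b 0 with hb | hb
  · left; nlinarith
  · right; nlinarith

set_option maxRecDepth 10000 in
lemma mem_of_mem_simVars : ∀ i ∈ simVars, i < 28 →
    i ∈ ({1, 9, 11, 12, 13, 21, 22, 23, 24, 25, 26, 27} : Finset (Fin 64)) := by
  decide

/-- Start to fill the tables. -/
def countCmd (k : ℕ) : Cmd := .asg 19 (.const k * .var 1)

/-- Compute the parameters of the queries. -/
def layoutCmd : Cmd := .asg 21 (.const k * .var 1 + 1 + .const k * .var 11) >>
  .asg 22 (.var 21 + .const 2) >> .asg 26 (.const Y.h * .var 12) >> .asg 27 (.const Y.typeFactor * .var 13)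

/-- Fill the tables, and prepare the queries. -/
def tables : Prog :=
  .seq (countCmd k).comp (.seq (wh (.var 19) (fillBody k).comp) Y.layoutCmd.comp)

/-- A constant in the cost of `tables`. -/
def tablesCost : ℕ := (countCmd k).growth 1 + roundCost (.var 19) (fillBody k) +
  Y.layoutCmd.growth 1

variable {Y} in
set_option maxHeartbeats 1000000 in
-- The tables lie directly behind the input, and the cells for the simulation lie behind the tables
-- or at negative addresses. All of the latter still hold `0`, so the simulations can start with tag
-- `0`.
lemma ok_tables {fuel n X t a : ℕ} {m : ℤ → ℤ} {s : State} {env env' : Env} {o : ℕ → ℤ}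
    {x : Fin k → Fin n → ℤ} (hp : Y.Prepared n X m env) (hX : X = sqSum m (k * n))
    (hmx : ∀ (i : Fin k) (j : Fin n), m (1 + (i : ℕ) * n + (j : ℕ)) = x i j)
    (hmz : ∀ z : ℤ, z < 0 ∨ (k * n : ℕ) + 1 ≤ z → m z = 0) (hfuel : k * n ≤ fuel)
    (hA : Agree {14, 15, 16, 17, 18} env env') (hs : Small (Y.maxLen n X) env')
    (ha : env'.v 14 = a) (h : At s env' o t) :
    Ok fuel Y.tables s fun s' => ∃ env'' tab,
      At s' env'' o (t + Y.tablesCost * ((k * n + 1) * Y.maxLen n X)) ∧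
      Y.Ready n (2 ^ Y.expo n X) (Y.range n X) (Y.simLen n X) tab 0 env'' ∧
      TabSpec x (Y.range n X) (2 ^ (blockLen X * blockLen X)) ((2 ^ Y.expo n X) ^ Y.kap) a tab ∧
      env''.v 0 = 0 := by
  have hlv : Y.maxLen n X = Y.simLen n X + blockLen X * blockLen X + 2 := rfl
  have hsim : Y.simLen n X = Y.lenConst + k * k + 3 * k + Y.h + Y.typeFactor +
    Y.lam * Y.expo n X + (Y.kap * Y.expo n X + (k + 1) * logSize n X) + 5 := rfl
  have hkG : (k + 1) * logSize n X = k * logSize n X + logSize n X := by ring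
  have hke : Y.expo n X ≤ Y.kap * Y.expo n X := Nat.le_mul_of_pos_left _ Y.kap_pos
  have hnG : n ≤ 2 ^ logSize n X := (Nat.le_succ n).trans (succ_le_two_pow_logSize n X)
  have hkn : k * n ≤ 2 ^ (k + logSize n X) := by
    rw [pow_add]; exact Nat.mul_le_mul Nat.lt_two_pow_self.le hnG
  have hCe : (2 ^ Y.expo n X) ^ Y.kap = 2 ^ (Y.kap * Y.expo n X) := by rw [← pow_mul, mul_comm]
  have hLe : (2 ^ Y.expo n X) ^ Y.lam = 2 ^ (Y.lam * Y.expo n X) := by rw [← pow_mul, mul_comm]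
  have hkC : k * (2 ^ Y.expo n X) ^ Y.kap ≤ 2 ^ (k + Y.kap * Y.expo n X) := by
    rw [pow_add, hCe]; exact Nat.mul_le_mul_right _ Nat.lt_two_pow_self.le
  have hS1 : k * n + 1 + k * (2 ^ Y.expo n X) ^ Y.kap + 2 ≤
      2 ^ (2 * k + logSize n X + Y.kap * Y.expo n X + 3) := by
    have h1 : 1 ≤ 2 ^ (k + logSize n X) := Nat.one_le_two_pow
    have h2 : 1 ≤ 2 ^ (k + Y.kap * Y.expo n X) := Nat.one_le_two_pow
    rw [show 2 * k + logSize n X + Y.kap * Y.expo n X + 3 =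
      (k + logSize n X) + (k + Y.kap * Y.expo n X) + 3 by ring, pow_add, pow_add _ _ (k + _)]
    generalize 2 ^ (k + logSize n X) = u at *
    generalize 2 ^ (k + Y.kap * Y.expo n X) = v at *
    nlinarith
  have hM : 0 < Y.range n X := by unfold range; positivity
  have hD : 0 < 2 ^ (blockLen X * blockLen X) := by positivity
  have hC : 0 < (2 ^ Y.expo n X) ^ Y.kap := by positivity
  -- the counter
  have hA1 : Agree {19} env' ((countCmd k).sem env') := by
    simp only [countCmd, Cmd.sem]
    exact (Agree.refl _ _).update (x := 19) (by decide) _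
  have hv1 : ((countCmd k).sem env').v 19 = (k * n : ℕ) := by
    simp only [countCmd, Cmd.sem, Expr.eval_mul, Expr.eval_const, Expr.eval_var,
      Function.update_apply, reduceIte, hA.v 1 (by decide), hp.v1]
    push_cast
    rfl
  have hs1 : Small (Y.maxLen n X) ((countCmd k).sem env') := by
    refine hs.of_agree hA1 ?_
    simp only [Finset.mem_singleton]
    rintro i rfl
    rw [hv1]
    exact len_le_of_le_two_pow hkn (by omega)
  refine Ok.seq (ok_cmd h hs (by simp [countCmd, Cmd.LoadsLe])) fun s1 a1 => ?_
  generalize (countCmd k).sem env' = env1 at a1 hA1 hv1 hs1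
  have hA1' : Agree {14, 15, 16, 17, 18, 19} env env1 := hA.trans hA1 (by decide) (by decide)
  have hm1 : env1.m = m := by rw [hA1'.m, hp.mem]
  refine Ok.seq (ok_fill hD hM hC a1 hs1 hfuel (by rw [hA1'.v 1 (by decide), hp.v1])
    (by rw [hA1'.v 3 (by decide), hp.v3]) (by rw [hA1'.v 11 (by decide), hp.v11])
    (by rw [hA1'.v 13 (by decide), hp.v13]) (by rw [hA1.v 14 (by decide), ha]) hv1 ?_ ?_) ?_
  · intro z h1 h2
    rw [hm1]
    have := natAbs_lt_of_sqSum (m := m) h1 h2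
    rw [← hX] at this
    exact (len_le_iff.mpr this).trans (by omega)
  · intro z hz
    rw [hm1]; exact hmz z (Or.inr hz)
  rintro s2 ⟨env2, b1, b2, b3, b4⟩
  rw [hm1] at b4
  have hr : ∀ i, i ∉ ({14, 15, 16, 17, 18, 19, 20} : Finset (Fin 64)) → env2.v i = env.v i := by
    intro i hi
    simp only [Finset.mem_insert, Finset.mem_singleton, not_or] at hi
    rw [b2 i (by simp [hi]), hA1'.v i (by simp [hi])]
  -- the layout
  have hA3 : Agree {21, 22, 26, 27} env2 (Y.layoutCmd.sem env2) := by
    simp only [layoutCmd, Cmd.sem_andThen, Cmd.sem]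
    exact ((((Agree.refl _ _).update (x := 21) (by decide) _).update (x := 22) (by decide)
      _).update (x := 26) (by decide) _).update (x := 27) (by decide) _
  have hv3 : (Y.layoutCmd.sem env2).v 21 = (k * n + 1 + k * (2 ^ Y.expo n X) ^ Y.kap : ℕ) ∧
      (Y.layoutCmd.sem env2).v 22 = (Y.layoutCmd.sem env2).v 21 + 2 ∧
      (Y.layoutCmd.sem env2).v 26 = (Y.h * (2 ^ Y.expo n X) ^ Y.lam : ℕ) ∧
      (Y.layoutCmd.sem env2).v 27 = (Y.typeFactor * Y.range n X : ℕ) := by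
    simp only [layoutCmd, Cmd.sem_andThen, Cmd.sem, Expr.eval_add, Expr.eval_mul, Expr.eval_const,
      Expr.eval_one, Expr.eval_var, Function.update_apply, reduceIte, Fin.reduceEq,
      hr 1 (by decide), hr 11 (by decide), hr 12 (by decide), hr 13 (by decide), hp.v1, hp.v11,
      hp.v12, hp.v13]
    push_cast
    exact ⟨rfl, trivial, rfl, rfl⟩
  refine (ok_cmd b1 b3 (by simp [layoutCmd, Cmd.loadsLe_andThen, Cmd.LoadsLe])).mono fun s3 c1 => ?_
  generalize Y.layoutCmd.sem env2 = env3 at c1 hA3 hv3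
  obtain ⟨v21, v22, v26, v27⟩ := hv3
  have hr3 : ∀ i, i ∉ ({14, 15, 16, 17, 18, 19, 20, 21, 22, 26, 27} : Finset (Fin 64)) →
      env3.v i = env.v i := by
    intro i hi
    simp only [Finset.mem_insert, Finset.mem_singleton, not_or] at hi
    rw [hA3.v i (by simp [hi]), hr i (by simp [hi])]
  refine ⟨env3, tableOf k n ((2 ^ Y.expo n X) ^ Y.kap) env3.m, c1.mono ?_, ?_, ?_, by
    rw [hr3 0 (by decide), hp.v0]⟩
  · have hl1 : Y.maxLen n X ≤ (k * n + 1) * Y.maxLen n X := Nat.le_mul_of_pos_left _ (by omega)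
    have e1 := Nat.mul_le_mul_left ((countCmd k).growth 1) hl1
    have e2 := Nat.mul_le_mul_left (Y.layoutCmd.growth 1) hl1
    have e3 : (k * n + 1) * (roundCost (.var 19) (fillBody k) * Y.maxLen n X) =
      roundCost (.var 19) (fillBody k) * ((k * n + 1) * Y.maxLen n X) := by ring
    rw [tablesCost]
    simp only [add_mul _ _ ((k * n + 1) * Y.maxLen n X)]
    omega
  · refine ⟨by positivity, by rw [hr3 1 (by decide), hp.v1], by rw [hr3 9 (by decide), hp.v9],
      by rw [hr3 11 (by decide), hp.v11], by rw [hr3 12 (by decide), hp.v12],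
      by rw [hr3 13 (by decide), hp.v13], v21, v22, by rw [hr3 23 (by decide), hp.v23]; rfl, v26,
      v27, ?_, ?_, ?_, Or.inl (by rw [hr3 0 (by decide), hp.v0])⟩
    · intro i hi hi28
      have := mem_of_mem_simVars i hi hi28
      simp only [Finset.mem_insert, Finset.mem_singleton] at this
      rcases this with rfl | rfl | rfl | rfl | rfl | rfl | rfl | rfl | rfl | rfl | rfl | rfl
      · rw [hr3 1 (by decide), hp.v1]; exact len_le_of_le_two_pow hnG (by omega)
      · rw [hr3 9 (by decide), hp.v9]; exact len_le_of_le_two_pow le_rfl (by omega)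
      · rw [hr3 11 (by decide), hp.v11, hCe]; exact len_le_of_le_two_pow le_rfl (by omega)
      · rw [hr3 12 (by decide), hp.v12, hLe]; exact len_le_of_le_two_pow le_rfl (by omega)
      · rw [hr3 13 (by decide), hp.v13]; exact len_le_of_le_two_pow le_rfl (by omega)
      · rw [v21]
        exact len_le_of_le_two_pow (le_trans (Nat.le_add_right _ 2) hS1) (by omega)
      · rw [v22, v21]
        exact len_le_of_le_two_pow hS1 (by omega)
      · rw [hr3 23 (by decide), hp.v23, len_zero]; omega
      · rw [hr3 24 (by decide), hp.v24, len_zero]; omega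
      · rw [hr3 25 (by decide), hp.v25, len_zero]; omega
      · rw [v26, hLe]
        refine len_le_of_le_two_pow (c := Y.h + Y.lam * Y.expo n X) ?_ (by omega)
        rw [pow_add]; exact Nat.mul_le_mul_right _ Nat.lt_two_pow_self.le
      · rw [v27]
        refine len_le_of_le_two_pow (c := Y.typeFactor + (Y.kap * Y.expo n X +
          (k + 1) * logSize n X)) ?_ (by omega)
        rw [pow_add]; exact Nat.mul_le_mul_right _ Nat.lt_two_pow_self.le
    · intro i c h1 h2
      rw [tableOf, if_pos ⟨h1, h2⟩, tableAddr]
    · intro b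
      have hz : m (b * env3.v 22 + env3.v 21 + 1) = 0 ∧
          ((b * env3.v 22 + env3.v 21 + 1 < (k * n : ℕ) + 1 ∨
          (k * n : ℕ) + 1 + k * ((2 ^ Y.expo n X) ^ Y.kap : ℕ) ≤
            b * env3.v 22 + env3.v 21 + 1)) := by
        have h21 : (k * n : ℕ) + 1 + (k : ℤ) * ((2 ^ Y.expo n X) ^ Y.kap : ℕ) = env3.v 21 := by
          rw [v21]; push_cast; rfl
        have h21' : (k * n : ℕ) + 1 ≤ env3.v 21 := by
          rw [← h21]
          exact le_add_of_nonneg_right (by positivity)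
        rw [h21, v22]
        rcases tag_addr_bounds (b := b) (z := env3.v 21) (by omega) with hb | hb
        · exact ⟨hmz _ (Or.inl hb), Or.inl (by omega)⟩
        · exact ⟨hmz _ (Or.inr (by omega)), Or.inr hb⟩
      rw [hA3.m, b4.out _ hz.2, hz.1]
      simp
  · rw [hA3.m]
    exact b4.tabSpec hC hmx

end Layout

/-! ### The whole program for `k`-SUM and its error -/

lemma avg_add_const_le {N : ℕ} (g : ℕ → ℝ≥0∞) (v : ℝ≥0∞) :
    avg N (fun a => g a + v) ≤ avg N g + v := by
  unfold avg
  rw [Finset.sum_add_distrib, mul_add, Finset.sum_const, Finset.card_range, nsmul_eq_mul, ← mul_assoc]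
  refine add_le_add_right ?_ _
  calc _ ≤ 1 * v := mul_le_mul_left (ENNReal.inv_mul_le_one _) _
    _ = v := one_mul v

open Classical in
lemma avg_indicator {N : ℕ} (p : ℕ → Prop) :
    avg N (fun a => if p a then 0 else 1) =
      ((Finset.range N).filter fun a => ¬ p a).card / (N : ℝ≥0∞) := by
  unfold avg
  rw [div_eq_mul_inv, mul_comm, Finset.card_filter]
  congr 1
  push_cast
  refine Finset.sum_congr rfl fun a _ => ?_
  by_cases h : p a <;> simp [h]

/-- Only finitely many tables are possible. -/
lemma finite_tabSpec {k n M D C : ℕ} (hD : 0 < D) (hM : 0 < M) (hC : 0 < C)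
    (x : Fin k → Fin n → ℤ) : {tab | ∃ a : ℤ, TabSpec x M D C a tab}.Finite := by
  have hCz : (0 : ℤ) < C := by exact_mod_cast hC
  refine (Set.finite_range fun (f : Fin k → Fin C → Fin (M + 1)) (i : Fin k) (c : ℤ) =>
    if h : 0 ≤ c ∧ c < C then (((f i ⟨c.toNat, by omega⟩ : Fin (M + 1)) : ℕ) : ℤ) else 0).subset ?_
  rintro tab ⟨a, h⟩
  refine ⟨fun i c => ⟨(tab i (c : ℕ)).toNat, ?_⟩, ?_⟩
  · have := h.le hD hM i (c : ℕ)
    omega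
  · funext i c
    by_cases hc : 0 ≤ c ∧ c < C
    · have h1 := h.nonneg hD hM i c
      simp only [hc, and_self, dite_true]
      have h2 : ((c.toNat : ℕ) : ℤ) = c := Int.toNat_of_nonneg hc.1
      rw [h2, Int.toNat_of_nonneg h1]
    · simp only [hc, dite_false]
      by_contra hne
      obtain ⟨j, h1, -⟩ := h.entry i c (Ne.symm hne)
      exact hc ⟨h1 ▸ Int.emod_nonneg _ hCz.ne', h1 ▸ Int.emod_lt_of_pos _ hCz⟩

namespace Layout
variable {k : ℕ} (Y : Layout k)

/-- The program for `k`-SUM that uses a program for Exact-Weight-`H`. -/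
noncomputable def program (c : Prog) : Prog :=
  .seq Y.prepare (.seq draw (.seq Y.tables (Y.calls c (Finset.univ : Finset (Fin k × Fin k)).toList)))

/-- A constant in the cost of the program, apart from the queries. -/
def programCost : ℕ := Y.prepareCost + drawCost + Y.tablesCost

/-- The largest square sum of the input. -/
def bound (I : SumInstance k) : ℕ := sqSum (initial ((kSum k).input I)).mem (k * I.n)

/-- The running time of the program, if the queries take time `T`. -/
noncomputable def programTime (c : Prog) (n X T : ℕ) : ℕ :=
  Y.programCost * ((k * n + blockLen X + Y.simLen n X + 1) * Y.maxLen n X) +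
    k * k * (Y.callCost c * (Y.simLen n X + 1) * T) + 1

lemma abs_le_of_bound (I : SumInstance k) (i : Fin k) (j : Fin I.n) :
    |I.x i j| ≤ (2 ^ (blockLen (bound I) * blockLen (bound I)) : ℕ) := by
  have h1 : (i : ℕ) * I.n + (j : ℕ) < k * I.n := by
    have := Nat.mul_le_mul_right I.n (Nat.succ_le_of_lt i.2)
    have := j.2
    rw [Nat.succ_mul] at *
    omega
  have h1' : ((i : ℕ) : ℤ) * I.n + (j : ℕ) < (k * I.n : ℕ) := by exact_mod_cast h1
  have h2 : 0 ≤ ((i : ℕ) : ℤ) * I.n + (j : ℕ) := by positivity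
  have := natAbs_lt_of_sqSum (m := (initial ((kSum k).input I)).mem) (K := k * I.n)
    (z := 1 + (i : ℕ) * I.n + (j : ℕ)) (by linarith) (by linarith)
  rw [(initial_mem_sum I).2.1] at this
  rw [← Int.natCast_natAbs]
  exact_mod_cast this.le

variable {Y} in
open Classical in
-- For a good multiplier only the `k * k` queries can err, each with weight `e`; for any other
-- multiplier the penalty is still at most one more. The averaged indicator is the probability of a
-- multiplier that is not good.
lemma wp_program {fuel : ℕ} {c : Prog} (I : SumInstance k) (hk : 0 < k) {X T : ℕ}
    {e : ℝ≥0∞} (hX : X = bound I) (hT : 1 ≤ T)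
    (hfuel : k * I.n + blockLen X + logSize I.n X + Y.expo I.n X + Y.hashBits I.n X ≤ fuel)
    (hsol : ∀ (a : ℕ) tab, TabSpec I.x (Y.range I.n X) (2 ^ (blockLen X * blockLen X))
      ((2 ^ Y.expo I.n X) ^ Y.kap) a tab → ∀ (p : Fin k × Fin k) (Ψ : State → ℝ≥0∞) (v : ℝ≥0∞),
      (∀ s, s.time ≤ T → (s.Accepts ↔ (exactWeight Y.H).Yes
        (Y.query (Y.range I.n X) (2 ^ Y.expo I.n X) (sumOf (Y.range I.n X) p) tab)) → Ψ s ≤ v) →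
      (∀ s, s.time ≤ T → Ψ s ≤ v + 1) →
      wp fuel c Ψ (initial ((exactWeight Y.H).input
        (Y.query (Y.range I.n X) (2 ^ Y.expo I.n X) (sumOf (Y.range I.n X) p) tab))) ≤ v + e) :
    wp fuel (Y.program c) (penalty (Y.programTime c I.n X T) ((kSum k).Yes I))
      (initial ((kSum k).input I)) ≤
      avg (Y.range I.n X * 2 ^ (blockLen X * blockLen X)) (fun a => if GoodMul I.x (Y.range I.n X)
        (2 ^ (blockLen X * blockLen X)) ((2 ^ Y.expo I.n X) ^ Y.kap) a then 0 else 1) +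
      (k * k : ℕ) * e := by
  obtain ⟨i0, i1, i2⟩ := initial_mem_sum I
  have hM : 0 < Y.range I.n X := by unfold range; positivity
  have hD : 0 < 2 ^ (blockLen X * blockLen X) := by positivity
  have hc5 : Y.lenConst + k * k + Y.hashBits I.n X + 5 ≤ Y.simLen I.n X := by unfold simLen; omega
  have hMu : Y.range I.n X ≤ 2 ^ Y.hashBits I.n X := le_rfl
  have hlen : (Finset.univ : Finset (Fin k × Fin k)).toList.length = k * k := by simp
  rw [program, wp_seq]
  refine ok_prepare (fuel := fuel) (X := X) (s := initial ((kSum k).input I))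
    (m := (initial ((kSum k).input I)).mem) ⟨fun _ => rfl, fun _ => rfl, rfl, le_rfl⟩ i0 hX
    (by omega) _ _ ?_
  rintro s1 ⟨env1, a1, hp⟩
  rw [wp_seq]
  refine le_trans ?_ (avg_add_const_le _ _)
  refine wp_draw a1 hp (by omega) (by omega) ?_
  intro a ha s2 env2 b1 b2 b3 b4
  rw [wp_seq]
  refine ok_tables (fuel := fuel) hp hX i1 i2 (by omega) b2 b3 b4 b1 _ _ ?_
  rintro s3 ⟨env3, tab, c1, c2, c3, c4⟩
  rw [← hlen]
  have htime : ∀ t, t ≤ Y.prepareCost * ((k * I.n + blockLen X + Y.simLen I.n X + 1) *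
      Y.maxLen I.n X) + drawCost * ((blockLen X + Y.simLen I.n X + 1) * Y.maxLen I.n X) +
      Y.tablesCost * ((k * I.n + 1) * Y.maxLen I.n X) +
      (Finset.univ : Finset (Fin k × Fin k)).toList.length *
        (Y.callCost c * (Y.simLen I.n X + 1) * T) + 1 → t ≤ Y.programTime c I.n X T := by
    intro t ht
    refine ht.trans ?_
    rw [programTime, programCost, hlen]
    have e1 := Nat.mul_le_mul_left drawCost (Nat.mul_le_mul_right (Y.maxLen I.n X)
      (show blockLen X + Y.simLen I.n X + 1 ≤ k * I.n + blockLen X + Y.simLen I.n X + 1 by omega))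
    have e2 := Nat.mul_le_mul_left Y.tablesCost (Nat.mul_le_mul_right (Y.maxLen I.n X)
      (show k * I.n + 1 ≤ k * I.n + blockLen X + Y.simLen I.n X + 1 by omega))
    simp only [add_mul _ _ ((k * I.n + blockLen X + Y.simLen I.n X + 1) * Y.maxLen I.n X)]
    omega
  refine wp_calls hM (fun z hz => (len_le_of_abs_le hM hMu hz).trans (by omega))
    (c3.nonneg hD hM) (fun i z => ?_) hT (hsol a tab c3) _ (by rw [hlen]; omega) c1 c2
    (fun _ _ => rfl) ?_ ?_
  · have h1 := c3.nonneg hD hM i z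
    have h2 := c3.le hD hM i z
    obtain ⟨u, hu⟩ := Int.eq_ofNat_of_zero_le h1
    rw [hu] at h2 ⊢
    exact len_le_of_le_two_pow ((Int.ofNat_le.mp h2).trans hMu) (by omega)
  · intro s4 ht hacc
    by_cases hg : GoodMul I.x (Y.range I.n X) (2 ^ (blockLen X * blockLen X))
        ((2 ^ Y.expo I.n X) ^ Y.kap) a
    · have hyes := exists_query_yes_iff hk c2.r_pos hD hM c3 hg
      have hacc' : s4.Accepts ↔ (kSum k).Yes I := by
        rw [hacc, c4]
        rw [show (kSum k).Yes I ↔ ∃ τ : Fin k → Fin I.n, ∑ i, I.x i (τ i) = 0 from Iff.rfl, ← hyes]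
        simp
      simp [penalty, htime _ ht, hacc']
    · rw [if_neg hg, penalty, if_pos (htime _ ht)]
      split_ifs <;> simp
  · intro s4 ht
    rw [penalty, if_pos (htime _ ht)]
    split_ifs <;> simp

end Layout

/-! ### Functions bounded by almost a power of the size -/

/-- The function `q` is nonnegative and at most a power of `σ`, with an exponent arbitrarily close
to `s`. -/
def SubPow {α : Type} (σ : α → ℕ) (s : ℝ) (q : α → ℝ) : Prop :=
  (∀ a, 0 ≤ q a) ∧ ∀ η : ℝ, 0 < η → ∃ K : ℝ, 0 ≤ K ∧ ∀ a, q a ≤ K * ((σ a : ℝ) + 1) ^ (s + η)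

namespace SubPow
variable {α : Type} {σ : α → ℕ} {s t : ℝ} {q r : α → ℝ}

lemma one_le_size (n : ℕ) : (1 : ℝ) ≤ (n : ℝ) + 1 := by
  have : (0 : ℝ) ≤ n := by positivity
  linarith

lemma mono (h : SubPow σ s q) (hst : s ≤ t) : SubPow σ t q := by
  refine ⟨h.1, fun η hη => ?_⟩
  obtain ⟨K, hK, h2⟩ := h.2 η hη
  refine ⟨K, hK, fun a => (h2 a).trans (mul_le_mul_of_nonneg_left ?_ hK)⟩
  exact Real.rpow_le_rpow_of_exponent_le (one_le_size _) (by linarith)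

lemma of_le (h : SubPow σ s q) (h0 : ∀ a, 0 ≤ r a) (hr : ∀ a, r a ≤ q a) : SubPow σ s r := by
  refine ⟨h0, fun η hη => ?_⟩
  obtain ⟨K, hK, h2⟩ := h.2 η hη
  exact ⟨K, hK, fun a => (hr a).trans (h2 a)⟩

lemma const {c : ℝ} (hc : 0 ≤ c) : SubPow σ 0 fun _ => c := by
  refine ⟨fun _ => hc, fun η hη => ⟨c, hc, fun a => ?_⟩⟩
  exact le_mul_of_one_le_right hc (Real.one_le_rpow (one_le_size _) (by linarith))

lemma natCast (c : ℕ) : SubPow σ 0 fun _ => (c : ℝ) := const (Nat.cast_nonneg c)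

lemma one : SubPow σ 0 fun _ => 1 := const zero_le_one

lemma add (h : SubPow σ s q) (h' : SubPow σ s r) : SubPow σ s fun a => q a + r a := by
  refine ⟨fun a => add_nonneg (h.1 a) (h'.1 a), fun η hη => ?_⟩
  obtain ⟨K, hK, h2⟩ := h.2 η hη
  obtain ⟨L, hL, h3⟩ := h'.2 η hη
  refine ⟨K + L, by linarith, fun a => ?_⟩
  rw [add_mul]
  exact add_le_add (h2 a) (h3 a)

lemma mul (h : SubPow σ s q) (h' : SubPow σ t r) : SubPow σ (s + t) fun a => q a * r a := by
  refine ⟨fun a => mul_nonneg (h.1 a) (h'.1 a), fun η hη => ?_⟩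
  obtain ⟨K, hK, h2⟩ := h.2 (η / 2) (by linarith)
  obtain ⟨L, hL, h3⟩ := h'.2 (η / 2) (by linarith)
  refine ⟨K * L, by positivity, fun a => ?_⟩
  have hp : (0 : ℝ) < (σ a : ℝ) + 1 := by positivity
  calc q a * r a ≤ (K * ((σ a : ℝ) + 1) ^ (s + η / 2)) * (L * ((σ a : ℝ) + 1) ^ (t + η / 2)) :=
        mul_le_mul (h2 a) (h3 a) (h'.1 a) (by positivity)
    _ = K * L * (((σ a : ℝ) + 1) ^ (s + η / 2) * ((σ a : ℝ) + 1) ^ (t + η / 2)) := by ring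
    _ = _ := by rw [← Real.rpow_add hp]; ring_nf

lemma const_mul (c : ℕ) (h : SubPow σ s q) : SubPow σ s fun a => (c : ℝ) * q a := by
  simpa using (natCast c).mul h

lemma mul_zero (h : SubPow σ s q) (h' : SubPow σ 0 r) : SubPow σ s fun a => q a * r a := by
  simpa using h.mul h'

lemma rpow (h : SubPow σ s q) {p : ℝ} (hp : 0 < p) : SubPow σ (s * p) fun a => q a ^ p := by
  refine ⟨fun a => Real.rpow_nonneg (h.1 a) _, fun η hη => ?_⟩
  obtain ⟨K, hK, h2⟩ := h.2 (η / p) (by positivity)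
  refine ⟨K ^ p, Real.rpow_nonneg hK _, fun a => ?_⟩
  have hb : (0 : ℝ) ≤ (σ a : ℝ) + 1 := by positivity
  calc q a ^ p ≤ (K * ((σ a : ℝ) + 1) ^ (s + η / p)) ^ p :=
        Real.rpow_le_rpow (h.1 a) (h2 a) hp.le
    _ = K ^ p * ((σ a : ℝ) + 1) ^ ((s + η / p) * p) := by
        rw [Real.mul_rpow hK (Real.rpow_nonneg hb _), ← Real.rpow_mul hb]
    _ = _ := by congr 2; field_simp

lemma size : SubPow σ 1 fun a => (σ a : ℝ) := by
  refine ⟨fun a => by positivity, fun η hη => ⟨1, zero_le_one, fun a => ?_⟩⟩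
  rw [one_mul]
  calc (σ a : ℝ) ≤ ((σ a : ℝ) + 1) ^ (1 : ℝ) := by rw [Real.rpow_one]; linarith
    _ ≤ _ := Real.rpow_le_rpow_of_exponent_le (one_le_size _) (by linarith)

lemma log : SubPow σ 0 fun a => ((Nat.log 2 (σ a + 1) + 1 : ℕ) : ℝ) := by
  refine ⟨fun a => by positivity, fun η hη => ⟨1 / η / Real.log 2 + 1, ?_, fun a => ?_⟩⟩
  · have := Real.log_pos (by norm_num : (1 : ℝ) < 2)
    positivity
  · have hl := Real.log_pos (by norm_num : (1 : ℝ) < 2)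
    have h1 : (Nat.log 2 (σ a + 1) : ℝ) ≤ Real.log ((σ a : ℝ) + 1) / Real.log 2 := by
      have := Real.natLog_le_logb (σ a + 1) 2
      rw [Real.logb] at this
      exact_mod_cast this
    have h2 := Real.log_le_rpow_div (by positivity : (0 : ℝ) ≤ (σ a : ℝ) + 1) hη
    have h3 : (1 : ℝ) ≤ ((σ a : ℝ) + 1) ^ η := Real.one_le_rpow (one_le_size _) hη.le
    simp only [zero_add, Nat.cast_add, Nat.cast_one, add_mul, one_mul]
    refine add_le_add (h1.trans ?_) h3
    calc Real.log ((σ a : ℝ) + 1) / Real.log 2 ≤ ((σ a : ℝ) + 1) ^ η / η / Real.log 2 := by gcongr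
      _ = _ := by ring

end SubPow

/-! ### Estimates for the parameters -/

/-- By minimality the previous exponent, a quarter of this one, was still too small for `X`; the
last summand covers the case that no round is made. -/
lemma blockLen_sq_le (X : ℕ) (hX : 1 ≤ X) : blockLen X * blockLen X ≤ 4 * Nat.log 2 X + 4 := by
  unfold blockLen
  rcases Nat.eq_zero_or_pos (rounds X) with h | h
  · rw [h]; simp
  · have h1 := Nat.find_min (exists_lt_two_pow_four_pow X) (m := rounds X - 1)
      (by unfold rounds at h ⊢; omega)
    have h2 : 4 ^ (rounds X - 1) ≤ Nat.log 2 X :=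
      (Nat.le_log_iff_pow_le (by norm_num) (by omega)).mpr (not_lt.mp h1)
    have h3 : 2 ^ rounds X * 2 ^ rounds X = 4 * 4 ^ (rounds X - 1) := by
      rw [← mul_pow, ← pow_succ', Nat.sub_add_cancel h]
      norm_num
    omega

/-- The largest number of bits. -/
def SumInstance.bits {k : ℕ} (I : SumInstance k) : ℕ :=
  Finset.univ.sup fun i => Finset.univ.sup fun j => len (I.x i j)

lemma SumInstance.len_le_bits {k : ℕ} (I : SumInstance k) (i : Fin k) (j : Fin I.n) :
    len (I.x i j) ≤ I.bits :=
  (Finset.le_sup (f := fun j => len (I.x i j)) (Finset.mem_univ j)).trans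
    (Finset.le_sup (f := fun i => Finset.univ.sup fun j => len (I.x i j)) (Finset.mem_univ i))

lemma SumInstance.size_eq {k : ℕ} (I : SumInstance k) : (kSum k).size I = I.n * I.bits := rfl

lemma SumInstance.n_le_size {k : ℕ} (hk : 0 < k) (I : SumInstance k) : I.n ≤ (kSum k).size I := by
  rw [I.size_eq]
  rcases Nat.eq_zero_or_pos I.n with h | h
  · simp [h]
  · exact Nat.le_mul_of_pos_right _ ((one_le_len _).trans (I.len_le_bits ⟨0, hk⟩ ⟨0, h⟩))

lemma SumInstance.bits_le_size {k : ℕ} (I : SumInstance k) : I.bits ≤ (kSum k).size I := by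
  rw [I.size_eq]
  rcases Nat.eq_zero_or_pos I.n with h | h
  · rw [h, zero_mul, bits, Nat.le_zero, ← bot_eq_zero, Finset.sup_eq_bot_iff]
    intro i _
    rw [Finset.sup_eq_bot_iff]
    intro j
    exact absurd j.2 (by omega)
  · exact Nat.le_mul_of_pos_left _ h

/-! ### The parameters in terms of the size of the instance -/

namespace Layout
variable {k : ℕ} (Y : Layout k)

lemma mem_eq_x (I : SumInstance k) {z : ℤ} (h1 : 1 ≤ z) (h2 : z ≤ (k * I.n : ℕ)) :
    ∃ i j, (initial ((kSum k).input I)).mem z = I.x i j := by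
  obtain ⟨u, rfl⟩ : ∃ u : ℕ, z = 1 + u := ⟨(z - 1).toNat, by omega⟩
  have hu : u < k * I.n := by omega
  set v : Fin (k * I.n) := ⟨u, hu⟩
  refine ⟨v.divNat, v.modNat, ?_⟩
  rw [← (initial_mem_sum I).2.1]
  congr 1
  have : (v.divNat : ℕ) * I.n + (v.modNat : ℕ) = u := by
    simp only [Fin.coe_divNat, Fin.coe_modNat, v]
    exact Nat.div_add_mod' u I.n
  rw [← this]
  push_cast
  ring

lemma bound_le (I : SumInstance k) : bound I ≤ (k * I.n + 1) * 4 ^ I.bits := by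
  have h1 : ∀ j ∈ Finset.range (k * I.n),
      ((initial ((kSum k).input I)).mem (((k * I.n : ℕ) : ℤ) - j)).natAbs ^ 2 ≤ 4 ^ I.bits := by
    intro j hj
    have hj' := Finset.mem_range.mp hj
    obtain ⟨a, b, hab⟩ := mem_eq_x I (z := ((k * I.n : ℕ) : ℤ) - j) (by omega) (by omega)
    rw [hab]
    have h2 : (I.x a b).natAbs < 2 ^ I.bits :=
      len_le_iff.mp ((I.len_le_bits a b).trans (Nat.le_succ _))
    calc (I.x a b).natAbs ^ 2 ≤ (2 ^ I.bits) ^ 2 := Nat.pow_le_pow_left h2.le 2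
      _ = 4 ^ I.bits := by rw [← pow_mul, mul_comm, pow_mul]; norm_num
  have h2 := Finset.sum_le_sum h1
  rw [Finset.sum_const, Finset.card_range, smul_eq_mul] at h2
  have h3 : 1 ≤ 4 ^ I.bits := Nat.one_le_pow _ _ (by norm_num)
  unfold bound sqSum
  rw [add_mul, one_mul]
  omega

lemma bits_le (I : SumInstance k) : I.bits ≤ blockLen (bound I) * blockLen (bound I) + 2 := by
  refine Finset.sup_le fun i _ => Finset.sup_le fun j _ => ?_
  have h := abs_le_of_bound I i j
  rw [← Int.natCast_natAbs] at h
  calc len (I.x i j) ≤ len ((I.x i j).natAbs : ℤ) := len_le_of_natAbs_le (by rw [Int.natAbs_natCast])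
    _ ≤ _ := len_le_of_le_two_pow (by exact_mod_cast h) le_rfl

/-- The logarithm of the size, plus one. -/
def sizeLog (I : SumInstance k) : ℕ := Nat.log 2 ((kSum k).size I + 1) + 1

lemma size_lt (I : SumInstance k) : (kSum k).size I + 1 < 2 ^ sizeLog I :=
  Nat.lt_pow_succ_log_self (by norm_num) _

lemma blockLen_le (hk : 0 < k) (I : SumInstance k) :
    blockLen (bound I) * blockLen (bound I) ≤ 8 * I.bits + (4 * k + 8) * sizeLog I := by
  have hX : 1 ≤ bound I := by unfold bound sqSum; omega
  have h1 : bound I < 2 ^ (k + sizeLog I + 2 * I.bits) := by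
    refine (bound_le I).trans_lt ?_
    rw [pow_add, pow_mul, show 2 ^ 2 = 4 by norm_num, pow_add]
    refine Nat.mul_lt_mul_of_pos_right ?_ (by positivity)
    have h2 : k * I.n + 1 ≤ k * ((kSum k).size I + 1) := by
      have := Nat.mul_le_mul_left k (I.n_le_size hk)
      rw [mul_add]
      omega
    exact h2.trans_lt (Nat.mul_lt_mul'' Nat.lt_two_pow_self (size_lt I))
  have h2 := Nat.log_lt_of_lt_pow (by omega) h1
  have h3 := blockLen_sq_le _ hX
  have h4 : k ≤ k * sizeLog I := Nat.le_mul_of_pos_right _ (by unfold sizeLog; omega)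
  have h5 : 1 ≤ sizeLog I := by unfold sizeLog; omega
  have h6 : (4 * k + 8) * sizeLog I = 4 * (k * sizeLog I) + 8 * sizeLog I := by ring
  omega

lemma logSize_le (hk : 0 < k) (I : SumInstance k) :
    logSize I.n (bound I) ≤ (4 * k + 20) * sizeLog I := by
  have h0 : 1 ≤ sizeLog I := by unfold sizeLog; omega
  have hs := size_lt I
  have h1 : I.n + 1 ≤ 2 ^ sizeLog I := by have := I.n_le_size hk; omega
  have h2 : blockLen (bound I) * blockLen (bound I) + 1 ≤
      2 ^ ((4 * k + 17) + 2 * sizeLog I) := by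
    have h3 := blockLen_le hk I
    have h4 : I.bits + 1 ≤ 2 ^ sizeLog I := by have := I.bits_le_size; omega
    have h5 : sizeLog I ≤ 2 ^ sizeLog I := Nat.lt_two_pow_self.le
    have h6 : 4 * k + 17 ≤ 2 ^ (4 * k + 17) := Nat.lt_two_pow_self.le
    have h7 : (4 * k + 8) * sizeLog I ≤ (4 * k + 8) * 2 ^ sizeLog I := Nat.mul_le_mul_left _ h5
    have h8 : (4 * k + 17) * 2 ^ sizeLog I ≤ 2 ^ (4 * k + 17) * 2 ^ sizeLog I :=
      Nat.mul_le_mul_right _ h6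
    have h9 : 2 ^ (4 * k + 17) * 2 ^ sizeLog I ≤ 2 ^ ((4 * k + 17) + 2 * sizeLog I) := by
      rw [← pow_add]; exact Nat.pow_le_pow_right (by norm_num) (by omega)
    have h10 : (4 * k + 17) * 2 ^ sizeLog I = (4 * k + 8) * 2 ^ sizeLog I + 9 * 2 ^ sizeLog I := by
      ring
    omega
  refine (Nat.clog_le_of_le_pow (y := sizeLog I + ((4 * k + 17) + 2 * sizeLog I)) ?_).trans ?_
  · rw [pow_add]; exact Nat.mul_le_mul h1 h2
  · have : 4 * k + 17 ≤ (4 * k + 17) * sizeLog I := Nat.le_mul_of_pos_right _ h0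
    have h3 : (4 * k + 20) * sizeLog I = (4 * k + 17) * sizeLog I + 3 * sizeLog I := by ring
    omega

/-- Together with `logSize_le` this makes `logSize`, which the program can compute, comparable to
the logarithm of the true size. The present direction expresses the error bounds, and the lower
bound for the sizes of the queries, by the size of the instance. -/
lemma log_size_le (I : SumInstance k) :
    Nat.log 2 ((kSum k).size I + 1) ≤ logSize I.n (bound I) + 1 := by
  have h1 : (kSum k).size I + 1 ≤ 2 ^ (logSize I.n (bound I) + 1) := by
    have h2 : (I.n + 1) * (blockLen (bound I) * blockLen (bound I) + 1) ≤
      2 ^ logSize I.n (bound I) := Nat.le_pow_clog (by norm_num) _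
    have h3 := Nat.mul_le_mul_left I.n (bits_le I)
    rw [I.size_eq, pow_succ]
    nlinarith
  exact (Nat.log_mono_right h1).trans (Nat.log_pow (by norm_num) _).le

/-- The number of cells is not much larger than necessary. -/
lemma cells_le (n X : ℕ) :
    (2 ^ Y.expo n X) ^ Y.kap ≤ 2 ^ Y.kap * (n * logSize n X + 1) := by
  rcases Nat.eq_zero_or_pos (Y.expo n X) with h | h
  · rw [h, pow_zero, one_pow]
    exact Nat.mul_pos (by positivity) (by omega)
  · have h1 := Nat.find_min (Y.exists_le_pow (n * logSize n X)) (m := Y.expo n X - 1)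
      (by unfold expo at h ⊢; omega)
    obtain ⟨e, he⟩ : ∃ e, Y.expo n X = e + 1 := ⟨Y.expo n X - 1, by omega⟩
    rw [he, Nat.add_sub_cancel] at h1
    rw [he, pow_succ, mul_pow, mul_comm]
    exact Nat.mul_le_mul_left _ (by omega)

lemma le_cells (n X : ℕ) : n * logSize n X ≤ (2 ^ Y.expo n X) ^ Y.kap :=
  Nat.find_spec (Y.exists_le_pow (n * logSize n X))

lemma expo_le (hk : 0 < k) (I : SumInstance k) : Y.kap * Y.expo I.n (bound I) ≤
    Y.kap + sizeLog I + logSize I.n (bound I) := by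
  have h1 := Y.cells_le I.n (bound I)
  have h2 : I.n * logSize I.n (bound I) + 1 ≤ 2 ^ (sizeLog I + logSize I.n (bound I)) := by
    have h3 : I.n + 1 ≤ 2 ^ sizeLog I := by
      have := I.n_le_size hk
      have := size_lt I
      omega
    have h4 : logSize I.n (bound I) + 1 ≤ 2 ^ logSize I.n (bound I) := Nat.lt_two_pow_self
    rw [pow_add]
    nlinarith
  rw [← pow_mul, mul_comm] at h1
  have h5 := h1.trans (Nat.mul_le_mul_left _ h2)
  rw [← pow_add] at h5
  have := (Nat.pow_le_pow_iff_right (by norm_num)).mp h5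
  omega

end Layout

namespace Layout
variable {k : ℕ} (Y : Layout k)

/-! ### The growth of the parameters -/

lemma subPow_sizeLog : SubPow (kSum k).size 0 fun I : SumInstance k => (sizeLog I : ℝ) :=
  SubPow.log

lemma subPow_logSize (hk : 0 < k) :
    SubPow (kSum k).size 0 fun I : SumInstance k => (logSize I.n (bound I) : ℝ) :=
  (subPow_sizeLog.const_mul (4 * k + 20)).of_le (fun _ => by positivity)
    fun I => by exact_mod_cast logSize_le hk I

lemma subPow_kap_expo (hk : 0 < k) :
    SubPow (kSum k).size 0 fun I : SumInstance k => (Y.kap : ℝ) * Y.expo I.n (bound I) :=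
  (((SubPow.natCast Y.kap).add subPow_sizeLog).add (subPow_logSize hk)).of_le
    (fun _ => by positivity) fun I => by exact_mod_cast Y.expo_le hk I

lemma subPow_expo (hk : 0 < k) :
    SubPow (kSum k).size 0 fun I : SumInstance k => (Y.expo I.n (bound I) : ℝ) :=
  (Y.subPow_kap_expo hk).of_le (fun _ => by positivity) fun I => by
    have : Y.expo I.n (bound I) ≤ Y.kap * Y.expo I.n (bound I) :=
      Nat.le_mul_of_pos_left _ Y.kap_pos
    exact_mod_cast this

lemma subPow_simLen (hk : 0 < k) :
    SubPow (kSum k).size 0 fun I : SumInstance k => (Y.simLen I.n (bound I) : ℝ) := by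
  have h := ((((SubPow.natCast (σ := (kSum k).size)
    (Y.lenConst + k * k + 3 * k + Y.h + Y.typeFactor)).add
    ((Y.subPow_expo hk).const_mul Y.lam)).add ((Y.subPow_kap_expo hk).add
      ((subPow_logSize hk).const_mul (k + 1)))).add (SubPow.natCast 5))
  refine h.of_le (fun _ => by positivity) fun I => le_of_eq ?_
  rw [simLen, hashBits]
  push_cast
  ring

lemma subPow_n (hk : 0 < k) : SubPow (kSum k).size 1 fun I : SumInstance k => (I.n : ℝ) :=
  SubPow.size.of_le (fun _ => by positivity) fun I => by exact_mod_cast I.n_le_size hk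

lemma subPow_blockLen_sq (hk : 0 < k) : SubPow (kSum k).size 1 fun I : SumInstance k =>
    ((blockLen (bound I) * blockLen (bound I) : ℕ) : ℝ) := by
  have h := (SubPow.size (σ := (kSum k).size)).const_mul 8 |>.add
    ((subPow_sizeLog.const_mul (4 * k + 8)).mono zero_le_one)
  refine h.of_le (fun _ => by positivity) fun I => ?_
  have h1 := (blockLen_le hk I).trans (Nat.add_le_add_right
    (Nat.mul_le_mul_left 8 I.bits_le_size) _)
  exact_mod_cast h1

lemma subPow_blockLen (hk : 0 < k) :
    SubPow (kSum k).size (1 / 2) fun I : SumInstance k => (blockLen (bound I) : ℝ) := by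
  have h := (subPow_blockLen_sq hk).rpow (p := 1 / 2) (by norm_num)
  rw [one_mul] at h
  refine h.of_le (fun _ => by positivity) fun I => le_of_eq ?_
  rw [← Real.sqrt_eq_rpow, Nat.cast_mul, Real.sqrt_mul_self (by positivity)]

lemma subPow_maxLen (hk : 0 < k) :
    SubPow (kSum k).size 1 fun I : SumInstance k => (Y.maxLen I.n (bound I) : ℝ) := by
  have h := (((Y.subPow_simLen hk).mono zero_le_one).add (subPow_blockLen_sq hk)).add
    ((SubPow.natCast 2).mono zero_le_one)
  refine h.of_le (fun _ => by positivity) fun I => le_of_eq ?_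
  rw [maxLen]
  push_cast
  ring

/-- Separate bounds for the two factors would only give exponent `2`. The gain comes from `n` times
the number of bits being the size itself, the rest of `maxLen` being logarithmic. -/
lemma subPow_n_mul_maxLen (hk : 0 < k) : SubPow (kSum k).size 1 fun I : SumInstance k =>
    (I.n : ℝ) * Y.maxLen I.n (bound I) := by
  have h := ((subPow_n hk).mul_zero (Y.subPow_simLen hk)).add
    (((SubPow.size (σ := (kSum k).size)).const_mul 8 |>.add
    ((subPow_n hk).mul_zero (subPow_sizeLog.const_mul (4 * k + 8)))).add
      ((subPow_n hk).const_mul 2))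
  refine h.of_le (fun _ => by positivity) fun I => ?_
  have h1 : I.n * Y.maxLen I.n (bound I) ≤ I.n * Y.simLen I.n (bound I) +
      (8 * (kSum k).size I + I.n * ((4 * k + 8) * sizeLog I) + 2 * I.n) := by
    have h2 := Nat.mul_le_mul_left I.n (blockLen_le hk I)
    rw [I.size_eq, maxLen]
    nlinarith
  exact_mod_cast h1

lemma subPow_cells (hk : 0 < k) : SubPow (kSum k).size 1 fun I : SumInstance k =>
    (((2 ^ Y.expo I.n (bound I)) ^ Y.kap : ℕ) : ℝ) := by
  have h := (((subPow_n hk).mul_zero (subPow_logSize hk)).add (SubPow.one.mono zero_le_one)).const_mul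
    (2 ^ Y.kap)
  exact h.of_le (fun _ => by positivity) fun I => by exact_mod_cast Y.cells_le I.n (bound I)

/-- The number of nodes in a part is the power `lam / kap` of the number of cells, which is the size
up to logarithmic factors. -/
lemma subPow_nodes (hk : 0 < k) : SubPow (kSum k).size ((Y.lam : ℝ) / Y.kap)
    fun I : SumInstance k => (((2 ^ Y.expo I.n (bound I)) ^ Y.lam : ℕ) : ℝ) := by
  have hkap : (0 : ℝ) < Y.kap := by exact_mod_cast Y.kap_pos
  have hlam : (0 : ℝ) < Y.lam := by exact_mod_cast Y.lam_pos
  have h := (Y.subPow_cells hk).rpow (p := (Y.lam : ℝ) / Y.kap) (by positivity)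
  rw [one_mul] at h
  refine h.of_le (fun _ => by positivity) fun I => le_of_eq ?_
  push_cast
  rw [← Real.rpow_natCast _ Y.kap, ← Real.rpow_mul (by positivity), mul_div_cancel₀ _ hkap.ne',
    Real.rpow_natCast]

/-- A bound for the size of the queries. -/
noncomputable def querySize (I : SumInstance k) : ℕ :=
  Y.h * (2 ^ Y.expo I.n (bound I)) ^ Y.lam * Y.simLen I.n (bound I)

lemma subPow_querySize (hk : 0 < k) : SubPow (kSum k).size ((Y.lam : ℝ) / Y.kap)
    fun I : SumInstance k => (Y.querySize I : ℝ) := by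
  have h := ((Y.subPow_nodes hk).const_mul Y.h).mul_zero (Y.subPow_simLen hk)
  refine h.of_le (fun _ => by positivity) fun I => le_of_eq ?_
  simp only [querySize]
  push_cast
  ring

/-- The threshold `3 / 2` comes from drawing the multiplier, where `blockLen` has exponent `1 / 2`
and `maxLen` exponent `1`. The queries are slowed down only by `simLen`, which does not involve the
length of the input numbers. -/
lemma subPow_programTime (hk : 0 < k) (c : Prog) {T : SumInstance k → ℕ} {s : ℝ} (hs : 3 / 2 ≤ s)
    (hT : SubPow (kSum k).size s fun I => (T I : ℝ)) :
    SubPow (kSum k).size s fun I => (Y.programTime c I.n (bound I) (T I) : ℝ) := by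
  have h1 := (((Y.subPow_n_mul_maxLen hk).const_mul k).mono (t := 3 / 2) (by norm_num)).add
    ((((subPow_blockLen hk).add ((Y.subPow_simLen hk).mono (by norm_num))).add
      (SubPow.one.mono (by norm_num))).mul (Y.subPow_maxLen hk) |>.mono (t := 3 / 2) (by norm_num))
  have h2 := (hT.mul_zero ((Y.subPow_simLen hk).add SubPow.one)).const_mul (k * k * Y.callCost c)
  have h3 := (((h1.mono hs).const_mul Y.programCost).add h2).add (SubPow.one.mono (by linarith))
  refine h3.of_le (fun _ => by positivity) fun I => le_of_eq ?_
  rw [programTime]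
  push_cast
  ring

/-! ### The error probability -/

open Classical in
-- The parameters are chosen for this estimate. The factor `R` of the range makes `n ^ k * G` at
-- most `M`, and `n * G ≤ C` makes `n * G * R` at most `M`; so both counts in `card_not_goodMul_le`
-- are at most a constant times `M * D / G`. The constant `42` is `3 * (6 + 8)`, with `3` from
-- `sizeLog I ≤ 3 * G`.
lemma avg_not_goodMul_le (hk : 0 < k) (I : SumInstance k) :
    avg (Y.range I.n (bound I) * 2 ^ (blockLen (bound I) * blockLen (bound I)))
      (fun a => if GoodMul I.x (Y.range I.n (bound I))
        (2 ^ (blockLen (bound I) * blockLen (bound I))) ((2 ^ Y.expo I.n (bound I)) ^ Y.kap) a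
        then 0 else 1) ≤ ((42 * k : ℕ) : ℝ≥0∞) / (sizeLog I : ℝ≥0∞) := by
  set G := logSize I.n (bound I) with hG
  set D := 2 ^ (blockLen (bound I) * blockLen (bound I)) with hD
  set C := (2 ^ Y.expo I.n (bound I)) ^ Y.kap with hC
  set M := Y.range I.n (bound I) with hM
  set R := (2 ^ G) ^ (k + 1) with hR
  have hMC : M = R * C := by
    rw [hM, range, pow_add, hR, hC, ← pow_mul, ← pow_mul, mul_comm G, mul_comm Y.kap, mul_comm]
  have hDp : 0 < D := by positivity
  have hCp : 0 < C := by positivity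
  have hMp : 0 < M := by rw [hMC]; positivity
  have hcard := card_not_goodMul_le hk I.x (D := D) hDp hMp hMC (abs_le_of_bound I)
  rw [avg_indicator]
  set A := ((Finset.range (M * D)).filter fun a : ℕ => ¬ GoodMul I.x M D C a).card
  have hn : I.n ≤ 2 ^ G := (Nat.le_succ _).trans (succ_le_two_pow_logSize _ _)
  have hGle : G ≤ 2 ^ G := Nat.lt_two_pow_self.le
  have h1 : I.n ^ k * G ≤ M := by
    calc I.n ^ k * G ≤ (2 ^ G) ^ k * 2 ^ G := Nat.mul_le_mul (Nat.pow_le_pow_left hn k) hGle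
      _ = R := (pow_succ _ _).symm
      _ ≤ M := hMC ▸ Nat.le_mul_of_pos_right _ hCp
  have h2 : I.n * G * R ≤ M := by
    rw [hMC, mul_comm R]
    exact Nat.mul_le_mul_right _ (Y.le_cells I.n (bound I))
  have hlog : sizeLog I ≤ 3 * G := by
    have := log_size_le I
    have := logSize_pos I.n (bound I)
    unfold sizeLog
    omega
  have h3 : A * sizeLog I ≤ 42 * k * (M * D) := by
    calc A * sizeLog I ≤ (6 * k * I.n ^ k * D + 8 * k * I.n * R * D) * (3 * G) :=
          Nat.mul_le_mul hcard hlog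
      _ = 3 * (6 * k * D * (I.n ^ k * G) + 8 * k * D * (I.n * G * R)) := by ring
      _ ≤ 3 * (6 * k * D * M + 8 * k * D * M) := by gcongr
      _ = _ := by ring
  have hl : (sizeLog I : ℝ≥0∞) ≠ 0 := by
    rw [Ne, Nat.cast_eq_zero]; unfold sizeLog; omega
  rw [ENNReal.div_le_iff (by exact_mod_cast (Nat.mul_pos hMp hDp).ne') (ENNReal.natCast_ne_top _),
    ← ENNReal.mul_div_right_comm, ENNReal.le_div_iff_mul_le (Or.inl hl)
      (Or.inl (ENNReal.natCast_ne_top _))]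
  exact_mod_cast h3

/-- The largest error probability for sizes at least `m`. -/
noncomputable def tailError (err : ℕ → ℝ≥0∞) (m : ℕ) : ℝ≥0∞ := ⨆ i ≥ m, min (err i) 1

lemma tailError_le_one (err : ℕ → ℝ≥0∞) (m : ℕ) : tailError err m ≤ 1 :=
  iSup₂_le fun _ _ => min_le_right _ _

lemma le_tailError (err : ℕ → ℝ≥0∞) {m i : ℕ} (h : m ≤ i) : min (err i) 1 ≤ tailError err m :=
  le_iSup₂ (f := fun i (_ : i ≥ m) => min (err i) 1) i h

/-- The size of a query is known only from below, and `err` need not be monotone, so the supremum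
over all larger sizes is used. The truncation at `1` keeps it finite even if early values of `err`
are not. -/
lemma tendsto_tailError {err : ℕ → ℝ≥0∞} (h : Filter.Tendsto err Filter.atTop (𝓝 0)) :
    Filter.Tendsto (tailError err) Filter.atTop (𝓝 0) := by
  rw [ENNReal.tendsto_nhds_zero] at h ⊢
  intro ε hε
  obtain ⟨N, hN⟩ := Filter.eventually_atTop.mp (h ε hε)
  filter_upwards [Filter.eventually_ge_atTop N] with m hm
  exact iSup₂_le fun i hi => (min_le_left _ _).trans (hN i (hm.trans hi))

/-! ### The reduction -/

variable {Y} in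
/-- The program for `k`-SUM is correct. -/
lemma program_solves (hk : 0 < k) {c : Prog} {T : ℕ → ℕ} {err : ℕ → ℝ≥0∞}
    (hc : c.Solves (exactWeight Y.H) T err) {T' : ℕ → ℕ} {S : SumInstance k → ℕ}
    (hS : ∀ I m, 1 ≤ m → m ≤ Y.querySize I → T m ≤ S I) (hS1 : ∀ I, 1 ≤ S I)
    (hT' : ∀ I, Y.programTime c I.n (bound I) (S I) ≤ T' ((kSum k).size I)) :
    (Y.program c).Solves (kSum k) T' fun N => ((42 * k : ℕ) : ℝ≥0∞) / (Nat.log 2 (N + 1) + 1 : ℕ) +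
      (k * k : ℕ) * tailError err (Nat.log 2 (N + 1) - 1) := by
  classical
  intro I
  set M := Y.range I.n (bound I) with hM
  set D := 2 ^ (blockLen (bound I) * blockLen (bound I)) with hD
  set r := 2 ^ Y.expo I.n (bound I) with hr
  have hrp : 0 < r := by positivity
  have hMp : 0 < M := by rw [hM, range]; positivity
  have hDp : 0 < D := by positivity
  have hMu : M = 2 ^ Y.hashBits I.n (bound I) := rfl
  choose F hF using hc
  have hfin := finite_tabSpec hDp hMp (Nat.pow_pos hrp (n := Y.kap)) I.x
  -- The fuel of the given program depends on the queried instance, and this depends on the random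
  -- multiplier. As only finitely many tables can occur, one amount of fuel is enough for all of
  -- them.
  obtain ⟨B, hB⟩ := (hfin.image fun tab =>
    ∑ p : Fin k × Fin k, F (Y.query M r (sumOf M p) tab)).bddAbove
  set fuel := k * I.n + blockLen (bound I) + logSize I.n (bound I) + Y.expo I.n (bound I) +
    Y.hashBits I.n (bound I) + B with hfuel
  have hwp := wp_program (Y := Y) (fuel := fuel) (c := c) I hk rfl (hS1 I)
    (e := tailError err (Nat.log 2 ((kSum k).size I + 1) - 1)) (by omega) (by
    intro a tab htab p Ψ v hgood hbad
    have hsize : Y.hashBits I.n (bound I) ≤ (exactWeight Y.H).size (Y.query M r (sumOf M p) tab) :=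
      le_query_size hk hrp hMp p hMu.ge
    have hG : logSize I.n (bound I) ≤ Y.hashBits I.n (bound I) := by
      unfold hashBits
      have : logSize I.n (bound I) ≤ (k + 1) * logSize I.n (bound I) :=
        Nat.le_mul_of_pos_left _ (by omega)
      omega
    have hGp := logSize_pos I.n (bound I)
    have hle : (exactWeight Y.H).size (Y.query M r (sumOf M p) tab) ≤ Y.querySize I :=
      (query_size_le hDp hMp htab p hMu.le).trans
        (Nat.mul_le_mul_left _ (by unfold simLen; omega))
    have htime := hS I _ (by omega) hle
    -- The size of a query is at least `hashBits`, hence at least `logSize`, hence at least the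
    -- logarithm of the instance size minus one; this is the argument of `tailError`.
    have hlog := log_size_le I
    have hfu : F (Y.query M r (sumOf M p) tab) ≤ fuel := by
      have h1 := hB ⟨tab, ⟨a, htab⟩, rfl⟩
      have h2 := Finset.single_le_sum (f := fun p => F (Y.query M r (sumOf M p) tab))
        (fun _ _ => Nat.zero_le _) (Finset.mem_univ p)
      simp only at h1 h2
      omega
    obtain ⟨h1, h2⟩ := hF (Y.query M r (sumOf M p) tab)
    refine (wp_antitone_fuel hfu c Ψ _).trans ((wp_le_of_solves h1
      (err := min (err ((exactWeight Y.H).size (Y.query M r (sumOf M p) tab))) 1)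
      (le_min h2 ?_) v (fun s hs => hgood s (hs.trans htime))
      fun s hs => hbad s (hs.trans htime)).trans ?_)
    · rw [PMF.toOuterMeasure_apply]
      exact (ENNReal.tsum_le_tsum fun o => Set.indicator_le_self _ _ _).trans (PMF.tsum_coe _).le
    · exact add_le_add_right (le_tailError err (by omega)) _)
  refine ⟨fuel, ?_⟩
  have hpen : ∀ s, penalty (T' ((kSum k).size I)) ((kSum k).Yes I) s ≤
      penalty (Y.programTime c I.n (bound I) (S I)) ((kSum k).Yes I) s := by
    intro s
    unfold penalty
    by_cases h : s.time ≤ Y.programTime c I.n (bound I) (S I)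
    · rw [if_pos h, if_pos (h.trans (hT' I))]
    · rw [if_neg h]; exact le_top
  refine solves_of_wp_le ?_ ((wp_mono fuel _ hpen _).trans (hwp.trans
    (add_le_add_left (Y.avg_not_goodMul_le hk I) _)))
  refine ENNReal.add_ne_top.mpr ⟨?_, ?_⟩
  · refine (ENNReal.div_lt_top (ENNReal.natCast_ne_top _) ?_).ne
    rw [Ne, Nat.cast_eq_zero]; omega
  · exact ENNReal.mul_ne_top (ENNReal.natCast_ne_top _)
      ((tailError_le_one _ _).trans_lt ENNReal.one_lt_top).ne

end Layout

lemma tendsto_log_succ : Filter.Tendsto (fun N => Nat.log 2 (N + 1)) Filter.atTop Filter.atTop := by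
  refine Filter.tendsto_atTop.mpr fun b => ?_
  filter_upwards [Filter.eventually_ge_atTop (2 ^ b)] with N hN
  exact (Nat.le_log_iff_pow_le (by norm_num) (by omega)).mpr (by omega)

/-- A time bound that holds for large sizes holds for all positive sizes with another constant. -/
lemma exists_const_of_isBigO {T : ℕ → ℕ} {f : ℕ → ℝ} (hf : ∀ m, 1 ≤ m → 1 ≤ f m)
    (h : (fun n => (T n : ℝ)) =O[Filter.atTop] f) :
    ∃ K : ℝ, 0 ≤ K ∧ ∀ m, 1 ≤ m → (T m : ℝ) ≤ K * f m := by
  obtain ⟨C, hC, hb⟩ := h.exists_pos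
  obtain ⟨N, hN⟩ := Filter.eventually_atTop.mp hb.bound
  refine ⟨C + ∑ i ∈ Finset.range N, (T i : ℝ), by positivity, fun m hm => ?_⟩
  have h1 := hf m hm
  have hs : 0 ≤ ∑ i ∈ Finset.range N, (T i : ℝ) := by positivity
  rcases lt_or_ge m N with hmN | hmN
  · have h2 : (T m : ℝ) ≤ ∑ i ∈ Finset.range N, (T i : ℝ) :=
      Finset.single_le_sum (f := fun i => (T i : ℝ)) (fun _ _ => by positivity)
        (Finset.mem_range.mpr hmN)
    nlinarith
  · have h2 := hN m hmN
    rw [Real.norm_of_nonneg (by positivity), Real.norm_of_nonneg (by linarith)] at h2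
    nlinarith

/-- A larger function gives a weaker time bound. -/
lemma Problem.SolvableInTime.mono {P : Problem} {f g : ℕ → ℝ} (h : P.SolvableInTime f)
    (hfg : ∀ n, 1 ≤ n → 0 ≤ f n ∧ f n ≤ g n) : P.SolvableInTime g := by
  obtain ⟨c, T, err, h1, h2, h3⟩ := h
  refine ⟨c, T, err, h1, h2.trans (Asymptotics.IsBigO.of_bound 1 ?_), h3⟩
  filter_upwards [Filter.eventually_ge_atTop 1] with n hn
  obtain ⟨h4, h5⟩ := hfg n hn
  rw [Real.norm_of_nonneg h4, Real.norm_of_nonneg (h4.trans h5), one_mul]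
  exact h5

/-! ### Transfer of running times from Exact-Weight-`H` to `k`-SUM -/

namespace Layout
variable {k : ℕ} {Y : Layout k}

/-- A fast algorithm for Exact-Weight-`H` gives a fast algorithm for `k`-SUM. -/
lemma solvableInTime_kSum (hk : 0 < k) {κ : ℝ} (hκ : κ * Y.lam = Y.kap) {γ η : ℝ} (hγ : 3 / 2 ≤ γ)
    (hη : 0 < η) (h : (exactWeight Y.H).SolvableInTime fun m => ((m : ℝ) ^ κ) ^ γ) :
    (kSum k).SolvableInTime fun n => (n : ℝ) ^ (γ + η) := by
  obtain ⟨c, T, err, hc, hO, herr⟩ := h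
  have hkap : (0 : ℝ) < Y.kap := by exact_mod_cast Y.kap_pos
  have hlam : (0 : ℝ) < Y.lam := by exact_mod_cast Y.lam_pos
  have hκ0 : 0 < κ := by
    by_contra hcon
    nlinarith
  have hβ : 0 < κ * γ := by positivity
  have hf : ∀ m : ℕ, ((m : ℝ) ^ κ) ^ γ = (m : ℝ) ^ (κ * γ) := fun m =>
    (Real.rpow_mul (by positivity) _ _).symm
  obtain ⟨K, hK, hTK⟩ := exists_const_of_isBigO (fun m hm => by
    rw [hf]; exact Real.one_le_rpow (by exact_mod_cast hm) hβ.le) hO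
  -- The given time bound need not be monotone, but its majorant is, so its value at the largest
  -- possible query size serves for all queries. The final `1` ensures positivity.
  set S : SumInstance k → ℕ := fun I => ⌈K * (Y.querySize I : ℝ) ^ (κ * γ)⌉₊ + 1 with hSdef
  have hS : ∀ I m, 1 ≤ m → m ≤ Y.querySize I → T m ≤ S I := by
    intro I m hm hle
    have h1 : (T m : ℝ) ≤ K * (Y.querySize I : ℝ) ^ (κ * γ) := by
      refine (hTK m hm).trans (mul_le_mul_of_nonneg_left ?_ hK)
      rw [hf]
      exact Real.rpow_le_rpow (by positivity) (by exact_mod_cast hle) hβ.le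
    have h2 : T m ≤ ⌈K * (Y.querySize I : ℝ) ^ (κ * γ)⌉₊ :=
      Nat.cast_le.mp (h1.trans (Nat.le_ceil _))
    exact h2.trans (Nat.le_succ _)
  have hSsub : SubPow (kSum k).size γ fun I => (S I : ℝ) := by
    have h1 := (Y.subPow_querySize hk).rpow hβ
    -- Queries have size about `n ^ (lam / kap)`, and `κ` is the reciprocal exponent, so the time
    -- for a query becomes `n ^ γ` up to the loss `η`.
    have h2 : (Y.lam : ℝ) / Y.kap * (κ * γ) = γ := by
      rw [← hκ]
      field_simp
    rw [h2] at h1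
    have h3 := ((SubPow.const hK).mul h1).add ((SubPow.natCast (σ := (kSum k).size) 2).mono
      (show (0 : ℝ) ≤ 0 + γ by linarith))
    rw [zero_add] at h3
    refine h3.of_le (fun _ => by positivity) fun I => ?_
    simp only [hSdef]
    have := (Nat.ceil_lt_add_one (show 0 ≤ K * (Y.querySize I : ℝ) ^ (κ * γ) by positivity)).le
    push_cast
    linarith
  obtain ⟨L, hL, hLb⟩ := (Y.subPow_programTime hk c hγ hSsub).2 η hη
  refine ⟨Y.program c, fun N => ⌈L * ((N : ℝ) + 1) ^ (γ + η)⌉₊, _, program_solves hk hc hS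
    (fun I => Nat.succ_le_succ (Nat.zero_le _))
    (fun I => Nat.cast_le.mp ((hLb I).trans (Nat.le_ceil _))), ?_, ?_⟩
  · refine Asymptotics.IsBigO.of_bound (L * 2 ^ (γ + η) + 1) ?_
    filter_upwards [Filter.eventually_ge_atTop 1] with N hN
    have hN' : (1 : ℝ) ≤ N := by exact_mod_cast hN
    have hpos : 0 < γ + η := by linarith
    have h1 : (1 : ℝ) ≤ (N : ℝ) ^ (γ + η) := Real.one_le_rpow hN' hpos.le
    rw [Real.norm_of_nonneg (by positivity), Real.norm_of_nonneg (by positivity)]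
    have h2 := (Nat.ceil_lt_add_one (show 0 ≤ L * ((N : ℝ) + 1) ^ (γ + η) by positivity)).le
    have h3 : ((N : ℝ) + 1) ^ (γ + η) ≤ 2 ^ (γ + η) * (N : ℝ) ^ (γ + η) := by
      rw [← Real.mul_rpow (by norm_num) (by positivity)]
      exact Real.rpow_le_rpow (by positivity) (by linarith) hpos.le
    calc _ ≤ _ := h2
      _ ≤ L * (2 ^ (γ + η) * (N : ℝ) ^ (γ + η)) + (N : ℝ) ^ (γ + η) := by gcongr
      _ = _ := by ring
  · have e1 : Filter.Tendsto (fun N : ℕ => ((42 * k : ℕ) : ℝ≥0∞) / (Nat.log 2 (N + 1) + 1 : ℕ))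
        Filter.atTop (𝓝 0) := by
      have := ENNReal.Tendsto.const_mul (a := ((42 * k : ℕ) : ℝ≥0∞))
        (ENNReal.tendsto_inv_nat_nhds_zero.comp
          ((Filter.tendsto_add_atTop_nat 1).comp tendsto_log_succ))
        (Or.inr (ENNReal.natCast_ne_top _))
      rw [mul_zero] at this
      exact this
    have e2 : Filter.Tendsto (fun N : ℕ => ((k * k : ℕ) : ℝ≥0∞) *
        tailError err (Nat.log 2 (N + 1) - 1)) Filter.atTop (𝓝 0) := by
      have := ENNReal.Tendsto.const_mul (a := ((k * k : ℕ) : ℝ≥0∞)) ((tendsto_tailError herr).comp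
        ((Filter.tendsto_sub_atTop_nat 1).comp tendsto_log_succ))
        (Or.inr (ENNReal.natCast_ne_top _))
      rw [mul_zero] at this
      exact this
    simpa using e1.add e2

/-- The lower bound for Exact-Weight-`H`. -/
theorem not_solvableInTime (hk : 3 ≤ k) (hsum : ∀ ε : ℝ, 0 < ε →
      ¬ (kSum k).SolvableInTime fun n => (n : ℝ) ^ ((⌈(k : ℝ) / 2⌉₊ : ℝ) - ε))
    {κ : ℝ} (hκ : κ * Y.lam = Y.kap) {δ : ℝ} (hδ : 0 < δ) :
    ¬ (exactWeight Y.H).SolvableInTime fun m =>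
      ((m : ℝ) ^ κ) ^ ((⌈(k : ℝ) / 2⌉₊ : ℝ) - δ) := by
  intro h
  have hc : (2 : ℝ) ≤ ⌈(k : ℝ) / 2⌉₊ := by
    have : 1 < ⌈(k : ℝ) / 2⌉₊ := by
      rw [Nat.lt_ceil]
      have : (3 : ℝ) ≤ k := by exact_mod_cast hk
      push_cast
      linarith
    exact_mod_cast this
  have hkap : (0 : ℝ) < Y.kap := by exact_mod_cast Y.kap_pos
  have hlam : (0 : ℝ) < Y.lam := by exact_mod_cast Y.lam_pos
  have hκ0 : 0 ≤ κ := by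
    by_contra hcon
    nlinarith
  -- Shrinking the gain to at most `1 / 2` keeps the exponent at `3 / 2` or more, because the
  -- ceiling is at least `2`. Half of the gain is then spent on the logarithmic factors.
  have hmin : 0 < min δ (1 / 2) := lt_min hδ (by norm_num)
  have h2 : (exactWeight Y.H).SolvableInTime fun m =>
      ((m : ℝ) ^ κ) ^ ((⌈(k : ℝ) / 2⌉₊ : ℝ) - min δ (1 / 2)) := by
    refine h.mono fun m hm => ⟨by positivity, ?_⟩
    refine Real.rpow_le_rpow_of_exponent_le ?_ (by linarith [min_le_left δ (1 / 2)])
    exact Real.one_le_rpow (by exact_mod_cast hm) hκ0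
  have h3 := solvableInTime_kSum (by omega) hκ
    (by linarith [min_le_right δ (1 / 2)]) (half_pos hmin) h2
  refine hsum _ (half_pos hmin) ?_
  convert h3 using 3
  ring

end Layout

/-! ### The four layouts -/

namespace Expr

/-- The remainder. -/
def rem (e f : Expr) : Expr := e - e / f * f

variable (e f : Expr) (s : Env)

@[simp] lemma eval_rem : (e.rem f).eval s = e.eval s % f.eval s := by
  simp only [rem, eval_sub, eval_mul, eval_div, Int.emod_def]
  ring

@[simp] lemma in_rem (S : Finset (Fin 64)) : (e.rem f).In S ↔ e.In S ∧ f.In S := by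
  simp [rem]

@[simp] lemma loadsLe_rem (l : ℕ) : (e.rem f).LoadsLe l s ↔ e.LoadsLe l s ∧ f.LoadsLe l s := by
  simp [rem]

lemma in_pow {S : Finset (Fin 64)} (n : ℕ) (h : e.In S) : (e.pow n).In S := by
  induction n with
  | zero => simp [pow]
  | succ n ih => simp [pow, h, ih]

/-- The sum of the `e / f ^ j` with `j < n`. -/
def shiftSum : ℕ → Expr
  | 0 => 0
  | n + 1 => shiftSum n + e / f.pow n

@[simp] lemma eval_shiftSum (n : ℕ) :
    (e.shiftSum f n).eval s = ∑ j ∈ Finset.range n, e.eval s / f.eval s ^ j := by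
  induction n with
  | zero => simp [shiftSum]
  | succ n ih => simp [shiftSum, ih, Finset.sum_range_succ]

lemma in_shiftSum {S : Finset (Fin 64)} (n : ℕ) (he : e.In S) (hf : f.In S) :
    (e.shiftSum f n).In S := by
  induction n with
  | zero => simp [shiftSum]
  | succ n ih => simp [shiftSum, ih, he, in_pow f n hf]

lemma loadsLe_shiftSum (n l : ℕ) (he : e.LoadsLe l s) (hf : f.LoadsLe l s) :
    (e.shiftSum f n).LoadsLe l s := by
  induction n with
  | zero => simp [shiftSum]
  | succ n ih => simp [shiftSum, ih, he, hf]

end Expr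

namespace Layout

/-- Every list is assigned to an edge at its own node. -/
noncomputable def ofNodes {k : ℕ} (H : SimpleGraph (Fin k)) (hH : ∀ v, ∃ u, H.Adj v u) :
    Layout k where
  h := k
  H := H
  src := id
  -- Any neighbour will do: the cell of a list is just the node chosen in its own part, and the edge
  -- is only a place for the weight.
  dst i := (hH i).choose
  adj i := (hH i).choose_spec
  noIso := hH
  kap := 1
  lam := 1
  kap_pos := one_pos
  lam_pos := one_pos
  cell _ := .var 41
  cell_in _ := by simp
  cell_loads _ _ _ := by simp
  cellF _ _ _ a _ := a
  cell_eval _ _ := rfl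
  cell_range _ _ _ _ _ _ ha _ := ⟨by positivity, by exact_mod_cast ha⟩
  complete r T c _ hc _ :=
    ⟨fun i => ⟨(c i).toNat, by have := hc i; omega⟩, fun i => Int.toNat_of_nonneg (hc i).1⟩

/-- A numbering of the nodes of the matching. -/
noncomputable def matchingEquiv (k : ℕ) : Fin (k * 2) ≃ Fin k × Bool :=
  (Fintype.equivFinOfCardEq (by simp)).symm

/-- The layout for the matching: every list has its own edge. -/
noncomputable def ofMatching (k : ℕ) : Layout k where
  h := k * 2
  H := (matchingGraph k).comap (matchingEquiv k)
  src i := (matchingEquiv k).symm (i, false)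
  dst i := (matchingEquiv k).symm (i, true)
  adj i := by simp [matchingGraph]
  noIso v := ⟨(matchingEquiv k).symm ((matchingEquiv k v).1, !(matchingEquiv k v).2), by
    simp [matchingGraph]⟩
  kap := 2
  lam := 1
  kap_pos := two_pos
  lam_pos := one_pos
  cell _ := .var 41 * .var 9 + .var 42
  cell_in _ := by simp
  cell_loads _ _ _ := by simp
  cellF _ r _ a b := a * r + b
  cell_eval _ _ := rfl
  cell_range _ r _ a b _ ha hb := by
    rw [pow_one] at ha hb
    refine ⟨by positivity, ?_⟩
    have : a * r + b < r ^ 2 := by nlinarith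
    exact_mod_cast this
  complete r T c hr hc _ := by
    have hrz : (0 : ℤ) < r := by exact_mod_cast hr
    -- The two ends of an edge are the two digits of the cell in base `r`, so the cells of different
    -- lists are independent.
    refine ⟨fun v => ⟨((if (matchingEquiv k v).2 then c (matchingEquiv k v).1 % r
      else c (matchingEquiv k v).1 / r).toNat), ?_⟩, fun i => ?_⟩
    · rw [pow_one]
      zify
      split_ifs
      · rw [Int.toNat_of_nonneg (Int.emod_nonneg _ hrz.ne')]
        exact Int.emod_lt_of_pos _ hrz
      · rw [Int.toNat_of_nonneg (Int.ediv_nonneg (hc _).1 hrz.le)]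
        refine Int.ediv_lt_of_lt_mul hrz ?_
        have := (hc (matchingEquiv k v).1).2
        push_cast at this
        nlinarith
    · simp only [Equiv.apply_symm_apply, Bool.false_eq_true, if_false, if_true]
      rw [Int.toNat_of_nonneg (Int.ediv_nonneg (hc _).1 hrz.le),
        Int.toNat_of_nonneg (Int.emod_nonneg _ hrz.ne')]
      exact Int.ediv_mul_add_emod _ _

/-- The cells in the layout for the star. -/
def starCell (k : ℕ) (i : Fin k) (r T a b : ℤ) : ℤ :=
  b * r + if (i : ℕ) < k - 1 then a / r ^ (i : ℕ) % r
    -- Modulo `r` the quotient `a / r ^ j` is the digit of `a` at place `j`, so the `k - 1` digits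
    -- of the center are the residues of all cells but the last, and the residue of the last is what
    -- `T` leaves over.
    else (T - ∑ j ∈ Finset.range (k - 1), a / r ^ j) % r

lemma exists_digits {r : ℕ} (hr : 0 < r) (n : ℕ) (c : ℕ → ℤ) :
    ∃ a : Fin (r ^ n), ∀ j < n, (a : ℤ) / (r : ℤ) ^ j % r = c j % r := by
  have hrz : (0 : ℤ) < r := by exact_mod_cast hr
  have hlt : ∀ j, (c j % r).toNat < r := fun j => by
    zify
    rw [Int.toNat_of_nonneg (Int.emod_nonneg _ hrz.ne')]
    exact Int.emod_lt_of_pos _ hrz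
  refine ⟨finFunctionFinEquiv fun j : Fin n => ⟨(c j % r).toNat, hlt j⟩, fun j hj => ?_⟩
  have h1 := finFunctionFinEquiv.symm_apply_apply (fun j : Fin n => (⟨(c j % r).toNat, hlt j⟩ : Fin r))
  have h2 := congrArg Fin.val (congrFun h1 ⟨j, hj⟩)
  rw [finFunctionFinEquiv_symm_apply_val] at h2
  zify at h2
  rw [h2, Int.toNat_of_nonneg (Int.emod_nonneg _ hrz.ne')]

lemma starCell_range {k : ℕ} (hk : 2 ≤ k) (i : Fin k) {r : ℕ} (T : ℤ) (a : ℤ) {b : ℕ}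
    (hr : 0 < r) (hb : b < r ^ (k - 1)) :
    0 ≤ starCell k i r T a b ∧ starCell k i r T a b < (r ^ k : ℕ) := by
  have hrz : (0 : ℤ) < r := by exact_mod_cast hr
  have hrem : ∀ z : ℤ, 0 ≤ z % r ∧ z % r < r := fun z =>
    ⟨Int.emod_nonneg _ hrz.ne', Int.emod_lt_of_pos _ hrz⟩
  have hb' : (b : ℤ) + 1 ≤ (r : ℤ) ^ (k - 1) := by exact_mod_cast hb
  have hpow : ((r ^ k : ℕ) : ℤ) = (r : ℤ) ^ (k - 1) * r := by
    rw [← pow_succ, Nat.sub_add_cancel (by omega)]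
    push_cast
    rfl
  have hbr : (0 : ℤ) ≤ b * r := by positivity
  have key : ∀ z : ℤ, 0 ≤ z ∧ z < r → 0 ≤ b * r + z ∧ b * r + z < (r ^ k : ℕ) := by
    intro z hz
    rw [hpow]
    constructor <;> nlinarith
  unfold starCell
  split_ifs
  · exact key _ (hrem _)
  · exact key _ (hrem _)

/-- The layout for the star: the center determines the residues of the cells modulo `rho`, and every
leaf determines the rest of a cell. -/
noncomputable def ofStar (k : ℕ) (hk : 2 ≤ k) : Layout k where
  h := k + 1
  H := kStarGraph k
  src _ := 0
  dst i := i.succ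
  adj i := SimpleGraph.starGraph_center_adj (Fin.succ_ne_zero i).symm
  noIso v := by
    rcases eq_or_ne v 0 with rfl | hv
    · exact ⟨Fin.succ ⟨0, by omega⟩, SimpleGraph.starGraph_center_adj (Fin.succ_ne_zero _).symm⟩
    · exact ⟨0, (SimpleGraph.starGraph_center_adj hv.symm).symm⟩
  kap := k
  lam := k - 1
  kap_pos := by omega
  lam_pos := by omega
  cell i := .var 42 * .var 9 + if (i : ℕ) < k - 1 then
    (Expr.var 41 / (Expr.var 9).pow i).rem (.var 9)
    else (.var 24 - (Expr.var 41).shiftSum (.var 9) (k - 1)).rem (.var 9)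
  cell_in i := by
    split_ifs <;> simp [Expr.in_pow, Expr.in_shiftSum]
  cell_loads i l s := by
    split_ifs <;> simp [Expr.loadsLe_shiftSum]
  cellF i := starCell k i
  cell_eval i s := by
    unfold starCell
    split_ifs <;> simp
  cell_range i r T a b hr _ hb := starCell_range hk i T a hr hb
  complete r T c hr hc hsum := by
    have hrz : (0 : ℤ) < r := by exact_mod_cast hr
    set d : ℕ → ℤ := fun j => if h : j < k then c ⟨j, h⟩ else 0 with hd
    obtain ⟨a, ha⟩ := exists_digits hr (k - 1) d
    have hdc : ∀ i : Fin k, d i = c i := fun i => by simp [hd]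
    have hlt : ∀ i, (c i / r).toNat < r ^ (k - 1) := by
      intro i
      zify
      rw [Int.toNat_of_nonneg (Int.ediv_nonneg (hc i).1 hrz.le)]
      refine Int.ediv_lt_of_lt_mul hrz ?_
      rw [← pow_succ, Nat.sub_add_cancel (by omega)]
      exact_mod_cast (hc i).2
    refine ⟨Fin.cons a fun i => ⟨(c i / r).toNat, hlt i⟩, fun i => ?_⟩
    rw [Fin.cons_zero, Fin.cons_succ, starCell]
    simp only []
    rw [Int.toNat_of_nonneg (Int.ediv_nonneg (hc i).1 hrz.le)]
    have hrem : (if (i : ℕ) < k - 1 then (a : ℤ) / (r : ℤ) ^ (i : ℕ) % r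
        else (T - ∑ j ∈ Finset.range (k - 1), (a : ℤ) / (r : ℤ) ^ j) % r) = c i % r := by
      split_ifs with hi
      · rw [ha _ hi, hdc]
      · have hi' : (i : ℕ) = k - 1 := by have := i.2; omega
        have h1 : ∑ j ∈ Finset.range (k - 1), (a : ℤ) / (r : ℤ) ^ j ≡
            ∑ j ∈ Finset.range (k - 1), d j [ZMOD r] :=
          Int.ModEq.sum fun j hj => ha j (Finset.mem_range.mp hj)
        -- Only the congruence modulo `r` is used, since the leaves choose the higher parts of the
        -- cells freely.
        have h2 : ∑ j, c j ≡ T [ZMOD r] :=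
          hsum.of_dvd (by exact_mod_cast dvd_pow_self r (by omega : k ≠ 0))
        have h3 : ∑ j, c j = ∑ j ∈ Finset.range (k - 1), d j + c i := by
          rw [← hdc i, hi', ← Finset.sum_range_succ, Nat.sub_add_cancel (by omega),
            ← Fin.sum_univ_eq_sum_range]
          exact Finset.sum_congr rfl fun j _ => (hdc j).symm
        have h4 := h2.symm.sub h1
        rw [h3, add_sub_cancel_left] at h4
        exact h4
    rw [hrem]
    exact Int.ediv_mul_add_emod _ _

/-- The cells in the layout for the path. -/
def pathCell (k : ℕ) (i : Fin k) (r T a b : ℤ) : ℤ :=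
  if (i : ℕ) = 0 then a else if (i : ℕ) = k - 1 then (T - b) % r else (b - a) % r

/-- The layout for the path: the differences of adjacent nodes, the first node, and the difference
of `T` and the last node are the cells. -/
noncomputable def ofPath (k : ℕ) (hk : 3 ≤ k) : Layout k where
  h := k - 1
  H := SimpleGraph.pathGraph (k - 1)
  -- The `k` lists share `k - 2` edges: list `0` joins list `1` on the first edge and list `k - 1`
  -- joins list `k - 2` on the last. The truncated subtraction and the minimum produce this at the
  -- ends, also for `k = 3`, where all three lists lie on one edge.
  src i := ⟨min ((i : ℕ) - 1) (k - 3), by omega⟩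
  dst i := ⟨min ((i : ℕ) - 1) (k - 3) + 1, by omega⟩
  adj i := SimpleGraph.pathGraph_adj.mpr (Or.inl rfl)
  noIso v := by
    rcases Nat.eq_zero_or_pos (v : ℕ) with hv | hv
    · exact ⟨⟨1, by omega⟩, SimpleGraph.pathGraph_adj.mpr (Or.inl (by simp [hv]))⟩
    · exact ⟨⟨v - 1, by omega⟩, SimpleGraph.pathGraph_adj.mpr (Or.inr (by simp; omega))⟩
  kap := 1
  lam := 1
  kap_pos := one_pos
  lam_pos := one_pos
  cell i := if (i : ℕ) = 0 then .var 41 else if (i : ℕ) = k - 1 then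
    (Expr.var 24 - .var 42).rem (.var 9) else (Expr.var 42 - .var 41).rem (.var 9)
  cell_in i := by split_ifs <;> simp
  cell_loads i l s := by split_ifs <;> simp
  cellF i := pathCell k i
  cell_eval i s := by
    unfold pathCell
    split_ifs <;> simp
  cell_range i r T a b hr ha hb := by
    have hrz : (0 : ℤ) < r := by exact_mod_cast hr
    rw [pow_one] at ha ⊢
    unfold pathCell
    split_ifs
    · exact ⟨by positivity, by exact_mod_cast ha⟩
    · exact ⟨Int.emod_nonneg _ hrz.ne', Int.emod_lt_of_pos _ hrz⟩
    · exact ⟨Int.emod_nonneg _ hrz.ne', Int.emod_lt_of_pos _ hrz⟩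
  complete r T c hr hc hsum := by
    have hrz : (0 : ℤ) < r := by exact_mod_cast hr
    simp only [pow_one] at hc hsum
    set d : ℕ → ℤ := fun j => if h : j < k then c ⟨j, h⟩ else 0 with hd
    have hdc : ∀ i : Fin k, d i = c i := fun i => by simp [hd]
    have hlt : ∀ j, ((∑ i ∈ Finset.range (j + 1), d i) % r).toNat < r ^ 1 := by
      intro j
      rw [pow_one]
      zify
      rw [Int.toNat_of_nonneg (Int.emod_nonneg _ hrz.ne')]
      exact Int.emod_lt_of_pos _ hrz
    -- The nodes are the partial sums of the cells modulo `r`: consecutive differences give back the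
    -- inner cells, and the last cell is `T` minus the last partial sum.
    refine ⟨fun v => ⟨((∑ i ∈ Finset.range ((v : ℕ) + 1), d i) % r).toNat, hlt v⟩, fun i => ?_⟩
    simp only [Int.toNat_of_nonneg (Int.emod_nonneg _ hrz.ne')]
    have hci : c i % r = c i := Int.emod_eq_of_lt (hc i).1 (hc i).2
    unfold pathCell
    split_ifs with h0 h1
    · have : min ((i : ℕ) - 1) (k - 3) = 0 := by omega
      rw [this, zero_add, Finset.sum_range_one, ← h0, hdc, hci]
    · have : min ((i : ℕ) - 1) (k - 3) + 1 + 1 = k - 1 := by omega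
      rw [this]
      have h3 : ∑ j, c j = ∑ j ∈ Finset.range (k - 1), d j + c i := by
        rw [← hdc i, h1, ← Finset.sum_range_succ, Nat.sub_add_cancel (by omega),
          ← Fin.sum_univ_eq_sum_range]
        exact Finset.sum_congr rfl fun j _ => (hdc j).symm
      rw [← hci, Int.sub_emod_emod]
      have h4 := hsum.symm.sub (Int.ModEq.refl (∑ j ∈ Finset.range (k - 1), d j))
      rw [h3, add_sub_cancel_left] at h4
      exact h4
    · have h2 : min ((i : ℕ) - 1) (k - 3) + 1 = i := by have := i.2; omega
      rw [h2, Finset.sum_range_succ, hdc, ← Int.sub_emod, add_sub_cancel_left, hci]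

end Layout

end FineGrained

/-! ### The four lower bounds -/

theorem theorem1 (k : ℕ) (hk : 3 ≤ k)
    (hsum : ∀ ε : ℝ, 0 < ε →
      ¬ (kSum k).SolvableInTime fun n => (n : ℝ) ^ ((⌈(k : ℝ) / 2⌉₊ : ℝ) - ε)) :
    -- any graph `H` on `k` nodes without isolated nodes
    (∀ H : SimpleGraph (Fin k), (∀ v, ∃ u, H.Adj v u) → ∀ δ : ℝ, 0 < δ →
      ¬ (exactWeight H).SolvableInTime fun n => (n : ℝ) ^ ((⌈(k : ℝ) / 2⌉₊ : ℝ) - δ)) ∧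
    -- the `k`-edge matching, where `m = √n`, that is, `n = m ^ 2`
    (∀ δ : ℝ, 0 < δ → ¬ (exactWeight (matchingGraph k)).SolvableInTime fun m =>
      ((m : ℝ) ^ (2 : ℝ)) ^ ((⌈(k : ℝ) / 2⌉₊ : ℝ) - δ)) ∧
    -- the `k`-edge star, where `m = n ^ (1 - 1 / k)`, that is, `n = m ^ (1 / (1 - 1 / k))`
    (∀ δ : ℝ, 0 < δ → ¬ (exactWeight (kStarGraph k)).SolvableInTime fun m =>
      ((m : ℝ) ^ (1 / (1 - 1 / (k : ℝ)))) ^ ((⌈(k : ℝ) / 2⌉₊ : ℝ) - δ)) ∧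
    -- the path on `k - 1` nodes
    (∀ δ : ℝ, 0 < δ → ¬ (exactWeight (SimpleGraph.pathGraph (k - 1))).SolvableInTime fun n =>
      (n : ℝ) ^ ((⌈(k : ℝ) / 2⌉₊ : ℝ) - δ)) := by
  refine ⟨fun H hH δ hδ => ?_, fun δ hδ h => ?_, fun δ hδ => ?_, fun δ hδ => ?_⟩
  · have := Layout.not_solvableInTime (Y := Layout.ofNodes H hH) hk hsum (κ := 1)
      (by simp [Layout.ofNodes]) hδ
    simp only [Real.rpow_one] at this
    exact this
  · exact Layout.not_solvableInTime (Y := Layout.ofMatching k) hk hsum (κ := 2)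
      (by simp [Layout.ofMatching]) hδ
      -- A layout needs its nodes numbered, so the matching is replaced by an isomorphic graph.
      (solvableInTime_of_iso (SimpleGraph.Iso.comap (Layout.matchingEquiv k) (matchingGraph k)).symm h)
  · refine Layout.not_solvableInTime (Y := Layout.ofStar k (by omega)) hk hsum ?_ hδ
    -- What remains is `κ * (k - 1) = k` for `κ = 1 / (1 - 1 / k)`, because a cell of the star is a
    -- number below `rho ^ k` while a part has `rho ^ (k - 1)` nodes.
    have hk' : (3 : ℝ) ≤ k := by exact_mod_cast hk
    have h1 : (k : ℝ) - 1 ≠ 0 := by linarith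
    have h2 : (k : ℝ) ≠ 0 := by linarith
    have h3 : ((k - 1 : ℕ) : ℝ) = k - 1 := by rw [Nat.cast_sub (by omega), Nat.cast_one]
    simp only [Layout.ofStar, h3]
    field_simp
  · have := Layout.not_solvableInTime (Y := Layout.ofPath k hk) hk hsum (κ := 1)
      (by simp [Layout.ofPath]) hδ
    simp only [Real.rpow_one] at this
    exact this
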